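/- Let $k$ be a field, and let $A$ be an associative unital two-sided noetherian $k$-algebra. Write $A^{\circ}$ for the opposite algebra and $A^{\mathrm e}=A\otimes_k A^{\circ}$, and let $D(\mathrm{Mod}\,A^{\mathrm e})$ be the derived category of left $A^{\mathrm e}$-modules. A *dualizing complex over $A$* is a complex $R\in D^{b}(\mathrm{Mod}\,A^{\mathrm e})$ such that (1) $R$ has finite injective dimension over $A$ and over $A^{\circ}$, that is, there is $q_0$ with $\mathrm{Ext}^q(M,R)=0$ for all $q>q_0$ and all $A$-modules (respectively $A^{\circ}$-modules) $M$; (2) the cohomology modules of $R$ are finitely generated over $A$ and over $A^{\circ}$; (3) the canonical morphisms $A\to\mathrm{RHom}_A(R,R)$ (right multiplications) and $A\to\mathrm{RHom}_{A^{\circ}}(R,R)$ (left multiplications) are isomorphisms in $D(\mathrm{Mod}\,A^{\mathrm e})$. On $R\otimes_k R$ there are two commuting actions of $A^{\mathrm e}$: the outside action $(a_1\otimes a_2^{\circ})(m\otimes n)=a_1m\otimes na_2$ and the inside action $(b_1\otimes b_2^{\circ})(m\otimes n)=mb_2\otimes b_1n$. The complex $\mathrm{RHom}_{A^{\mathrm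 e}}(A,R\otimes_k R)$ is formed with respect to the outside action and is an object of $D(\mathrm{Mod}\,A^{\mathrm e})$ through the inside action. A *rigid dualizing complex over $A$* is a pair $(R,\phi)$ consisting of a dualizing complex $R$ over $A$ and an isomorphism $\phi:R\to\mathrm{RHom}_{A^{\mathrm e}}(A,R\otimes_k R)$ in $D(\mathrm{Mod}\,A^{\mathrm e})$. (a) Let $B$ be another two-sided noetherian $k$-algebra and $f:A\to B$ a $k$-algebra homomorphism such that $B$ is finitely generated as a left and as a right $A$-module. Let $(R_A,\phi_A)$ and $(R_B,\phi_B)$ be rigid dualizing complexes over $A$ and over $B$. Then there is at most one morphism $\psi:R_B\to R_A$ in $D(\mathrm{Mod}\,A^{\mathrm e})$ satisfying both of the following conditions: (i) the morphisms $R_B\to\mathrm{RHom}_A(B,R_A)$ and $R_B\to\mathrm{RHom}_{A^{\circ}}(B,R_A)$ induced by $\psi$ (given by $r\mapsto(b\mapsto\psi(br))$ and $r\mapsto(b\mapsto\psi(rb))$) are isomorphisms in $D(\mathrm{Mod}\,A^{\mathrm e})$; (ii) $\phi_A\circ\psi=(\psi\otimes\psi)\circ\phi_B$ in $D(\mathrm{Mod}\,A^{\mathrm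 e})$, where $\psi\otimes\psi:\mathrm{RHom}_{B^{\mathrm e}}(B,R_B\otimes_k R_B)\to\mathrm{RHom}_{A^{\mathrm e}}(A,R_A\otimes_k R_A)$ is the morphism induced by $f$ and $\psi$. (b) If $(R,\phi)$ and $(R',\phi')$ are rigid dualizing complexes over $A$, then there is exactly one isomorphism $\psi:R\to R'$ in $D(\mathrm{Mod}\,A^{\mathrm e})$ such that $\phi'\circ\psi=\mathrm{RHom}_{A^{\mathrm e}}(A,\psi\otimes\psi)\circ\phi$. -/

import Mathlib

universe u

namespace RigidDC

open CategoryTheory Limits TensorProduct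

set_option linter.unusedSectionVars false

section Total

open HomologicalComplex

variable {C D : Type*} [Category* C] [Category* D] [Preadditive C] [Preadditive D]
  [HasZeroObject D] [HasCoproducts.{0} D]
  (F : C ⥤ C ⥤ D) [F.Additive] [∀ X, (F.obj X).Additive]

instance (K L : CochainComplex C ℤ) :
    HasMapBifunctor K L F (ComplexShape.up ℤ) := fun _ => inferInstance

lemma isStrictlyGE_mapBifunctor (K L : CochainComplex C ℤ) (m n : ℤ)
    [K.IsStrictlyGE m] [L.IsStrictlyGE n] :
    CochainComplex.IsStrictlyGE (mapBifunctor K L F (ComplexShape.up ℤ)) (m + n) := by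
  rw [CochainComplex.isStrictlyGE_iff]
  intro i hi
  rw [IsZero.iff_id_eq_zero]
  apply mapBifunctor.hom_ext
  intro p q hpq
  have hpq' : p + q = i := hpq
  have hz : IsZero ((F.obj (K.X p)).obj (L.X q)) := by
    by_cases hp : p < m
    · exact ((F.flip.obj (L.X q)).map_isZero (K.isZero_of_isStrictlyGE m p hp))
    · exact (F.obj _).map_isZero (L.isZero_of_isStrictlyGE n q (by omega))
  exact hz.eq_of_src _ _

/-- The functor sending a bounded below complex `K` to the total complex of the
bicomplex `F(Kᵖ, K^q)`, and a chain map `f` to `F(f, f)`. -/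
noncomputable def diagTotal : CochainComplex.Plus C ⥤ CochainComplex.Plus D where
  obj K := ⟨mapBifunctor K.obj K.obj F (ComplexShape.up ℤ), by
    obtain ⟨n, hn⟩ := K.property
    exact ⟨n + n, isStrictlyGE_mapBifunctor F K.obj K.obj n n⟩⟩
  map f := ObjectProperty.homMk (mapBifunctorMap f.hom f.hom F (ComplexShape.up ℤ))
  map_id K := by
    ext : 1
    apply HomologicalComplex.hom_ext
    intro n
    change (mapBifunctorMap (𝟙 K.obj) (𝟙 K.obj) F (ComplexShape.up ℤ)).f n = 𝟙 _
    apply mapBifunctor.hom_ext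
    intro p q h
    rw [ι_mapBifunctorMap]
    simp
  map_comp {K L M} f g := by
    ext : 1
    apply HomologicalComplex.hom_ext
    intro n
    change (mapBifunctorMap (f.hom ≫ g.hom) (f.hom ≫ g.hom) F (ComplexShape.up ℤ)).f n =
      (mapBifunctorMap f.hom f.hom F (ComplexShape.up ℤ)).f n ≫
        (mapBifunctorMap g.hom g.hom F (ComplexShape.up ℤ)).f n
    apply mapBifunctor.hom_ext
    intro p q h
    rw [ι_mapBifunctorMap, ι_mapBifunctorMap_assoc, ι_mapBifunctorMap]
    simp

variable {C' D' : Type*} [Category* C'] [Category* D'] [Preadditive C'] [Preadditive D']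
  [HasZeroObject D'] [HasCoproducts.{0} D']
  {F} {F' : C' ⥤ C' ⥤ D'} [F'.Additive] [∀ X, (F'.obj X).Additive]
  {G : D ⥤ D'} [G.Additive]

section Comparison

variable {K L : CochainComplex C ℤ} {K' L' : CochainComplex C' ℤ}
  (e : ∀ p q, (F'.obj (K'.X p)).obj (K'.X q) ≅ G.obj ((F.obj (K.X p)).obj (K.X q)))
  (e' : ∀ p q, (F'.obj (L'.X p)).obj (L'.X q) ≅ G.obj ((F.obj (L.X p)).obj (L.X q)))

/-- The map from the total complex of `F'(K', K')` to `G` applied to the total complex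
of `F(K, K)`, in degree `n`, induced by isomorphisms `F'(K'ᵖ, K'^q) ≅ G(F(Kᵖ, K^q))`. -/
noncomputable def totalCompX (n : ℤ) :
    (mapBifunctor K' K' F' (ComplexShape.up ℤ)).X n ⟶
    G.obj ((mapBifunctor K K F (ComplexShape.up ℤ)).X n) :=
  mapBifunctorDesc (fun p q h => (e p q).hom ≫
    G.map (ιMapBifunctor K K F (ComplexShape.up ℤ) p q n h))

lemma ι_totalCompX (p q n : ℤ) (h : ComplexShape.π (ComplexShape.up ℤ) (ComplexShape.up ℤ)
    (ComplexShape.up ℤ) (p, q) = n) :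
    ιMapBifunctor K' K' F' (ComplexShape.up ℤ) p q n h ≫ totalCompX e n =
      (e p q).hom ≫ G.map (ιMapBifunctor K K F (ComplexShape.up ℤ) p q n h) :=
  ι_mapBifunctorDesc _ _ _ _

lemma isIso_totalCompX [PreservesColimitsOfSize.{0, 0} G] (n : ℤ) :
    IsIso (totalCompX e n) := by
  let Z := (((F.mapBifunctorHomologicalComplex (ComplexShape.up ℤ) (ComplexShape.up ℤ)).obj K).obj
    K).toGradedObject
  let p := ComplexShape.π (ComplexShape.up ℤ) (ComplexShape.up ℤ) (ComplexShape.up ℤ)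
  let hc := isColimitOfHasCoproductOfPreservesColimit G (Z.mapObjFun p n)
  let i : G.obj ((mapBifunctor K K F (ComplexShape.up ℤ)).X n) ⟶
      (mapBifunctor K' K' F' (ComplexShape.up ℤ)).X n :=
    Cofan.IsColimit.desc hc (fun x => (e x.1.1 x.1.2).inv ≫
      ιMapBifunctor K' K' F' (ComplexShape.up ℤ) x.1.1 x.1.2 n x.2)
  have hi : ∀ a b (h : p (a, b) = n),
      G.map (ιMapBifunctor K K F (ComplexShape.up ℤ) a b n h) ≫ i =
        (e a b).inv ≫ ιMapBifunctor K' K' F' (ComplexShape.up ℤ) a b n h :=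
    fun a b h => Cofan.IsColimit.fac hc _ ⟨(a, b), h⟩
  refine ⟨i, ?_, ?_⟩
  · apply mapBifunctor.hom_ext
    intro a b h
    rw [← Category.assoc, ι_totalCompX, Category.assoc, hi, Iso.hom_inv_id_assoc,
      Category.comp_id]
  · refine Cofan.IsColimit.hom_ext hc _ _ ?_
    rintro ⟨⟨a, b⟩, h : p (a, b) = n⟩
    change G.map (ιMapBifunctor K K F (ComplexShape.up ℤ) a b n h) ≫ i ≫ _ =
      G.map (ιMapBifunctor K K F (ComplexShape.up ℤ) a b n h) ≫ 𝟙 _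
    rw [← Category.assoc, hi a b h, Category.comp_id, Category.assoc, ι_totalCompX,
      Iso.inv_hom_id_assoc]

/-- The isomorphism between the total complex of `F'(K', K')` and `G` applied to the total
complex of `F(K, K)`, induced by isomorphisms `F'(K'ᵖ, K'^q) ≅ G(F(Kᵖ, K^q))` compatible with
the differentials. -/
noncomputable def totalCompIso [PreservesColimitsOfSize.{0, 0} G]
    (h₁ : ∀ p p' q, (F'.map (K'.d p p')).app (K'.X q) ≫ (e p' q).hom =
      (e p q).hom ≫ G.map ((F.map (K.d p p')).app (K.X q)))
    (h₂ : ∀ p q q', (F'.obj (K'.X p)).map (K'.d q q') ≫ (e p q').hom =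
      (e p q).hom ≫ G.map ((F.obj (K.X p)).map (K.d q q'))) :
    mapBifunctor K' K' F' (ComplexShape.up ℤ) ≅
      (G.mapHomologicalComplex (ComplexShape.up ℤ)).obj (mapBifunctor K K F (ComplexShape.up ℤ)) :=
  HomologicalComplex.Hom.isoOfComponents
    (fun n => @asIso D' _ _ _ (totalCompX e n) (isIso_totalCompX e n)) (by
      intro n m hnm
      obtain rfl : n + 1 = m := hnm
      apply mapBifunctor.hom_ext
      intro p q h
      obtain rfl : p + q = n := h
      change ιMapBifunctor K' K' F' (ComplexShape.up ℤ) p q _ rfl ≫ totalCompX e _ ≫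
        G.map ((mapBifunctor K K F (ComplexShape.up ℤ)).d _ _) =
        ιMapBifunctor K' K' F' (ComplexShape.up ℤ) p q _ rfl ≫
          (mapBifunctor K' K' F' (ComplexShape.up ℤ)).d _ _ ≫ totalCompX e _
      have hp : (ComplexShape.up ℤ).Rel p (p + 1) := rfl
      have hq : (ComplexShape.up ℤ).Rel q (q + 1) := rfl
      have hp' : ComplexShape.π (ComplexShape.up ℤ) (ComplexShape.up ℤ)
        (ComplexShape.up ℤ) (p + 1, q) = p + q + 1 := by
        change p + 1 + q = p + q + 1; ring
      have hq' : ComplexShape.π (ComplexShape.up ℤ) (ComplexShape.up ℤ)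
        (ComplexShape.up ℤ) (p, q + 1) = p + q + 1 := by
        change p + (q + 1) = p + q + 1; ring
      rw [← Category.assoc, ι_totalCompX, Category.assoc, ← G.map_comp, mapBifunctor.d_eq,
        mapBifunctor.d_eq, Preadditive.comp_add, Preadditive.add_comp, Preadditive.comp_add,
        mapBifunctor.ι_D₁, mapBifunctor.ι_D₂, mapBifunctor.ι_D₁_assoc, mapBifunctor.ι_D₂_assoc,
        mapBifunctor.d₁_eq _ _ _ _ hp _ _ hp', mapBifunctor.d₁_eq _ _ _ _ hp _ _ hp',
        mapBifunctor.d₂_eq _ _ _ _ _ hq _ hq', mapBifunctor.d₂_eq _ _ _ _ _ hq _ hq']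
      simp only [Units.smul_def, Functor.map_add, Functor.map_zsmul, Preadditive.zsmul_comp,
        Preadditive.comp_add, Preadditive.comp_zsmul, Category.assoc, ι_totalCompX,
        Functor.map_comp]
      rw [reassoc_of% h₁, reassoc_of% h₂])

lemma totalCompX_naturality (f : K ⟶ L) (f' : K' ⟶ L')
    (hf : ∀ p q, (F'.map (f'.f p)).app (K'.X q) ≫ (F'.obj (L'.X p)).map (f'.f q) ≫ (e' p q).hom =
      (e p q).hom ≫ G.map ((F.map (f.f p)).app (K.X q) ≫ (F.obj (L.X p)).map (f.f q))) (n : ℤ) :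
    (mapBifunctorMap f' f' F' (ComplexShape.up ℤ)).f n ≫ totalCompX e' n =
      totalCompX e n ≫ G.map ((mapBifunctorMap f f F (ComplexShape.up ℤ)).f n) := by
  apply mapBifunctor.hom_ext
  intro p q h
  rw [ι_mapBifunctorMap_assoc, ι_totalCompX, ← Category.assoc (ιMapBifunctor _ _ _ _ _ _ _ _),
    ι_totalCompX, Category.assoc, ← G.map_comp, ι_mapBifunctorMap, reassoc_of% hf]
  simp only [Functor.map_comp, Category.assoc]

end Comparison

variable {H : C ⥤ C'} [H.Additive] [PreservesColimitsOfSize.{0, 0} G]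
  (e : ∀ X Y, (F'.obj (H.obj X)).obj (H.obj Y) ≅ G.obj ((F.obj X).obj Y))
  (h₁ : ∀ {X X' : C} (f : X ⟶ X') (Y : C), (F'.map (H.map f)).app (H.obj Y) ≫ (e X' Y).hom =
      (e X Y).hom ≫ G.map ((F.map f).app Y))
  (h₂ : ∀ (X : C) {Y Y' : C} (f : Y ⟶ Y'), (F'.obj (H.obj X)).map (H.map f) ≫ (e X Y').hom =
      (e X Y).hom ≫ G.map ((F.obj X).map f))

/-- If `F'(HX, HY) ≅ G(F(X, Y))` naturally, then the total complex of `F'(HK, HK)` is `G`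
applied to the total complex of `F(K, K)`. -/
noncomputable def diagTotalCompIso :
    H.mapCochainComplexPlus ⋙ diagTotal F' ≅ diagTotal F ⋙ G.mapCochainComplexPlus :=
  NatIso.ofComponents
    (fun K => ObjectProperty.isoMk _ (totalCompIso (K := K.obj)
      (K' := (H.mapHomologicalComplex (ComplexShape.up ℤ)).obj K.obj)
      (fun p q => e (K.obj.X p) (K.obj.X q)) (fun p p' q => h₁ _ _) (fun p q q' => h₂ _ _)))
    (by
      intro K L f
      ext : 1
      apply HomologicalComplex.hom_ext
      intro n
      refine totalCompX_naturality (K' := (H.mapHomologicalComplex (ComplexShape.up ℤ)).obj K.obj)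
        (L' := (H.mapHomologicalComplex (ComplexShape.up ℤ)).obj L.obj)
        (fun p q => e (K.obj.X p) (K.obj.X q))
        (fun p q => e (L.obj.X p) (L.obj.X q)) f.hom
        ((H.mapHomologicalComplex (ComplexShape.up ℤ)).map f.hom) ?_ n
      have key : ∀ {X X' Y Y' : C} (u : X ⟶ X') (v : Y ⟶ Y'),
          (F'.map (H.map u)).app (H.obj Y) ≫ (F'.obj (H.obj X')).map (H.map v) ≫ (e X' Y').hom =
            (e X Y).hom ≫ G.map ((F.map u).app Y ≫ (F.obj X').map v) := by
        intro X X' Y Y' u v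
        rw [h₂, ← Category.assoc, h₁, G.map_comp, Category.assoc]
      exact fun p q => key _ _)

/-- The total complex functor respects homotopies: if `f` is a homotopy equivalence, so is
`F(f, f)`. -/
lemma quasiIso_diagTotal_of_homotopyEquiv [CategoryWithHomology D] {K L : CochainComplex.Plus C}
    (f : K ⟶ L) (hf : homotopyEquivalences C (ComplexShape.up ℤ) f.hom) :
    QuasiIso ((diagTotal F).map f).hom := by
  obtain ⟨h, hh⟩ := hf
  have hcomp : ∀ {K₁ K₂ K₃ : CochainComplex C ℤ} (u : K₁ ⟶ K₂) (v : K₂ ⟶ K₃),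
      mapBifunctorMap u u F (ComplexShape.up ℤ) ≫ mapBifunctorMap v v F (ComplexShape.up ℤ) =
        mapBifunctorMap (u ≫ v) (u ≫ v) F (ComplexShape.up ℤ) := by
    intro K₁ K₂ K₃ u v
    apply HomologicalComplex.hom_ext
    intro n
    apply mapBifunctor.hom_ext
    intro p q h
    rw [HomologicalComplex.comp_f, ι_mapBifunctorMap, ι_mapBifunctorMap_assoc, ι_mapBifunctorMap]
    simp
  have hid : ∀ (K₁ : CochainComplex C ℤ), mapBifunctorMap (𝟙 K₁) (𝟙 K₁) F (ComplexShape.up ℤ) =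
      𝟙 _ := by
    intro K₁
    apply HomologicalComplex.hom_ext
    intro n
    apply mapBifunctor.hom_ext
    intro p q h
    rw [ι_mapBifunctorMap]
    simp
  have hhom : ∀ {K₁ K₂ : CochainComplex C ℤ} {u v : K₁ ⟶ K₂} (_ : Homotopy u v),
      Nonempty (Homotopy (mapBifunctorMap u u F (ComplexShape.up ℤ))
        (mapBifunctorMap v v F (ComplexShape.up ℤ))) := fun {K₁ K₂ u v} w =>
    ⟨(mapBifunctorMapHomotopy₁ w u F (ComplexShape.up ℤ)).trans
      (mapBifunctorMapHomotopy₂ v w F (ComplexShape.up ℤ))⟩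
  let E : HomotopyEquiv (mapBifunctor K.obj K.obj F (ComplexShape.up ℤ))
      (mapBifunctor L.obj L.obj F (ComplexShape.up ℤ)) :=
    { hom := mapBifunctorMap h.hom h.hom F (ComplexShape.up ℤ)
      inv := mapBifunctorMap h.inv h.inv F (ComplexShape.up ℤ)
      homotopyHomInvId := (Homotopy.ofEq (hcomp _ _)).trans
        ((hhom h.homotopyHomInvId).some.trans (Homotopy.ofEq (hid _)))
      homotopyInvHomId := (Homotopy.ofEq (hcomp _ _)).trans
        ((hhom h.homotopyInvHomId).some.trans (Homotopy.ofEq (hid _))) }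
  have hE : ((diagTotal F).map f).hom = E.hom := by
    change mapBifunctorMap f.hom f.hom F (ComplexShape.up ℤ) =
      mapBifunctorMap h.hom h.hom F (ComplexShape.up ℤ)
    rw [hh]
  rw [hE]
  exact homotopyEquivalences_le_quasiIso _ _ _ ⟨E, rfl⟩

end Total

section ExtTensor

attribute [local instance] ModuleCat.moduleOfAlgebraModule
  ModuleCat.isScalarTower_of_algebra_moduleCat

variable (k : Type u) [Field k] {S : Type u} [Ring S] [Algebra k S]

/-- The underlying abelian group of the external tensor product `M ⊗ₖ N`. -/
def ExtTensor (M N : ModuleCat.{u} S) : Type u := M ⊗[k] N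

noncomputable instance (M N : ModuleCat.{u} S) : AddCommGroup (ExtTensor k M N) :=
  inferInstanceAs (AddCommGroup (M ⊗[k] N))

/-- The action of `S ⊗ₖ S` on `M ⊗ₖ N`: `(s ⊗ t) • (m ⊗ n) = (s • m) ⊗ (t • n)`. -/
noncomputable def extAction (M N : ModuleCat.{u} S) :
    S ⊗[k] S →ₐ[k] Module.End k (M ⊗[k] N) :=
  Module.endTensorEndAlgHom.comp
    (Algebra.TensorProduct.map (Algebra.lsmul k k M) (Algebra.lsmul k k N))

noncomputable instance (M N : ModuleCat.{u} S) : Module (S ⊗[k] S) (ExtTensor k M N) :=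
  Module.compHom (M ⊗[k] N) (extAction k M N).toRingHom

lemma extTensor_smul_def (M N : ModuleCat.{u} S) (z : S ⊗[k] S) (x : M ⊗[k] N) :
    (z • (show ExtTensor k M N from x) : ExtTensor k M N) = extAction k M N z x := rfl

lemma extAction_tmul (M N : ModuleCat.{u} S) (s t : S) (m : M) (n : N) :
    extAction k M N (s ⊗ₜ t) (m ⊗ₜ n) = (s • m) ⊗ₜ[k] (t • n) := rfl

/-- The `k`-linear map underlying an `S`-linear map. -/
def kLin {M N : ModuleCat.{u} S} (f : M ⟶ N) : M →ₗ[k] N := f.hom.restrictScalars k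

lemma kLin_apply {M N : ModuleCat.{u} S} (f : M ⟶ N) (m : M) : kLin k f m = f m := rfl

lemma extAction_map {M M' N N' : ModuleCat.{u} S} (f : M ⟶ M') (g : N ⟶ N') (z : S ⊗[k] S)
    (x : M ⊗[k] N) : TensorProduct.map (kLin k f) (kLin k g) (extAction k M N z x) =
      extAction k M' N' z (TensorProduct.map (kLin k f) (kLin k g) x) := by
  induction z using TensorProduct.induction_on with
  | zero => simp only [map_zero, LinearMap.zero_apply]
  | add z w hz hw => simp only [map_add, LinearMap.add_apply, hz, hw]
  | tmul s t =>
    induction x using TensorProduct.induction_on with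
    | zero => simp only [map_zero]
    | add x y hx hy => simp only [map_add, hx, hy]
    | tmul m n =>
      rw [extAction_tmul, TensorProduct.map_tmul, TensorProduct.map_tmul, extAction_tmul,
        kLin_apply, kLin_apply, kLin_apply, kLin_apply, map_smul, map_smul]

/-- The map `f ⊗ g : M ⊗ₖ N ⟶ M' ⊗ₖ N'` of `S ⊗ₖ S`-modules. -/
noncomputable def extTensorMap {M M' N N' : ModuleCat.{u} S} (f : M ⟶ M') (g : N ⟶ N') :
    ModuleCat.of (S ⊗[k] S) (ExtTensor k M N) ⟶ ModuleCat.of (S ⊗[k] S) (ExtTensor k M' N') :=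
  ModuleCat.ofHom (X := ExtTensor k M N) (Y := ExtTensor k M' N')
    { toFun := TensorProduct.map (kLin k f) (kLin k g)
      map_add' := fun x y => map_add (TensorProduct.map (kLin k f) (kLin k g)) x y
      map_smul' := fun z x => extAction_map k f g z x }

lemma extTensorMap_apply {M M' N N' : ModuleCat.{u} S} (f : M ⟶ M') (g : N ⟶ N')
    (x : M ⊗[k] N) : (extTensorMap k f g).hom x = TensorProduct.map (kLin k f) (kLin k g) x := rfl

lemma extTensor_hom_ext {M N : ModuleCat.{u} S} {P : ModuleCat.{u} (S ⊗[k] S)}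
    {f g : ModuleCat.of (S ⊗[k] S) (ExtTensor k M N) ⟶ P}
    (h : ∀ (m : M) (n : N), f.hom (m ⊗ₜ[k] n : M ⊗[k] N) = g.hom (m ⊗ₜ[k] n : M ⊗[k] N)) :
    f = g := by
  ext x
  refine TensorProduct.induction_on (motive := fun x : M ⊗[k] N => f.hom x = g.hom x) x ?_ h ?_
  · exact (map_zero f.hom).trans (map_zero g.hom).symm
  · intro x y hx hy
    exact (map_add f.hom x y).trans ((congrArg₂ (· + ·) hx hy).trans (map_add g.hom x y).symm)

/-- The external tensor product bifunctor `(M, N) ↦ M ⊗ₖ N`, from `S`-modules to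
`S ⊗ₖ S`-modules. -/
noncomputable def extTensor : ModuleCat.{u} S ⥤ ModuleCat.{u} S ⥤ ModuleCat.{u} (S ⊗[k] S) where
  obj M :=
    { obj N := ModuleCat.of (S ⊗[k] S) (ExtTensor k M N)
      map g := extTensorMap k (𝟙 M) g
      map_id N := extTensor_hom_ext k (fun _ _ => rfl)
      map_comp f g := extTensor_hom_ext k (fun _ _ => rfl) }
  map f :=
    { app N := extTensorMap k f (𝟙 N)
      naturality _ _ g := extTensor_hom_ext k (fun _ _ => rfl) }
  map_id M := by
    ext N : 2
    exact extTensor_hom_ext k (fun _ _ => rfl)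
  map_comp f g := by
    ext N : 2
    exact extTensor_hom_ext k (fun _ _ => rfl)

instance : (extTensor k (S := S)).Additive where
  map_add {M M' f g} := by
    ext N : 2
    exact extTensor_hom_ext k (fun m n => TensorProduct.add_tmul (f m) (g m) n)

instance (M : ModuleCat.{u} S) : ((extTensor k).obj M).Additive where
  map_add {N N' f g} := extTensor_hom_ext k (fun m n => TensorProduct.tmul_add m (f n) (g n))

section Restrict

variable {k} {T : Type u} [Ring T] [Algebra k T] (φ : S →ₐ[k] T)

/-- Restriction of scalars along an algebra homomorphism. -/
noncomputable abbrev resMod : ModuleCat.{u} T ⥤ ModuleCat.{u} S := ModuleCat.restrictScalars φ.toRingHom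

/-- The identity map `res M → M`, as a `k`-linear equivalence. -/
noncomputable def resKLin (M : ModuleCat.{u} T) : (resMod φ).obj M ≃ₗ[k] M :=
  { AddEquiv.refl M with
    map_smul' := fun c m => by
      change φ (algebraMap k S c) • (show M from m) = algebraMap k T c • (show M from m)
      rw [AlgHom.commutes] }

lemma extAction_res (M N : ModuleCat.{u} T) (z : S ⊗[k] S)
    (x : (resMod φ).obj M ⊗[k] (resMod φ).obj N) :
    TensorProduct.congr (resKLin φ M) (resKLin φ N)
      (extAction k ((resMod φ).obj M) ((resMod φ).obj N) z x) =
    extAction k M N (Algebra.TensorProduct.map φ φ z)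
      (TensorProduct.congr (resKLin φ M) (resKLin φ N) x) := by
  induction z using TensorProduct.induction_on with
  | zero => simp only [map_zero, LinearMap.zero_apply]
  | add z w hz hw => simp only [map_add, LinearMap.add_apply, hz, hw]
  | tmul s t =>
    induction x using TensorProduct.induction_on with
    | zero => simp only [map_zero]
    | add x y hx hy => simp only [map_add, hx, hy]
    | tmul m n => rfl

/-- External tensor products commute with restriction of scalars. -/
noncomputable def extTensorRes (M N : ModuleCat.{u} T) :
    ((extTensor k).obj ((resMod φ).obj M)).obj ((resMod φ).obj N) ≅
      (resMod (Algebra.TensorProduct.map φ φ)).obj (((extTensor k).obj M).obj N) :=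
  LinearEquiv.toModuleIso (X₁ := ExtTensor k ((resMod φ).obj M) ((resMod φ).obj N))
    (X₂ := (resMod (Algebra.TensorProduct.map φ φ)).obj (((extTensor k).obj M).obj N))
    (m₂ := ModuleCat.isModule _)
    { (TensorProduct.congr (resKLin φ M) (resKLin φ N)).toAddEquiv with
      map_smul' := fun z x => extAction_res φ M N z x }

end Restrict

end ExtTensor

/-- Derived categories of module categories are formed with the standard construction. -/
noncomputable instance (S : Type u) [Ring S] : HasDerivedCategory.{u + 1} (ModuleCat.{u} S) :=
  HasDerivedCategory.standard _

/-- The full subcategory `D⁺(Mod S)` of the derived category `D(Mod S)`. -/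
abbrev DPlus (S : Type u) [Ring S] := DerivedCategory.Plus (ModuleCat.{u} S)

/-- The localization functor from bounded below complexes to `D⁺(Mod S)`. -/
noncomputable abbrev QPlus (S : Type u) [Ring S] :
    CochainComplex.Plus (ModuleCat.{u} S) ⥤ DPlus S :=
  DerivedCategory.Plus.Q

/-- The localization functor from the bounded below homotopy category to `D⁺(Mod S)`. -/
noncomputable abbrev QhPlus (S : Type u) [Ring S] :
    HomotopyCategory.Plus (ModuleCat.{u} S) ⥤ DPlus S :=
  DerivedCategory.Plus.Qh

instance (S : Type u) [Ring S] :
    (QPlus S).IsLocalization (CochainComplex.Plus.quasiIso (ModuleCat.{u} S)) :=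
  inferInstanceAs ((HomotopyCategory.Plus.quotient _ ⋙ QhPlus S).IsLocalization _)

section Exact

variable {S T : Type u} [Ring S] [Ring T] (G : ModuleCat.{u} T ⥤ ModuleCat.{u} S) [G.Additive]

/-- Applying an additive functor termwise commutes with passing to the homotopy category. -/
def quotientMapIso :
    G.mapCochainComplexPlus ⋙ HomotopyCategory.Plus.quotient _ ≅
      HomotopyCategory.Plus.quotient _ ⋙ G.mapHomotopyCategoryPlus :=
  Iso.refl _

variable [PreservesFiniteLimits G] [PreservesFiniteColimits G]

lemma exact_isInvertedBy :
    (HomotopyCategory.Plus.quasiIso (ModuleCat.{u} T)).IsInvertedBy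
      (G.mapHomotopyCategoryPlus ⋙ QhPlus S) := by
  intro K L f hf
  obtain ⟨K, rfl⟩ := HomotopyCategory.Plus.quotient_obj_surjective K
  obtain ⟨L, rfl⟩ := HomotopyCategory.Plus.quotient_obj_surjective L
  obtain ⟨f, rfl⟩ := (HomotopyCategory.Plus.quotient _).map_surjective f
  have hf' : QuasiIso f.hom := (HomotopyCategory.quotient_map_mem_quasiIso_iff f.hom).1 hf
  have h2 : QuasiIso ((G.mapHomologicalComplex (ComplexShape.up ℤ)).map f.hom) :=
    HomologicalComplex.quasiIso_map_of_preservesHomology f.hom G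
  exact Localization.inverts (QhPlus S) (HomotopyCategory.Plus.quasiIso _) _
    ((HomotopyCategory.quotient_map_mem_quasiIso_iff
      ((G.mapHomologicalComplex (ComplexShape.up ℤ)).map f.hom)).2 h2)

/-- The functor on derived categories induced by an exact functor. -/
noncomputable def exactD : DPlus T ⥤ DPlus S :=
  Localization.lift (G.mapHomotopyCategoryPlus ⋙ QhPlus S) (exact_isInvertedBy G) (QhPlus T)

/-- `exactD G` is computed by applying `G` termwise. -/
noncomputable def exactDIso : QhPlus T ⋙ exactD G ≅ G.mapHomotopyCategoryPlus ⋙ QhPlus S :=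
  Localization.fac _ (exact_isInvertedBy G) _

/-- `exactD G` is computed by applying `G` termwise. -/
noncomputable def exactDIsoQ : QPlus T ⋙ exactD G ≅ G.mapCochainComplexPlus ⋙ QPlus S :=
  Functor.isoWhiskerLeft (HomotopyCategory.Plus.quotient _) (exactDIso G)

end Exact

section Restriction

variable {k : Type u} [Field k] {S T : Type u} [Ring S] [Ring T] [Algebra k S] [Algebra k T]

instance preservesFiniteLimits_resMod (φ : S →ₐ[k] T) : PreservesFiniteLimits (resMod φ) := by
  have h : ∀ X : ShortComplex (ModuleCat.{u} T), X.Exact → (X.map (resMod φ)).Exact := by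
    intro X hX
    rw [ShortComplex.ShortExact.moduleCat_exact_iff_function_exact] at hX ⊢
    exact hX
  have h' := ((Functor.exact_tfae (resMod φ)).out 1 3).mp h
  exact h'.1

/-- Restriction of scalars on derived categories. -/
noncomputable abbrev resD (φ : S →ₐ[k] T) : DPlus T ⥤ DPlus S := exactD (resMod φ)

end Restriction

section Sq

variable (k : Type u) [Field k] (S : Type u) [Ring S] [Algebra k S]

lemma injective_of_field (V : ModuleCat.{u} k) : Injective V :=
  have : Module.Injective k V := Module.injective_of_isSemisimpleRing k V
  Module.injective_object_of_injective_module k V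

lemma quasiIso_sq_field {K L : CochainComplex.Plus (ModuleCat.{u} k)} (f : K ⟶ L)
    (hf : CochainComplex.Plus.quasiIso _ f) :
    QuasiIso ((diagTotal (extTensor k (S := k))).map f).hom := by
  have : ∀ V : ModuleCat.{u} k, Injective V := injective_of_field k
  have hK : CochainComplex.IsKInjective K.obj := by
    obtain ⟨n, _⟩ := K.property
    exact CochainComplex.isKInjective_of_injective K.obj n
  have hL : CochainComplex.IsKInjective L.obj := by
    obtain ⟨n, _⟩ := L.property
    exact CochainComplex.isKInjective_of_injective L.obj n
  exact quasiIso_diagTotal_of_homotopyEquiv f ((CochainComplex.IsKInjective.quasiIso_iff f.hom).1 hf)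

variable {k S} in
lemma extTensorRes_natural_left {T : Type u} [Ring T] [Algebra k T] (φ : S →ₐ[k] T)
    {X X' : ModuleCat.{u} T} (f : X ⟶ X') (Y : ModuleCat.{u} T) :
    ((extTensor k).map ((resMod φ).map f)).app ((resMod φ).obj Y) ≫ (extTensorRes φ X' Y).hom =
      (extTensorRes φ X Y).hom ≫
        (resMod (Algebra.TensorProduct.map φ φ)).map (((extTensor k).map f).app Y) :=
  extTensor_hom_ext k (fun _ _ => rfl)

variable {k S} in
lemma extTensorRes_natural_right {T : Type u} [Ring T] [Algebra k T] (φ : S →ₐ[k] T)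
    (X : ModuleCat.{u} T) {Y Y' : ModuleCat.{u} T} (f : Y ⟶ Y') :
    ((extTensor k).obj ((resMod φ).obj X)).map ((resMod φ).map f) ≫ (extTensorRes φ X Y').hom =
      (extTensorRes φ X Y).hom ≫
        (resMod (Algebra.TensorProduct.map φ φ)).map (((extTensor k).obj X).map f) :=
  extTensor_hom_ext k (fun _ _ => rfl)

variable {k S} in
/-- The complex `K ⊗ₖ K` commutes with restriction of scalars. -/
noncomputable def sqResIso {T : Type u} [Ring T] [Algebra k T] (φ : S →ₐ[k] T) :
    (resMod φ).mapCochainComplexPlus ⋙ diagTotal (extTensor k (S := S)) ≅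
      diagTotal (extTensor k (S := T)) ⋙
        (resMod (Algebra.TensorProduct.map φ φ)).mapCochainComplexPlus :=
  diagTotalCompIso (extTensorRes φ) (extTensorRes_natural_left φ) (extTensorRes_natural_right φ)

lemma quasiIso_sq {K L : CochainComplex.Plus (ModuleCat.{u} S)} (f : K ⟶ L)
    (hf : CochainComplex.Plus.quasiIso _ f) :
    CochainComplex.Plus.quasiIso _ ((diagTotal (extTensor k (S := S))).map f) := by
  let φ : k →ₐ[k] S := Algebra.ofId k S
  have hf' : QuasiIso f.hom := hf
  have h1 : CochainComplex.Plus.quasiIso _ ((resMod φ).mapCochainComplexPlus.map f) :=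
    HomologicalComplex.quasiIso_map_of_preservesHomology f.hom (resMod φ)
  have h2 : CochainComplex.Plus.quasiIso _ ((diagTotal (extTensor k (S := k))).map
    ((resMod φ).mapCochainComplexPlus.map f)) := quasiIso_sq_field k _ h1
  have h3 : CochainComplex.Plus.quasiIso _
      ((resMod (Algebra.TensorProduct.map φ φ)).mapCochainComplexPlus.map
        ((diagTotal (extTensor k (S := S))).map f)) :=
    ((CochainComplex.Plus.quasiIso _).arrow_mk_iso_iff
      (Arrow.isoOfNatIso (sqResIso φ) (Arrow.mk f))).1 h2
  exact (HomologicalComplex.quasiIso_map_iff_of_preservesHomology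
    ((diagTotal (extTensor k (S := S))).map f).hom
    (resMod (Algebra.TensorProduct.map φ φ))).1 h3

lemma sq_isInvertedBy :
    (CochainComplex.Plus.quasiIso (ModuleCat.{u} S)).IsInvertedBy
      (diagTotal (extTensor k (S := S)) ⋙ QPlus (S ⊗[k] S)) := fun _ _ f hf =>
  Localization.inverts (QPlus (S ⊗[k] S)) (CochainComplex.Plus.quasiIso _) _
    (quasiIso_sq k S f hf)

/-- The tensor square `M ↦ M ⊗ₖ M`, `ψ ↦ ψ ⊗ ψ`, from `D⁺(Mod S)` to `D⁺(Mod (S ⊗ₖ S))`, where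
`(s ⊗ t)(m ⊗ n) = sm ⊗ tn`. As `k` is a field, it is computed on any bounded below complex. -/
noncomputable def tensorSq : DPlus S ⥤ DPlus (S ⊗[k] S) :=
  Localization.lift (diagTotal (extTensor k (S := S)) ⋙ QPlus (S ⊗[k] S)) (sq_isInvertedBy k S)
    (QPlus S)

/-- `tensorSq` is computed by total complexes. -/
noncomputable def tensorSqIso :
    QPlus S ⋙ tensorSq k S ≅ diagTotal (extTensor k (S := S)) ⋙ QPlus (S ⊗[k] S) :=
  Localization.fac _ (sq_isInvertedBy k S) _

variable {k S} in
/-- The canonical isomorphism `res M ⊗ₖ res M ≅ res (M ⊗ₖ M)` in the derived category. -/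
noncomputable def tensorSqRes {T : Type u} [Ring T] [Algebra k T] (φ : S →ₐ[k] T) :
    resD φ ⋙ tensorSq k S ≅ tensorSq k T ⋙ resD (Algebra.TensorProduct.map φ φ) :=
  Localization.liftNatIso (QPlus T) (CochainComplex.Plus.quasiIso _)
    (QPlus T ⋙ resD φ ⋙ tensorSq k S)
    (QPlus T ⋙ tensorSq k T ⋙ resD (Algebra.TensorProduct.map φ φ)) _ _
    (Functor.isoWhiskerRight (exactDIsoQ (resMod φ)) (tensorSq k S) ≪≫
      Functor.isoWhiskerLeft (resMod φ).mapCochainComplexPlus (tensorSqIso k S) ≪≫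
      Functor.isoWhiskerRight (sqResIso φ) (QPlus (S ⊗[k] S)) ≪≫
      Functor.isoWhiskerLeft (diagTotal (extTensor k (S := T)))
        (exactDIsoQ (resMod (Algebra.TensorProduct.map φ φ))).symm ≪≫
      Functor.isoWhiskerRight (tensorSqIso k T).symm
        (resD (Algebra.TensorProduct.map φ φ)))

end Sq

section Hom

attribute [local instance] ModuleCat.moduleOfAlgebraModule
  ModuleCat.isScalarTower_of_algebra_moduleCat

/-- The data needed to form `Hom_S(M, N)` for a module `N` over an algebra `P`: commuting
homomorphisms `S → P` and `T → P`, and an `S`-module `M` with a commuting right action of `U`.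
Then `Hom_S(M, N)` is a module over `U ⊗ₖ T`. -/
structure HomDatum (k S U T P : Type u) [Field k] [Ring S] [Ring U] [Ring T] [Ring P]
    [Algebra k S] [Algebra k U] [Algebra k T] [Algebra k P] where
  /-- the action of `S` on `P`-modules -/
  src : S →ₐ[k] P
  /-- the action of `T` on `P`-modules -/
  tgt : T →ₐ[k] P
  comm : ∀ s t, Commute (src s) (tgt t)
  /-- the first argument of `Hom` -/
  M : ModuleCat.{u} S
  /-- the right action of `U` on `M` -/
  act : U →ₐ[k] (Module.End S M)ᵐᵒᵖ

namespace HomDatum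

variable {k S U T P : Type u} [Field k] [Ring S] [Ring U] [Ring T] [Ring P]
    [Algebra k S] [Algebra k U] [Algebra k T] [Algebra k P] (H : HomDatum k S U T P)

/-- The abelian group `Hom_S(M, N)`. -/
abbrev Carrier (N : ModuleCat.{u} P) : Type u := H.M →ₗ[S] (resMod H.src).obj N

/-- The endomorphism of `Hom_S(M, N)` induced by an element of `T`. -/
noncomputable def smulT (N : ModuleCat.{u} P) (t : T) : Module.End S ((resMod H.src).obj N) where
  toFun n := (show (resMod H.src).obj N from H.tgt t • (show N from n))
  map_add' x y := smul_add (H.tgt t) (show N from x) (show N from y)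
  map_smul' s x := by
    change H.tgt t • H.src s • (show N from x) = H.src s • H.tgt t • (show N from x)
    rw [smul_smul, smul_smul, (H.comm s t).eq]

/-- The action of `U` on `Hom_S(M, N)` by precomposition. -/
noncomputable def actU (N : ModuleCat.{u} P) : U →ₐ[k] Module.End k (H.Carrier N) where
  toFun u :=
    { toFun h := h ∘ₗ (H.act u).unop
      map_add' h h' := LinearMap.add_comp _ _ _
      map_smul' c h := LinearMap.smul_comp _ _ _ }
  map_one' := by ext h m; simp
  map_mul' u v := by ext h m; simp
  map_zero' := by ext h m; simp
  map_add' u v := by ext h m; simp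
  commutes' c := by
    ext h m
    simp [Module.algebraMap_end_apply, AlgHom.commutes, MulOpposite.algebraMap_apply]

/-- The action of `T` on `Hom_S(M, N)` through the target. -/
noncomputable def actT (N : ModuleCat.{u} P) : T →ₐ[k] Module.End k (H.Carrier N) where
  toFun t :=
    { toFun h := H.smulT N t ∘ₗ h
      map_add' h h' := LinearMap.comp_add _ _ _
      map_smul' c h := by
        ext m
        exact map_smul (H.smulT N t) (algebraMap k S c) (h m) }
  map_one' := by
    ext h m
    exact (congrArg (· • (show N from h m)) (map_one H.tgt)).trans (one_smul P (show N from h m))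
  map_mul' u v := by
    ext h m
    exact (congrArg (· • (show N from h m)) (map_mul H.tgt u v)).trans
      (mul_smul _ _ (show N from h m))
  map_zero' := by
    ext h m
    exact (congrArg (· • (show N from h m)) (map_zero H.tgt)).trans (zero_smul P (show N from h m))
  map_add' u v := by
    ext h m
    exact (congrArg (· • (show N from h m)) (map_add H.tgt u v)).trans
      (add_smul _ _ (show N from h m))
  commutes' c := by
    ext h m
    change H.tgt (algebraMap k T c) • (show N from h m) =
      H.src (algebraMap k S c) • (show N from h m)
    rw [AlgHom.commutes, AlgHom.commutes]

/-- The action `(u ⊗ t) • h = t ∘ h ∘ u` of `U ⊗ₖ T` on `Hom_S(M, N)`. -/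
noncomputable def action (N : ModuleCat.{u} P) : U ⊗[k] T →ₐ[k] Module.End k (H.Carrier N) :=
  Algebra.TensorProduct.lift (H.actU N) (H.actT N) (fun _ _ => (commute_iff_eq _ _).2 rfl)

/-- The type underlying the `U ⊗ₖ T`-module `Hom_S(M, N)`. -/
def HomModule (N : ModuleCat.{u} P) : Type u := H.Carrier N

noncomputable instance (N : ModuleCat.{u} P) : AddCommGroup (H.HomModule N) :=
  inferInstanceAs (AddCommGroup (H.Carrier N))

noncomputable instance (N : ModuleCat.{u} P) : Module (U ⊗[k] T) (H.HomModule N) :=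
  Module.compHom (H.Carrier N) (H.action N).toRingHom

lemma action_tmul (N : ModuleCat.{u} P) (x : U) (t : T) (h : H.Carrier N) (m : H.M) :
    (show N from (H.action N (x ⊗ₜ t) h) m) = H.tgt t • (show N from h ((H.act x).unop m)) := rfl

lemma action_one_tmul (N : ModuleCat.{u} P) (t : T) (h : H.Carrier N) :
    H.action N (1 ⊗ₜ t) h = H.smulT N t ∘ₗ h := by
  have h1 : H.action N (1 ⊗ₜ t) = H.actU N 1 * H.actT N t := rfl
  rw [h1, map_one, one_mul]
  rfl

/-- An additive map out of `Hom_S(M, N)` is linear if it is compatible with pure tensors. -/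
lemma isLinear_of_tmul {N : ModuleCat.{u} P} {V : Type u} [AddCommGroup V]
    [Module (U ⊗[k] T) V] (f : H.Carrier N →+ V)
    (hf : ∀ x t h, f (H.action N (x ⊗ₜ t) h) = (x ⊗ₜ[k] t : U ⊗[k] T) • f h)
    (z : U ⊗[k] T) (h : H.Carrier N) : f (H.action N z h) = z • f h := by
  induction z using TensorProduct.induction_on with
  | zero => simp only [map_zero, LinearMap.zero_apply, zero_smul]
  | add z w hz hw => simp only [map_add, LinearMap.add_apply, hz, hw, add_smul]
  | tmul x t => exact hf x t h

/-- The postcomposition map `Hom_S(M, N) → Hom_S(M, N')`. -/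
noncomputable def homMap {N N' : ModuleCat.{u} P} (g : N ⟶ N') :
    H.Carrier N →+ H.HomModule N' where
  toFun h := (((resMod H.src).map g).hom ∘ₗ h : H.Carrier N')
  map_zero' := LinearMap.comp_zero _
  map_add' _ _ := LinearMap.comp_add _ _ _

/-- The functor `Hom_S(M, -)` from `P`-modules to `U ⊗ₖ T`-modules. -/
noncomputable def functor : ModuleCat.{u} P ⥤ ModuleCat.{u} (U ⊗[k] T) where
  obj N := ModuleCat.of (U ⊗[k] T) (H.HomModule N)
  map {N N'} g := ModuleCat.ofHom (X := H.HomModule N) (Y := H.HomModule N')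
    { toFun := H.homMap g
      map_add' := map_add (H.homMap g)
      map_smul' z h := H.isLinear_of_tmul (H.homMap g) (fun x t h => by
        refine LinearMap.ext fun m => ?_
        exact map_smul g.hom (H.tgt t) (show N from h ((H.act x).unop m))) z h }
  map_id N := rfl
  map_comp f g := rfl

instance : H.functor.Additive where
  map_add := rfl

end HomDatum

section Env

variable (k A : Type u) [Field k] [Ring A] [Algebra k A]

/-- The enveloping algebra `Aᵉ = A ⊗ₖ Aᵒᵖ`. -/
abbrev Env := A ⊗[k] Aᵐᵒᵖ

/-- `A` as a module over `Aᵉ`: `(a ⊗ b) • x = a x b`. -/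
noncomputable def bimodSelf : ModuleCat.{u} (Env k A) :=
  letI : Module (Env k A) A := Module.compHom A (AlgHom.mulLeftRight k A).toRingHom
  ModuleCat.of (Env k A) A

/-- The outside action of `Aᵉ` on `Aᵉ ⊗ₖ Aᵉ`-modules; on `M ⊗ₖ N` it is
`(a ⊗ b) • (m ⊗ n) = a m ⊗ n b`. -/
noncomputable def outside : Env k A →ₐ[k] Env k A ⊗[k] Env k A :=
  Algebra.TensorProduct.map Algebra.TensorProduct.includeLeft Algebra.TensorProduct.includeRight

/-- The inside action of `Aᵉ` on `Aᵉ ⊗ₖ Aᵉ`-modules; on `M ⊗ₖ N` it is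
`(a ⊗ b) • (m ⊗ n) = m b ⊗ a n`. -/
noncomputable def inside : Env k A →ₐ[k] Env k A ⊗[k] Env k A :=
  (Algebra.TensorProduct.map Algebra.TensorProduct.includeRight
    Algebra.TensorProduct.includeLeft).comp
      (Algebra.TensorProduct.comm k A Aᵐᵒᵖ).toAlgHom

variable {k} in
lemma commute_of_tmul {X Y Z W R : Type u} [Ring X] [Ring Y] [Ring Z] [Ring W] [Ring R]
    [Algebra k X] [Algebra k Y] [Algebra k Z] [Algebra k W] [Algebra k R]
    (F : X ⊗[k] Y →ₐ[k] R) (G : Z ⊗[k] W →ₐ[k] R)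
    (h : ∀ x y z w, Commute (F (x ⊗ₜ y)) (G (z ⊗ₜ w))) (s : X ⊗[k] Y) (t : Z ⊗[k] W) :
    Commute (F s) (G t) := by
  induction s using TensorProduct.induction_on with
  | zero => simp only [map_zero, Commute.zero_left]
  | add s s' hs hs' => simpa only [map_add] using hs.add_left hs'
  | tmul a b =>
    induction t using TensorProduct.induction_on with
    | zero => simp only [map_zero, Commute.zero_right]
    | add t t' ht ht' => simpa only [map_add] using ht.add_right ht'
    | tmul c d => exact h a b c d

lemma commute_outside_inside_tmul (a c : A) (b d : Aᵐᵒᵖ) :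
    Commute (outside k A (a ⊗ₜ[k] b)) (inside k A (c ⊗ₜ[k] d)) := by
  have h1 : outside k A (a ⊗ₜ[k] b) = (a ⊗ₜ[k] 1) ⊗ₜ[k] (1 ⊗ₜ[k] b) := rfl
  have h2 : inside k A (c ⊗ₜ[k] d) = (1 ⊗ₜ[k] d) ⊗ₜ[k] (c ⊗ₜ[k] 1) := rfl
  rw [h1, h2, commute_iff_eq]
  simp only [Algebra.TensorProduct.tmul_mul_tmul, mul_one, one_mul]

lemma commute_outside_inside (s t : Env k A) : Commute (outside k A s) (inside k A t) :=
  commute_of_tmul (R := Env k A ⊗[k] Env k A) (outside k A) (inside k A)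
    (fun a b c d => commute_outside_inside_tmul k A a c b d) s t

/-- The data defining the functor `Hom_{Aᵉ}(A, -)` from `Aᵉ ⊗ₖ Aᵉ`-modules, with respect to the
outside action, to `Aᵉ`-modules, through the inside action. -/
noncomputable def envDatum : HomDatum k (Env k A) k (Env k A) (Env k A ⊗[k] Env k A) where
  src := outside k A
  tgt := inside k A
  comm := commute_outside_inside k A
  M := bimodSelf k A
  act := Algebra.ofId k _

/-- The functor `Hom_{Aᵉ}(A, -)` from `Aᵉ ⊗ₖ Aᵉ`-modules to `Aᵉ`-modules. -/
noncomputable def homEnv : ModuleCat.{u} (Env k A ⊗[k] Env k A) ⥤ ModuleCat.{u} (Env k A) :=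
  (envDatum k A).functor ⋙ resMod Algebra.TensorProduct.includeRight

instance : (homEnv k A).Additive := by
  dsimp only [homEnv]
  infer_instance

end Env
end Hom

section Maps

variable {k A B : Type u} [Field k] [Ring A] [Ring B] [Algebra k A] [Algebra k B]

/-- The homomorphism `Aᵉ → Bᵉ` induced by `A → B`. -/
noncomputable def envMap (f : A →ₐ[k] B) : Env k A →ₐ[k] Env k B :=
  Algebra.TensorProduct.map f (AlgHom.op f)

lemma envMap_tmul (f : A →ₐ[k] B) (a : A) (b : Aᵐᵒᵖ) :
    envMap f (a ⊗ₜ b) = f a ⊗ₜ MulOpposite.op (f b.unop) := rfl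

lemma envMap_left (f : A →ₐ[k] B) (a : A) : envMap f (a ⊗ₜ 1) = f a ⊗ₜ 1 := by
  rw [envMap_tmul, MulOpposite.unop_one, map_one, MulOpposite.op_one]

lemma envMap_right (f : A →ₐ[k] B) (a : Aᵐᵒᵖ) :
    envMap f (1 ⊗ₜ a) = 1 ⊗ₜ MulOpposite.op (f a.unop) := by
  rw [envMap_tmul, map_one]

/-- The homomorphism `Aᵉ ⊗ Aᵉ → Bᵉ ⊗ Bᵉ` induced by `A → B`. -/
noncomputable def env2Map (f : A →ₐ[k] B) : Env k A ⊗[k] Env k A →ₐ[k] Env k B ⊗[k] Env k B :=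
  Algebra.TensorProduct.map (envMap f) (envMap f)

/-- `B` as a left `A`-module. -/
noncomputable def leftMod (f : A →ₐ[k] B) : ModuleCat.{u} A := (resMod f).obj (ModuleCat.of B B)

/-- `B` as a right `A`-module, that is as an `Aᵒᵖ`-module. -/
noncomputable def rightMod (f : A →ₐ[k] B) : ModuleCat.{u} Aᵐᵒᵖ :=
  (resMod (AlgHom.op f)).obj (ModuleCat.of Bᵐᵒᵖ B)

attribute [local instance] ModuleCat.moduleOfAlgebraModule
  ModuleCat.isScalarTower_of_algebra_moduleCat

/-- Right multiplication by elements of `A` on the left `A`-module `B`. -/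
noncomputable def leftAct (f : A →ₐ[k] B) : A →ₐ[k] (Module.End A (leftMod f))ᵐᵒᵖ where
  toFun a := MulOpposite.op
    { toFun := fun b : B => (b * f a : B)
      map_add' := fun x y : B => add_mul x y (f a)
      map_smul' := fun (c : A) (x : B) => mul_assoc (f c) x (f a) }
  map_one' := MulOpposite.unop_injective (LinearMap.ext fun b : B => by
    change b * f 1 = b
    rw [map_one, mul_one])
  map_mul' a a' := MulOpposite.unop_injective (LinearMap.ext fun b : B => by
    change b * f (a * a') = b * f a * f a'
    rw [map_mul, mul_assoc])
  map_zero' := MulOpposite.unop_injective (LinearMap.ext fun b : B => by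
    change b * f 0 = 0
    rw [map_zero, mul_zero])
  map_add' a a' := MulOpposite.unop_injective (LinearMap.ext fun b : B => by
    change b * f (a + a') = b * f a + b * f a'
    rw [map_add, mul_add])
  commutes' c := MulOpposite.unop_injective (LinearMap.ext fun b : B => by
    change b * f (algebraMap k A c) = f (algebraMap k A c) * b
    rw [AlgHom.commutes, Algebra.commutes])

/-- Left multiplication by elements of `A` on the right `A`-module `B`. -/
noncomputable def rightAct (f : A →ₐ[k] B) : Aᵐᵒᵖ →ₐ[k] (Module.End Aᵐᵒᵖ (rightMod f))ᵐᵒᵖ where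
  toFun a := MulOpposite.op
    { toFun := fun b : B => (f a.unop * b : B)
      map_add' := fun x y : B => mul_add (f a.unop) x y
      map_smul' := fun (c : Aᵐᵒᵖ) (x : B) => (mul_assoc (f a.unop) x (f c.unop)).symm }
  map_one' := MulOpposite.unop_injective (LinearMap.ext fun b : B => by
    change f 1 * b = b
    rw [map_one, one_mul])
  map_mul' a a' := MulOpposite.unop_injective (LinearMap.ext fun b : B => by
    change f (a'.unop * a.unop) * b = f a'.unop * (f a.unop * b)
    rw [map_mul, mul_assoc])
  map_zero' := MulOpposite.unop_injective (LinearMap.ext fun b : B => by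
    change f 0 * b = 0
    rw [map_zero, zero_mul])
  map_add' a a' := MulOpposite.unop_injective (LinearMap.ext fun b : B => by
    change f (a.unop + a'.unop) * b = f a.unop * b + f a'.unop * b
    rw [map_add, add_mul])
  commutes' c := MulOpposite.unop_injective (LinearMap.ext fun b : B => by
    change f (algebraMap k A c) * b = b * f (algebraMap k A c)
    rw [AlgHom.commutes, Algebra.commutes])

/-- The data defining the functor `Hom_A(B, -)` on `Aᵉ`-modules. -/
noncomputable def leftDatum (f : A →ₐ[k] B) : HomDatum k A A Aᵐᵒᵖ (Env k A) where
  src := Algebra.TensorProduct.includeLeft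
  tgt := Algebra.TensorProduct.includeRight
  comm a b := by
    change (a ⊗ₜ[k] 1) * (1 ⊗ₜ[k] b) = (1 ⊗ₜ[k] b) * (a ⊗ₜ[k] 1)
    simp only [Algebra.TensorProduct.tmul_mul_tmul, mul_one, one_mul]
  M := leftMod f
  act := leftAct f

/-- The data defining the functor `Hom_{Aᵒᵖ}(B, -)` on `Aᵉ`-modules. -/
noncomputable def rightDatum (f : A →ₐ[k] B) : HomDatum k Aᵐᵒᵖ Aᵐᵒᵖ A (Env k A) where
  src := Algebra.TensorProduct.includeRight
  tgt := Algebra.TensorProduct.includeLeft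
  comm b a := by
    change (1 ⊗ₜ[k] b) * (a ⊗ₜ[k] 1) = (a ⊗ₜ[k] 1) * (1 ⊗ₜ[k] b)
    simp only [Algebra.TensorProduct.tmul_mul_tmul, mul_one, one_mul]
  M := rightMod f
  act := rightAct f

/-- The functor `Hom_A(B, -)` from `Aᵉ`-modules to `Aᵉ`-modules;
`((a ⊗ a') • h)(b) = h(b a) a'`. -/
noncomputable def homLeft (f : A →ₐ[k] B) : ModuleCat.{u} (Env k A) ⥤ ModuleCat.{u} (Env k A) :=
  (leftDatum f).functor

/-- The functor `Hom_{Aᵒᵖ}(B, -)` from `Aᵉ`-modules to `Aᵉ`-modules;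
`((a ⊗ a') • h)(b) = a h(a' b)`. -/
noncomputable def homRight (f : A →ₐ[k] B) : ModuleCat.{u} (Env k A) ⥤ ModuleCat.{u} (Env k A) :=
  (rightDatum f).functor ⋙ resMod (Algebra.TensorProduct.comm k A Aᵐᵒᵖ).toAlgHom

instance (f : A →ₐ[k] B) : (homLeft f).Additive := by
  dsimp only [homLeft]
  infer_instance

instance (f : A →ₐ[k] B) : (homRight f).Additive := by
  dsimp only [homRight]
  infer_instance

/-- For a `Bᵉ`-module `N`, the map `N → Hom_A(B, N)`, `n ↦ (b ↦ b n)`. -/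
noncomputable def evalLeftMap (f : A →ₐ[k] B) (N : ModuleCat.{u} (Env k B)) :
    N →+ (leftDatum f).Carrier ((resMod (envMap f)).obj N) where
  toFun n :=
    { toFun := fun b : B => ((b ⊗ₜ[k] (1 : Bᵐᵒᵖ) : Env k B) • n : N)
      map_add' := fun x y : B => by
        change ((x + y) ⊗ₜ[k] (1 : Bᵐᵒᵖ) : Env k B) • n = (x ⊗ₜ[k] 1 : Env k B) • n +
          (y ⊗ₜ[k] 1 : Env k B) • n
        rw [TensorProduct.add_tmul, add_smul]
      map_smul' := fun (a : A) (x : B) => by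
        change ((f a * x) ⊗ₜ[k] (1 : Bᵐᵒᵖ) : Env k B) • n =
          envMap f (a ⊗ₜ[k] 1) • (x ⊗ₜ[k] 1 : Env k B) • n
        rw [envMap_left, smul_smul, Algebra.TensorProduct.tmul_mul_tmul, one_mul] }
  map_zero' := LinearMap.ext fun b : B => smul_zero (A := N) (b ⊗ₜ[k] (1 : Bᵐᵒᵖ) : Env k B)
  map_add' n n' := LinearMap.ext fun b : B => smul_add (b ⊗ₜ[k] (1 : Bᵐᵒᵖ) : Env k B) n n'

/-- For a `Bᵉ`-module `N`, the map `N → Hom_{Aᵒᵖ}(B, N)`, `n ↦ (b ↦ n b)`. -/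
noncomputable def evalRightMap (f : A →ₐ[k] B) (N : ModuleCat.{u} (Env k B)) :
    N →+ (rightDatum f).Carrier ((resMod (envMap f)).obj N) where
  toFun n :=
    { toFun := fun b : B => (((1 : B) ⊗ₜ[k] MulOpposite.op b : Env k B) • n : N)
      map_add' := fun x y : B => by
        change ((1 : B) ⊗ₜ[k] (MulOpposite.op x + MulOpposite.op y) : Env k B) • n =
          (1 ⊗ₜ[k] MulOpposite.op x : Env k B) • n + (1 ⊗ₜ[k] MulOpposite.op y : Env k B) • n
        rw [TensorProduct.tmul_add, add_smul]
      map_smul' := fun (a : Aᵐᵒᵖ) (x : B) => by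
        change ((1 : B) ⊗ₜ[k] MulOpposite.op (x * f a.unop) : Env k B) • n =
          envMap f (1 ⊗ₜ[k] a) • (1 ⊗ₜ[k] MulOpposite.op x : Env k B) • n
        rw [envMap_right, smul_smul, Algebra.TensorProduct.tmul_mul_tmul, one_mul,
          MulOpposite.op_mul] }
  map_zero' := LinearMap.ext fun b : B => smul_zero (A := N) ((1 : B) ⊗ₜ[k] MulOpposite.op b : Env k B)
  map_add' n n' := LinearMap.ext fun b : B =>
    smul_add ((1 : B) ⊗ₜ[k] MulOpposite.op b : Env k B) n n'

lemma evalLeftMap_smul (f : A →ₐ[k] B) (N : ModuleCat.{u} (Env k B)) (z : Env k A) (n : N) :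
    evalLeftMap f N (envMap f z • n) =
      (leftDatum f).action ((resMod (envMap f)).obj N) z (evalLeftMap f N n) := by
  induction z using TensorProduct.induction_on with
  | zero =>
    have h0 : envMap f 0 • n = 0 := by rw [map_zero]; exact zero_smul (Env k B) n
    rw [h0, map_zero, map_zero, LinearMap.zero_apply]
  | add z w hz hw => simp only [map_add, add_smul, LinearMap.add_apply, hz, hw]
  | tmul a a' =>
    refine LinearMap.ext fun b : B => ?_
    change (b ⊗ₜ[k] 1 : Env k B) • envMap f (a ⊗ₜ a') • n =
      envMap f (1 ⊗ₜ a') • ((b * f a) ⊗ₜ[k] 1 : Env k B) • n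
    rw [smul_smul, smul_smul, envMap_tmul, envMap_right, Algebra.TensorProduct.tmul_mul_tmul,
      Algebra.TensorProduct.tmul_mul_tmul, one_mul, one_mul, mul_one]

/-- The natural map `N → Hom_A(B, N)`, `n ↦ (b ↦ b n)`, for `Bᵉ`-modules `N`. -/
noncomputable def evalLeft (f : A →ₐ[k] B) : resMod (envMap f) ⟶ resMod (envMap f) ⋙ homLeft f where
  app N := ModuleCat.ofHom (X := (resMod (envMap f)).obj N)
      (Y := (leftDatum f).HomModule ((resMod (envMap f)).obj N))
    { toFun := evalLeftMap f N
      map_add' := map_add (evalLeftMap f N)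
      map_smul' z n := evalLeftMap_smul f N z n }
  naturality N N' g := by
    ext n
    refine LinearMap.ext fun b : B => ?_
    exact (map_smul g.hom (b ⊗ₜ[k] 1 : Env k B) (show N from n)).symm

lemma evalRightMap_smul (f : A →ₐ[k] B) (N : ModuleCat.{u} (Env k B)) (z : Env k A) (n : N) :
    evalRightMap f N (envMap f z • n) =
      (rightDatum f).action ((resMod (envMap f)).obj N)
        ((Algebra.TensorProduct.comm k A Aᵐᵒᵖ).toAlgHom z) (evalRightMap f N n) := by
  induction z using TensorProduct.induction_on with
  | zero =>
    have h0 : envMap f 0 • n = 0 := by rw [map_zero]; exact zero_smul (Env k B) n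
    rw [h0, map_zero, map_zero, map_zero, LinearMap.zero_apply]
  | add z w hz hw => simp only [map_add, add_smul, LinearMap.add_apply, hz, hw]
  | tmul a a' =>
    refine LinearMap.ext fun b : B => ?_
    change ((1 : B) ⊗ₜ[k] MulOpposite.op b : Env k B) • envMap f (a ⊗ₜ a') • n =
      envMap f (a ⊗ₜ 1) • ((1 : B) ⊗ₜ[k] MulOpposite.op (f a'.unop * b) : Env k B) • n
    rw [smul_smul, smul_smul, envMap_tmul, envMap_left, Algebra.TensorProduct.tmul_mul_tmul,
      Algebra.TensorProduct.tmul_mul_tmul, one_mul, one_mul, mul_one, MulOpposite.op_mul]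

/-- The natural map `N → Hom_{Aᵒᵖ}(B, N)`, `n ↦ (b ↦ n b)`, for `Bᵉ`-modules `N`. -/
noncomputable def evalRight (f : A →ₐ[k] B) :
    resMod (envMap f) ⟶ resMod (envMap f) ⋙ homRight f where
  app N := ModuleCat.ofHom (X := (resMod (envMap f)).obj N)
      (Y := (homRight f).obj ((resMod (envMap f)).obj N))
    { toFun := evalRightMap f N
      map_add' := map_add (evalRightMap f N)
      map_smul' z n := evalRightMap_smul f N z n }
  naturality N N' g := by
    ext n
    refine LinearMap.ext fun b : B => ?_
    exact (map_smul g.hom ((1 : B) ⊗ₜ[k] MulOpposite.op b : Env k B) (show N from n)).symm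

/-- The map `f : A → B` as a homomorphism of `Aᵉ`-modules. -/
noncomputable def bimodMap (f : A →ₐ[k] B) :
    bimodSelf k A →ₗ[Env k A] (resMod (envMap f)).obj (bimodSelf k B) where
  toFun a := (f (show A from a) : B)
  map_add' x y := map_add f (show A from x) (show A from y)
  map_smul' z x := by
    change f (AlgHom.mulLeftRight k A z (show A from x)) =
      AlgHom.mulLeftRight k B (envMap f z) (f (show A from x))
    generalize (show A from x) = y
    induction z using TensorProduct.induction_on with
    | zero => simp only [map_zero, LinearMap.zero_apply]
    | add z w hz hw => simp only [map_add, LinearMap.add_apply, hz, hw]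
    | tmul a a' =>
      rw [envMap_tmul, AlgHom.mulLeftRight_apply, AlgHom.mulLeftRight_apply, map_mul, map_mul,
        MulOpposite.unop_op]

lemma env2Map_outside (f : A →ₐ[k] B) (z : Env k A) :
    env2Map f (outside k A z) = outside k B (envMap f z) := by
  induction z using TensorProduct.induction_on with
  | zero => simp only [map_zero]
  | add z w hz hw => simp only [map_add, hz, hw]
  | tmul a a' =>
    change envMap f (a ⊗ₜ[k] 1) ⊗ₜ[k] envMap f (1 ⊗ₜ[k] a') =
      (f a ⊗ₜ[k] 1) ⊗ₜ[k] (1 ⊗ₜ[k] MulOpposite.op (f a'.unop))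
    rw [envMap_left, envMap_right]

lemma env2Map_inside (f : A →ₐ[k] B) (z : Env k A) :
    env2Map f (inside k A z) = inside k B (envMap f z) := by
  induction z using TensorProduct.induction_on with
  | zero => simp only [map_zero]
  | add z w hz hw => simp only [map_add, hz, hw]
  | tmul a a' =>
    change envMap f (1 ⊗ₜ[k] a') ⊗ₜ[k] envMap f (a ⊗ₜ[k] 1) =
      (1 ⊗ₜ[k] MulOpposite.op (f a'.unop)) ⊗ₜ[k] (f a ⊗ₜ[k] 1)
    rw [envMap_left, envMap_right]

/-- The map `Hom_{Bᵉ}(B, N) → Hom_{Aᵉ}(A, N)`, `h ↦ h ∘ f`, for a `Bᵉ ⊗ Bᵉ`-module `N`. -/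
noncomputable def precompMap (f : A →ₐ[k] B) (N : ModuleCat.{u} (Env k B ⊗[k] Env k B)) :
    (envDatum k B).Carrier N →+ (envDatum k A).Carrier ((resMod (env2Map f)).obj N) where
  toFun h :=
    { toFun := fun a => h (bimodMap f a)
      map_add' := fun x y => (congrArg h (map_add (bimodMap f) x y)).trans (map_add h _ _)
      map_smul' := fun z x => (congrArg h (map_smul (bimodMap f) z x)).trans
        ((map_smul h (envMap f z) (bimodMap f x)).trans
          (congrArg (fun w => w • (show N from h (bimodMap f x))) (env2Map_outside f z).symm)) }
  map_zero' := rfl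
  map_add' _ _ := rfl

lemma precompMap_smul (f : A →ₐ[k] B) (N : ModuleCat.{u} (Env k B ⊗[k] Env k B)) (z : Env k A)
    (h : (envDatum k B).Carrier N) :
    precompMap f N ((envDatum k B).action N (1 ⊗ₜ envMap f z) h) =
      (envDatum k A).action ((resMod (env2Map f)).obj N) (1 ⊗ₜ z) (precompMap f N h) := by
  rw [HomDatum.action_one_tmul, HomDatum.action_one_tmul]
  refine LinearMap.ext fun a => ?_
  exact congrArg (fun w => w • (show N from h (bimodMap f a))) (env2Map_inside f z).symm

lemma homEnv_smul (N : ModuleCat.{u} (Env k A ⊗[k] Env k A)) (z : Env k A)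
    (h : (homEnv k A).obj N) : z • h = (envDatum k A).action N (1 ⊗ₜ z) h := rfl

lemma resMod_homEnv_smul (f : A →ₐ[k] B) (N : ModuleCat.{u} (Env k B ⊗[k] Env k B)) (z : Env k A)
    (h : (resMod (envMap f)).obj ((homEnv k B).obj N)) :
    z • h = (envDatum k B).action N (1 ⊗ₜ envMap f z) h := rfl

/-- `precompMap` as a homomorphism of `Aᵉ`-modules. -/
noncomputable def precompLin (f : A →ₐ[k] B) (N : ModuleCat.{u} (Env k B ⊗[k] Env k B)) :
    (resMod (envMap f)).obj ((homEnv k B).obj N) →ₗ[Env k A]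
      (homEnv k A).obj ((resMod (env2Map f)).obj N) where
  toFun := precompMap f N
  map_add' := map_add (precompMap f N)
  map_smul' z h := (congrArg (precompMap f N) (resMod_homEnv_smul f N z h)).trans
    ((precompMap_smul f N z h).trans
      (homEnv_smul ((resMod (env2Map f)).obj N) z (precompMap f N h)).symm)


noncomputable def precompHom (f : A →ₐ[k] B) (N : ModuleCat.{u} (Env k B ⊗[k] Env k B)) :
    (resMod (envMap f)).obj ((homEnv k B).obj N) ⟶
      (homEnv k A).obj ((resMod (env2Map f)).obj N) :=
  ModuleCat.homEquiv.symm (precompLin f N)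

noncomputable def precomp (f : A →ₐ[k] B) :
    homEnv k B ⋙ resMod (envMap f) ⟶ resMod (env2Map f) ⋙ homEnv k A where
  app N := precompHom f N
  naturality N N' g := by
    ext h
    rfl

end Maps

section Derived

variable {P P' X Y : Type u} [Ring P] [Ring P'] [Ring X] [Ring Y]

/-- The natural transformation on bounded below homotopy categories induced by a natural
transformation. -/
def mapHPlus {F G : ModuleCat.{u} P ⥤ ModuleCat.{u} X} [F.Additive] [G.Additive] (τ : F ⟶ G) :
    F.mapHomotopyCategoryPlus ⟶ G.mapHomotopyCategoryPlus where
  app K := ObjectProperty.homMk ((NatTrans.mapHomotopyCategory τ (ComplexShape.up ℤ)).app K.obj)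
  naturality K L g := by
    ext : 1
    exact (NatTrans.mapHomotopyCategory τ (ComplexShape.up ℤ)).naturality g.hom

/-- The right derived functor `RF : D⁺(Mod P) ⥤ D⁺(Mod X)`, computed by injective resolutions. -/
noncomputable abbrev RD (F : ModuleCat.{u} P ⥤ ModuleCat.{u} X) [F.Additive] :
    DPlus P ⥤ DPlus X :=
  F.rightDerivedFunctorPlus

/-- The canonical morphism `F(K) ⟶ RF(K)`. -/
noncomputable abbrev unitRD (F : ModuleCat.{u} P ⥤ ModuleCat.{u} X) [F.Additive] :
    F.mapHomotopyCategoryPlus ⋙ QhPlus X ⟶ QhPlus P ⋙ RD F :=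
  F.rightDerivedFunctorPlusUnit

section Precomp

variable {F : ModuleCat.{u} P ⥤ ModuleCat.{u} X} [F.Additive]
  {G : ModuleCat.{u} X ⥤ ModuleCat.{u} Y} [G.Additive]
  [PreservesFiniteLimits G] [PreservesFiniteColimits G]
  {H : ModuleCat.{u} P ⥤ ModuleCat.{u} P'} [H.Additive]
  [PreservesFiniteLimits H] [PreservesFiniteColimits H]
  {F' : ModuleCat.{u} P' ⥤ ModuleCat.{u} Y} [F'.Additive]

instance isRightDerived_comp_exactD :
    (RD F ⋙ exactD G).IsRightDerivedFunctor
      (F := (F.mapHomotopyCategoryPlus ⋙ QhPlus X) ⋙ exactD G) (L := QhPlus P)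
      (Functor.whiskerRight (unitRD F) (exactD G))
      (HomotopyCategory.Plus.quasiIso (ModuleCat.{u} P)) := by
  refine (HomotopyCategory.Plus.localizerMorphism_derives
    ((F.mapHomotopyCategoryPlus ⋙ QhPlus X) ⋙ exactD G)).isRightDerivedFunctor_of_isIso _ ?_
  intro K
  rw [Functor.whiskerRight_app]
  infer_instance

/-- The morphism `G(RF(K)) ⟶ RF'(H(K))` induced by a natural transformation `G ∘ F ⟶ F' ∘ H`,
where `G` and `H` are exact. On a complex `I` of injectives it is
`G(RF(I)) = G(F(I)) ⟶ F'(H(I)) ⟶ RF'(H(I))`. -/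
noncomputable def derivedComparison (τ : F ⋙ G ⟶ H ⋙ F') :
    RD F ⋙ exactD G ⟶ exactD H ⋙ RD F' :=
  (RD F ⋙ exactD G).rightDerivedDesc (F := (F.mapHomotopyCategoryPlus ⋙ QhPlus X) ⋙ exactD G)
    (L := QhPlus P) (Functor.whiskerRight (unitRD F) (exactD G))
    (HomotopyCategory.Plus.quasiIso (ModuleCat.{u} P)) (exactD H ⋙ RD F')
    (Functor.whiskerLeft F.mapHomotopyCategoryPlus (exactDIso G).hom ≫
      Functor.whiskerRight
        ((Functor.mapHomotopyCategoryPlusCompIso (Iso.refl (F ⋙ G))).hom ≫ mapHPlus τ ≫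
          (Functor.mapHomotopyCategoryPlusCompIso (Iso.refl (H ⋙ F'))).inv) (QhPlus Y) ≫
      Functor.whiskerLeft H.mapHomotopyCategoryPlus (unitRD F') ≫
      Functor.whiskerRight (exactDIso H).inv (RD F'))

/-- The morphism `H(K) ⟶ RF'(H(K))` induced by a natural transformation `H ⟶ F' ∘ H`, where `H`
is exact. -/
noncomputable def derivedEval {F' : ModuleCat.{u} P' ⥤ ModuleCat.{u} P'} [F'.Additive]
    (τ : H ⟶ H ⋙ F') : exactD H ⟶ exactD H ⋙ RD F' :=
  Localization.liftNatTrans (QhPlus P) (HomotopyCategory.Plus.quasiIso (ModuleCat.{u} P))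
    (QhPlus P ⋙ exactD H) (QhPlus P ⋙ exactD H ⋙ RD F') _ _
    ((exactDIso H).hom ≫
      Functor.whiskerRight (mapHPlus τ ≫
        (Functor.mapHomotopyCategoryPlusCompIso (Iso.refl (H ⋙ F'))).inv) (QhPlus P') ≫
      Functor.whiskerLeft H.mapHomotopyCategoryPlus (unitRD F') ≫
      Functor.whiskerRight (exactDIso H).inv (RD F'))

end Precomp

end Derived

section Rigid

variable (k A : Type u) [Field k] [Ring A] [Algebra k A]

/-- The functor `RHom_{Aᵉ}(A, -)` from `D⁺(Mod (Aᵉ ⊗ Aᵉ))` to `D⁺(Mod Aᵉ)`. -/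
noncomputable def rhomEnv : DPlus (Env k A ⊗[k] Env k A) ⥤ DPlus (Env k A) := RD (homEnv k A)

/-- The functor `M ↦ RHom_{Aᵉ}(A, M ⊗ₖ M)` on `D⁺(Mod Aᵉ)`. -/
noncomputable def rhomSq : DPlus (Env k A) ⥤ DPlus (Env k A) :=
  tensorSq k (Env k A) ⋙ rhomEnv k A

variable {k A} {B : Type u} [Ring B] [Algebra k B] (f : A →ₐ[k] B)

/-- The morphism `RHom_{Bᵉ}(B, M ⊗ₖ M) ⟶ RHom_{Aᵉ}(A, N ⊗ₖ N)` induced by `f : A → B` and a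
morphism `ψ : M ⟶ N` in the derived category of `Aᵉ`-modules. -/
noncomputable def rhomSqMap {M : DPlus (Env k B)} {N : DPlus (Env k A)}
    (ψ : (resD (envMap f)).obj M ⟶ N) :
    (resD (envMap f)).obj ((rhomSq k B).obj M) ⟶ (rhomSq k A).obj N :=
  (derivedComparison (precomp f)).app ((tensorSq k (Env k B)).obj M) ≫
    (rhomEnv k A).map ((tensorSqRes (envMap f)).inv.app M ≫ (tensorSq k (Env k A)).map ψ)

/-- The morphism `M ⟶ RHom_A(B, N)`, `m ↦ (b ↦ ψ(b m))`, induced by `ψ : M ⟶ N`. -/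
noncomputable def inducedLeft {M : DPlus (Env k B)} {N : DPlus (Env k A)}
    (ψ : (resD (envMap f)).obj M ⟶ N) :
    (resD (envMap f)).obj M ⟶ (RD (homLeft f)).obj N :=
  (derivedEval (evalLeft f)).app M ≫ (RD (homLeft f)).map ψ

/-- The morphism `M ⟶ RHom_{Aᵒᵖ}(B, N)`, `m ↦ (b ↦ ψ(m b))`, induced by `ψ : M ⟶ N`. -/
noncomputable def inducedRight {M : DPlus (Env k B)} {N : DPlus (Env k A)}
    (ψ : (resD (envMap f)).obj M ⟶ N) :
    (resD (envMap f)).obj M ⟶ (RD (homRight f)).obj N :=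
  (derivedEval (evalRight f)).app M ≫ (RD (homRight f)).map ψ

end Rigid

section Dualizing

variable {k S A P : Type u} [Field k] [Ring S] [Ring A] [Ring P] [Algebra k S] [Algebra k P]

/-- If `t : P` commutes with the image of `σ : S → P`, then multiplication by `t` is an
`S`-linear endomorphism of every `P`-module. -/
noncomputable def mulNat (σ : S →ₐ[k] P) (t : P) (h : ∀ s, Commute (σ s) t) :
    resMod σ ⟶ resMod σ where
  app N := ModuleCat.homEquiv.symm
    { toFun := fun n => (show (resMod σ).obj N from t • (show N from n))
      map_add' := fun x y => smul_add t (show N from x) (show N from y)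
      map_smul' := fun s x => by
        change t • σ s • (show N from x) = σ s • t • (show N from x)
        rw [smul_smul, smul_smul, (h s).eq] }
  naturality N N' g := by
    ext n
    exact (map_smul g.hom t (show N from n)).symm

open CochainComplex HomComplex

/-- Multiplication by `t : P` as a degree zero cochain of the complex `Hom_S(I, I)`. -/
noncomputable def mulCochain (σ : S →ₐ[k] P) (t : P) (h : ∀ s, Commute (σ s) t)
    (I : CochainComplex (ModuleCat.{u} P) ℤ) :
    Cochain (((resMod σ).mapHomologicalComplex (ComplexShape.up ℤ)).obj I)
      (((resMod σ).mapHomologicalComplex (ComplexShape.up ℤ)).obj I) 0 :=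
  Cochain.ofHom ((NatTrans.mapHomologicalComplex (mulNat σ t h) (ComplexShape.up ℤ)).app I)

lemma mulCochain_zero (σ : S →ₐ[k] P) (t : P) (h : ∀ s, Commute (σ s) t) (ht : t = 0)
    (I : CochainComplex (ModuleCat.{u} P) ℤ) : mulCochain σ t h I = 0 := by
  rw [mulCochain, ← Cochain.ofHom_zero]
  congr 1
  ext n x
  exact (congrArg (· • (show I.X n from x)) ht).trans (zero_smul P (show I.X n from x))

lemma mulCochain_add (σ : S →ₐ[k] P) (t a b : P) (h : ∀ s, Commute (σ s) t)
    (ha : ∀ s, Commute (σ s) a) (hb : ∀ s, Commute (σ s) b) (ht : t = a + b)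
    (I : CochainComplex (ModuleCat.{u} P) ℤ) :
    mulCochain σ t h I = mulCochain σ a ha I + mulCochain σ b hb I := by
  rw [mulCochain, mulCochain, mulCochain, ← Cochain.ofHom_add]
  congr 1
  ext n x
  exact (congrArg (· • (show I.X n from x)) ht).trans (add_smul a b (show I.X n from x))

/-- For an additive map `τ : A → P` whose image commutes with that of `σ : S → P`, the
canonical morphism of complexes `A ⟶ Hom_S(I, I)` sending `a` to multiplication by `τ(a)`. -/
noncomputable def canonicalMap (σ : S →ₐ[k] P) (τ : A →+ P) (h : ∀ s a, Commute (σ s) (τ a))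
    (I : CochainComplex (ModuleCat.{u} P) ℤ) :
    (HomologicalComplex.single AddCommGrpCat.{u} (ComplexShape.up ℤ) 0).obj (AddCommGrpCat.of A) ⟶
      HomComplex (((resMod σ).mapHomologicalComplex (ComplexShape.up ℤ)).obj I)
        (((resMod σ).mapHomologicalComplex (ComplexShape.up ℤ)).obj I) :=
  HomologicalComplex.mkHomFromSingle
    (AddCommGrpCat.ofHom
      { toFun := fun a => mulCochain σ (τ a) (fun s => h s a) I
        map_zero' := mulCochain_zero σ _ _ (map_zero τ) I
        map_add' := fun a b => mulCochain_add σ _ _ _ _ _ _ (map_add τ a b) I })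
    (fun i _ => by
      refine ConcreteCategory.hom_ext _ _ fun a => ?_
      exact δ_ofHom ((NatTrans.mapHomologicalComplex (mulNat σ (τ a) (fun s => h s a))
        (ComplexShape.up ℤ)).app I))

end Dualizing

section RigidComplex

variable (k A : Type u) [Field k] [Ring A] [Algebra k A]

/-- The homomorphism `A → Aᵉ`, `a ↦ a ⊗ 1`. -/
noncomputable abbrev inclLeft : A →ₐ[k] Env k A := Algebra.TensorProduct.includeLeft

/-- The homomorphism `Aᵒᵖ → Aᵉ`, `a ↦ 1 ⊗ a`. -/
noncomputable abbrev inclRight : Aᵐᵒᵖ →ₐ[k] Env k A := Algebra.TensorProduct.includeRight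

lemma commute_incl (a : A) (b : Aᵐᵒᵖ) : Commute (inclLeft k A a) (inclRight k A b) := by
  change (a ⊗ₜ[k] 1) * (1 ⊗ₜ[k] b) = (1 ⊗ₜ[k] b) * (a ⊗ₜ[k] 1)
  simp only [Algebra.TensorProduct.tmul_mul_tmul, mul_one, one_mul]

/-- For a complex `I` of `Aᵉ`-modules, the canonical morphism `A ⟶ Hom_A(I, I)` sending `a` to
the endomorphism `x ↦ x a`. -/
noncomputable def canonicalLeft (I : CochainComplex (ModuleCat.{u} (Env k A)) ℤ) :=
  canonicalMap (inclLeft k A)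
    ((inclRight k A : Aᵐᵒᵖ →+ Env k A).comp (MulOpposite.opAddEquiv : A ≃+ Aᵐᵒᵖ).toAddMonoidHom)
    (fun a b => commute_incl k A a (MulOpposite.op b)) I

/-- For a complex `I` of `Aᵉ`-modules, the canonical morphism `A ⟶ Hom_{Aᵒᵖ}(I, I)` sending `a`
to the endomorphism `x ↦ a x`. -/
noncomputable def canonicalRight (I : CochainComplex (ModuleCat.{u} (Env k A)) ℤ) :=
  canonicalMap (inclRight k A) (inclLeft k A : A →+ Env k A)
    (fun b a => (commute_incl k A a b).symm) I

variable {k}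

/-- `N ∈ D⁺(Mod S)` has finite injective dimension: there is `q₀` with `Ext^q(M, N) = 0` for all
`S`-modules `M` and all `q > q₀`. -/
def FiniteInjDim {S : Type u} [Ring S] (N : DPlus S) : Prop :=
  ∃ q₀ : ℤ, ∀ (M : ModuleCat.{u} S) (q : ℤ), q₀ < q →
    ∀ g : (DerivedCategory.Plus.singleFunctor (ModuleCat.{u} S) 0).obj M ⟶ N⟦q⟧, g = 0

/-- All cohomology modules are finitely generated. -/
def FiniteCohomology {S : Type u} [Ring S] (N : DPlus S) : Prop :=
  ∀ q : ℤ, Module.Finite S ((DerivedCategory.Plus.homologyFunctor (ModuleCat.{u} S) q).obj N)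

variable {A}

/-- A complex `R ∈ Dᵇ(Mod Aᵉ)` is dualizing over `A` if it has finite injective dimension and
finitely generated cohomology over `A` and over `Aᵒᵖ`, and if the canonical morphisms
`A ⟶ RHom_A(R, R)` and `A ⟶ RHom_{Aᵒᵖ}(R, R)` are isomorphisms. The latter complexes are computed
by replacing `R` with a bounded below complex `I` of injective `Aᵉ`-modules (which are
injective over `A` and over `Aᵒᵖ`), and a morphism of complexes is an isomorphism in the derived
category if and only if the map of underlying complexes of abelian groups is a
quasi-isomorphism. -/
structure IsDualizing (R : DPlus (Env k A)) : Prop where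
  bounded : ∃ n : ℤ, R.IsLE n
  injDim_left : FiniteInjDim ((resD (inclLeft k A)).obj R)
  injDim_right : FiniteInjDim ((resD (inclRight k A)).obj R)
  finite_left : FiniteCohomology ((resD (inclLeft k A)).obj R)
  finite_right : FiniteCohomology ((resD (inclRight k A)).obj R)
  canonical_left : ∀ I : CochainComplex.Plus (ModuleCat.{u} (Env k A)),
    (∀ n, Injective (I.obj.X n)) → Nonempty ((QPlus (Env k A)).obj I ≅ R) →
      QuasiIso (canonicalLeft k A I.obj)
  canonical_right : ∀ I : CochainComplex.Plus (ModuleCat.{u} (Env k A)),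
    (∀ n, Injective (I.obj.X n)) → Nonempty ((QPlus (Env k A)).obj I ≅ R) →
      QuasiIso (canonicalRight k A I.obj)

variable (k A)

/-- A rigid dualizing complex over `A` is a dualizing complex `R` together with an isomorphism
`φ : R ≅ RHom_{Aᵉ}(A, R ⊗ₖ R)` in the derived category of `Aᵉ`-modules. -/
structure RigidDualizingComplex where
  /-- the underlying complex -/
  R : DPlus (Env k A)
  isDualizing : IsDualizing R
  /-- the rigidifying isomorphism -/
  φ : R ≅ (rhomSq k A).obj R

variable {k A} {B : Type u} [Ring B] [Algebra k B]

/-- A homomorphism `f : A → B` is finite if `B` is finitely generated as a left and as a right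
`A`-module. -/
structure IsFiniteHom (f : A →ₐ[k] B) : Prop where
  left : Module.Finite A (leftMod f)
  right : Module.Finite Aᵐᵒᵖ (rightMod f)

/-- A morphism `ψ : R_B ⟶ R_A` in the derived category of `Aᵉ`-modules is a rigid trace if it
induces isomorphisms `R_B ≅ RHom_A(B, R_A)` and `R_B ≅ RHom_{Aᵒᵖ}(B, R_A)`, and if it is
compatible with the rigidifying isomorphisms. -/
structure IsRigidTrace (f : A →ₐ[k] B) (RA : RigidDualizingComplex k A)
    (RB : RigidDualizingComplex k B) (ψ : (resD (envMap f)).obj RB.R ⟶ RA.R) : Prop where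
  isIso_left : IsIso (inducedLeft f ψ)
  isIso_right : IsIso (inducedRight f ψ)
  comm : ψ ≫ RA.φ.hom = (resD (envMap f)).map RB.φ.hom ≫ rhomSqMap f ψ

end RigidComplex

end RigidDC

open CategoryTheory RigidDC

universe v

namespace RigidDC

set_option linter.unusedSectionVars false

open CategoryTheory Limits TensorProduct CochainComplex HomComplex

open CategoryTheory Limits TensorProduct

/-! ### Quasi-isomorphisms tested on elements. -/

section Elements

open HomologicalComplex

/-! Everything rests on what the canonical isomorphisms say about a dualizing complex `R` over `A`.
The `A`-linear derived endomorphisms of `R` are the right multiplications by elements of `A`, each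
by a unique element, and `R` has no negative self-extensions over `A`. The same holds on the other
side with left multiplications.

Descent from one side to both. Let `S = Λ ⊗ U` over the field `k`, and suppose that the negative
extensions over `Λ` from `M` to `N` vanish. Then `S`-linear derived maps `M → N` are determined by
the underlying `Λ`-linear ones (`homotopic_of_res`), and a `Λ`-linear map lifts as soon as it
commutes with every element of `U` up to homotopy (`exists_lift_res`). The proof shifts dimensions
along `N → G(F(N))`, where `F` restricts to `Λ` and `G` is its right adjoint; over `Λ` the target is
a product of copies of `N`, because `S` is free over `Λ` on elements that commute with `Λ`.

Part (a), `IsRigidTrace.unique`. By condition (i) and adjunction, `A`-linear derived maps `R_B →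
R_A` are `B`-linear maps `R_B → RHom_A(B, R_A) ≅ R_B`, hence of the form `r ↦ ψ(r c)` with a unique
`c` in `B` (`ActPair.isFreeMap_precomp`). So a second trace is `ψ' = ψ(- c)`; since `ψ'` is
bilinear, uniqueness makes `c` commute with the image of `A`, and descent makes the equality one of
bimodule maps. The other side gives `ψ' = ψ(d -)`. Using `c` on the first factor and `d` on the
second, `ψ' ⊗ ψ'` is `ψ ⊗ ψ` composed with the inside action of `d ⊗ c`. Condition (ii) turns this
into `ψ'(r) = ψ(d r c) = ψ'(r c)`, so `c = 1` by uniqueness and `ψ' = ψ`.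

Part (b), the unique normalization. The same computation with `A = B` shows that `φ` intertwines the
square of an endomorphism `e` of `R` with `e ∘ e` (`RigidDualizingComplex.φ_comp_rhomSq_map`). If `w
: R ≅ R'` is any isomorphism, it fails to respect the rigidifying isomorphisms by an automorphism
`c` of `R`; rescaling `w` by an automorphism changes this defect by one power of it, so exactly one
rescaling, by the inverse of `c`, is rigid.

Part (b), existence of some isomorphism (`nonempty_iso`). Both complexes are isomorphic to
`RHom_{Aᵉ}(A, R ⊗ R')`. For `R'`, put `P = RHom_{Aᵒᵖ}(R', R)`. Biduality gives `R' ≅ RHom_A(P, R)`.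
Insert the rigidity `R ≅ RHom_{Aᵉ}(A, R ⊗ R)`, exchange the two Hom functors, and pull the first
factor `R` out: `RHom_A(P, R ⊗ R) ≅ R ⊗ RHom_A(P, R) ≅ R ⊗ R'`. The resulting isomorphism is only
linear on the right, but all its constituents are natural in `R'`, so it commutes with left
multiplications up to homotopy and descent corrects it (`ActPair.exists_quasiIso_homFun`). For `R`
the argument uses the rigidity of `R'`, with the sides and the tensor factors exchanged.

Biduality (`ActPair.quasiIso_bidual`) and the tensor evaluation (`ActPair.quasiIso_tensHomTo`) are
reduced by `devissage` to the ring itself, placed in one degree. Complexes are represented by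
injective resolutions over `Aᵉ`, except that biduality needs a bounded complex that is injective on
each side; finite injective dimension provides it as a truncation of the resolution. -/

lemma ab_exact_cycles (K : CochainComplex AddCommGrpCat.{v} ℤ) (i j : ℤ) (hij : i + 1 = j)
    (c : K.cycles j) (hc : K.homologyπ j c = 0) :
    ∃ w : K.X i, K.toCycles i j w = c := by
  have hS : (ShortComplex.mk (K.toCycles i j) (K.homologyπ j) (K.toCycles_comp_homologyπ i j)).Exact :=
    ShortComplex.exact_of_g_is_cokernel _ (K.homologyIsCokernel i j (by simp; omega))
  exact (ShortComplex.ab_exact_iff _).1 hS c hc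

lemma ab_exists_cycle (K : CochainComplex AddCommGrpCat.{v} ℤ) (i j : ℤ) (hij : i + 1 = j)
    (x : K.X i) (hx : K.d i j x = 0) : ∃ c : K.cycles i, K.iCycles i c = x := by
  have hS : (ShortComplex.mk (K.iCycles i) (K.d i j) (K.iCycles_d i j)).Exact :=
    ShortComplex.exact_of_f_is_kernel _ (K.cyclesIsKernel i j (by simp; omega))
  exact (ShortComplex.ab_exact_iff _).1 hS x hx

lemma ab_iCycles_injective (K : CochainComplex AddCommGrpCat.{v} ℤ) (i : ℤ) :
    Function.Injective (K.iCycles i) :=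
  (AddCommGrpCat.mono_iff_injective _).1 inferInstance

lemma ab_homologyπ_surjective (K : CochainComplex AddCommGrpCat.{v} ℤ) (i : ℤ) :
    Function.Surjective (K.homologyπ i) :=
  (AddCommGrpCat.epi_iff_surjective _).1 inferInstance

lemma ab_mono_homologyMap_iff {K L : CochainComplex AddCommGrpCat.{v} ℤ} (f : K ⟶ L) (i j k : ℤ)
    (hij : i + 1 = j) (hjk : j + 1 = k) : Mono (homologyMap f j) ↔
      ∀ (x : K.X j) (y : L.X i), K.d j k x = 0 → L.d i j y = f.f j x → ∃ w, K.d i j w = x := by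
  rw [AddCommGrpCat.mono_iff_injective, injective_iff_map_eq_zero]
  constructor
  · intro h x y hx hy
    obtain ⟨c, rfl⟩ := ab_exists_cycle K j k hjk x hx
    have h1 : cyclesMap f j c = L.toCycles i j y := by
      apply ab_iCycles_injective
      rw [← ConcreteCategory.comp_apply, ← ConcreteCategory.comp_apply, cyclesMap_i, toCycles_i, hy]
      rfl
    have h2 : K.homologyπ j c = 0 := by
      apply h
      rw [← ConcreteCategory.comp_apply, homologyπ_naturality, ConcreteCategory.comp_apply, h1,
        ← ConcreteCategory.comp_apply, toCycles_comp_homologyπ]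
      rfl
    obtain ⟨w, hw⟩ := ab_exact_cycles K i j hij c h2
    refine ⟨w, ?_⟩
    rw [← hw, ← ConcreteCategory.comp_apply, toCycles_i]
  · intro h z hz
    obtain ⟨c, rfl⟩ := ab_homologyπ_surjective K j z
    rw [← ConcreteCategory.comp_apply, homologyπ_naturality, ConcreteCategory.comp_apply] at hz
    obtain ⟨y, hy⟩ := ab_exact_cycles L i j hij _ hz
    obtain ⟨w, hw⟩ := h (K.iCycles j c) y
      (by rw [← ConcreteCategory.comp_apply, iCycles_d]; rfl)
      (by
        rw [← ConcreteCategory.comp_apply, ← cyclesMap_i, ConcreteCategory.comp_apply, ← hy,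
          ← ConcreteCategory.comp_apply, toCycles_i])
    have : K.toCycles i j w = c := by
      apply ab_iCycles_injective
      rw [← ConcreteCategory.comp_apply, toCycles_i, hw]
    rw [← this, ← ConcreteCategory.comp_apply, toCycles_comp_homologyπ]
    rfl

lemma ab_epi_homologyMap_iff {K L : CochainComplex AddCommGrpCat.{v} ℤ} (f : K ⟶ L) (i j k : ℤ)
    (hij : i + 1 = j) (hjk : j + 1 = k) : Epi (homologyMap f j) ↔
      ∀ (y : L.X j), L.d j k y = 0 →
        ∃ (x : K.X j) (w : L.X i), K.d j k x = 0 ∧ f.f j x = y + L.d i j w := by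
  rw [AddCommGrpCat.epi_iff_surjective]
  constructor
  · intro h y hy
    obtain ⟨c, rfl⟩ := ab_exists_cycle L j k hjk y hy
    obtain ⟨z, hz⟩ := h (L.homologyπ j c)
    obtain ⟨e, rfl⟩ := ab_homologyπ_surjective K j z
    rw [← ConcreteCategory.comp_apply, homologyπ_naturality, ConcreteCategory.comp_apply] at hz
    obtain ⟨w, hw⟩ := ab_exact_cycles L i j hij (cyclesMap f j e - c) (by rw [map_sub, hz, sub_self])
    refine ⟨K.iCycles j e, w, by rw [← ConcreteCategory.comp_apply, iCycles_d]; rfl, ?_⟩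
    rw [← ConcreteCategory.comp_apply, ← cyclesMap_i, ConcreteCategory.comp_apply,
      ← toCycles_i, ConcreteCategory.comp_apply, ← map_add, hw, add_sub_cancel]
  · intro h z
    obtain ⟨c, rfl⟩ := ab_homologyπ_surjective L j z
    obtain ⟨x, w, hx, hxw⟩ := h (L.iCycles j c) (by rw [← ConcreteCategory.comp_apply, iCycles_d]; rfl)
    obtain ⟨e, rfl⟩ := ab_exists_cycle K j k hjk x hx
    refine ⟨K.homologyπ j e, ?_⟩
    have : cyclesMap f j e = c + L.toCycles i j w := by
      apply ab_iCycles_injective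
      rw [map_add, ← ConcreteCategory.comp_apply, ← ConcreteCategory.comp_apply, cyclesMap_i,
        toCycles_i, ConcreteCategory.comp_apply, hxw]
    rw [← ConcreteCategory.comp_apply, homologyπ_naturality, ConcreteCategory.comp_apply, this,
      map_add, ← ConcreteCategory.comp_apply (L.toCycles i j), toCycles_comp_homologyπ]
    exact add_zero _

lemma ab_quasiIso_iff {K L : CochainComplex AddCommGrpCat.{v} ℤ} (f : K ⟶ L) : QuasiIso f ↔
    (∀ i j k, i + 1 = j → j + 1 = k →
      ∀ (x : K.X j) (y : L.X i), K.d j k x = 0 → L.d i j y = f.f j x → ∃ w, K.d i j w = x) ∧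
    (∀ i j k, i + 1 = j → j + 1 = k → ∀ (y : L.X j), L.d j k y = 0 →
        ∃ (x : K.X j) (w : L.X i), K.d j k x = 0 ∧ f.f j x = y + L.d i j w) := by
  constructor
  · intro h
    refine ⟨fun i j k hij hjk => (ab_mono_homologyMap_iff f i j k hij hjk).1 inferInstance,
      fun i j k hij hjk => (ab_epi_homologyMap_iff f i j k hij hjk).1 inferInstance⟩
  · rintro ⟨h1, h2⟩
    rw [quasiIso_iff]
    intro j
    rw [quasiIsoAt_iff_isIso_homologyMap]
    have := (ab_mono_homologyMap_iff f (j - 1) j (j + 1) (by omega) rfl).2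
      (h1 _ _ _ (by omega) rfl)
    have := (ab_epi_homologyMap_iff f (j - 1) j (j + 1) (by omega) rfl).2
      (h2 _ _ _ (by omega) rfl)
    exact isIso_of_mono_of_epi _

variable {R : Type*} [Ring R]

/-- The complex of abelian groups underlying a complex of modules. -/
noncomputable abbrev toAb (R : Type*) [Ring R] :
    CochainComplex (ModuleCat.{v} R) ℤ ⥤ CochainComplex AddCommGrpCat.{v} ℤ :=
  (forget₂ (ModuleCat.{v} R) AddCommGrpCat.{v}).mapHomologicalComplex (ComplexShape.up ℤ)

lemma quasiIso_toAb_iff {K L : CochainComplex (ModuleCat.{v} R) ℤ} (f : K ⟶ L) :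
    QuasiIso ((toAb R).map f) ↔ QuasiIso f :=
  quasiIso_map_iff_of_preservesHomology f (forget₂ (ModuleCat.{v} R) AddCommGrpCat.{v})

/-- The elements of the Hom complexes below are cochains. In this form the two halves of a
quasi-isomorphism are literally statements about cocycles up to coboundaries, so homology objects
need not be identified. -/
lemma mod_quasiIso_iff {K L : CochainComplex (ModuleCat.{v} R) ℤ} (f : K ⟶ L) : QuasiIso f ↔
    (∀ i j k, i + 1 = j → j + 1 = k →
      ∀ (x : K.X j) (y : L.X i), K.d j k x = 0 → L.d i j y = f.f j x → ∃ w, K.d i j w = x) ∧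
    (∀ i j k, i + 1 = j → j + 1 = k → ∀ (y : L.X j), L.d j k y = 0 →
        ∃ (x : K.X j) (w : L.X i), K.d j k x = 0 ∧ f.f j x = y + L.d i j w) :=
  (quasiIso_toAb_iff f).symm.trans (ab_quasiIso_iff _)

lemma mod_exactAt_iff (K : CochainComplex (ModuleCat.{v} R) ℤ) (i j k : ℤ) (hij : i + 1 = j)
    (hjk : j + 1 = k) : K.ExactAt j ↔ ∀ x : K.X j, K.d j k x = 0 → ∃ w, K.d i j w = x := by
  rw [K.exactAt_iff' i j k (by simp; omega) (by simp; omega)]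
  exact ShortComplex.moduleCat_exact_iff _

/-- A chain map of module complexes which agrees, as a map of sets, with a quasi-isomorphism over
another ring, is a quasi-isomorphism. -/
lemma quasiIso_of_toAb_eq {R' : Type*} [Ring R'] {K L : CochainComplex (ModuleCat.{v} R) ℤ}
    {K' L' : CochainComplex (ModuleCat.{v} R') ℤ} (f : K ⟶ L) (f' : K' ⟶ L')
    (e : Arrow.mk ((toAb R).map f) ≅ Arrow.mk ((toAb R').map f')) (hf : QuasiIso f) : QuasiIso f' := by
  rw [← quasiIso_toAb_iff] at hf ⊢
  exact ((HomologicalComplex.quasiIso AddCommGrpCat.{v} (ComplexShape.up ℤ)).arrow_mk_iso_iff e).1 hf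

end Elements

open CategoryTheory Limits TensorProduct

/-! ### External tensor products of modules over two algebras. -/

section Box

attribute [local instance] ModuleCat.moduleOfAlgebraModule
  ModuleCat.isScalarTower_of_algebra_moduleCat

variable (k : Type u) [Field k] {X Y : Type u} [Ring X] [Ring Y] [Algebra k X] [Algebra k Y]

/-- The underlying abelian group of the external tensor product `M ⊗ₖ N` of an `X`-module and a
`Y`-module. -/
def Box (M : ModuleCat.{u} X) (N : ModuleCat.{u} Y) : Type u := M ⊗[k] N

noncomputable instance (M : ModuleCat.{u} X) (N : ModuleCat.{u} Y) : AddCommGroup (Box k M N) :=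
  inferInstanceAs (AddCommGroup (M ⊗[k] N))

/-- The action of `X ⊗ₖ Y` on `M ⊗ₖ N`. -/
noncomputable def boxAction (M : ModuleCat.{u} X) (N : ModuleCat.{u} Y) :
    X ⊗[k] Y →ₐ[k] Module.End k (M ⊗[k] N) :=
  Module.endTensorEndAlgHom.comp
    (Algebra.TensorProduct.map (Algebra.lsmul k k M) (Algebra.lsmul k k N))

noncomputable instance (M : ModuleCat.{u} X) (N : ModuleCat.{u} Y) :
    Module (X ⊗[k] Y) (Box k M N) :=
  Module.compHom (M ⊗[k] N) (boxAction k M N).toRingHom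

variable {k} in
/-- Two additive maps out of `M ⊗ₖ N` agreeing on pure tensors are equal. -/
lemma box_addHom_ext {M : ModuleCat.{u} X} {N : ModuleCat.{u} Y} {V : Type*} [AddCommGroup V]
    {f g : Box k M N →+ V} (h : ∀ (m : M) (n : N), f (m ⊗ₜ[k] n : M ⊗[k] N) =
      g (m ⊗ₜ[k] n : M ⊗[k] N)) : f = g := by
  ext x
  refine TensorProduct.induction_on (motive := fun x : M ⊗[k] N => f x = g x) x ?_ h ?_
  · exact (map_zero f).trans (map_zero g).symm
  · intro x y hx hy
    exact (map_add f x y).trans ((congrArg₂ (· + ·) hx hy).trans (map_add g x y).symm)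

/-- An additive map out of `M ⊗ₖ N` compatible with the actions on pure tensors is linear. -/
lemma box_isLinear {M : ModuleCat.{u} X} {N : ModuleCat.{u} Y} {V : Type*} [AddCommGroup V]
    [Module (X ⊗[k] Y) V] (f : Box k M N →+ V)
    (h : ∀ (x : X) (y : Y) (m : M) (n : N), f ((x • m) ⊗ₜ[k] (y • n) : M ⊗[k] N) =
      (x ⊗ₜ[k] y : X ⊗[k] Y) • f (m ⊗ₜ[k] n : M ⊗[k] N)) (z : X ⊗[k] Y) (b : Box k M N) :
    f (z • b) = z • f b := by
  induction z using TensorProduct.induction_on with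
  | zero => rw [zero_smul, zero_smul, map_zero]
  | add z w hz hw => rw [add_smul, add_smul, map_add, hz, hw]
  | tmul x y =>
    refine TensorProduct.induction_on (motive := fun b : M ⊗[k] N =>
      f ((x ⊗ₜ[k] y : X ⊗[k] Y) • (show Box k M N from b)) =
        (x ⊗ₜ[k] y : X ⊗[k] Y) • f (show Box k M N from b)) b ?_ ?_ ?_
    · exact (congrArg f (smul_zero (A := Box k M N) _)).trans
        ((map_zero f).trans ((smul_zero _).symm.trans
          (congrArg (fun t => (x ⊗ₜ[k] y : X ⊗[k] Y) • t) (map_zero f).symm)))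
    · intro m n
      exact h x y m n
    · intro b c hb hc
      have h1 : (x ⊗ₜ[k] y : X ⊗[k] Y) • (show Box k M N from b + c) =
        (x ⊗ₜ[k] y : X ⊗[k] Y) • (show Box k M N from b) +
          (x ⊗ₜ[k] y : X ⊗[k] Y) • (show Box k M N from c) := smul_add (A := Box k M N) _ _ _
      have h2 : f (show Box k M N from b + c) = f (show Box k M N from b) +
        f (show Box k M N from c) := map_add f _ _
      rw [h1, h2, map_add, hb, hc, smul_add]

variable {k} in
/-- The homomorphism out of `M ⊗ₖ N` defined by a map compatible with the actions of `X`
and `Y`. -/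
noncomputable def boxDesc {M : ModuleCat.{u} X} {N : ModuleCat.{u} Y} {V : ModuleCat.{u} (X ⊗[k] Y)}
    (φ : M →+ N →+ V) (h : ∀ x y m n, φ (x • m) (y • n) = (x ⊗ₜ[k] y : X ⊗[k] Y) • φ m n) :
    ModuleCat.of (X ⊗[k] Y) (Box k M N) ⟶ V :=
  ModuleCat.ofHom (X := Box k M N)
    { toFun := TensorProduct.liftAddHom φ (fun c m n => by
        -- Balancedness over `k` comes for free, since a scalar may be moved across the tensor sign
        -- of `X ⊗ₖ Y`.
        have h1 := h (algebraMap k X c) 1 m n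
        have h2 := h 1 (algebraMap k Y c) m n
        rw [one_smul] at h1 h2
        have h3 : (algebraMap k X c ⊗ₜ[k] (1 : Y)) = (1 : X) ⊗ₜ[k] algebraMap k Y c := by
          rw [Algebra.algebraMap_eq_smul_one, Algebra.algebraMap_eq_smul_one, smul_tmul]
        rw [h3, ← h2] at h1
        exact h1)
      map_add' := fun x y => map_add _ x y
      map_smul' := fun z b => box_isLinear k (M := M) (N := N) (V := V)
        (TensorProduct.liftAddHom φ _) (fun x y m n => h x y m n) z b }

lemma box_hom_ext {M : ModuleCat.{u} X} {N : ModuleCat.{u} Y} {V : ModuleCat.{u} (X ⊗[k] Y)}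
    {f g : ModuleCat.of (X ⊗[k] Y) (Box k M N) ⟶ V}
    (h : ∀ (m : M) (n : N), f.hom (m ⊗ₜ[k] n : M ⊗[k] N) = g.hom (m ⊗ₜ[k] n : M ⊗[k] N)) :
    f = g := by
  have := box_addHom_ext (k := k) (M := M) (N := N) (f := f.hom.toAddMonoidHom)
    (g := g.hom.toAddMonoidHom) h
  ext x
  exact DFunLike.congr_fun this x

/-- The map `f ⊗ g : M ⊗ₖ N ⟶ M' ⊗ₖ N'` of `X ⊗ₖ Y`-modules. -/
noncomputable def boxMap {M M' : ModuleCat.{u} X} {N N' : ModuleCat.{u} Y} (f : M ⟶ M')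
    (g : N ⟶ N') :
    ModuleCat.of (X ⊗[k] Y) (Box k M N) ⟶ ModuleCat.of (X ⊗[k] Y) (Box k M' N') :=
  boxDesc (V := ModuleCat.of (X ⊗[k] Y) (Box k M' N'))
    { toFun := fun m =>
        { toFun := fun n => (f m ⊗ₜ[k] g n : M' ⊗[k] N')
          map_zero' := by rw [map_zero, tmul_zero]; rfl
          map_add' := fun n n' => by rw [map_add, tmul_add]; rfl }
      map_zero' := by
        ext n
        change (f 0 ⊗ₜ[k] g n : M' ⊗[k] N') = 0
        rw [map_zero, zero_tmul]
      map_add' := fun m m' => by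
        ext n
        change (f (m + m') ⊗ₜ[k] g n : M' ⊗[k] N') = f m ⊗ₜ[k] g n + f m' ⊗ₜ[k] g n
        rw [map_add, add_tmul] }
    (fun x y m n => by
      change (f (x • m) ⊗ₜ[k] g (y • n) : M' ⊗[k] N') = (x • f m) ⊗ₜ[k] (y • g n)
      rw [map_smul, map_smul])

/-- The external tensor product bifunctor, from `X`-modules and `Y`-modules to
`X ⊗ₖ Y`-modules. -/
noncomputable def boxTensor :
    ModuleCat.{u} X ⥤ ModuleCat.{u} Y ⥤ ModuleCat.{u} (X ⊗[k] Y) where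
  obj M :=
    { obj N := ModuleCat.of (X ⊗[k] Y) (Box k M N)
      map g := boxMap k (𝟙 M) g
      map_id N := box_hom_ext k (fun _ _ => rfl)
      map_comp f g := box_hom_ext k (fun _ _ => rfl) }
  map f :=
    { app N := boxMap k f (𝟙 N)
      naturality _ _ g := box_hom_ext k (fun _ _ => rfl) }
  map_id M := by
    ext N : 2
    exact box_hom_ext k (fun _ _ => rfl)
  map_comp f g := by
    ext N : 2
    exact box_hom_ext k (fun _ _ => rfl)

instance : (boxTensor k (X := X) (Y := Y)).Additive where
  map_add {M M' f g} := by
    ext N : 2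
    exact box_hom_ext k (fun m n => TensorProduct.add_tmul (f m) (g m) n)

instance (M : ModuleCat.{u} X) : ((boxTensor k (Y := Y)).obj M).Additive where
  map_add {N N' f g} := box_hom_ext k (fun m n => TensorProduct.tmul_add m (f n) (g n))

/-- As `k` is a field, `- ⊗ₖ N` preserves monomorphisms. -/
lemma mono_boxMap {M M' : ModuleCat.{u} X} (N : ModuleCat.{u} Y) (f : M ⟶ M') [Mono f] :
    Mono (boxMap k f (𝟙 N)) := by
  rw [ModuleCat.mono_iff_injective] at *
  have h := Module.Flat.rTensor_preserves_injective_linearMap (M := N)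
    (f.hom.restrictScalars k : M →ₗ[k] M') ‹_›
  have e : ∀ x : M ⊗[k] N, (boxMap k f (𝟙 N)).hom x =
      LinearMap.rTensor N (f.hom.restrictScalars k : M →ₗ[k] M') x := by
    intro x
    have := box_addHom_ext (k := k) (M := M) (N := N) (f := (boxMap k f (𝟙 N)).hom.toAddMonoidHom)
      (g := (LinearMap.rTensor N (f.hom.restrictScalars k : M →ₗ[k] M')).toAddMonoidHom)
      (fun _ _ => rfl)
    exact DFunLike.congr_fun this x
  intro a b hab
  exact h ((e a).symm.trans (Eq.trans hab (e b)))

end Box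

/-! ### Injectivity of Hom modules and of restrictions of scalars. -/

section Injective

attribute [local instance] ModuleCat.moduleOfAlgebraModule
  ModuleCat.isScalarTower_of_algebra_moduleCat

variable {k : Type u} [Field k] {Λ T Z : Type u} [Ring Λ] [Ring T] [Ring Z]
  [Algebra k Λ] [Algebra k T] [Algebra k Z] (σ : Λ →ₐ[k] Z) (τ : T →ₐ[k] Z)
  (h : ∀ s t, Commute (σ s) (τ t))

/-- The homomorphism `T ⊗ₖ Λ → Z` defined by commuting homomorphisms. -/
noncomputable abbrev liftComm : T ⊗[k] Λ →ₐ[k] Z :=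
  Algebra.TensorProduct.lift τ σ (fun t s => (h s t).symm)

/-- If `E` is injective over `T ⊗ₖ Λ`, then `Hom_Λ(M, E)` is injective over `T`. -/
lemma exists_extension_hom (E : ModuleCat.{u} Z) (hE : Injective ((resMod (liftComm σ τ h)).obj E))
    (M : ModuleCat.{u} Λ) {P P' : ModuleCat.{u} T} (i : P ⟶ P') [Mono i]
    (g : P →+ (M →ₗ[Λ] (resMod σ).obj E))
    (hg : ∀ (t : T) (p : P) (m : M), (show E from g (t • p) m) = τ t • (show E from g p m)) :
    ∃ g' : P' →+ (M →ₗ[Λ] (resMod σ).obj E),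
      (∀ (t : T) (p : P') (m : M), (show E from g' (t • p) m) = τ t • (show E from g' p m)) ∧
      ∀ p, g' (i p) = g p := by
  -- By tensor-hom adjunction `g` amounts to a `T ⊗ₖ Λ`-linear map `P ⊗ₖ M → E`.
  let φ : P →+ M →+ (resMod (liftComm σ τ h)).obj E :=
    { toFun := fun p => (g p).toAddMonoidHom
      map_zero' := by rw [map_zero]; rfl
      map_add' := fun x y => by rw [map_add]; rfl }
  have hφ : ∀ t l p m, φ (t • p) (l • m) = (t ⊗ₜ[k] l : T ⊗[k] Λ) • φ p m := by
    intro t l p m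
    change (show E from g (t • p) (l • m)) = (τ t * σ l) • (show E from g p m)
    rw [hg, map_smul, mul_smul]
    rfl
  -- Since `k` is a field, `i ⊗ M` remains injective, and injectivity of `E` over `T ⊗ₖ Λ` extends
  -- the map to `P' ⊗ₖ M`.
  have := mono_boxMap k M i
  let G := Injective.factorThru (boxDesc φ hφ) (boxMap k i (𝟙 M))
  have hG : boxMap k i (𝟙 M) ≫ G = boxDesc φ hφ := Injective.comp_factorThru _ _
  have hG' : ∀ (t : T) (l : Λ) (p : P') (m : M),
      (show E from G.hom ((t • p) ⊗ₜ[k] (l • m) : P' ⊗[k] M)) =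
        τ t • σ l • (show E from G.hom (p ⊗ₜ[k] m : P' ⊗[k] M)) := by
    intro t l p m
    rw [← mul_smul]
    exact map_smul G.hom (t ⊗ₜ[k] l : T ⊗[k] Λ) (show Box k P' M from p ⊗ₜ[k] m)
  let g' : P' →+ (M →ₗ[Λ] (resMod σ).obj E) :=
    { toFun := fun p =>
        { toFun := fun m => (show E from G.hom (p ⊗ₜ[k] m : P' ⊗[k] M))
          map_add' := fun m m' => by rw [tmul_add]; exact map_add G.hom _ _
          map_smul' := fun l m => by
            have := hG' 1 l p m
            rw [one_smul, map_one, one_smul] at this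
            exact this }
      map_zero' := LinearMap.ext fun m => by
        change G.hom ((0 : P') ⊗ₜ[k] m : P' ⊗[k] M) = 0
        rw [zero_tmul]
        exact map_zero G.hom
      map_add' := fun p p' => LinearMap.ext fun m => by
        change G.hom ((p + p') ⊗ₜ[k] m : P' ⊗[k] M) = _
        rw [add_tmul]
        exact map_add G.hom _ _ }
  refine ⟨g', fun t p m => ?_, fun p => LinearMap.ext fun m => ?_⟩
  · have := hG' t 1 p m
    rw [one_smul, map_one, one_smul] at this
    exact this
  · exact DFunLike.congr_fun (congrArg ModuleCat.Hom.hom hG) (p ⊗ₜ[k] m : P ⊗[k] M)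

/-- Restriction of scalars along a bijective homomorphism preserves injective modules. -/
lemma injective_res_of_bijective {X Z : Type u} [Ring X] [Ring Z] [Algebra k X] [Algebra k Z]
    (γ : X →ₐ[k] Z) (hγ : Function.Bijective γ) (E : ModuleCat.{u} Z) [Injective E] :
    Injective ((resMod γ).obj E) := by
  let e : X ≃+* Z := RingEquiv.ofBijective γ hγ
  have : (resMod γ).IsEquivalence := ModuleCat.restrictScalars_isEquivalence_of_ringEquiv e
  exact (resMod γ).asEquivalence.symm.toAdjunction.map_injective E ‹_›

/-- If `T ⊗ₖ Λ ≅ Z`, then restriction of scalars along `T → Z` preserves injective modules. -/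
lemma injective_res (hb : Function.Bijective (liftComm σ τ h)) (E : ModuleCat.{u} Z)
    [Injective E] : Injective ((resMod τ).obj E) := by
  have hE := injective_res_of_bijective (liftComm σ τ h) hb E
  refine ⟨fun {P P'} g i _ => ?_⟩
  -- The restriction of `E` to `T` is `Hom_Λ(Λ, E)`, so the extension result applies with `M = Λ`;
  -- evaluation at `1` goes back.
  let g₁ : P →+ (ModuleCat.of Λ Λ →ₗ[Λ] (resMod σ).obj E) :=
    { toFun := fun p => LinearMap.toSpanSingleton Λ ((resMod σ).obj E) (show E from g.hom p)
      map_zero' := by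
        ext
        change σ _ • (show E from g.hom 0) = 0
        rw [map_zero]
        exact smul_zero (A := E) (σ _)
      map_add' := fun x y => by
        ext
        change σ _ • (show E from g.hom (x + y)) = σ _ • (show E from g.hom x) +
          σ _ • (show E from g.hom y)
        rw [map_add]
        exact smul_add _ _ _ }
  obtain ⟨g', h1, h2⟩ := exists_extension_hom σ τ h E hE (ModuleCat.of Λ Λ) i g₁ (fun t p m => by
    change σ _ • (show E from g.hom (t • p)) = τ t • σ _ • (show E from g.hom p)
    rw [map_smul]
    change σ _ • τ t • (show E from g.hom p) = τ t • σ _ • (show E from g.hom p)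
    rw [smul_smul, smul_smul, (h _ t).eq])
  refine ⟨ModuleCat.ofHom (Y := (resMod τ).obj E)
    { toFun := fun p => (show E from g' p (1 : Λ))
      map_add' := fun x y => by rw [map_add]; rfl
      map_smul' := fun t p => h1 t p (1 : Λ) }, ?_⟩
  ext p
  change (show E from g' (i p) (1 : Λ)) = _
  rw [h2]
  change σ 1 • (show E from g.hom p) = _
  rw [map_one]
  exact one_smul _ _

end Injective

open CategoryTheory Limits CochainComplex HomComplex

/-! ### Cochains into K-injective complexes. -/

section KInjective

variable {C : Type*} [Category* C] [Abelian C]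

lemma acyclic_mappingCone {F' F : CochainComplex C ℤ} (φ : F' ⟶ F)
    [hφ : QuasiIso φ] :
    (mappingCone φ).Acyclic := by
  rw [← HomotopyCategory.quotient_obj_mem_subcategoryAcyclic_iff_acyclic]
  have hφ := (HomotopyCategory.quotient_map_mem_quasiIso_iff φ).2 hφ
  rw [HomotopyCategory.quasiIso_eq_trW_subcategoryAcyclic] at hφ
  exact (ObjectProperty.trW_iff_of_distinguished _ _
    (HomotopyCategory.mappingCone_triangleh_distinguished φ)).1 hφ

variable {F' F L L' : CochainComplex C ℤ} (φ : F' ⟶ F)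

/-- The cone of `φ` is acyclic, so the cocycle `fst · z` on it has a primitive. Up to signs, the
restriction of this primitive to `F` is the extension of `z`, and its restriction to `F'` measures
the error. -/
lemma precomp_surj [QuasiIso φ] [L.IsKInjective] {n n' m : ℤ} (hn : n + 1 = n') (hm : m + 1 = n)
    (z : Cochain F' L n) (hz : δ n n' z = 0) : ∃ (y : Cochain F L n) (w : Cochain F' L m),
      δ n n' y = 0 ∧ (Cochain.ofHom φ).comp y (zero_add n) = z + δ m n w := by
  let c : Cocycle (mappingCone φ) L n' := Cocycle.mk ((mappingCone.fst φ).1.comp z (by omega))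
    (n' + 1) rfl (by
      rw [δ_comp (mappingCone.fst φ).1 z _ 2 n' _ rfl rfl hn, hz]
      simp)
  obtain ⟨w, hw⟩ := IsKInjective.eq_δ_of_cocycle c (acyclic_mappingCone φ) n hn
  have hw : δ n n' w = (mappingCone.fst φ).1.comp z (by omega) := hw
  -- The signs undo those of `δ (inl · w)`: the cone differential contributes `(-1)ⁿ`, and `(-1)ⁿ
  -- (-1)ⁿ⁺¹ = -1`.
  refine ⟨n'.negOnePow • (Cochain.ofHom (mappingCone.inr φ)).comp w (zero_add n), 
    n.negOnePow • n'.negOnePow • (mappingCone.inl φ).comp w (by omega), ?_, ?_⟩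
  · rw [δ_units_smul, δ_ofHom_comp, hw, mappingCone.inr_fst_assoc, smul_zero]
  · have e : δ m n ((mappingCone.inl φ).comp w (by omega)) = z +
        n.negOnePow • (Cochain.ofHom φ).comp ((Cochain.ofHom (mappingCone.inr φ)).comp w
          (zero_add n)) (zero_add n) := by
      rw [δ_comp (mappingCone.inl φ) w (by omega) 0 n' n hm rfl hn, hw, mappingCone.inl_fst_assoc,
        mappingCone.δ_inl, Cochain.ofHom_comp, Cochain.comp_assoc_of_first_is_zero_cochain]
    rw [δ_units_smul, δ_units_smul, e, Cochain.comp_units_smul, smul_add, smul_add, smul_smul,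
      smul_smul, smul_smul]
    subst hn
    simp [Int.negOnePow_succ]

/-- A cocycle on `F` together with a primitive of its pullback to `F'` is a cocycle on the acyclic
cone of `φ`; a primitive of it restricts to a primitive on `F`. -/
lemma precomp_inj [QuasiIso φ] [L.IsKInjective] {n n' m : ℤ} (hn : n + 1 = n') (hm : m + 1 = n)
    (y : Cochain F L n) (hy : δ n n' y = 0) (w : Cochain F' L m)
    (h : (Cochain.ofHom φ).comp y (zero_add n) = δ m n w) :
    ∃ v : Cochain F L m, δ m n v = y := by
  let c : Cocycle (mappingCone φ) L n := mappingCone.descCocycle φ (n.negOnePow • w)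
    (Cocycle.mk y n' hn hy) hm (by rw [δ_units_smul, ← h]; rfl)
  obtain ⟨v, hv⟩ := IsKInjective.eq_δ_of_cocycle c (acyclic_mappingCone φ) m hm
  refine ⟨(Cochain.ofHom (mappingCone.inr φ)).comp v (zero_add m), ?_⟩
  rw [δ_ofHom_comp, hv]
  exact mappingCone.inr_descCochain φ _ y hm

/-- The image of a map into a K-injective complex is determined by its restriction along a
quasi-isomorphism, up to homotopy. -/
lemma exists_factor [QuasiIso φ] [L.IsKInjective] (g : F' ⟶ L) :
    ∃ g' : F ⟶ L, Nonempty (Homotopy (φ ≫ g') g) := by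
  obtain ⟨y, w, hy, hw⟩ := precomp_surj φ (zero_add 1) (neg_add_cancel 1) (Cochain.ofHom g) (by simp)
  refine ⟨(Cocycle.mk y 1 (zero_add 1) hy).homOf, ⟨(Cochain.equivHomotopy _ _).symm ⟨w, ?_⟩⟩⟩
  rw [Cochain.ofHom_comp, Cocycle.cochain_ofHom_homOf_eq_coe, add_comm]
  exact hw

lemma homotopy_of_precomp [QuasiIso φ] [L.IsKInjective] (g g' : F ⟶ L)
    (h : Homotopy (φ ≫ g) (φ ≫ g')) : Nonempty (Homotopy g g') := by
  obtain ⟨w, hw⟩ := Cochain.equivHomotopy _ _ h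
  obtain ⟨v, hv⟩ := precomp_inj φ (zero_add 1) (neg_add_cancel 1) (Cochain.ofHom g - Cochain.ofHom g')
    (by simp) w (by
      rw [Cochain.comp_sub, ← Cochain.ofHom_comp, ← Cochain.ofHom_comp, hw, add_sub_cancel_right])
  exact ⟨(Cochain.equivHomotopy _ _).symm ⟨v, by rw [hv, sub_add_cancel]⟩⟩

/-- Extending `𝟙 L` along `ψ` gives a homotopy left inverse; it is also a right inverse because
homotopies between maps into `L'` can be tested after precomposing with `ψ`. -/
lemma exists_homotopyEquiv [L.IsKInjective] [L'.IsKInjective] (ψ : L ⟶ L') [QuasiIso ψ] :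
    ∃ ρ : L' ⟶ L, Nonempty (Homotopy (ψ ≫ ρ) (𝟙 L)) ∧ Nonempty (Homotopy (ρ ≫ ψ) (𝟙 L')) := by
  obtain ⟨ρ, ⟨h⟩⟩ := exists_factor ψ (𝟙 L)
  exact ⟨ρ, ⟨h⟩, homotopy_of_precomp ψ _ _ (((Homotopy.ofEq (Category.assoc _ _ _).symm).trans
    (h.compRight ψ)).trans (Homotopy.ofEq (by simp)))⟩

lemma exists_cochain_of_homotopy {f g : F' ⟶ F} (h : Nonempty (Homotopy f g)) :
    ∃ w : Cochain F' F (-1), Cochain.ofHom f = Cochain.ofHom g + δ (-1) 0 w := by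
  obtain ⟨w, hw⟩ := Cochain.equivHomotopy _ _ h.some
  exact ⟨w, by rw [hw, add_comm]⟩

/-- Postcomposition with homotopic maps. -/
lemma comp_homotopic {f g : L ⟶ L'} (h : Nonempty (Homotopy f g)) {n n' m : ℤ} (hn : n + 1 = n')
    (hm : m + 1 = n) (z : Cochain F L n) (hz : δ n n' z = 0) :
    ∃ w : Cochain F L' m, z.comp (Cochain.ofHom f) (add_zero n) =
      z.comp (Cochain.ofHom g) (add_zero n) + δ m n w := by
  obtain ⟨w, hw⟩ := exists_cochain_of_homotopy h
  refine ⟨z.comp w (by omega), ?_⟩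
  rw [hw, Cochain.comp_add, δ_comp z w _ n' 0 n hm hn (neg_add_cancel 1), hz]
  simp

/-- Between K-injective complexes a quasi-isomorphism has a homotopy inverse, so the source `F` may
be arbitrary. -/
lemma postcomp_surj [L.IsKInjective] [L'.IsKInjective] (ψ : L ⟶ L') [QuasiIso ψ] {n n' m : ℤ}
    (hn : n + 1 = n') (hm : m + 1 = n) (z : Cochain F L' n) (hz : δ n n' z = 0) :
    ∃ (y : Cochain F L n) (w : Cochain F L' m),
      δ n n' y = 0 ∧ y.comp (Cochain.ofHom ψ) (add_zero n) = z + δ m n w := by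
  obtain ⟨ρ, -, h⟩ := exists_homotopyEquiv ψ
  obtain ⟨w, hw⟩ := comp_homotopic h hn hm z hz
  refine ⟨z.comp (Cochain.ofHom ρ) (add_zero n), w, ?_, ?_⟩
  · rw [δ_comp_ofHom, hz, Cochain.zero_comp]
  · rw [Cochain.comp_assoc_of_third_is_zero_cochain, ← Cochain.ofHom_comp, hw, Cochain.comp_id]

lemma postcomp_inj [L.IsKInjective] [L'.IsKInjective] (ψ : L ⟶ L') [QuasiIso ψ] {n n' m : ℤ}
    (hn : n + 1 = n') (hm : m + 1 = n) (z : Cochain F L n) (hz : δ n n' z = 0)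
    (w : Cochain F L' m) (h : z.comp (Cochain.ofHom ψ) (add_zero n) = δ m n w) :
    ∃ v : Cochain F L m, δ m n v = z := by
  obtain ⟨ρ, h', -⟩ := exists_homotopyEquiv ψ
  obtain ⟨w', hw⟩ := comp_homotopic h' hn hm z hz
  -- Here `w ρ` is a primitive of `z ψ ρ`, which differs from `z` by the coboundary of `w'`.
  refine ⟨w.comp (Cochain.ofHom ρ) (add_zero m) - w', ?_⟩
  rw [δ_sub, δ_comp_ofHom, ← h, Cochain.comp_assoc_of_third_is_zero_cochain, ← Cochain.ofHom_comp,
    hw, Cochain.comp_id, add_sub_cancel_right]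

end KInjective

open CategoryTheory Limits CochainComplex HomComplex

/-! ### Descent of homotopy classes along a functor with a right adjoint. -/

section Adjunction

variable {C D : Type*} [Category* C] [Category* D] [Abelian C] [Abelian D]
  {F : C ⥤ D} {G : D ⥤ C} [F.Additive] [G.Additive] (adj : F ⊣ G)

/-- The functor induced by `F` on cochain complexes. -/
abbrev onCplx (F : C ⥤ D) [F.Additive] : CochainComplex C ℤ ⥤ CochainComplex D ℤ :=
  F.mapHomologicalComplex (ComplexShape.up ℤ)

/-- The unit of an adjunction on complexes. -/
@[simps]
def unitCplx (K : CochainComplex C ℤ) : K ⟶ (onCplx G).obj ((onCplx F).obj K) where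
  f p := adj.unit.app (K.X p)
  comm' p q _ := (adj.unit.naturality (K.d p q)).symm

/-- A natural transformation on complexes. -/
@[simps]
def natCplx {F F' : C ⥤ D} [F.Additive] [F'.Additive] (α : F ⟶ F') (K : CochainComplex C ℤ) :
    (onCplx F).obj K ⟶ (onCplx F').obj K where
  f p := α.app (K.X p)
  comm' p q _ := (α.naturality (K.d p q)).symm

/-- The counit of an adjunction on complexes. -/
@[simps]
def counitCplx (K : CochainComplex D ℤ) : (onCplx F).obj ((onCplx G).obj K) ⟶ K where
  f p := adj.counit.app (K.X p)
  comm' p q _ := (adj.counit.naturality (K.d p q)).symm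

variable {M N : CochainComplex C ℤ}

/-- The cochain `M ⟶ GF(N)` adjoint to a cochain `F(M) ⟶ F(N)`. -/
def adjCochain {n : ℤ} (w : Cochain ((onCplx F).obj M) ((onCplx F).obj N) n) :
    Cochain M ((onCplx G).obj ((onCplx F).obj N)) n :=
  (Cochain.ofHom (unitCplx adj M)).comp (w.map G) (zero_add n)

lemma δ_adjCochain {n m : ℤ} (w : Cochain ((onCplx F).obj M) ((onCplx F).obj N) n) :
    δ n m (adjCochain adj w) = adjCochain adj (δ n m w) := by
  rw [adjCochain, δ_ofHom_comp, δ_map, adjCochain]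

lemma adjCochain_map {n : ℤ} (z : Cochain M N n) :
    adjCochain adj (z.map F) = z.comp (Cochain.ofHom (unitCplx adj N)) (add_zero n) := by
  ext p q h
  rw [adjCochain, Cochain.zero_cochain_comp_v, Cochain.comp_zero_cochain_v, Cochain.ofHom_v,
    Cochain.ofHom_v]
  exact (adj.unit.naturality (z.v p q h)).symm

lemma map_adjCochain {n : ℤ} (w : Cochain ((onCplx F).obj M) ((onCplx F).obj N) n) :
    ((adjCochain adj w).map F).comp (Cochain.ofHom (counitCplx adj ((onCplx F).obj N)))
      (add_zero n) = w := by
  ext p q h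
  have e {X : C} {Y : D} (w : F.obj X ⟶ Y) :
      F.map (adj.unit.app X ≫ G.map w) ≫ adj.counit.app Y = w := by
    simp
  rw [Cochain.comp_zero_cochain_v, adjCochain, Cochain.map_v, Cochain.zero_cochain_comp_v,
    Cochain.ofHom_v, Cochain.ofHom_v, Cochain.map_v]
  exact e (w.v p q h)

variable (F) in
/-- A cocycle in negative degrees `F(M) ⟶ F(N)` is a coboundary. -/
def VanishNeg (M N : CochainComplex D ℤ) : Prop :=
  ∀ i j l : ℤ, i < 0 → i + 1 = j → l + 1 = i → ∀ z : Cochain M N i, δ i j z = 0 →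
    ∃ w : Cochain M N l, δ l i w = z

lemma VanishNeg.of_retract {M N N' : CochainComplex D ℤ} (h : VanishNeg M N) (i : N' ⟶ N)
    (r : N ⟶ N') (hir : i ≫ r = 𝟙 N') : VanishNeg M N' := by
  intro a b c h1 h2 h3 z hz
  obtain ⟨w, hw⟩ := h a b c h1 h2 h3 (z.comp (Cochain.ofHom i) (add_zero a))
    (by rw [δ_comp_ofHom, hz, Cochain.zero_comp])
  refine ⟨w.comp (Cochain.ofHom r) (add_zero c), ?_⟩
  rw [δ_comp_ofHom, hw, Cochain.comp_assoc_of_third_is_zero_cochain, ← Cochain.ofHom_comp, hir,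
    Cochain.comp_id]

variable (G) in
/-- `F(G(Y))` is the product of copies of `Y` indexed by `B`, naturally in `Y`. -/
structure ProdDatum (F : C ⥤ D) (G : D ⥤ C) (B : Type*) where
  /-- the projections -/
  ev (b : B) : G ⋙ F ⟶ 𝟭 D
  exists_lift {X Y : D} (f : B → (X ⟶ Y)) : ∃ g : X ⟶ F.obj (G.obj Y), ∀ b, g ≫ (ev b).app Y = f b
  hom_ext {X Y : D} {f g : X ⟶ F.obj (G.obj Y)}
    (h : ∀ b, f ≫ (ev b).app Y = g ≫ (ev b).app Y) : f = g

variable {B : Type*} (E : ProdDatum F G B)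

/-- The projections on complexes. -/
@[simps]
def evCplx (b : B) (K : CochainComplex D ℤ) : (onCplx F).obj ((onCplx G).obj K) ⟶ K where
  f p := (E.ev b).app (K.X p)
  comm' p q _ := ((E.ev b).naturality (K.d p q)).symm

lemma ProdDatum.cochain_ext {M N : CochainComplex D ℤ} {n : ℤ}
    {z z' : Cochain M ((onCplx F).obj ((onCplx G).obj N)) n}
    (h : ∀ b, z.comp (Cochain.ofHom (evCplx E b N)) (add_zero n) =
      z'.comp (Cochain.ofHom (evCplx E b N)) (add_zero n)) : z = z' := by
  ext p q hpq
  refine E.hom_ext fun b => ?_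
  have := Cochain.congr_v (h b) p q hpq
  rw [Cochain.comp_zero_cochain_v, Cochain.comp_zero_cochain_v, Cochain.ofHom_v]
    at this
  exact this

lemma ProdDatum.exists_cochain {M N : CochainComplex D ℤ} {n : ℤ} (w : B → Cochain M N n) :
    ∃ z : Cochain M ((onCplx F).obj ((onCplx G).obj N)) n,
      ∀ b, z.comp (Cochain.ofHom (evCplx E b N)) (add_zero n) = w b := by
  choose g hg using fun (p q : ℤ) (h : p + n = q) => E.exists_lift (fun b => (w b).v p q h)
  refine ⟨Cochain.mk g, fun b => ?_⟩
  ext p q h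
  rw [Cochain.comp_zero_cochain_v, Cochain.ofHom_v]
  exact hg p q h b

/-- A cochain into `F(G(N))` is a coboundary if its components are. -/
lemma ProdDatum.exact_of_components {M N : CochainComplex D ℤ} {n m : ℤ}
    (z : Cochain M ((onCplx F).obj ((onCplx G).obj N)) n)
    (h : ∀ b, ∃ w : Cochain M N m, δ m n w =
      z.comp (Cochain.ofHom (evCplx E b N)) (add_zero n)) : ∃ w, δ m n w = z := by
  choose w hw using h
  obtain ⟨y, hy⟩ := E.exists_cochain w
  refine ⟨y, E.cochain_ext fun b => ?_⟩
  rw [← δ_comp_ofHom, hy, hw]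

lemma ProdDatum.vanishNeg (E : ProdDatum F G B) {M N : CochainComplex D ℤ} (h : VanishNeg M N) :
    VanishNeg M ((onCplx F).obj ((onCplx G).obj N)) := by
  intro i j l hi hj hl z hz
  exact E.exact_of_components z fun b => h i j l hi hj hl _ (by
    rw [δ_comp_ofHom, hz, Cochain.zero_comp])

variable [F.Faithful] [F.PreservesMonomorphisms]

instance (K : CochainComplex C ℤ) (p : ℤ) : Mono ((unitCplx adj K).f p) :=
  inferInstanceAs (Mono (adj.unit.app (K.X p)))

/-- The cokernel of the unit. -/
noncomputable def unitCoker (N : CochainComplex C ℤ) : CochainComplex C ℤ :=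
  cokernel (unitCplx adj N)

/-- The projection to the cokernel of the unit. -/
noncomputable def unitπ (N : CochainComplex C ℤ) :
    (onCplx G).obj ((onCplx F).obj N) ⟶ unitCoker adj N :=
  cokernel.π (unitCplx adj N)

lemma unitCplx_unitπ (N : CochainComplex C ℤ) : unitCplx adj N ≫ unitπ adj N = 0 :=
  cokernel.condition _

/-- The short complex `N ⟶ G(F(N)) ⟶ coker`. -/
noncomputable def unitSC (N : CochainComplex C ℤ) : ShortComplex (CochainComplex C ℤ) :=
  ShortComplex.mk (unitCplx adj N) (unitπ adj N) (unitCplx_unitπ adj N)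

lemma unitSC_shortExact (N : CochainComplex C ℤ) : (unitSC adj N).ShortExact where
  exact := ShortComplex.exact_cokernel _
  mono_f := HomologicalComplex.mono_of_mono_f (unitCplx adj N) (fun p => inferInstance)
  epi_g := inferInstanceAs (Epi (cokernel.π (unitCplx adj N)))

/-- The unit is a monomorphism because `F` is faithful, and it splits in each degree because `N` is
termwise injective. The splittings need not commute with the differentials. -/
lemma exists_unit_splitting (N : CochainComplex C ℤ) [∀ p, Injective (N.X p)] (p : ℤ) :
    ∃ (r : ((onCplx G).obj ((onCplx F).obj N)).X p ⟶ N.X p)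
      (s : (unitCoker adj N).X p ⟶ ((onCplx G).obj ((onCplx F).obj N)).X p),
      s ≫ (unitπ adj N).f p = 𝟙 _ ∧ r ≫ (unitCplx adj N).f p = 𝟙 _ - (unitπ adj N).f p ≫ s := by
  have : Injective (((unitSC adj N).map (HomologicalComplex.eval C _ p)).X₁) :=
    inferInstanceAs (Injective (N.X p))
  let σ := ((unitSC_shortExact adj N).map_of_exact
    (HomologicalComplex.eval C _ p)).splittingOfInjective
  exact ⟨σ.r, σ.s, σ.s_g, σ.r_f⟩

lemma exists_unit_splittings (N : CochainComplex C ℤ) [∀ p, Injective (N.X p)] :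
    ∃ (r : Cochain ((onCplx G).obj ((onCplx F).obj N)) N 0)
      (s : Cochain (unitCoker adj N) ((onCplx G).obj ((onCplx F).obj N)) 0),
      s.comp (Cochain.ofHom (unitπ adj N)) (add_zero 0) = Cochain.ofHom (𝟙 _) ∧
      r.comp (Cochain.ofHom (unitCplx adj N)) (add_zero 0) = Cochain.ofHom (𝟙 _) -
        (Cochain.ofHom (unitπ adj N)).comp s (add_zero 0) := by
  choose r s hs hr using exists_unit_splitting adj N
  refine ⟨Cochain.ofHoms r, Cochain.ofHoms s, ?_, ?_⟩
  · ext p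
    rw [Cochain.zero_cochain_comp_v, Cochain.ofHom_v, Cochain.ofHom_v, Cochain.ofHoms_v, hs]
    rfl
  · ext p
    rw [Cochain.sub_v, Cochain.zero_cochain_comp_v, Cochain.zero_cochain_comp_v, Cochain.ofHom_v,
      Cochain.ofHom_v, Cochain.ofHom_v, Cochain.ofHoms_v, Cochain.ofHoms_v, hr]
    rfl

variable [F.PreservesInjectiveObjects]

/-- In each degree the cokernel is a direct summand of `G(F(N))`, which is injective because `G` has
a left adjoint preserving monomorphisms. Hence the cokernel can replace `N` in the induction below.
-/
lemma injective_unitCoker [∀ p, Injective (N.X p)] (p : ℤ) : Injective ((unitCoker adj N).X p) := by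
  obtain ⟨r, s, hs, hr⟩ := exists_unit_splitting adj N p
  have : Injective (F.obj (N.X p)) := inferInstance
  have : Injective (((onCplx G).obj ((onCplx F).obj N)).X p) :=
    adj.map_injective _ this
  exact (Retract.mk s _ hs).injective

lemma isStrictlyGE_unitCoker (n : ℤ) [N.IsStrictlyGE n] : (unitCoker adj N).IsStrictlyGE n := by
  rw [isStrictlyGE_iff]
  intro i hi
  have h := (unitSC_shortExact adj N).map_of_exact (HomologicalComplex.eval C _ i)
  have : Epi ((unitπ adj N).f i) := h.epi_g
  refine IsZero.of_epi ((unitπ adj N).f i) ?_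
  exact G.map_isZero (F.map_isZero (N.isZero_of_isStrictlyGE n i hi))

/-- Over `D`, the cokernel of the unit is a direct summand. -/
lemma exists_section (N : CochainComplex C ℤ) [∀ p, Injective (N.X p)] :
    ∃ s : (onCplx F).obj (unitCoker adj N) ⟶ (onCplx F).obj ((onCplx G).obj ((onCplx F).obj N)),
      s ≫ (onCplx F).map (unitπ adj N) = 𝟙 _ ∧
      (onCplx F).map (unitπ adj N) ≫ s =
        𝟙 _ - counitCplx adj ((onCplx F).obj N) ≫ (onCplx F).map (unitCplx adj N) := by
  obtain ⟨r, σ, hσ, hr⟩ := exists_unit_splittings adj N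
  -- By the triangle identity the counit retracts `F(η)`, so this is the idempotent complementary to
  -- `F(N)` inside `F(G(F(N)))`.
  let e : (onCplx F).obj ((onCplx G).obj ((onCplx F).obj N)) ⟶
      (onCplx F).obj ((onCplx G).obj ((onCplx F).obj N)) :=
    𝟙 _ - counitCplx adj ((onCplx F).obj N) ≫ (onCplx F).map (unitCplx adj N)
  have he : (onCplx F).map (unitCplx adj N) ≫ e = 0 := by
    ext p
    have h2 : F.map (adj.unit.app (N.X p)) ≫ (𝟙 _ - adj.counit.app (F.obj (N.X p)) ≫
        F.map (adj.unit.app (N.X p))) = 0 := by simp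
    exact h2
  have he' : e ≫ (onCplx F).map (unitπ adj N) = (onCplx F).map (unitπ adj N) := by
    have : (onCplx F).map (unitCplx adj N) ≫ (onCplx F).map (unitπ adj N) = 0 := by
      rw [← Functor.map_comp, unitCplx_unitπ, Functor.map_zero]
    rw [Preadditive.sub_comp, Category.assoc, this, comp_zero, sub_zero, Category.id_comp]
  -- Composing with the idempotent removes the dependence on the choice of degreewise section, and
  -- makes it a chain map.
  let y := (σ.map F).comp (Cochain.ofHom e) (add_zero 0)
  have hy : (Cochain.ofHom ((onCplx F).map (unitπ adj N))).comp y (add_zero 0) =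
      Cochain.ofHom e := by
    have h1 : (Cochain.ofHom (unitπ adj N)).comp σ (add_zero 0) = Cochain.ofHom (𝟙 _) -
      r.comp (Cochain.ofHom (unitCplx adj N)) (add_zero 0) := by rw [hr, sub_sub_cancel]
    rw [← Cochain.comp_assoc_of_first_is_zero_cochain, ← Cochain.map_ofHom, ← Cochain.map_comp, h1,
      Cochain.map_sub, Cochain.sub_comp, Cochain.map_ofHom, CategoryTheory.Functor.map_id, Cochain.id_comp,
      Cochain.map_comp, Cochain.comp_assoc_of_third_is_zero_cochain, Cochain.map_ofHom,
      ← Cochain.ofHom_comp, he, Cochain.ofHom_zero, Cochain.comp_zero, sub_zero]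
  have hσ' : (σ.map F).comp (Cochain.ofHom ((onCplx F).map (unitπ adj N))) (add_zero 0) =
      Cochain.ofHom (𝟙 _) := by
    rw [← Cochain.map_ofHom, ← Cochain.map_comp, hσ, Cochain.map_ofHom, CategoryTheory.Functor.map_id]
  -- The projection followed by `y` is the chain map `e`, so the projection kills `δ y`; as the
  -- projection has a degreewise section, `δ y` vanishes.
  have hδ : δ 0 1 y = 0 := by
    have := congrArg (δ 0 1) hy
    rw [δ_ofHom_comp, δ_ofHom] at this
    rw [← Cochain.id_comp (δ 0 1 y), ← hσ', Cochain.comp_assoc_of_first_is_zero_cochain, this,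
      Cochain.comp_zero]
  let s := (Cocycle.mk y 1 (zero_add 1) hδ).homOf
  have h1 : (onCplx F).map (unitπ adj N) ≫ s = e := by
    apply Cochain.ofHom_injective
    rw [Cochain.ofHom_comp, Cocycle.cochain_ofHom_homOf_eq_coe]
    exact hy
  refine ⟨s, ?_, h1⟩
  apply Cochain.ofHom_injective
  rw [Cochain.ofHom_comp, Cocycle.cochain_ofHom_homOf_eq_coe, ← hσ']
  change y.comp _ _ = _
  rw [Cochain.comp_assoc_of_third_is_zero_cochain, ← Cochain.ofHom_comp, he']

/-- Over `D` the cokernel is a summand of `F(G(F(N)))`, which is a product of copies of `F(N)`. -/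
lemma VanishNeg.unitCoker (E : ProdDatum F G B) [∀ p, Injective (N.X p)]
    (h : VanishNeg ((onCplx F).obj M) ((onCplx F).obj N)) :
    VanishNeg ((onCplx F).obj M) ((onCplx F).obj (unitCoker adj N)) := by
  obtain ⟨s, hs, -⟩ := exists_section adj N
  exact (E.vanishNeg h).of_retract s _ hs

/-- If the image of `c` in the cokernel of the unit is a coboundary, then `c` is, up to a
coboundary, in the image of the unit. -/
lemma exists_preimage [∀ p, Injective (N.X p)] {n m : ℤ} (hm : m + 1 = n)
    (c : Cochain M ((onCplx G).obj ((onCplx F).obj N)) n)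
    (v : Cochain M (unitCoker adj N) m)
    (hv : δ m n v = c.comp (Cochain.ofHom (unitπ adj N)) (add_zero n)) :
    ∃ (y : Cochain M N n) (t : Cochain M ((onCplx G).obj ((onCplx F).obj N)) m),
      c = y.comp (Cochain.ofHom (unitCplx adj N)) (add_zero n) + δ m n t := by
  obtain ⟨r, s, hs, hr⟩ := exists_unit_splittings adj N
  -- The degreewise section lifts `v`; after subtracting `δ t` the image of `c` in the cokernel is
  -- zero, so the retraction `r` recovers a cochain into `N`.
  let t : Cochain M ((onCplx G).obj ((onCplx F).obj N)) m := v.comp s (add_zero m)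
  have ht : (c - δ m n t).comp (Cochain.ofHom (unitπ adj N)) (add_zero n) = 0 := by
    rw [Cochain.sub_comp, ← δ_comp_ofHom, Cochain.comp_assoc_of_third_is_zero_cochain, hs,
      Cochain.comp_id, hv, sub_self]
  refine ⟨(c - δ m n t).comp r (add_zero n), t, ?_⟩
  have : (c - δ m n t).comp (r.comp (Cochain.ofHom (unitCplx adj N)) (add_zero 0)) (add_zero n) =
      c - δ m n t := by
    rw [hr, Cochain.comp_sub, Cochain.comp_id, ← Cochain.comp_assoc_of_third_is_zero_cochain, ht,
      Cochain.zero_comp, sub_zero]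
  rw [Cochain.comp_assoc_of_third_is_zero_cochain, this, sub_add_cancel]

lemma comp_unitCplx_injective {n : ℤ} {y y' : Cochain M N n}
    (h : y.comp (Cochain.ofHom (unitCplx adj N)) (add_zero n) =
      y'.comp (Cochain.ofHom (unitCplx adj N)) (add_zero n)) : y = y' := by
  ext p q hpq
  have := Cochain.congr_v h p q hpq
  rw [Cochain.comp_zero_cochain_v, Cochain.comp_zero_cochain_v] at this
  rw [Cochain.ofHom_v] at this
  exact (cancel_mono ((unitCplx adj N).f q)).1 this

/-- Cochains from a cohomologically bounded above complex to a bounded below complex of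
injectives vanish in low degrees, up to coboundaries. -/
lemma exact_of_lt (a b : ℤ) [M.IsLE a] [N.IsStrictlyGE b] [∀ p, Injective (N.X p)]
    {i j l : ℤ} (hi : i < b - a) (hij : i + 1 = j) (hl : l + 1 = i) (z : Cochain M N i)
    (hz : δ i j z = 0) : ∃ w, δ l i w = z := by
  have : N.IsKInjective := isKInjective_of_injective N b
  -- After replacing `M` by its truncation, concentrated in degrees at most `a`, no nonzero cochain
  -- of degree below `b - a` remains.
  have : QuasiIso (M.ιTruncLE a) := (M.quasiIso_ιTruncLE_iff a).2 inferInstance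
  refine precomp_inj (M.ιTruncLE a) hij hl z hz 0 ?_
  rw [δ_zero]
  ext p q hpq
  by_cases hp : a < p
  · exact ((M.truncLE a).isZero_of_isStrictlyLE a p hp).eq_of_src _ _
  · exact (N.isZero_of_isStrictlyGE b q (by omega)).eq_of_tgt _ _

include adj in
/-- A cocycle of nonpositive degree over `C` which is a coboundary over `D` is a coboundary. -/
lemma exact_of_exact_map (E : ProdDatum F G B) (a b : ℤ) [M.IsLE a] (d : ℕ) :
    ∀ (N : CochainComplex C ℤ) [N.IsStrictlyGE b] [∀ p, Injective (N.X p)],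
      VanishNeg ((onCplx F).obj M) ((onCplx F).obj N) →
      ∀ i j l : ℤ, i ≤ 0 → i + 1 = j → l + 1 = i → i < b - a + d → ∀ (z : Cochain M N i),
        δ i j z = 0 → ∀ (w : Cochain ((onCplx F).obj M) ((onCplx F).obj N) l),
        δ l i w = z.map F → ∃ y, δ l i y = z := by
  -- Dimension shifting along `N → G(F(N)) → coker`. The number `d` bounds how far the degree lies
  -- above the range where all cocycles bound for reasons of degree.
  induction d with
  | zero =>
    intro N _ _ _ i j l _ hij hl hi z hz w _
    exact exact_of_lt a b (by simpa using hi) hij hl z hz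
  | succ d ih =>
    intro N _ _ hN i j l hi0 hij hl hi z hz w hw
    have := isStrictlyGE_unitCoker adj (N := N) b
    have := injective_unitCoker adj (N := N)
    have hN₁ := hN.unitCoker adj E
    -- The adjoint of the primitive over `D` is a primitive of `z` in `G(F(N))`; its image in the
    -- cokernel is therefore a cocycle, one degree lower.
    have hc : δ l i (adjCochain adj w) =
        z.comp (Cochain.ofHom (unitCplx adj N)) (add_zero i) := by
      rw [δ_adjCochain, hw, adjCochain_map]
    have hzero : (Cochain.ofHom (unitCplx adj N)).comp (Cochain.ofHom (unitπ adj N))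
        (add_zero 0) = 0 := by
      rw [← Cochain.ofHom_comp, unitCplx_unitπ, Cochain.ofHom_zero]
    have hc' : δ l i ((adjCochain adj w).comp (Cochain.ofHom (unitπ adj N)) (add_zero l)) = 0 := by
      rw [δ_comp_ofHom, hc, Cochain.comp_assoc_of_third_is_zero_cochain, hzero, Cochain.comp_zero]
    -- This degree is negative, so over `D` the cocycle bounds by the vanishing hypothesis for the
    -- cokernel.
    obtain ⟨x, hx⟩ := hN₁ l i (l - 1) (by omega) hl (by omega) (Cochain.map _ F) (by
      rw [δ_map, hc', Cochain.map_zero])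
    -- Over `C` it bounds by induction: the degree and `d` have both dropped by one.
    obtain ⟨v, hv⟩ := ih _ hN₁ l i (l - 1) (by omega) hl (by omega)
      (by push_cast at hi; omega) _ hc' x hx
    -- Hence the primitive in `G(F(N))` can be moved into `N` by a coboundary, which does not change
    -- its differential.
    obtain ⟨y, t, hy⟩ := exists_preimage adj (show l - 1 + 1 = l by omega) _ v hv
    refine ⟨y, comp_unitCplx_injective adj ?_⟩
    rw [← hc, hy, δ_add, δ_δ, add_zero, δ_comp_ofHom]

include adj in
lemma exact_of_exact_map' (E : ProdDatum F G B) (a b : ℤ) [M.IsLE a] [N.IsStrictlyGE b]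
    [∀ p, Injective (N.X p)] (hN : VanishNeg ((onCplx F).obj M) ((onCplx F).obj N))
    (z : Cochain M N 0) (hz : δ 0 1 z = 0)
    (w : Cochain ((onCplx F).obj M) ((onCplx F).obj N) (-1)) (hw : δ (-1) 0 w = z.map F) :
    ∃ y, δ (-1) 0 y = z :=
  -- Any `d` with `0 < b - a + d` serves.
  exact_of_exact_map adj E a b ((0 - (b - a) + 1).toNat) N hN 0 1 (-1) le_rfl (by omega) (by omega)
    (by omega) z hz w hw

include adj in
/-- Chain maps over `C` which are homotopic over `D` are homotopic. -/
lemma homotopic_of_map (E : ProdDatum F G B) (a b : ℤ) [M.IsLE a] [N.IsStrictlyGE b]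
    [∀ p, Injective (N.X p)] (hN : VanishNeg ((onCplx F).obj M) ((onCplx F).obj N))
    (f g : M ⟶ N) (h : Nonempty (Homotopy ((onCplx F).map f) ((onCplx F).map g))) :
    Nonempty (Homotopy f g) := by
  obtain ⟨w, hw⟩ := exists_cochain_of_homotopy h
  obtain ⟨y, hy⟩ := exact_of_exact_map' adj E a b hN (Cochain.ofHom f - Cochain.ofHom g) (by simp) w
    (by rw [Cochain.map_sub, Cochain.map_ofHom, Cochain.map_ofHom, hw, add_sub_cancel_left])
  exact ⟨(Cochain.equivHomotopy _ _).symm ⟨y, by rw [hy, sub_add_cancel]⟩⟩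

/-- Multiplication by `b` on the objects `F(X)`. -/
@[simps!]
def ProdDatum.act (E : ProdDatum F G B) (b : B) : F ⟶ F :=
  (Functor.leftUnitor F).inv ≫ Functor.whiskerRight adj.unit F ≫
    (Functor.associator F G F).hom ≫ Functor.whiskerLeft F (E.ev b) ≫ (Functor.rightUnitor F).hom

/-- Together with the next identity: a map `z` over `D` gives two maps into `F(G(F(Y)))`, one by
adjunction and one by `F(η)`. Their components at `c` are `z` after the action of `c` and `z` before
it, so the two agree exactly when `z` is equivariant. -/
lemma act_aux₁ (E : ProdDatum F G B) (c : B) {X Y : C} (z : F.obj X ⟶ F.obj Y) :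
    F.map (adj.unit.app X ≫ G.map z) ≫ (E.ev c).app (F.obj Y) = (E.act adj c).app X ≫ z := by
  have h := (E.ev c).naturality z
  dsimp at h
  simp [h]

lemma act_aux₂ (E : ProdDatum F G B) (c : B) {X Y : C} (z : F.obj X ⟶ F.obj Y) :
    (z ≫ F.map (adj.unit.app Y)) ≫ (E.ev c).app (F.obj Y) = z ≫ (E.act adj c).app Y := by
  simp

/-- A chain map over `D` which commutes with the action of `B` up to homotopy lifts to `C`, up
to homotopy. -/
lemma exists_lift_of_commute (E : ProdDatum F G B) (a b : ℤ) [M.IsLE a] [N.IsStrictlyGE b]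
    [∀ p, Injective (N.X p)] (hN : VanishNeg ((onCplx F).obj M) ((onCplx F).obj N))
    (z : (onCplx F).obj M ⟶ (onCplx F).obj N)
    (hz : ∀ c : B, Nonempty (Homotopy (natCplx (E.act adj c) M ≫ z) (z ≫ natCplx (E.act adj c) N))) :
    ∃ y : M ⟶ N, Nonempty (Homotopy ((onCplx F).map y) z) := by
  obtain ⟨s, hs, hs'⟩ := exists_section adj N
  have := isStrictlyGE_unitCoker adj (N := N) b
  have := injective_unitCoker adj (N := N)
  have hN₁ := hN.unitCoker adj E
  -- The adjoint of `z`; lifting `z` to `C` means moving this map into `N` along the unit, up to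
  -- homotopy.
  let zh : M ⟶ (onCplx G).obj ((onCplx F).obj N) := unitCplx adj M ≫ (onCplx G).map z
  have hzh : Cochain.ofHom zh = adjCochain adj (Cochain.ofHom z) := by
    rw [adjCochain, Cochain.map_ofHom, ← Cochain.ofHom_comp]
  -- The obstruction to doing so.
  let q : M ⟶ (unitCoker adj N) := zh ≫ (unitπ adj N)
  have hzε : (onCplx F).map zh ≫ counitCplx adj ((onCplx F).obj N) = z := by
    have := map_adjCochain adj (Cochain.ofHom z)
    rw [← hzh, Cochain.map_ofHom, ← Cochain.ofHom_comp] at this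
    exact Cochain.ofHom_injective this
  -- the difference of the two extensions of `z` to `F(G(F(N)))` is a coboundary
  obtain ⟨x, hx⟩ := E.exact_of_components (m := -1) (Cochain.ofHom ((onCplx F).map zh -
      z ≫ (onCplx F).map (unitCplx adj N))) (fun c => by
    obtain ⟨w, hw⟩ := exists_cochain_of_homotopy (hz c)
    refine ⟨w, ?_⟩
    have h1 : (onCplx F).map zh ≫ evCplx E c _ = natCplx (E.act adj c) M ≫ z := by
      ext p
      exact act_aux₁ adj E c (z.f p)
    have h2 : (z ≫ (onCplx F).map (unitCplx adj N)) ≫ evCplx E c _ =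
        z ≫ natCplx (E.act adj c) N := by
      ext p
      exact act_aux₂ adj E c (z.f p)
    rw [← Cochain.ofHom_comp, Preadditive.sub_comp, h1, h2, Cochain.ofHom_sub, hw,
      add_sub_cancel_left])
  -- The second extension of `z` dies in the cokernel, so over `D` the obstruction is the image of a
  -- null-homotopic difference.
  have hq : (onCplx F).map q = ((onCplx F).map zh - z ≫ (onCplx F).map (unitCplx adj N)) ≫
      (onCplx F).map (unitπ adj N) := by
    have : (onCplx F).map (unitCplx adj N) ≫ (onCplx F).map (unitπ adj N) = 0 := by
      rw [← Functor.map_comp, unitCplx_unitπ, Functor.map_zero]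
    rw [Preadditive.sub_comp, Category.assoc, this, comp_zero, sub_zero, ← Functor.map_comp]
  -- In degree zero, a primitive over `D` suffices for a primitive over `C`.
  obtain ⟨v, hv⟩ := exact_of_exact_map' adj E a b hN₁ (Cochain.ofHom q) (by simp)
    (x.comp (Cochain.ofHom ((onCplx F).map (unitπ adj N))) (add_zero _)) (by
      rw [δ_comp_ofHom, hx, Cochain.map_ofHom, hq, Cochain.ofHom_comp])
  obtain ⟨y, t, hy⟩ := exists_preimage adj (neg_add_cancel 1) (Cochain.ofHom zh) v
    (by rw [hv, ← Cochain.ofHom_comp])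
  -- The cochain `y` is a cocycle because the unit is degreewise injective and `y` followed by it
  -- differs from a chain map by a coboundary.
  have hy0 : δ 0 1 y = 0 := by
    apply comp_unitCplx_injective adj
    rw [← δ_comp_ofHom, Cochain.zero_comp, ← sub_eq_of_eq_add hy, δ_sub, δ_δ, δ_ofHom, sub_zero]
  refine ⟨(Cocycle.mk y 1 (zero_add 1) hy0).homOf, ⟨(Cochain.equivHomotopy _ _).symm
    ⟨-(t.map F).comp (Cochain.ofHom (counitCplx adj ((onCplx F).obj N))) (add_zero _), ?_⟩⟩⟩
  have e1 : Cochain.ofHom ((onCplx F).map (Cocycle.mk y 1 (zero_add 1) hy0).homOf) = y.map F := by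
    rw [← Cochain.map_ofHom, Cocycle.cochain_ofHom_homOf_eq_coe]
    rfl
  have e2 : ((y.comp (Cochain.ofHom (unitCplx adj N)) (add_zero 0)).map F).comp
      (Cochain.ofHom (counitCplx adj ((onCplx F).obj N))) (add_zero 0) = y.map F := by
    rw [← adjCochain_map, map_adjCochain]
  rw [e1, ← e2, ← sub_eq_of_eq_add hy, Cochain.map_sub, Cochain.sub_comp, Cochain.map_ofHom,
    ← Cochain.ofHom_comp, hzε, δ_neg, δ_comp_ofHom, δ_map]
  abel

end Adjunction

/-! ### Descent along `Λ → S` when `S ≅ Λ ⊗ U`. -/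

section Coextension

variable {k : Type u} [Field k] {Λ S U : Type u} [Ring Λ] [Ring S] [Ring U] [Algebra k Λ]
  [Algebra k S] [Algebra k U]

/-- The functor right adjoint to restriction of scalars. -/
noncomputable abbrev coextMod (τ : Λ →ₐ[k] S) : ModuleCat.{u} Λ ⥤ ModuleCat.{u} S :=
  ModuleCat.coextendScalars τ.toRingHom

/-- The adjunction between restriction and coextension of scalars. -/
noncomputable abbrev resCoextAdj (τ : Λ →ₐ[k] S) : resMod τ ⊣ coextMod τ :=
  ModuleCat.restrictCoextendScalarsAdj τ.toRingHom

instance (τ : Λ →ₐ[k] S) : (coextMod τ).Additive where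
  map_add := rfl

/-- If `S` has a basis over `Λ` consisting of elements commuting with `Λ`, then the coextension of
`Y` is, over `Λ`, a product of copies of `Y`. -/
noncomputable def prodDatumOfBasis (τ : Λ →ₐ[k] S) {B : Type*} (b : Module.Basis B Λ
      ((resMod τ).obj (ModuleCat.of S S)))
    (hb : ∀ i l, (show S from b i) * τ l = τ l * (show S from b i)) :
    ProdDatum (resMod τ) (coextMod τ) B where
  ev i :=
    { app := fun Y => ModuleCat.ofHom (X := (resMod τ).obj ((coextMod τ).obj Y)) (Y := Y)
        { toFun := fun h => (ModuleCat.CoextendScalars.equiv τ.toRingHom Y h) (b i)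
          map_add' := fun x y => rfl
          map_smul' := fun l h => by
            change (ModuleCat.CoextendScalars.equiv τ.toRingHom Y h)
              ((show S from b i) * τ l) = _
            rw [hb]
            exact map_smul (ModuleCat.CoextendScalars.equiv τ.toRingHom Y h) l (b i) }
      naturality := fun X Y g => rfl }
  exists_lift {X Y} f := by
    -- Prescribing the values `f i x` on the basis depends `Λ`-linearly on `x` only because the
    -- basis elements commute with `Λ`: the coextended structure multiplies the argument on the
    -- right.
    have key (x : X) (l : Λ) (s : (resMod τ).obj (ModuleCat.of S S)) :
        b.constr ℕ (fun i => f i (l • x)) s =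
          b.constr ℕ (fun i => f i x) ((show S from s) * τ l : S) := by
      let R : (resMod τ).obj (ModuleCat.of S S) →ₗ[Λ] (resMod τ).obj (ModuleCat.of S S) :=
        { toFun := fun s => (show S from s) * τ l
          map_add' := fun x y => add_mul (show S from x) (show S from y) (τ l)
          map_smul' := fun m x => mul_assoc (τ m) (show S from x) (τ l) }
      have : b.constr ℕ (fun i => f i (l • x)) = b.constr ℕ (fun i => f i x) ∘ₗ R := by
        refine b.ext fun i => ?_
        have h1 : R (b i) = l • b i := hb i l
        rw [LinearMap.comp_apply, h1, map_smul, Module.Basis.constr_basis,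
          Module.Basis.constr_basis, map_smul]
      exact LinearMap.congr_fun this s
    refine ⟨ModuleCat.ofHom (Y := (resMod τ).obj ((coextMod τ).obj Y))
      { toFun := fun x => (ModuleCat.CoextendScalars.equiv τ.toRingHom Y).symm
          (b.constr ℕ (fun i => f i x))
        map_add' := fun x y => ?_
        map_smul' := fun l x => ?_ }, fun i => ?_⟩
    · apply (ModuleCat.CoextendScalars.equiv τ.toRingHom Y).injective
      refine b.ext fun i => ?_
      refine (b.constr_basis ℕ _ i).trans ?_
      refine (map_add (f i).hom x y).trans ?_
      exact (congrArg₂ (· + ·) (b.constr_basis ℕ (fun i => f i x) i)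
        (b.constr_basis ℕ (fun i => f i y) i)).symm
    · apply (ModuleCat.CoextendScalars.equiv τ.toRingHom Y).injective
      exact LinearMap.ext fun s => key x l s
    · ext x
      exact b.constr_basis ℕ (fun i => f i x) i
  hom_ext {X Y f g} h := by
    ext x
    apply (ModuleCat.CoextendScalars.equiv τ.toRingHom Y).injective
    exact b.ext fun i => LinearMap.congr_fun (congrArg ModuleCat.Hom.hom (h i)) x

variable (τ : Λ →ₐ[k] S) (σ : U →ₐ[k] S) (h : ∀ u l, Commute (σ u) (τ l))
  (hb : Function.Bijective (liftComm σ τ h))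

/-- The `Λ`-linear map `Λ ⊗ₖ U → S`. -/
noncomputable def liftCommLin : Λ ⊗[k] U →ₗ[Λ] (resMod τ).obj (ModuleCat.of S S) where
  toFun := liftComm σ τ h
  map_add' := map_add (liftComm σ τ h)
  map_smul' l x := by
    have h1 : l • x = (l ⊗ₜ[k] (1 : U)) * x := by
      induction x using TensorProduct.induction_on with
      | zero => simp
      | add x y hx hy => rw [smul_add, hx, hy, mul_add]
      | tmul a c => simp [TensorProduct.smul_tmul']
    have h2 : liftComm σ τ h (l ⊗ₜ[k] (1 : U)) = τ l := by simp
    refine (congrArg (liftComm σ τ h) h1).trans ((map_mul _ _ _).trans ?_)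
    exact congrArg (· * liftComm σ τ h x) h2

/-- A basis of `S ≅ Λ ⊗ₖ U` over `Λ`, coming from `U`. -/
noncomputable def basisOfBijective {B : Type*} (b : Module.Basis B k U) :
    Module.Basis B Λ ((resMod τ).obj (ModuleCat.of S S)) :=
  (Algebra.TensorProduct.basis Λ b).map (LinearEquiv.ofBijective (liftCommLin τ σ h) hb)

lemma basisOfBijective_apply {B : Type*} (b : Module.Basis B k U) (i : B) :
    basisOfBijective τ σ h hb b i = σ (b i) := by
  rw [basisOfBijective, Module.Basis.map_apply, Algebra.TensorProduct.basis_apply]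
  change τ 1 * σ (b i) = σ (b i)
  rw [map_one, one_mul]

/-- If `S ≅ Λ ⊗ₖ U`, then the coextension of `Y` is, over `Λ`, a product of copies of `Y`. -/
noncomputable def prodDatum : ProdDatum (resMod τ) (coextMod τ) (Module.Free.ChooseBasisIndex k U) :=
  prodDatumOfBasis τ (basisOfBijective τ σ h hb (Module.Free.chooseBasis k U)) (fun i l => by
    rw [basisOfBijective_apply]
    exact h _ _)

/-- Makes the equivariance hypothesis of the abstract lifting result concrete: the operators
attached to the adjunction are multiplications by elements of `U`. -/
lemma prodDatum_act (i : Module.Free.ChooseBasisIndex k U) :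
    (prodDatum τ σ h hb).act (resCoextAdj τ) i =
      mulNat τ (σ (Module.Free.chooseBasis k U i)) (fun l => (h _ l).symm) := by
  ext N x
  change (show S from basisOfBijective τ σ h hb (Module.Free.chooseBasis k U) i) •
    (show N from x) = _
  rw [basisOfBijective_apply]
  rfl

include hb in
lemma preservesInjectiveObjects_resMod : (resMod τ).PreservesInjectiveObjects where
  injective_obj {E} _ := injective_res σ τ h hb E

instance : (resMod τ).PreservesMonomorphisms :=
  inferInstance

include hb in
/-- Chain maps over `S` which are homotopic over `Λ` are homotopic. -/
lemma homotopic_of_res {M N : CochainComplex (ModuleCat.{u} S) ℤ} (a b : ℤ) [M.IsLE a]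
    [N.IsStrictlyGE b] [∀ p, Injective (N.X p)]
    (hN : VanishNeg ((onCplx (resMod τ)).obj M) ((onCplx (resMod τ)).obj N)) (f g : M ⟶ N)
    (w : Nonempty (Homotopy ((onCplx (resMod τ)).map f) ((onCplx (resMod τ)).map g))) :
    Nonempty (Homotopy f g) :=
  have := preservesInjectiveObjects_resMod τ σ h hb
  homotopic_of_map (resCoextAdj τ) (prodDatum τ σ h hb) a b hN f g w

include hb in
/-- A chain map over `Λ` which commutes with `U` up to homotopy lifts to `S`, up to homotopy. -/
lemma exists_lift_res {M N : CochainComplex (ModuleCat.{u} S) ℤ} (a b : ℤ) [M.IsLE a]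
    [N.IsStrictlyGE b] [∀ p, Injective (N.X p)]
    (hN : VanishNeg ((onCplx (resMod τ)).obj M) ((onCplx (resMod τ)).obj N))
    (z : (onCplx (resMod τ)).obj M ⟶ (onCplx (resMod τ)).obj N)
    (hz : ∀ c : U, Nonempty (Homotopy
      (natCplx (mulNat τ (σ c) (fun l => (h c l).symm)) M ≫ z)
      (z ≫ natCplx (mulNat τ (σ c) (fun l => (h c l).symm)) N))) :
    ∃ y : M ⟶ N, Nonempty (Homotopy ((onCplx (resMod τ)).map y) z) :=
  have := preservesInjectiveObjects_resMod τ σ h hb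
  exists_lift_of_commute (resCoextAdj τ) (prodDatum τ σ h hb) a b hN z
    (fun c => by rw [prodDatum_act]; exact hz _)

end Coextension

/-! ### Degreewise split sequences of complexes. -/

section Split

lemma isGE_of_quasiIso {C : Type*} [Category* C] [Abelian C] {K L : CochainComplex C ℤ} (f : K ⟶ L)
    [QuasiIso f] (n : ℤ) [L.IsGE n] : K.IsGE n := by
  rw [isGE_iff]
  intro i hi
  exact (exactAt_iff_of_quasiIsoAt f i).2 (L.exactAt_of_isGE n i)

lemma isLE_of_quasiIso {C : Type*} [Category* C] [Abelian C] {K L : CochainComplex C ℤ} (f : K ⟶ L)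
    [QuasiIso f] (n : ℤ) [K.IsLE n] : L.IsLE n := by
  rw [isLE_iff]
  intro i hi
  exact (exactAt_iff_of_quasiIsoAt f i).1 (K.exactAt_of_isLE n i)

variable {C : Type*} [Category* C] [Abelian C]

/-- A short complex of complexes which is split in each degree. -/
def DegreewiseSplit (S : ShortComplex (CochainComplex C ℤ)) : Prop :=
  ∀ n, Nonempty (S.map (HomologicalComplex.eval C (ComplexShape.up ℤ) n)).Splitting

lemma DegreewiseSplit.shortExact {S : ShortComplex (CochainComplex C ℤ)} (h : DegreewiseSplit S) :
    S.ShortExact :=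
  HomologicalComplex.shortExact_of_degreewise_shortExact _ (fun n => (h n).some.shortExact)

/-- The splittings are not chain maps, but they are cochains of degree zero, which is all that
functoriality of Hom in each degree requires. -/
lemma DegreewiseSplit.exists_cochains {S : ShortComplex (CochainComplex C ℤ)}
    (h : DegreewiseSplit S) : ∃ (r : Cochain S.X₂ S.X₁ 0) (s : Cochain S.X₃ S.X₂ 0),
      (Cochain.ofHom S.f).comp r (add_zero 0) = Cochain.ofHom (𝟙 _) ∧
      s.comp (Cochain.ofHom S.g) (add_zero 0) = Cochain.ofHom (𝟙 _) ∧
      r.comp (Cochain.ofHom S.f) (add_zero 0) + (Cochain.ofHom S.g).comp s (add_zero 0) =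
        Cochain.ofHom (𝟙 _) := by
  have hh (n : ℤ) : ∃ (r : S.X₂.X n ⟶ S.X₁.X n) (s : S.X₃.X n ⟶ S.X₂.X n),
      S.f.f n ≫ r = 𝟙 _ ∧ s ≫ S.g.f n = 𝟙 _ ∧ r ≫ S.f.f n + S.g.f n ≫ s = 𝟙 _ :=
    ⟨(h n).some.r, (h n).some.s, (h n).some.f_r, (h n).some.s_g, (h n).some.id⟩
  choose r s h1 h2 h3 using hh
  refine ⟨Cochain.ofHoms r, Cochain.ofHoms s, ?_, ?_, ?_⟩
  · ext p
    rw [Cochain.zero_cochain_comp_v, Cochain.ofHom_v, Cochain.ofHoms_v, Cochain.ofHom_v, h1]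
    rfl
  · ext p
    rw [Cochain.zero_cochain_comp_v, Cochain.ofHom_v, Cochain.ofHoms_v, Cochain.ofHom_v, h2]
    rfl
  · ext p
    rw [Cochain.add_v, Cochain.zero_cochain_comp_v, Cochain.ofHom_v, Cochain.ofHoms_v,
      Cochain.zero_cochain_comp_v, Cochain.ofHom_v, Cochain.ofHoms_v, Cochain.ofHom_v, h3]
    rfl

lemma degreewiseSplit_mappingCone {K L : CochainComplex C ℤ} (φ : K ⟶ L) :
    DegreewiseSplit (mappingCone.triangleRotateShortComplex φ) :=
  fun n => ⟨mappingCone.triangleRotateShortComplexSplitting φ n⟩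

end Split

/-! ### The complex `Hom_Λ(F, G)` with its residual action. -/

section HomCplx

variable {k : Type u} [Field k]

/-- Commuting actions of `Λ` and `T` on `Z`-modules. -/
structure ActPair (k Λ T Z : Type u) [Field k] [Ring Λ] [Ring T] [Ring Z] [Algebra k Λ]
    [Algebra k T] [Algebra k Z] where
  /-- the action of `Λ` -/
  src : Λ →ₐ[k] Z
  /-- the action of `T` -/
  tgt : T →ₐ[k] Z
  comm : ∀ s t, Commute (src s) (tgt t)

variable {Λ T Z : Type u} [Ring Λ] [Ring T] [Ring Z] [Algebra k Λ] [Algebra k T] [Algebra k Z]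
  (D : ActPair k Λ T Z)

namespace ActPair

/-- The underlying complex of `Λ`-modules. -/
noncomputable abbrev res (G : CochainComplex (ModuleCat.{u} Z) ℤ) : CochainComplex (ModuleCat.{u} Λ) ℤ :=
  (onCplx (resMod D.src)).obj G

/-- Multiplication by an element of `T` on a complex of `Z`-modules. -/
noncomputable def mul (t : T) (G : CochainComplex (ModuleCat.{u} Z) ℤ) : D.res G ⟶ D.res G :=
  natCplx (mulNat D.src (D.tgt t) (fun s => D.comm s t)) G

/-- The cochains `Hom_Λ(F, G)` of degree `n`. -/
def Carrier (F : CochainComplex (ModuleCat.{u} Λ) ℤ) (G : CochainComplex (ModuleCat.{u} Z) ℤ)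
    (n : ℤ) : Type u := Cochain F (D.res G) n

noncomputable instance (F : CochainComplex (ModuleCat.{u} Λ) ℤ) (G : CochainComplex (ModuleCat.{u} Z) ℤ)
    (n : ℤ) : AddCommGroup (D.Carrier F G n) := inferInstanceAs (AddCommGroup (Cochain F (D.res G) n))

/-- Cochains are equal if they agree on elements. -/
lemma cochain_hom_ext {R : Type u} [Ring R] {F G : CochainComplex (ModuleCat.{u} R) ℤ} {n : ℤ}
    {z z' : Cochain F G n} (h : ∀ p q hpq x, z.v p q hpq x = z'.v p q hpq x) : z = z' := by
  ext p q hpq x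
  exact h p q hpq x

lemma mul_one' (G : CochainComplex (ModuleCat.{u} Z) ℤ) : D.mul 1 G = 𝟙 _ := by
  ext n x
  exact (congrArg (· • (show G.X n from x)) (map_one D.tgt)).trans (one_smul Z (show G.X n from x))

lemma mul_mul' (t t' : T) (G : CochainComplex (ModuleCat.{u} Z) ℤ) :
    D.mul (t * t') G = D.mul t' G ≫ D.mul t G := by
  ext n x
  exact (congrArg (· • (show G.X n from x)) (map_mul D.tgt t t')).trans
    (mul_smul _ _ (show G.X n from x))

lemma mul_add' (t t' : T) (G : CochainComplex (ModuleCat.{u} Z) ℤ) :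
    D.mul (t + t') G = D.mul t G + D.mul t' G := by
  ext n x
  exact (congrArg (· • (show G.X n from x)) (map_add D.tgt t t')).trans
    (add_smul _ _ (show G.X n from x))

lemma mul_zero' (G : CochainComplex (ModuleCat.{u} Z) ℤ) : D.mul 0 G = 0 := by
  ext n x
  exact (congrArg (· • (show G.X n from x)) (map_zero D.tgt)).trans
    (zero_smul Z (show G.X n from x))

/-- Multiplication by an element of `T` on cochains. -/
noncomputable def smulC {F : CochainComplex (ModuleCat.{u} Λ) ℤ}
    {G : CochainComplex (ModuleCat.{u} Z) ℤ} {n : ℤ} (t : T) (z : Cochain F (D.res G) n) :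
    Cochain F (D.res G) n :=
  z.comp (Cochain.ofHom (D.mul t G)) (add_zero n)

section

variable {F : CochainComplex (ModuleCat.{u} Λ) ℤ} {G : CochainComplex (ModuleCat.{u} Z) ℤ} {n : ℤ}
  (t t' : T) (z z' : Cochain F (D.res G) n)

lemma smulC_one : D.smulC 1 z = z := by rw [smulC, mul_one', Cochain.comp_id]

lemma smulC_mul : D.smulC (t * t') z = D.smulC t (D.smulC t' z) := by
  rw [smulC, smulC, smulC, mul_mul', Cochain.ofHom_comp, Cochain.comp_assoc_of_third_is_zero_cochain]

lemma smulC_add : D.smulC t (z + z') = D.smulC t z + D.smulC t z' := Cochain.add_comp _ _ _ _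

lemma smulC_zero : D.smulC t (0 : Cochain F (D.res G) n) = 0 := Cochain.zero_comp _ _

lemma add_smulC : D.smulC (t + t') z = D.smulC t z + D.smulC t' z := by
  rw [smulC, mul_add', Cochain.ofHom_add, Cochain.comp_add]
  rfl

lemma zero_smulC : D.smulC 0 z = 0 := by
  rw [smulC, mul_zero', Cochain.ofHom_zero, Cochain.comp_zero]

lemma δ_smulC (m : ℤ) : δ n m (D.smulC t z) = D.smulC t (δ n m z) := δ_comp_ofHom _ _ _

lemma comp_smulC {F' : CochainComplex (ModuleCat.{u} Λ) ℤ} {l a : ℤ} (φ : Cochain F' F l)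
    (h : l + n = a) : φ.comp (D.smulC t z) h = D.smulC t (φ.comp z h) :=
  (Cochain.comp_assoc_of_third_is_zero_cochain _ _ _ _).symm

lemma smulC_comp {G' : CochainComplex (ModuleCat.{u} Z) ℤ} (ψ : G ⟶ G') :
    (D.smulC t z).comp (Cochain.ofHom ((onCplx (resMod D.src)).map ψ)) (add_zero n) =
      D.smulC t (z.comp (Cochain.ofHom ((onCplx (resMod D.src)).map ψ)) (add_zero n)) := by
  have : D.mul t G ≫ (onCplx (resMod D.src)).map ψ =
      (onCplx (resMod D.src)).map ψ ≫ D.mul t G' := by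
    ext n x
    exact map_smul (ψ.f n).hom (D.tgt t) (show G.X n from x)
  rw [smulC, smulC, Cochain.comp_assoc_of_third_is_zero_cochain, ← Cochain.ofHom_comp, this,
    Cochain.ofHom_comp, Cochain.comp_assoc_of_third_is_zero_cochain]

lemma smulC_v (p q : ℤ) (hpq : p + n = q) (x : F.X p) :
    (show G.X q from (D.smulC t z).v p q hpq x) = D.tgt t • (show G.X q from z.v p q hpq x) := by
  rw [smulC, Cochain.comp_zero_cochain_v, Cochain.ofHom_v]
  rfl

end

noncomputable instance (F : CochainComplex (ModuleCat.{u} Λ) ℤ)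
    (G : CochainComplex (ModuleCat.{u} Z) ℤ) (n : ℤ) : Module T (D.Carrier F G n) where
  smul t z := D.smulC t z
  one_smul z := D.smulC_one z
  mul_smul t t' z := D.smulC_mul t t' z
  smul_zero t := D.smulC_zero t
  smul_add t z z' := D.smulC_add t z z'
  add_smul t t' z := D.add_smulC t t' z
  zero_smul z := D.zero_smulC z

/-- The complex `Hom_Λ(F, G)`, as a complex of `T`-modules. -/
noncomputable def homCplx (F : CochainComplex (ModuleCat.{u} Λ) ℤ)
    (G : CochainComplex (ModuleCat.{u} Z) ℤ) : CochainComplex (ModuleCat.{u} T) ℤ where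
  X n := ModuleCat.of T (D.Carrier F G n)
  d n m := ModuleCat.ofHom (X := D.Carrier F G n) (Y := D.Carrier F G m)
    { toFun := δ (F := F) n m
      map_add' := δ_add (F := F) (n := n) (m := m)
      map_smul' := fun t z => D.δ_smulC t z m }
  shape n m h := by
    ext z
    exact δ_shape (F := F) (G := D.res G) n m h z
  d_comp_d' n m l _ _ := by
    ext z
    exact δ_δ (F := F) n m l z

variable {F F' F'' : CochainComplex (ModuleCat.{u} Λ) ℤ}
  {G G' G'' : CochainComplex (ModuleCat.{u} Z) ℤ}

/-- Precomposition with a zero cochain. -/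
noncomputable def precompLin (φ : Cochain F' F 0) (G : CochainComplex (ModuleCat.{u} Z) ℤ) (n : ℤ) :
    (D.homCplx F G).X n ⟶ (D.homCplx F' G).X n :=
  ModuleCat.ofHom (X := D.Carrier F G n) (Y := D.Carrier F' G n)
    { toFun := fun z => φ.comp (K := D.res G) z (zero_add n)
      map_add' := fun z z' => Cochain.comp_add (K := D.res G) φ z z' (zero_add n)
      map_smul' := fun t z => D.comp_smulC t z φ (zero_add n) }

lemma precompLin_comp (φ : Cochain F' F 0) (φ' : Cochain F'' F' 0) (n : ℤ) :
    D.precompLin φ G n ≫ D.precompLin φ' G n = D.precompLin (φ'.comp φ (add_zero 0)) G n := by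
  ext z
  exact (Cochain.comp_assoc_of_first_is_zero_cochain (K := F) (L := D.res G) φ' φ z (zero_add n)).symm

lemma precompLin_id (n : ℤ) : D.precompLin (Cochain.ofHom (𝟙 F)) G n = 𝟙 _ := by
  ext z
  exact Cochain.id_comp (G := D.res G) z

/-- Functoriality in the first variable. -/
noncomputable def mapLeft (φ : F' ⟶ F) (G : CochainComplex (ModuleCat.{u} Z) ℤ) :
    D.homCplx F G ⟶ D.homCplx F' G where
  f n := D.precompLin (Cochain.ofHom φ) G n
  comm' n m _ := by
    ext z
    exact δ_ofHom_comp (K := D.res G) φ z m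

@[simp]
lemma mapLeft_id : D.mapLeft (𝟙 F) G = 𝟙 _ := by
  ext1 n
  exact D.precompLin_id n

lemma mapLeft_comp (φ : F' ⟶ F) (φ' : F'' ⟶ F') :
    D.mapLeft (φ' ≫ φ) G = D.mapLeft φ G ≫ D.mapLeft φ' G := by
  ext1 n
  refine Eq.trans ?_ (D.precompLin_comp _ _ n).symm
  rw [← Cochain.ofHom_comp]
  rfl

@[simp]
lemma mapLeft_zero : D.mapLeft (0 : F' ⟶ F) G = 0 := by
  ext n z
  exact (congrArg (fun w => Cochain.comp w (K := D.res G) z (zero_add n)) (Cochain.ofHom_zero _ _)).trans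
    (Cochain.zero_comp (K := D.res G) z (zero_add n))

/-- Functoriality in the second variable. -/
noncomputable def mapRight (F : CochainComplex (ModuleCat.{u} Λ) ℤ) (ψ : G ⟶ G') :
    D.homCplx F G ⟶ D.homCplx F G' where
  f n := ModuleCat.ofHom (X := D.Carrier F G n) (Y := D.Carrier F G' n)
    { toFun := fun z => Cochain.comp (F := F) z (Cochain.ofHom ((onCplx (resMod D.src)).map ψ))
        (add_zero n)
      map_add' := fun z z' => Cochain.add_comp (F := F) z z' _ (add_zero n)
      map_smul' := fun t z => D.smulC_comp t z ψ }
  comm' n m _ := by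
    ext z
    exact δ_comp_ofHom (F := F) z ((onCplx (resMod D.src)).map ψ) m

lemma mapLeft_mapRight (φ : F' ⟶ F) (ψ : G ⟶ G') :
    D.mapLeft φ G ≫ D.mapRight F' ψ = D.mapRight F ψ ≫ D.mapLeft φ G' := by
  ext n z
  exact Cochain.comp_assoc_of_third_is_zero_cochain (F := F') (K := D.res G) (L := D.res G')
    (Cochain.ofHom φ) z _ (zero_add n)

lemma quasiIso_mapLeft (φ : F' ⟶ F) [QuasiIso φ] [(D.res G).IsKInjective] :
    QuasiIso (D.mapLeft φ G) := by
  rw [mod_quasiIso_iff]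
  refine ⟨fun i j l hi hj x y hx hy => ?_, fun i j l hi hj y hy => ?_⟩
  · exact precomp_inj (L := D.res G) φ hj hi x hx y hy.symm
  · exact precomp_surj (L := D.res G) φ hj hi y hy

lemma quasiIso_mapRight (ψ : G ⟶ G') [QuasiIso ((onCplx (resMod D.src)).map ψ)]
    [(D.res G).IsKInjective] [(D.res G').IsKInjective] : QuasiIso (D.mapRight F ψ) := by
  rw [mod_quasiIso_iff]
  refine ⟨fun i j l hi hj x y hx hy => ?_, fun i j l hi hj y hy => ?_⟩
  · exact postcomp_inj (F := F) ((onCplx (resMod D.src)).map ψ) hj hi x hx y hy.symm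
  · exact postcomp_surj (F := F) ((onCplx (resMod D.src)).map ψ) hj hi y hy

/-- The short complex obtained by applying `Hom_Λ(-, G)`. -/
noncomputable def homSC (S : ShortComplex (CochainComplex (ModuleCat.{u} Λ) ℤ))
    (G : CochainComplex (ModuleCat.{u} Z) ℤ) : ShortComplex (CochainComplex (ModuleCat.{u} T) ℤ) :=
  ShortComplex.mk (D.mapLeft S.g G) (D.mapLeft S.f G) (by rw [← mapLeft_comp, S.zero, mapLeft_zero])

/-- Each term of the Hom complex is functorial for cochains of degree zero, hence keeps splittings;
contravariance exchanges section and retraction. -/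
lemma degreewiseSplit_homSC {S : ShortComplex (CochainComplex (ModuleCat.{u} Λ) ℤ)}
    (h : DegreewiseSplit S) : DegreewiseSplit (D.homSC S G) := by
  obtain ⟨r, s, h1, h2, h3⟩ := h.exists_cochains
  refine fun n => ⟨{ r := D.precompLin s G n, s := D.precompLin r G n, f_r := ?_, s_g := ?_, id := ?_ }⟩
  · refine (D.precompLin_comp _ _ n).trans ?_
    rw [h2, precompLin_id]
    rfl
  · refine (D.precompLin_comp _ _ n).trans ?_
    rw [h1, precompLin_id]
    rfl
  · ext z
    have key (z : Cochain S.X₂ (D.res G) n) :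
        (Cochain.ofHom S.g).comp (s.comp z (zero_add n)) (zero_add n) +
        r.comp ((Cochain.ofHom S.f).comp z (zero_add n)) (zero_add n) = z := by
      have := congrArg (fun w => Cochain.comp w z (zero_add n)) h3
      rwa [Cochain.id_comp, Cochain.add_comp, Cochain.comp_assoc_of_first_is_zero_cochain,
        Cochain.comp_assoc_of_first_is_zero_cochain, add_comm] at this
    exact key z

/-- A cochain of degree `i` maps `F^p` to `G^(p+i)`; when `i < n` one of the two is zero for every
`p`. -/
lemma isStrictlyGE_homCplx (a b n : ℤ) [F.IsStrictlyLE a] [G.IsStrictlyGE b] (hn : a + n ≤ b) :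
    (D.homCplx F G).IsStrictlyGE n := by
  rw [isStrictlyGE_iff]
  intro i hi
  refine @ModuleCat.isZero_of_subsingleton _ _ _ ⟨fun z z' => ?_⟩
  refine Cochain.ext (F := F) (G := D.res G) z z' fun p q hpq => ?_
  by_cases hp : a < p
  · exact (F.isZero_of_isStrictlyLE a p hp).eq_of_src _ _
  · exact ((resMod D.src).map_isZero (G.isZero_of_isStrictlyGE b q (by omega))).eq_of_tgt _ _

lemma isStrictlyLE_homCplx (a b n : ℤ) [F.IsStrictlyGE a] [G.IsStrictlyLE b] (hn : b ≤ a + n) :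
    (D.homCplx F G).IsStrictlyLE n := by
  rw [isStrictlyLE_iff]
  intro i hi
  refine @ModuleCat.isZero_of_subsingleton _ _ _ ⟨fun z z' => ?_⟩
  refine Cochain.ext (F := F) (G := D.res G) z z' fun p q hpq => ?_
  by_cases hp : p < a
  · exact (F.isZero_of_isStrictlyGE a p hp).eq_of_src _ _
  · exact ((resMod D.src).map_isZero (G.isZero_of_isStrictlyLE b q (by omega))).eq_of_tgt _ _

/-- For a K-injective target, `F` may be replaced by its truncation, so a bound on its cohomology is
enough. -/
lemma isGE_homCplx (a b n : ℤ) [F.IsLE a] [G.IsStrictlyGE b] [(D.res G).IsKInjective]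
    (hn : a + n ≤ b) : (D.homCplx F G).IsGE n := by
  have : QuasiIso (F.ιTruncLE a) := (F.quasiIso_ιTruncLE_iff a).2 inferInstance
  have := D.quasiIso_mapLeft (F.ιTruncLE a) (G := G)
  have := D.isStrictlyGE_homCplx (F := F.truncLE a) (G := G) a b n hn
  exact isGE_of_quasiIso (D.mapLeft (F.ιTruncLE a) G) n

lemma isLE_homCplx (a b n : ℤ) [F.IsGE a] [G.IsStrictlyLE b] [(D.res G).IsKInjective]
    (hn : b ≤ a + n) : (D.homCplx F G).IsLE n := by
  have : QuasiIso (F.πTruncGE a) := (F.quasiIso_πTruncGE_iff a).2 inferInstance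
  have := D.quasiIso_mapLeft (F.πTruncGE a) (G := G)
  have := D.isStrictlyLE_homCplx (F := F.truncGE a) (G := G) a b n hn
  exact isLE_of_quasiIso (D.mapLeft (F.πTruncGE a) G) n

end ActPair

end HomCplx

/-! ### Four-lemma arguments in a single degree. -/

section EpiMono

variable {C : Type*} [Category* C] [Abelian C]

/-- A morphism of complexes is epi on `Hⁱ` and mono on `Hⁱ⁺¹`. -/
def EpiMono {K L : CochainComplex C ℤ} (f : K ⟶ L) (i : ℤ) : Prop :=
  Epi (HomologicalComplex.homologyMap f i) ∧ Mono (HomologicalComplex.homologyMap f (i + 1))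

/-- Working with one `i` at a time makes the condition suitable for dévissage: it passes along
triangles by the four lemmas, and it holds trivially once both complexes vanish around degree `i`.
-/
lemma quasiIso_of_epiMono {K L : CochainComplex C ℤ} (f : K ⟶ L) (h : ∀ i, EpiMono f i) :
    QuasiIso f := by
  rw [quasiIso_iff]
  intro i
  rw [quasiIsoAt_iff_isIso_homologyMap]
  obtain ⟨j, rfl⟩ : ∃ j, i = j + 1 := ⟨i - 1, by omega⟩
  have := (h (j + 1)).1
  have := (h j).2
  exact isIso_of_mono_of_epi _

lemma epiMono_of_quasiIso {K L : CochainComplex C ℤ} (f : K ⟶ L) [QuasiIso f] (i : ℤ) :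
    EpiMono f i := ⟨inferInstance, inferInstance⟩

lemma epiMono_of_exactAt {K L : CochainComplex C ℤ} (f : K ⟶ L) (i : ℤ) (hL : L.ExactAt i)
    (hK : K.ExactAt (i + 1)) : EpiMono f i :=
  ⟨⟨fun _ _ _ => ((HomologicalComplex.exactAt_iff_isZero_homology _ _).1 hL).eq_of_src _ _⟩,
    ⟨fun _ _ _ => ((HomologicalComplex.exactAt_iff_isZero_homology _ _).1 hK).eq_of_tgt _ _⟩⟩

variable {S₁ S₂ : ShortComplex (CochainComplex C ℤ)} (φ : S₁ ⟶ S₂)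

/-- Four lemmas on the long exact sequences: the outer maps are the isomorphisms induced by `τ₁`, or
the map on `Hⁱ⁺¹` induced by `τ₂`. -/
lemma epiMono_τ₃ (h₁ : S₁.ShortExact) (h₂ : S₂.ShortExact) (i : ℤ) [QuasiIso φ.τ₁]
    (h : EpiMono φ.τ₂ i) : EpiMono φ.τ₃ i := by
  refine ⟨HomologicalComplex.HomologySequence.epi_homologyMap_τ₃ φ h₁ h₂ i h.1
    (fun j _ => inferInstance) (fun j hj => ?_),
    HomologicalComplex.HomologySequence.mono_homologyMap_τ₃ φ h₁ h₂ _ inferInstance h.2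
      (fun j _ => inferInstance)⟩
  obtain rfl : i + 1 = j := hj
  exact h.2

open HomologicalComplex.HomologySequence ComposableArrows in
-- The same with the isomorphisms induced by `τ₃`, in degrees `i - 1` and `i`.
lemma epiMono_τ₁ (h₁ : S₁.ShortExact) (h₂ : S₂.ShortExact) (i : ℤ) [QuasiIso φ.τ₃]
    (h : EpiMono φ.τ₂ i) : EpiMono φ.τ₁ i := by
  constructor
  · have hij : (ComplexShape.up ℤ).Rel (i - 1) i := by simp
    apply Abelian.epi_of_epi_of_epi_of_mono
      ((δ₀Functor ⋙ δ₀Functor).map (mapComposableArrows₅ φ h₁ h₂ (i - 1) i hij))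
    · exact (composableArrows₅_exact h₁ (i - 1) i hij).δ₀.δ₀
    · exact (composableArrows₅_exact h₂ (i - 1) i hij).δ₀.δ₀
    · exact (inferInstance : Epi (HomologicalComplex.homologyMap φ.τ₃ (i - 1)))
    · exact h.1
    · exact (inferInstance : Mono (HomologicalComplex.homologyMap φ.τ₃ i))
  · have hij : (ComplexShape.up ℤ).Rel i (i + 1) := by simp
    apply Abelian.mono_of_epi_of_mono_of_mono
      ((δ₀Functor ⋙ δlastFunctor).map (mapComposableArrows₅ φ h₁ h₂ i (i + 1) hij))
    · exact (composableArrows₅_exact h₁ i (i + 1) hij).δ₀.δlast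
    · exact (composableArrows₅_exact h₂ i (i + 1) hij).δ₀.δlast
    · exact h.1
    · exact (inferInstance : Mono (HomologicalComplex.homologyMap φ.τ₃ i))
    · exact h.2

lemma quasiIso_τ₁ (h₁ : S₁.ShortExact) (h₂ : S₂.ShortExact) [QuasiIso φ.τ₂] [QuasiIso φ.τ₃] :
    QuasiIso φ.τ₁ :=
  quasiIso_of_epiMono _ fun i => epiMono_τ₁ φ h₁ h₂ i (epiMono_of_quasiIso _ i)

end EpiMono

/-! ### Dévissage for complexes with noetherian cohomology. -/

section Devissage

open HomologicalComplex

variable {Λ : Type u} [Ring Λ]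

/-- All cohomology modules are noetherian. -/
def NoethHomology (K : CochainComplex (ModuleCat.{u} Λ) ℤ) : Prop :=
  ∀ i, IsNoetherian Λ (K.homology i)

lemma isNoetherian_of_isZero {M : ModuleCat.{u} Λ} (h : IsZero M) : IsNoetherian Λ M := by
  have := ModuleCat.subsingleton_of_isZero h
  infer_instance

lemma isNoetherian_of_exact {S : ShortComplex (ModuleCat.{u} Λ)} (h : S.Exact)
    (h₁ : IsNoetherian Λ S.X₁) (h₃ : IsNoetherian Λ S.X₃) : IsNoetherian Λ S.X₂ :=
  isNoetherian_of_range_eq_ker S.f.hom S.g.hom ((ShortComplex.moduleCat_exact_iff_range_eq_ker S).1 h)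

lemma isNoetherian_of_moduleIso {M N : ModuleCat.{u} Λ} (e : M ≅ N) (h : IsNoetherian Λ M) :
    IsNoetherian Λ N :=
  isNoetherian_of_linearEquiv e.toLinearEquiv

lemma isNoetherian_of_exact_X₂ {S : ShortComplex (CochainComplex (ModuleCat.{u} Λ) ℤ)}
    (hS : S.ShortExact) (i : ℤ) (h₁ : IsNoetherian Λ (S.X₁.homology i))
    (h₃ : IsNoetherian Λ (S.X₃.homology i)) : IsNoetherian Λ (S.X₂.homology i) :=
  isNoetherian_of_exact (hS.homology_exact₂ i) h₁ h₃

lemma isNoetherian_of_exact_X₁ {S : ShortComplex (CochainComplex (ModuleCat.{u} Λ) ℤ)}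
    (hS : S.ShortExact) (i : ℤ) (h₃ : IsNoetherian Λ (S.X₃.homology (i - 1)))
    (h₂ : IsNoetherian Λ (S.X₂.homology i)) : IsNoetherian Λ (S.X₁.homology i) :=
  isNoetherian_of_exact (hS.homology_exact₁ (i - 1) i (by simp)) h₃ h₂

lemma isNoetherian_of_exact_X₃ {S : ShortComplex (CochainComplex (ModuleCat.{u} Λ) ℤ)}
    (hS : S.ShortExact) (i : ℤ) (h₂ : IsNoetherian Λ (S.X₂.homology i))
    (h₁ : IsNoetherian Λ (S.X₁.homology (i + 1))) : IsNoetherian Λ (S.X₃.homology i) :=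
  isNoetherian_of_exact (hS.homology_exact₃ i (i + 1) (by simp)) h₂ h₁

/-- The complex `Λ` in degree `n`. -/
noncomputable abbrev singleRing (Λ : Type u) [Ring Λ] (n : ℤ) : CochainComplex (ModuleCat.{u} Λ) ℤ :=
  (single (ModuleCat.{u} Λ) (ComplexShape.up ℤ) n).obj (ModuleCat.of Λ Λ)

noncomputable def singleRingShiftIso (n m : ℤ) (h : 1 + m = n) :
    (singleRing Λ n)⟦(1 : ℤ)⟧ ≅ singleRing Λ m :=
  ((CochainComplex.singleFunctors (ModuleCat.{u} Λ)).shiftIso 1 m n h).app (ModuleCat.of Λ Λ)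

lemma noethHomology_singleRing [IsNoetherianRing Λ] (n : ℤ) : NoethHomology (singleRing Λ n) := by
  intro i
  by_cases h : i = n
  · subst h
    exact isNoetherian_of_moduleIso (singleObjHomologySelfIso (ComplexShape.up ℤ) i (ModuleCat.of Λ Λ)).symm
      (inferInstanceAs (IsNoetherian Λ Λ))
  · exact isNoetherian_of_isZero (isZero_single_obj_homology _ _ _ _ h)

lemma isZero_homology_shift_singleRing (n i : ℤ) (h : 1 + i ≠ n) :
    IsZero (((singleRing Λ n)⟦(1 : ℤ)⟧).homology i) :=
  (isZero_single_obj_homology (ComplexShape.up ℤ) (n - 1) (ModuleCat.of Λ Λ) i (by omega)).of_iso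
    ((homologyFunctor _ _ i).mapIso (singleRingShiftIso (Λ := Λ) n (n - 1) (by omega)))

/-- Every cohomology class is killed by a map to the cone of a morphism from a free module. -/
lemma exists_cone_kills (K : CochainComplex (ModuleCat.{u} Λ) ℤ) (n : ℤ) (x : K.homology n) :
    ∃ φ : singleRing Λ n ⟶ K, homologyMap (mappingCone.inr φ) n x = 0 := by
  obtain ⟨c, rfl⟩ := (ModuleCat.epi_iff_surjective (K.homologyπ n)).1 inferInstance x
  -- The generator is sent to a cycle representing `x`.
  let g : ModuleCat.of Λ Λ ⟶ K.X n := ModuleCat.ofHom (LinearMap.toSpanSingleton Λ _ (K.iCycles n c))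
  let φ : singleRing Λ n ⟶ K := mkHomFromSingle g (fun j _ => by
    ext
    change K.d n j ((1 : Λ) • K.iCycles n c) = 0
    rw [one_smul]
    exact ConcreteCategory.congr_hom (K.iCycles_d n j) c)
  refine ⟨φ, ?_⟩
  -- The generator, placed in the cone one degree lower; its boundary is the image of the cycle.
  let w : (mappingCone φ).X (n - 1) := (mappingCone.inl φ).v n (n - 1) (by omega)
    ((singleObjXSelf (ComplexShape.up ℤ) n (ModuleCat.of Λ Λ)).inv (1 : Λ))
  have hw : (mappingCone φ).d (n - 1) n w = (mappingCone.inr φ).f n (K.iCycles n c) := by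
    have h1 := mappingCone.inl_v_d φ n (n - 1) (n + 1) (by omega) (by omega)
    rw [single_obj_d, zero_comp, sub_zero] at h1
    have h2 := ConcreteCategory.congr_hom h1
      ((singleObjXSelf (ComplexShape.up ℤ) n (ModuleCat.of Λ Λ)).inv (1 : Λ))
    refine h2.trans ?_
    change (mappingCone.inr φ).f n (φ.f n _) = _
    congr 1
    rw [mkHomFromSingle_f]
    change g ((singleObjXSelf (ComplexShape.up ℤ) n (ModuleCat.of Λ Λ)).hom _) = _
    have h3 := ConcreteCategory.congr_hom (singleObjXSelf (ComplexShape.up ℤ) n (ModuleCat.of Λ Λ)).inv_hom_id (1 : Λ)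
    refine (congrArg g h3).trans ?_
    exact one_smul Λ (K.iCycles n c)
  have hc : cyclesMap (mappingCone.inr φ) n c = (mappingCone φ).toCycles (n - 1) n w := by
    apply (ModuleCat.mono_iff_injective ((mappingCone φ).iCycles n)).1 inferInstance
    have h1 := ConcreteCategory.congr_hom (cyclesMap_i (mappingCone.inr φ) n) c
    have h2 := ConcreteCategory.congr_hom ((mappingCone φ).toCycles_i (n - 1) n) w
    exact h1.trans (hw.symm.trans h2.symm)
  have h1 := ConcreteCategory.congr_hom (homologyπ_naturality (mappingCone.inr φ) n) c
  have h2 := ConcreteCategory.congr_hom ((mappingCone φ).toCycles_comp_homologyπ (n - 1) n) w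
  refine h1.trans (Eq.trans ?_ h2)
  exact congrArg ((mappingCone φ).homologyπ n) hc

/-- Dévissage: a property of complexes with noetherian cohomology, bounded above, holds if it holds
far to the left and descends along cones of morphisms from free modules of rank one. -/
theorem devissage [IsNoetherianRing Λ] (Q : CochainComplex (ModuleCat.{u} Λ) ℤ → Prop)
    (hstep : ∀ S : ShortComplex (CochainComplex (ModuleCat.{u} Λ) ℤ), DegreewiseSplit S →
      ∀ n, Nonempty (S.X₃ ≅ singleRing Λ n) → Q S.X₂ → Q S.X₁)
    (N : ℤ) (hN : ∀ K, K.IsLE N → Q K) (K : CochainComplex (ModuleCat.{u} Λ) ℤ) (m : ℤ)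
    (hm : K.IsLE m) (hK : NoethHomology K) : Q K := by
  -- Outer induction on the distance `r` between the cohomological bound and `N`.
  have main : ∀ (r : ℕ) (K : CochainComplex (ModuleCat.{u} Λ) ℤ), K.IsLE (N + r) →
      NoethHomology K → Q K := by
    intro r
    induction r with
    | zero => exact fun K hK _ => hN K (by simpa using hK)
    | succ r ih =>
      -- Inner induction on the number of generators of the top cohomology module; with none left,
      -- the bound drops by one.
      have inner : ∀ (n : ℤ) (hn : n = N + (r + 1 : ℕ)) (g : ℕ)
          (K : CochainComplex (ModuleCat.{u} Λ) ℤ), K.IsLE n →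
          NoethHomology K → ∀ v : Fin g → K.homology n,
          Submodule.span Λ (Set.range v) = ⊤ → Q K := by
        intro n hn g
        induction g with
        | zero =>
          intro K hK hK' v hv
          refine ih K ?_ hK'
          rw [isLE_iff]
          intro i hi
          by_cases h : n < i
          · exact K.exactAt_of_isLE _ i h
          · obtain rfl : i = n := by push_cast at hn; omega
            rw [exactAt_iff_isZero_homology]
            refine @ModuleCat.isZero_of_subsingleton _ _ _ ?_
            rw [Set.range_eq_empty, Submodule.span_empty] at hv
            exact (Submodule.subsingleton_iff Λ).1 (subsingleton_of_bot_eq_top hv)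
        | succ g ihg =>
          intro K hK hK' v hv
          obtain ⟨φ, hφ⟩ := exists_cone_kills K n (v 0)
          have hS := degreewiseSplit_mappingCone φ
          have hSE := hS.shortExact
          -- The sequence is `K → cone φ → Λ[1]`, with the shifted ring in degree `n - 1`; the
          -- property descends from the cone to `K`.
          refine hstep _ hS (n - 1) ⟨singleRingShiftIso n (n - 1) (by omega)⟩
            (ihg (mappingCone φ) ?_ ?_ (fun j => homologyMap (mappingCone.inr φ) n (v j.succ)) ?_)
          · rw [isLE_iff]
            intro i hi
            refine hSE.exactAt_X₂ i (K.exactAt_of_isLE _ i hi) ?_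
            rw [exactAt_iff_isZero_homology]
            exact isZero_homology_shift_singleRing n i (by omega)
          · intro i
            refine isNoetherian_of_exact_X₂ hSE i (hK' i) ?_
            exact isNoetherian_of_moduleIso ((homologyFunctor _ _ i).mapIso
              (singleRingShiftIso n (n - 1) (by omega)).symm) (noethHomology_singleRing _ i)
          -- The shifted ring has no cohomology in degree `n`, so the generators of `Hⁿ(K)` map to
          -- generators of `Hⁿ` of the cone, and the first of them maps to zero.
          · have hsurj : Function.Surjective (homologyMap (mappingCone.inr φ) n) := by
              rw [← ModuleCat.epi_iff_surjective]
              refine (hSE.homology_exact₂ n).epi_f ?_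
              exact (isZero_homology_shift_singleRing n n (by omega)).eq_of_tgt _ _
            have h1 := congrArg (Submodule.map (homologyMap (mappingCone.inr φ) n).hom) hv
            rw [Submodule.map_span, Submodule.map_top, LinearMap.range_eq_top.2 hsurj,
              ← Set.range_comp] at h1
            rw [← h1]
            apply le_antisymm
            · refine Submodule.span_mono ?_
              rintro _ ⟨j, rfl⟩
              exact ⟨j.succ, rfl⟩
            · rw [Submodule.span_le]
              rintro _ ⟨j, rfl⟩
              refine Fin.cases ?_ (fun j => ?_) j
              · change homologyMap (mappingCone.inr φ) n (v 0) ∈ _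
                rw [hφ]
                exact Submodule.zero_mem _
              · exact Submodule.subset_span ⟨j, rfl⟩
      intro K hK hK'
      have := hK' (N + (r + 1 : ℕ))
      obtain ⟨g, v, hv⟩ := Submodule.fg_iff_exists_fin_generating_family.1
        (Module.Finite.fg_top (R := Λ) (M := K.homology (N + (r + 1 : ℕ))))
      exact inner _ rfl g K hK hK' v hv
  refine main (m - N).toNat K ?_ hK
  rw [isLE_iff]
  intro i hi
  exact K.exactAt_of_isLE m i (by omega)

end Devissage

/-! ### Shifting a module between degrees. -/

section SingleInduction

variable {C : Type*} [Category* C] [Abelian C]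

/-- The cone of the identity is acyclic. -/
lemma acyclic_cone_id (K : CochainComplex C ℤ) : (mappingCone (𝟙 K)).Acyclic :=
  acyclic_mappingCone (𝟙 K)

/-- A property of complexes which is invariant under isomorphisms and shifts through cones of
identities holds for a module placed in any degree if it holds for it placed in degree zero. -/
lemma single_induction (Q : CochainComplex C ℤ → Prop) (hiso : ∀ K L, (K ≅ L) → Q K → Q L)
    (hS : ∀ S : ShortComplex (CochainComplex C ℤ), DegreewiseSplit S →
      S.X₂.Acyclic → (Q S.X₁ ↔ Q S.X₃)) (X : C)
    (h0 : Q ((HomologicalComplex.single C (ComplexShape.up ℤ) 0).obj X)) (n : ℤ) :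
    Q ((HomologicalComplex.single C (ComplexShape.up ℤ) n).obj X) := by
  have key (n : ℤ) : Q ((HomologicalComplex.single C (ComplexShape.up ℤ) (n + 1)).obj X) ↔
      Q ((HomologicalComplex.single C (ComplexShape.up ℤ) n).obj X) := by
    let K := (HomologicalComplex.single C (ComplexShape.up ℤ) (n + 1)).obj X
    let e : K⟦(1 : ℤ)⟧ ≅ (HomologicalComplex.single C (ComplexShape.up ℤ) n).obj X :=
      ((CochainComplex.singleFunctors C).shiftIso 1 n (n + 1) (by omega)).app X
    -- The cone of the identity is an acyclic middle term between `K` and `K[1]`.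
    exact (hS _ (degreewiseSplit_mappingCone (𝟙 K)) (acyclic_cone_id K)).trans ⟨hiso _ _ e, hiso _ _ e.symm⟩
  induction n using Int.induction_on with
  | zero => exact h0
  | succ n ih => exact (key n).2 ih
  | pred n ih => exact (key (-n - 1)).1 (by simpa using ih)

end SingleInduction

/-! ### Finiteness of Hom complexes and biduality. -/

section HomCplx

variable {k : Type u} [Field k] {Λ T Z : Type u} [Ring Λ] [Ring T] [Ring Z] [Algebra k Λ]
  [Algebra k T] [Algebra k Z] (D : ActPair k Λ T Z)

namespace ActPair

lemma acyclic_homCplx (F : CochainComplex (ModuleCat.{u} Λ) ℤ)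
    (G : CochainComplex (ModuleCat.{u} Z) ℤ) [(D.res G).IsKInjective] (hF : F.Acyclic) :
    (D.homCplx F G).Acyclic := by
  intro i
  rw [mod_exactAt_iff _ (i - 1) i (i + 1) (by omega) rfl]
  intro (z : Cochain F (D.res G) i) hz
  exact IsKInjective.eq_δ_of_cocycle (Cocycle.mk z (i + 1) rfl hz) hF (i - 1) (by omega)

/-- The isomorphism of `Hom_Λ(F, G)` and `Hom_Λ(F', G)` induced by an isomorphism. -/
noncomputable def mapLeftIso {F F' : CochainComplex (ModuleCat.{u} Λ) ℤ} (e : F ≅ F')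
    (G : CochainComplex (ModuleCat.{u} Z) ℤ) : D.homCplx F G ≅ D.homCplx F' G where
  hom := D.mapLeft e.inv G
  inv := D.mapLeft e.hom G
  hom_inv_id := by rw [← mapLeft_comp, e.hom_inv_id, mapLeft_id]
  inv_hom_id := by rw [← mapLeft_comp, e.inv_hom_id, mapLeft_id]

/-- The generator of `Λ`, placed in degree `0`. -/
noncomputable def genOne (Λ : Type u) [Ring Λ] : (singleRing Λ 0).X 0 :=
  (HomologicalComplex.singleObjXSelf (ComplexShape.up ℤ) 0 (ModuleCat.of Λ Λ)).inv (1 : Λ)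

lemma genOne_span (x : (singleRing Λ 0).X 0) : ∃ a : Λ, x = a • genOne Λ := by
  let e := HomologicalComplex.singleObjXSelf (ComplexShape.up ℤ) 0 (ModuleCat.of Λ Λ)
  refine ⟨e.hom x, ?_⟩
  have h1 : e.inv (e.hom x) = x := ConcreteCategory.congr_hom e.hom_inv_id x
  have h2 : e.inv ((e.hom x : Λ) • (1 : Λ)) = (e.hom x : Λ) • e.inv (1 : Λ) :=
    map_smul e.inv.hom (e.hom x : Λ) (1 : Λ)
  rw [smul_eq_mul, mul_one] at h2
  exact h1.symm.trans h2

lemma singleRing_hom_ext {F : CochainComplex (ModuleCat.{u} Λ) ℤ} {f g : singleRing Λ 0 ⟶ F}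
    (h : f.f 0 (genOne Λ) = g.f 0 (genOne Λ)) : f = g := by
  apply HomologicalComplex.from_single_hom_ext
  refine ModuleCat.hom_ext (LinearMap.ext fun (x : (singleRing Λ 0).X 0) => ?_)
  obtain ⟨a, rfl⟩ := genOne_span x
  have h1 := map_smul (f.f 0).hom a (genOne Λ)
  have h2 := map_smul (g.f 0).hom a (genOne Λ)
  exact h1.trans ((congrArg (a • ·) h).trans h2.symm)

/-- The morphism from `Λ` in degree `0` determined by a cycle. -/
noncomputable def fromGen {F : CochainComplex (ModuleCat.{u} Λ) ℤ} (x : F.X 0) (hx : F.d 0 1 x = 0) :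
    singleRing Λ 0 ⟶ F :=
  HomologicalComplex.mkHomFromSingle (ModuleCat.ofHom (LinearMap.toSpanSingleton Λ _ x)) (by
    intro j hj
    obtain rfl : 0 + 1 = j := hj
    ext
    change F.d 0 1 ((1 : Λ) • x) = 0
    rw [one_smul, hx])

lemma fromGen_genOne {F : CochainComplex (ModuleCat.{u} Λ) ℤ} (x : F.X 0) (hx : F.d 0 1 x = 0) :
    (fromGen x hx).f 0 (genOne Λ) = x := by
  rw [fromGen, HomologicalComplex.mkHomFromSingle_f]
  have h := ConcreteCategory.congr_hom
    (HomologicalComplex.singleObjXSelf (ComplexShape.up ℤ) 0 (ModuleCat.of Λ Λ)).inv_hom_id (1 : Λ)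
  refine (congrArg (LinearMap.toSpanSingleton Λ (F.X 0) x) h).trans ?_
  exact one_smul Λ x

/-- Cochains from `Λ` in degree `0` are determined by their value at the generator. -/
lemma genOne_cochain_ext {F : CochainComplex (ModuleCat.{u} Λ) ℤ} {n : ℤ}
    {z z' : Cochain (singleRing Λ 0) F n}
    (h : z.v 0 n (zero_add n) (genOne Λ) = z'.v 0 n (zero_add n) (genOne Λ)) : z = z' := by
  ext p q hpq x
  by_cases hp : p = 0
  · subst hp
    obtain rfl : n = q := by omega
    obtain ⟨a, rfl⟩ := genOne_span x
    have h1 := map_smul (z.v 0 n hpq).hom a (genOne Λ)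
    have h2 := map_smul (z'.v 0 n hpq).hom a (genOne Λ)
    exact h1.trans ((congrArg (a • ·) h).trans h2.symm)
  · have := (HomologicalComplex.isZero_single_obj_X (ComplexShape.up ℤ) 0 (ModuleCat.of Λ Λ) p hp).eq_of_src
      (z.v p q hpq) (z'.v p q hpq)
    rw [this]

lemma exists_genOne_cochain {F : CochainComplex (ModuleCat.{u} Λ) ℤ} {n : ℤ} (x : F.X n) :
    ∃ z : Cochain (singleRing Λ 0) F n, z.v 0 n (zero_add n) (genOne Λ) = x := by
  refine ⟨Cochain.single ((HomologicalComplex.singleObjXSelf (.up ℤ) 0 (ModuleCat.of Λ Λ)).hom ≫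
    ModuleCat.ofHom (LinearMap.toSpanSingleton Λ _ x)) n, ?_⟩
  rw [Cochain.single_v]
  have h := ConcreteCategory.congr_hom
    (HomologicalComplex.singleObjXSelf (ComplexShape.up ℤ) 0 (ModuleCat.of Λ Λ)).inv_hom_id (1 : Λ)
  refine (congrArg (LinearMap.toSpanSingleton Λ (F.X n) x) h).trans ?_
  exact one_smul Λ x

lemma δ_genOne {F : CochainComplex (ModuleCat.{u} Λ) ℤ} {n m : ℤ} (hm : n + 1 = m)
    (z : Cochain (singleRing Λ 0) F n) : (δ n m z).v 0 m (zero_add m) (genOne Λ) =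
      F.d n m (z.v 0 n (zero_add n) (genOne Λ)) := by
  rw [δ_v n m hm z 0 m (zero_add m) n 1 (by omega) (by omega), HomologicalComplex.single_obj_d,
    zero_comp, smul_zero, add_zero]
  rfl

/-- The pair with the two actions exchanged. -/
def swap : ActPair k T Λ Z where
  src := D.tgt
  tgt := D.src
  comm t s := (D.comm s t).symm

/-- Evaluation at the generator: `Hom_Λ(Λ, G) → G`. -/
noncomputable def evalOne (G : CochainComplex (ModuleCat.{u} Z) ℤ) :
    D.homCplx (singleRing Λ 0) G ⟶ D.swap.res G where
  f n := ModuleCat.ofHom (X := D.Carrier (singleRing Λ 0) G n)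
    (Y := (D.swap.res G).X n)
    { toFun z := Cochain.v (F := singleRing Λ 0) (G := D.res G) z 0 n (zero_add n) (genOne Λ)
      map_add' z z' := rfl
      map_smul' t z := D.smulC_v (F := singleRing Λ 0) t z 0 n (zero_add n) (genOne Λ) }
  comm' n m h := by
    obtain rfl : n + 1 = m := h
    ext z
    exact (δ_genOne (F := D.res G) rfl z).symm

/-- Cochains out of the ring in degree zero are the same as elements of the target: this starts
every dévissage below. -/
instance isIso_evalOne (G : CochainComplex (ModuleCat.{u} Z) ℤ) : IsIso (D.evalOne G) := by
  have (n : ℤ) : IsIso ((D.evalOne G).f n) := by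
    rw [ConcreteCategory.isIso_iff_bijective]
    constructor
    · intro (z : Cochain (singleRing Λ 0) (D.res G) n) (z' : Cochain (singleRing Λ 0) (D.res G) n) h
      exact genOne_cochain_ext (F := D.res G) h
    · intro x
      exact exists_genOne_cochain (F := D.res G) x
  exact HomologicalComplex.Hom.isIso_of_components _

/-- `Hom_Λ(F, G)` has noetherian cohomology if `F` is bounded above with noetherian cohomology. -/
lemma noethHomology_homCplx [IsNoetherianRing Λ] (F : CochainComplex (ModuleCat.{u} Λ) ℤ)
    (G : CochainComplex (ModuleCat.{u} Z) ℤ) (m b : ℤ) [F.IsLE m] (hF : NoethHomology F)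
    [G.IsStrictlyGE b] [(D.res G).IsKInjective]
    (hG : NoethHomology (D.swap.res G)) : NoethHomology (D.homCplx F G) := by
  intro i
  have base (n : ℤ) : NoethHomology (D.homCplx (singleRing Λ n) G) := by
    refine single_induction (fun K => NoethHomology (D.homCplx K G)) ?_ ?_ _ ?_ n
    · intro K L e h j
      exact isNoetherian_of_moduleIso ((HomologicalComplex.homologyFunctor _ _ j).mapIso
        (D.mapLeftIso e G)) (h j)
    · intro S hS hc
      have hc' := D.acyclic_homCplx S.X₂ G hc
      have hSE := (D.degreewiseSplit_homSC (G := G) hS).shortExact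
      have hz (j : ℤ) : IsNoetherian T ((D.homCplx S.X₂ G).homology j) :=
        isNoetherian_of_isZero ((HomologicalComplex.exactAt_iff_isZero_homology _ _).1 (hc' j))
      refine ⟨fun h j => isNoetherian_of_exact_X₁ hSE j (h _) (hz j),
        fun h j => isNoetherian_of_exact_X₃ hSE j (hz j) (h _)⟩
    · intro j
      exact isNoetherian_of_moduleIso ((HomologicalComplex.homologyFunctor _ _ j).mapIso
        (asIso (D.evalOne G)).symm) (hG j)
  -- For a fixed degree `i`: once `K` lives in degrees at most `b - i - 1`, the complex `Hom(K, G)`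
  -- lives in degrees at least `i + 1`.
  refine devissage (fun K => IsNoetherian T ((D.homCplx K G).homology i)) ?_ (b - i - 1) ?_ F m
    inferInstance hF
  · rintro S hS n ⟨e⟩ h
    refine isNoetherian_of_exact_X₃ (D.degreewiseSplit_homSC (G := G) hS).shortExact i h ?_
    exact isNoetherian_of_moduleIso ((HomologicalComplex.homologyFunctor _ _ (i + 1)).mapIso
        (D.mapLeftIso e.symm G)) (base n (i + 1))
  · intro K hK
    have := D.isGE_homCplx (F := K) (G := G) (b - i - 1) b (i + 1) (by omega)
    exact isNoetherian_of_isZero ((HomologicalComplex.exactAt_iff_isZero_homology _ _).1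
      ((D.homCplx K G).exactAt_of_isGE (i + 1) i (by omega)))

section Biduality

variable {K K' : CochainComplex (ModuleCat.{u} Λ) ℤ} {J : CochainComplex (ModuleCat.{u} Z) ℤ}

/-- Evaluation of cochains at an element. -/
noncomputable def evalLin {i p q : ℤ} (h : i + p = q) (x : K.X i) :
    (D.homCplx K J).X p ⟶ (D.swap.res J).X q :=
  ModuleCat.ofHom (X := D.Carrier K J p) (Y := (D.swap.res J).X q)
    { toFun z := Cochain.v (F := K) (G := D.res J) z i q h x
      map_add' z z' := rfl
      map_smul' t z := D.smulC_v (F := K) t z i q h x }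

/-- The cochain `h ↦ ± h(x)`. -/
noncomputable def bidualCochain (J : CochainComplex (ModuleCat.{u} Z) ℤ) {i : ℤ} (x : K.X i) :
    Cochain (D.homCplx K J) (D.swap.res J) i :=
  Cochain.mk fun p _ hpq => (p * i).negOnePow • D.evalLin (by omega) x

lemma bidualCochain_add {i : ℤ} (x y : K.X i) :
    D.bidualCochain J (x + y) = D.bidualCochain J x + D.bidualCochain J y := by
  refine cochain_hom_ext fun p q hpq (z : Cochain K (D.res J) p) => ?_
  have h : ((p * i).negOnePow • z.v i q (by omega) (x + y) : (D.res J).X q) =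
      (p * i).negOnePow • z.v i q (by omega) x + (p * i).negOnePow • z.v i q (by omega) y := by
    rw [map_add, smul_add]
  exact h

lemma bidualCochain_smul {i : ℤ} (a : Λ) (x : K.X i) :
    D.bidualCochain J (a • x) = D.swap.smulC a (D.bidualCochain J x) := by
  refine cochain_hom_ext fun p q hpq (z : Cochain K (D.res J) p) => ?_
  refine Eq.trans ?_ (D.swap.smulC_v (F := D.homCplx K J) a (D.bidualCochain J x) p q hpq z).symm
  have h : ((p * i).negOnePow • z.v i q (by omega) (a • x) : (D.res J).X q) =
      a • ((p * i).negOnePow • z.v i q (by omega) x : (D.res J).X q) := by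
    rw [Units.smul_def, Units.smul_def, smul_comm a, map_smul]
  exact h

/-- The sign `(-1)^(p i)` in evaluation at `x` is the Koszul sign for exchanging a cochain of degree
`p` with an element of degree `i`. It makes the two terms containing `d (z x)` cancel and leaves
evaluation at `d x`. -/
lemma δ_bidualCochain {i j : ℤ} (hij : i + 1 = j) (x : K.X i) :
    δ i j (D.bidualCochain J x) = D.bidualCochain J (K.d i j x) := by
  refine cochain_hom_ext fun p q hpq (z : Cochain K (D.res J) p) => ?_
  rw [δ_v i j hij _ p q hpq (p + i) (p + 1) (by omega) (by omega)]
  have h1 : (δ p (p + 1) z).v i q (by omega) x =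
      (D.res J).d (p + i) q (z.v i (p + i) (by omega) x) +
        (p + 1).negOnePow • z.v j q (by omega) (K.d i j x) := by
    rw [δ_v p (p + 1) rfl z i q (by omega) (p + i) j (by omega) (by omega)]
    rfl
  have h2 : (D.res J).d (p + i) q ((p * i).negOnePow • z.v i (p + i) (by omega) x : (D.res J).X (p + i)) +
      j.negOnePow • (((p + 1) * i).negOnePow • (δ p (p + 1) z).v i q (by omega) x : (D.res J).X q) =
      ((p * j).negOnePow • z.v j q (by omega) (K.d i j x) : (D.res J).X q) := by
    rw [h1]
    -- Parities of exponents, with `j = i + 1`: the first identity gives the cancellation, the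
    -- second the sign of the remaining term.
    have e1 : j.negOnePow * ((p + 1) * i).negOnePow = -(p * i).negOnePow := by
      rw [← Int.negOnePow_add, ← Int.negOnePow_succ, Int.negOnePow_eq_iff]
      refine ⟨i, ?_⟩
      subst hij
      ring
    have e2 : -(p * i).negOnePow * (p + 1).negOnePow = (p * j).negOnePow := by
      rw [← Int.negOnePow_succ, ← Int.negOnePow_add, Int.negOnePow_eq_iff]
      refine ⟨1, ?_⟩
      subst hij
      ring
    rw [smul_smul, e1, smul_add, smul_smul, e2, Units.smul_def (p * i).negOnePow, Units.smul_def,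
      map_zsmul]
    rw [← add_assoc, Units.val_neg, neg_smul]
    refine (congrArg (· + _) ?_).trans (zero_add _)
    exact add_neg_cancel _
  exact h2

/-- The biduality morphism `K → Hom_T(Hom_Λ(K, J), J)`. -/
noncomputable def bidual (K : CochainComplex (ModuleCat.{u} Λ) ℤ)
    (J : CochainComplex (ModuleCat.{u} Z) ℤ) : K ⟶ D.swap.homCplx (D.homCplx K J) J where
  f i := ModuleCat.ofHom (Y := D.swap.Carrier (D.homCplx K J) J i)
    { toFun x := D.bidualCochain J x
      map_add' := D.bidualCochain_add
      map_smul' := D.bidualCochain_smul }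
  comm' i j hij := by
    ext x
    exact D.δ_bidualCochain hij x

lemma bidual_naturality (f : K ⟶ K') :
    f ≫ D.bidual K' J = D.bidual K J ≫ D.swap.mapLeft (D.mapLeft f J) J := by
  ext i x
  refine cochain_hom_ext fun p q hpq (z : Cochain K' (D.res J) p) => ?_
  have h : ((p * i).negOnePow • z.v i q (by omega) (f.f i x) : (D.res J).X q) =
      (p * i).negOnePow • ((Cochain.ofHom f).comp z (zero_add p)).v i q (by omega) x := by
    rw [Cochain.zero_cochain_comp_v, Cochain.ofHom_v]
    rfl
  refine h.trans ?_
  change _ = ((Cochain.ofHom (D.mapLeft f J)).comp (D.bidualCochain J x) (zero_add i)).v p q hpq z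
  exact (congrArg (fun w => w z) (Cochain.zero_cochain_comp_v (Cochain.ofHom (D.mapLeft f J))
    (D.bidualCochain J x) p q hpq)).symm

/-- The morphism `T → Hom_Λ(J, J)` given by multiplications. -/
noncomputable def canon (J : CochainComplex (ModuleCat.{u} Z) ℤ) :
    singleRing T 0 ⟶ D.homCplx (D.res J) J :=
  fromGen (F := D.homCplx (D.res J) J) (Cochain.ofHom (𝟙 (D.res J))) (δ_ofHom (𝟙 (D.res J)))

/-- Biduality for the ring itself is given by multiplications. -/
lemma bidual_singleRing : D.bidual (singleRing Λ 0) J =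
    D.swap.canon J ≫ D.swap.mapLeft (D.evalOne J) J := by
  refine singleRing_hom_ext ?_
  refine Eq.trans ?_ (congrArg ((D.swap.mapLeft (D.evalOne J) J).f 0)
    (fromGen_genOne (F := D.swap.homCplx (D.swap.res J) J) _ (δ_ofHom (𝟙 (D.swap.res J))))).symm
  refine cochain_hom_ext fun p q hpq (z : Cochain (singleRing Λ 0) (D.res J) p) => ?_
  obtain rfl : p = q := by omega
  have h1 : ((p * 0).negOnePow • z.v 0 p (by omega) (genOne Λ) : (D.res J).X p) =
    z.v 0 p (by omega) (genOne Λ) := by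
      rw [mul_zero, Int.negOnePow_zero, one_smul]
  refine Eq.trans h1 ?_
  change _ = ((Cochain.ofHom (D.evalOne J)).comp (Cochain.ofHom (𝟙 (D.swap.res J))) (zero_add 0)).v p p
    hpq z
  rw [Cochain.comp_id, Cochain.ofHom_v]
  rfl

/-- Biduality. -/
theorem quasiIso_bidual [IsNoetherianRing Λ] (K : CochainComplex (ModuleCat.{u} Λ) ℤ)
    (J : CochainComplex (ModuleCat.{u} Z) ℤ) (m a b : ℤ) [K.IsLE m] (hK : NoethHomology K)
    [J.IsStrictlyGE a] [J.IsStrictlyLE b] [(D.res J).IsKInjective] [(D.swap.res J).IsKInjective]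
    (hJ : QuasiIso (D.swap.canon J)) : QuasiIso (D.bidual K J) := by
  -- Biduality is a natural transformation from the identity to an exact double dual, so it induces
  -- a map of short exact sequences.
  let bisc (S : ShortComplex (CochainComplex (ModuleCat.{u} Λ) ℤ)) := D.swap.homSC (D.homSC S J) J
  have hbisc {S : ShortComplex (CochainComplex (ModuleCat.{u} Λ) ℤ)} (hS : DegreewiseSplit S) :
      (bisc S).ShortExact :=
    (D.swap.degreewiseSplit_homSC (D.degreewiseSplit_homSC (G := J) hS)).shortExact
  let φ (S : ShortComplex (CochainComplex (ModuleCat.{u} Λ) ℤ)) : S ⟶ bisc S :=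
    ShortComplex.Hom.mk (D.bidual S.X₁ J) (D.bidual S.X₂ J) (D.bidual S.X₃ J)
      (D.bidual_naturality S.f).symm (D.bidual_naturality S.g).symm
  have hiso (K L : CochainComplex (ModuleCat.{u} Λ) ℤ) (e : K ≅ L) (h : QuasiIso (D.bidual K J)) :
      QuasiIso (D.bidual L J) := by
    have h1 := D.bidual_naturality (J := J) e.hom
    have : IsIso (D.swap.mapLeft (D.mapLeft e.hom J) J) :=
      (D.swap.mapLeftIso (D.mapLeftIso e.symm J).symm J).isIso_hom
    have h2 : QuasiIso (e.hom ≫ D.bidual L J) := by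
      rw [h1]
      infer_instance
    exact quasiIso_of_comp_left e.hom _
  -- In degree zero biduality for the ring is the canonical morphism `Λ → Hom_T(J, J)`; cones of
  -- identities transport this to other degrees.
  have base (n : ℤ) : QuasiIso (D.bidual (singleRing Λ n) J) := by
    refine single_induction (fun K => QuasiIso (D.bidual K J)) hiso ?_ _ ?_ n
    · intro S hS hc
      have h1 := hS.shortExact
      have h2 := hbisc hS
      have hc' : (D.swap.homCplx (D.homCplx S.X₂ J) J).Acyclic :=
        D.swap.acyclic_homCplx _ J (D.acyclic_homCplx S.X₂ J hc)
      have : QuasiIso (φ S).τ₂ := quasiIso_of_epiMono _ fun i =>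
        epiMono_of_exactAt _ i (hc' i) (hc (i + 1))
      refine ⟨fun h => ?_, fun h => ?_⟩
      · have : QuasiIso (φ S).τ₁ := h
        exact HomologicalComplex.HomologySequence.quasiIso_τ₃ (φ S) h1 h2 this inferInstance
      · have : QuasiIso (φ S).τ₃ := h
        exact quasiIso_τ₁ (φ S) h1 h2
    · rw [bidual_singleRing]
      have : IsIso (D.swap.mapLeft (D.evalOne J) J) :=
        (D.swap.mapLeftIso (asIso (D.evalOne J)).symm J).isIso_hom
      infer_instance
  refine quasiIso_of_epiMono _ fun i => ?_
  -- If `K` lies in degrees at most `N`, then `Hom(K, J)` lies in degrees at least `a - N` and the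
  -- double dual in degrees at most `b - a + N`. Both bounds must be at most `i - 1`; this uses that
  -- `J` is bounded on both sides.
  refine devissage (fun K => EpiMono (D.bidual K J) i) ?_ (min (i - 1) (i - 1 - (b - a))) ?_ K m
    inferInstance hK
  · rintro S hS n ⟨e⟩ h
    have : QuasiIso (φ S).τ₃ := hiso _ _ e.symm (base n)
    exact epiMono_τ₁ (φ S) hS.shortExact (hbisc hS) i h
  · intro K hK
    set N := min (i - 1) (i - 1 - (b - a)) with hN
    have h1 : N ≤ i - 1 := min_le_left _ _
    have h2 : N ≤ i - 1 - (b - a) := min_le_right _ _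
    have := D.isGE_homCplx (F := K) (G := J) N a (a - N) (by omega)
    have := D.swap.isLE_homCplx (F := D.homCplx K J) (G := J) (a - N) b (i - 1) (by omega)
    exact epiMono_of_exactAt _ i (exactAt_of_isLE _ (i - 1) i (by omega))
      (K.exactAt_of_isLE N (i + 1) (by omega))

end Biduality

end ActPair

end HomCplx

/-! ### Tensor products of complexes over `k`. -/

section Tens

attribute [local instance] ModuleCat.moduleOfAlgebraModule
  ModuleCat.isScalarTower_of_algebra_moduleCat

variable (k : Type u) [Field k] {X Y : Type u} [Ring X] [Ring Y] [Algebra k X] [Algebra k Y]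

/-- The tensor product over `k` of a complex of `X`-modules and a complex of `Y`-modules. -/
noncomputable abbrev tens (K : CochainComplex (ModuleCat.{u} X) ℤ)
    (L : CochainComplex (ModuleCat.{u} Y) ℤ) : CochainComplex (ModuleCat.{u} (X ⊗[k] Y)) ℤ :=
  HomologicalComplex.mapBifunctor K L (boxTensor k) (ComplexShape.up ℤ)

/-- The tensor product of two chain maps. -/
noncomputable abbrev tensMap {K K' : CochainComplex (ModuleCat.{u} X) ℤ}
    {L L' : CochainComplex (ModuleCat.{u} Y) ℤ} (f : K ⟶ K') (g : L ⟶ L') :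
    tens k K L ⟶ tens k K' L' :=
  HomologicalComplex.mapBifunctorMap f g (boxTensor k) (ComplexShape.up ℤ)

variable {K K' K'' : CochainComplex (ModuleCat.{u} X) ℤ}
  {L L' L'' : CochainComplex (ModuleCat.{u} Y) ℤ}

variable {k} in
/-- The pure tensors. -/
noncomputable def tmk {p q n : ℤ} (h : p + q = n) (x : K.X p) (y : L.X q) : (tens k K L).X n :=
  (HomologicalComplex.ιMapBifunctor K L (boxTensor k) (ComplexShape.up ℤ) p q n h).hom
    (x ⊗ₜ[k] y : K.X p ⊗[k] L.X q)

section

variable {p q n : ℤ} (h : p + q = n)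

lemma tmk_add_left (x x' : K.X p) (y : L.X q) :
    tmk (k := k) h (x + x') y = tmk h x y + tmk h x' y := by
  unfold tmk
  rw [TensorProduct.add_tmul]
  exact map_add _ _ _

lemma tmk_add_right (x : K.X p) (y y' : L.X q) :
    tmk (k := k) h x (y + y') = tmk h x y + tmk h x y' := by
  unfold tmk
  rw [TensorProduct.tmul_add]
  exact map_add _ _ _

/-- Pure tensors as a biadditive map. -/
noncomputable def tmkHom : K.X p →+ L.X q →+ (tens k K L).X n :=
  AddMonoidHom.mk' (fun x => AddMonoidHom.mk' (fun y => tmk h x y) (tmk_add_right k h x))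
    (fun x x' => by
      ext y
      exact tmk_add_left k h x x' y)

lemma tmk_zero_right (x : K.X p) : tmk (k := k) h x (0 : L.X q) = 0 := map_zero (tmkHom k h x)

lemma tmk_units_smul_right (x : K.X p) (y : L.X q) (s : ℤˣ) :
    tmk (k := k) h x (s • y) = s • tmk h x y := by
  rw [Units.smul_def, Units.smul_def]
  exact map_zsmul (tmkHom k h x) _ _

lemma smul_tmk (a : X) (b : Y) (x : K.X p) (y : L.X q) :
    (a ⊗ₜ[k] b : X ⊗[k] Y) • tmk (k := k) h x y = tmk h (a • x) (b • y) :=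
  (map_smul (HomologicalComplex.ιMapBifunctor K L (boxTensor k) (ComplexShape.up ℤ) p q n h).hom
    (a ⊗ₜ[k] b : X ⊗[k] Y) _).symm

end

variable {k} in
lemma tens_hom_ext {n : ℤ} {V : ModuleCat.{u} (X ⊗[k] Y)} {f g : (tens k K L).X n ⟶ V}
    (hfg : ∀ p q (h : p + q = n) (x : K.X p) (y : L.X q), f (tmk h x y) = g (tmk h x y)) : f = g := by
  apply HomologicalComplex.mapBifunctor.hom_ext
  intro p q h
  exact box_hom_ext k (fun x y => hfg p q h x y)

-- The elements all of whose multiples satisfy `Q` form a submodule, although those satisfying `Q`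
-- need not. The projection modulo this submodule kills pure tensors, hence is zero.
variable {k} in
lemma tens_induction {n : ℤ} {Q : (tens k K L).X n → Prop} (h0 : Q 0)
    (hadd : ∀ s t, Q s → Q t → Q (s + t))
    (htmk : ∀ p q (h : p + q = n) (x : K.X p) (y : L.X q), Q (tmk h x y)) (t : (tens k K L).X n) :
    Q t := by
  let N : Submodule (X ⊗[k] Y) ((tens k K L).X n) :=
    { carrier := {t | ∀ s : X ⊗[k] Y, Q (s • t)}
      zero_mem' := fun s => by rw [smul_zero]; exact h0
      add_mem' := fun ha hb s => by rw [smul_add]; exact hadd _ _ (ha s) (hb s)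
      smul_mem' := fun c x hx s => by rw [smul_smul]; exact hx _ }
  have : ModuleCat.ofHom N.mkQ = 0 := by
    apply tens_hom_ext
    intro p q h x y
    refine (Submodule.Quotient.mk_eq_zero N).2 fun s => ?_
    induction s using TensorProduct.induction_on with
    | zero => rw [zero_smul]; exact h0
    | add a b ha hb => rw [add_smul]; exact hadd _ _ ha hb
    | tmul a b => rw [smul_tmk]; exact htmk _ _ _ _ _
  have ht : t ∈ N := (Submodule.Quotient.mk_eq_zero N).1
    (congrArg (fun (f : (tens k K L).X n ⟶ ModuleCat.of (X ⊗[k] Y) (_ ⧸ N)) => f t) this)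
  have := ht 1
  rwa [one_smul] at this

lemma tensMap_tmk (f : K ⟶ K') (g : L ⟶ L') {p q n : ℤ} (h : p + q = n) (x : K.X p) (y : L.X q) :
    (tensMap k f g).f n (tmk h x y) = tmk (k := k) h (f.f p x) (g.f q y) := by
  have := HomologicalComplex.ι_mapBifunctorMap f g (boxTensor k) (ComplexShape.up ℤ) p q n h
  exact congrArg (fun φ => φ.hom (x ⊗ₜ[k] y : K.X p ⊗[k] L.X q)) this

lemma tensMap_comp (f : K ⟶ K') (f' : K' ⟶ K'') (g : L ⟶ L') (g' : L' ⟶ L'') :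
    tensMap k (f ≫ f') (g ≫ g') = tensMap k f g ≫ tensMap k f' g' := by
  ext1 n
  apply tens_hom_ext
  intro p q h x y
  refine (tensMap_tmk k _ _ h x y).trans ?_
  exact ((congrArg _ (tensMap_tmk k f g h x y)).trans (tensMap_tmk k _ _ h _ _)).symm

lemma tensMap_id : tensMap k (𝟙 K) (𝟙 L) = 𝟙 _ := by
  ext1 n
  apply tens_hom_ext
  intro p q h x y
  exact tensMap_tmk k _ _ h x y

lemma tensMap_zero_right (f : K ⟶ K') : tensMap k f (0 : L ⟶ L') = 0 := by
  ext1 n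
  apply tens_hom_ext
  intro p q h x y
  exact (tensMap_tmk k _ _ h x y).trans (tmk_zero_right k h _)

instance (f : K ⟶ K') (g : L ⟶ L') [IsIso f] [IsIso g] : IsIso (tensMap k f g) :=
  ⟨tensMap k (inv f) (inv g), by rw [← tensMap_comp, IsIso.hom_inv_id, IsIso.hom_inv_id, tensMap_id],
    by rw [← tensMap_comp, IsIso.inv_hom_id, IsIso.inv_hom_id, tensMap_id]⟩

lemma d_tmk {p q n m p' q' : ℤ} (h : p + q = n) (hm : n + 1 = m) (hp : p + 1 = p') (hq : q + 1 = q')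
    (x : K.X p) (y : L.X q) : (tens k K L).d n m (tmk h x y) =
      tmk (k := k) (by omega) (K.d p p' x) y +
        p.negOnePow • tmk (k := k) (by omega) x (L.d q q' y) := by
  subst hm hp hq
  have hp : (ComplexShape.up ℤ).Rel p (p + 1) := rfl
  have hq : (ComplexShape.up ℤ).Rel q (q + 1) := rfl
  have hp' : ComplexShape.π (ComplexShape.up ℤ) (ComplexShape.up ℤ)
    (ComplexShape.up ℤ) (p + 1, q) = n + 1 := by
    change p + 1 + q = n + 1; omega
  have hq' : ComplexShape.π (ComplexShape.up ℤ) (ComplexShape.up ℤ)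
    (ComplexShape.up ℤ) (p, q + 1) = n + 1 := by
    change p + (q + 1) = n + 1; omega
  have key : HomologicalComplex.ιMapBifunctor K L (boxTensor k) (ComplexShape.up ℤ) p q n h ≫
      (tens k K L).d n (n + 1) =
      ((boxTensor k).map (K.d p (p + 1))).app (L.X q) ≫
        HomologicalComplex.ιMapBifunctor K L (boxTensor k) (ComplexShape.up ℤ) (p + 1) q (n + 1) hp' +
      p.negOnePow • (((boxTensor k).obj (K.X p)).map (L.d q (q + 1)) ≫
        HomologicalComplex.ιMapBifunctor K L (boxTensor k) (ComplexShape.up ℤ) p (q + 1) (n + 1) hq') := by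
    rw [HomologicalComplex.mapBifunctor.d_eq, Preadditive.comp_add,
      HomologicalComplex.mapBifunctor.ι_D₁, HomologicalComplex.mapBifunctor.ι_D₂,
      HomologicalComplex.mapBifunctor.d₁_eq _ _ _ _ hp _ _ hp',
      HomologicalComplex.mapBifunctor.d₂_eq _ _ _ _ _ hq _ hq']
    congr 1
    exact one_smul _ _
  have := congrArg (fun φ => φ.hom (x ⊗ₜ[k] y : K.X p ⊗[k] L.X q)) key
  exact this

section Desc

variable {k}

/-- Morphisms out of the terms of a tensor product. -/
noncomputable def tensDescX {n : ℤ} {V : ModuleCat.{u} (X ⊗[k] Y)}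
    (φ : ∀ p q, p + q = n → K.X p →+ L.X q →+ V)
    (hφ : ∀ p q h a b x y, φ p q h (a • x) (b • y) = (a ⊗ₜ[k] b : X ⊗[k] Y) • φ p q h x y) :
    (tens k K L).X n ⟶ V :=
  HomologicalComplex.mapBifunctorDesc (fun p q h => boxDesc (φ p q h) (hφ p q h))

lemma tensDescX_tmk {n : ℤ} {V : ModuleCat.{u} (X ⊗[k] Y)}
    (φ : ∀ p q, p + q = n → K.X p →+ L.X q →+ V)
    (hφ : ∀ p q h a b x y, φ p q h (a • x) (b • y) = (a ⊗ₜ[k] b : X ⊗[k] Y) • φ p q h x y)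
    (p q : ℤ) (h : p + q = n) (x : K.X p) (y : L.X q) :
    tensDescX φ hφ (tmk h x y) = φ p q h x y := by
  have := HomologicalComplex.ι_mapBifunctorDesc (F := boxTensor k) (c := ComplexShape.up ℤ)
    (K₁ := K) (K₂ := L) (fun p q h => boxDesc (φ p q h) (hφ p q h)) p q h
  exact congrArg (fun φ => φ.hom (x ⊗ₜ[k] y : K.X p ⊗[k] L.X q)) this

/-- Chain maps out of a tensor product. -/
noncomputable def tensDesc {G : CochainComplex (ModuleCat.{u} (X ⊗[k] Y)) ℤ}
    (φ : ∀ n p q, p + q = n → K.X p →+ L.X q →+ G.X n)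
    (hφ : ∀ n p q h a b x y, φ n p q h (a • x) (b • y) = (a ⊗ₜ[k] b : X ⊗[k] Y) • φ n p q h x y)
    (hd : ∀ n p q h x y, G.d n (n + 1) (φ n p q h x y) =
      φ (n + 1) (p + 1) q (by omega) (K.d p (p + 1) x) y +
        p.negOnePow • φ (n + 1) p (q + 1) (by omega) x (L.d q (q + 1) y)) :
    tens k K L ⟶ G where
  f n := tensDescX (φ n) (hφ n)
  comm' n m hm := by
    obtain rfl : n + 1 = m := hm
    apply tens_hom_ext
    intro p q h x y
    have h1 := congrArg (G.d n (n + 1)) (tensDescX_tmk (φ n) (hφ n) p q h x y)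
    refine (h1.trans (hd n p q h x y)).trans ?_
    have h2 := congrArg (tensDescX (φ (n + 1)) (hφ (n + 1))) (d_tmk k h rfl rfl rfl x y)
    refine Eq.trans ?_ h2.symm
    rw [map_add, Units.smul_def, Units.smul_def, map_zsmul, tensDescX_tmk, tensDescX_tmk]

lemma tensDesc_tmk {G : CochainComplex (ModuleCat.{u} (X ⊗[k] Y)) ℤ}
    (φ : ∀ n p q, p + q = n → K.X p →+ L.X q →+ G.X n)
    (hφ : ∀ n p q h a b x y, φ n p q h (a • x) (b • y) = (a ⊗ₜ[k] b : X ⊗[k] Y) • φ n p q h x y)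
    (hd : ∀ n p q h x y, G.d n (n + 1) (φ n p q h x y) =
      φ (n + 1) (p + 1) q (by omega) (K.d p (p + 1) x) y +
        p.negOnePow • φ (n + 1) p (q + 1) (by omega) x (L.d q (q + 1) y))
    {p q n : ℤ} (h : p + q = n) (x : K.X p) (y : L.X q) :
    (tensDesc φ hφ hd).f n (tmk h x y) = φ n p q h x y :=
  tensDescX_tmk (φ n) (hφ n) p q h x y

end Desc

section Restriction

variable {k} {X' Y' : Type u} [Ring X'] [Ring Y'] [Algebra k X'] [Algebra k Y']
  (φ : X' →ₐ[k] X) (ψ : Y' →ₐ[k] Y)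

lemma boxRes_isLinear (M : ModuleCat.{u} X) (N : ModuleCat.{u} Y) (z : X' ⊗[k] Y')
    (t : Box k ((resMod φ).obj M) ((resMod ψ).obj N)) :
    TensorProduct.congr (resKLin φ M) (resKLin ψ N) (z • t) =
      (Algebra.TensorProduct.map φ ψ z) •
        (show Box k M N from TensorProduct.congr (resKLin φ M) (resKLin ψ N) t) :=
  box_isLinear (k := k) (M := (resMod φ).obj M) (N := (resMod ψ).obj N)
    (V := (resMod (Algebra.TensorProduct.map φ ψ)).obj (((boxTensor k).obj M).obj N))
    (TensorProduct.congr (resKLin φ M) (resKLin ψ N)).toAddEquiv.toAddMonoidHom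
    (fun _ _ _ _ => rfl) z t

/-- External tensor products commute with restriction of scalars. -/
noncomputable def boxRes (M : ModuleCat.{u} X) (N : ModuleCat.{u} Y) :
    ((boxTensor k).obj ((resMod φ).obj M)).obj ((resMod ψ).obj N) ≅
      (resMod (Algebra.TensorProduct.map φ ψ)).obj (((boxTensor k).obj M).obj N) :=
  LinearEquiv.toModuleIso (X₁ := Box k ((resMod φ).obj M) ((resMod ψ).obj N))
    (X₂ := (resMod (Algebra.TensorProduct.map φ ψ)).obj (((boxTensor k).obj M).obj N))
    (m₂ := ModuleCat.isModule _)
    { (TensorProduct.congr (resKLin φ M) (resKLin ψ N)).toAddEquiv with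
      map_smul' := fun z x => boxRes_isLinear φ ψ M N z x }

variable (K L)

/-- Pure tensors, as a biadditive map between restrictions of scalars. -/
noncomputable def tmkRes {p q n : ℤ} (h : p + q = n) :
    ((onCplx (resMod φ)).obj K).X p →+ ((onCplx (resMod ψ)).obj L).X q →+
      ((onCplx (resMod (Algebra.TensorProduct.map φ ψ))).obj (tens k K L)).X n :=
  AddMonoidHom.mk' (fun x => AddMonoidHom.mk' (fun y => tmk (K := K) (L := L) h x y)
    (fun y y' => tmk_add_right (K := K) (L := L) k h x y y'))
    (fun x x' => AddMonoidHom.ext fun y => tmk_add_left (K := K) (L := L) k h x x' y)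

lemma tmkRes_smul {p q n : ℤ} (h : p + q = n) (a : X') (b : Y')
    (x : ((onCplx (resMod φ)).obj K).X p) (y : ((onCplx (resMod ψ)).obj L).X q) :
    tmkRes K L φ ψ h (a • x) (b • y) = (a ⊗ₜ[k] b : X' ⊗[k] Y') • tmkRes K L φ ψ h x y := by
  have h1 := smul_tmk (K := K) (L := L) k h (φ a) (ψ b) x y
  have h2 : (φ a ⊗ₜ[k] ψ b : X ⊗[k] Y) = Algebra.TensorProduct.map φ ψ (a ⊗ₜ[k] b) := rfl
  rw [h2] at h1
  exact h1.symm

lemma d_tmkRes (n p q : ℤ) (h : p + q = n)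
    (x : ((onCplx (resMod φ)).obj K).X p) (y : ((onCplx (resMod ψ)).obj L).X q) :
    ((onCplx (resMod (Algebra.TensorProduct.map φ ψ))).obj (tens k K L)).d n (n + 1)
      (tmkRes K L φ ψ h x y) =
      tmkRes K L φ ψ (by omega) (((onCplx (resMod φ)).obj K).d p (p + 1) x) y +
        p.negOnePow • tmkRes K L φ ψ (by omega) x (((onCplx (resMod ψ)).obj L).d q (q + 1) y) :=
  d_tmk (K := K) (L := L) k h rfl rfl rfl x y

/-- The comparison between the tensor product of restrictions and the restriction of the tensor
product. -/
noncomputable def tensResHom :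
    tens k ((onCplx (resMod φ)).obj K) ((onCplx (resMod ψ)).obj L) ⟶
      (onCplx (resMod (Algebra.TensorProduct.map φ ψ))).obj (tens k K L) :=
  tensDesc (fun _ _ _ h => tmkRes K L φ ψ h)
    (fun _ _ _ h a b x y => tmkRes_smul K L φ ψ h a b x y)
    (fun n p q h x y => d_tmkRes K L φ ψ n p q h x y)

lemma tensResHom_tmk {p q n : ℤ} (h : p + q = n) (x : K.X p) (y : L.X q) :
    (tensResHom K L φ ψ).f n (tmk (K := (onCplx (resMod φ)).obj K)
      (L := (onCplx (resMod ψ)).obj L) h x y) = tmk (k := k) h x y :=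
  tensDesc_tmk (fun _ _ _ h => tmkRes K L φ ψ h) _ _ h x y

/-- Restriction of scalars preserves coproducts, so an inverse can be defined summand by summand and
checked on pure tensors. -/
instance isIso_tensResHom : IsIso (tensResHom K L φ ψ) := by
  have (n : ℤ) : IsIso ((tensResHom K L φ ψ).f n) := by
    let G := resMod (Algebra.TensorProduct.map φ ψ)
    let F := boxTensor k (X := X) (Y := Y)
    let F' := boxTensor k (X := X') (Y := Y')
    let K₁ := (onCplx (resMod φ)).obj K
    let L₁ := (onCplx (resMod ψ)).obj L
    let W := (((F.mapBifunctorHomologicalComplex (ComplexShape.up ℤ) (ComplexShape.up ℤ)).obj K).obj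
      L).toGradedObject
    let p := ComplexShape.π (ComplexShape.up ℤ) (ComplexShape.up ℤ) (ComplexShape.up ℤ)
    let hc := isColimitOfHasCoproductOfPreservesColimit G (W.mapObjFun p n)
    let i : G.obj ((tens k K L).X n) ⟶ (tens k K₁ L₁).X n :=
      Cofan.IsColimit.desc hc (fun x => (boxRes φ ψ (K.X x.1.1) (L.X x.1.2)).inv ≫
        HomologicalComplex.ιMapBifunctor K₁ L₁ F' (ComplexShape.up ℤ) x.1.1 x.1.2 n x.2)
    let t : (tens k K₁ L₁).X n ⟶ G.obj ((tens k K L).X n) := (tensResHom K L φ ψ).f n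
    change IsIso t
    have hi : ∀ a b (h : p (a, b) = n),
        G.map (HomologicalComplex.ιMapBifunctor K L F (ComplexShape.up ℤ) a b n h) ≫ i =
          (boxRes φ ψ (K.X a) (L.X b)).inv ≫
            HomologicalComplex.ιMapBifunctor K₁ L₁ F' (ComplexShape.up ℤ) a b n h :=
      fun a b h => Cofan.IsColimit.fac hc _ ⟨(a, b), h⟩
    have hi' : ∀ a b (h : a + b = n) (x : K.X a) (y : L.X b),
        i (tmk (k := k) h x y) = tmk (K := K₁) (L := L₁) h x y := fun a b h x y =>
      congrArg (fun f => f.hom (x ⊗ₜ[k] y : K.X a ⊗[k] L.X b)) (hi a b h)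
    refine ⟨i, ?_, ?_⟩
    · apply tens_hom_ext
      intro a b h x y
      exact (congrArg i (tensResHom_tmk K L φ ψ h x y)).trans (hi' a b h x y)
    · refine ModuleCat.hom_ext (LinearMap.ext fun z => ?_)
      refine tens_induction (K := K) (L := L) (n := n)
        (Q := fun z => t (i z) = (show G.obj ((tens k K L).X n) from z)) ?_ ?_ ?_ z
      · exact (congrArg t (map_zero i.hom)).trans (map_zero t.hom)
      · intro z w hz hw
        exact (congrArg t (map_add i.hom z w)).trans ((map_add t.hom _ _).trans (congrArg₂ (· + ·) hz hw))
      · intro a b h x y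
        exact (congrArg t (hi' a b h x y)).trans (tensResHom_tmk K L φ ψ h x y)
  exact HomologicalComplex.Hom.isIso_of_components _

variable {K L}

lemma tensResHom_naturality (f : K ⟶ K') (g : L ⟶ L') :
    tensMap k ((onCplx (resMod φ)).map f) ((onCplx (resMod ψ)).map g) ≫ tensResHom K' L' φ ψ =
      tensResHom K L φ ψ ≫ (onCplx (resMod (Algebra.TensorProduct.map φ ψ))).map (tensMap k f g) := by
  ext1 n
  apply tens_hom_ext
  intro p q h x y
  have h1 := congrArg ((tensResHom K' L' φ ψ).f n) (tensMap_tmk k ((onCplx (resMod φ)).map f)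
    ((onCplx (resMod ψ)).map g) h x y)
  have h2 := congrArg ((tensMap k f g).f n) (tensResHom_tmk K L φ ψ h x y)
  refine (h1.trans (tensResHom_tmk K' L' φ ψ h _ _)).trans ?_
  exact (h2.trans (tensMap_tmk k f g h x y)).symm

end Restriction

end Tens

/-! ### Complexes of vector spaces. -/

section Field

variable {k : Type u} [Field k]

/-- Over a field the map onto the range has a section, and this section extends to the whole target.
-/
lemma exists_pseudoinverse {V W : Type u} [AddCommGroup V] [Module k V] [AddCommGroup W] [Module k W]
    (f : V →ₗ[k] W) : ∃ s : W →ₗ[k] V, ∀ x, f (s (f x)) = f x := by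
  obtain ⟨g, hg⟩ := f.rangeRestrict.exists_rightInverse_of_surjective f.range_rangeRestrict
  obtain ⟨s, hs⟩ := g.exists_extend
  refine ⟨s, fun x => ?_⟩
  have h1 : s (f x) = g (f.rangeRestrict x) := LinearMap.congr_fun hs (f.rangeRestrict x)
  rw [h1]
  exact congrArg Subtype.val (LinearMap.congr_fun hg (f.rangeRestrict x))

/-- Over a field, all complexes are K-injective. -/
lemma isKInjective_of_field (L : CochainComplex (ModuleCat.{u} k) ℤ) : L.IsKInjective where
  nonempty_homotopy_zero {K} f hK := by
    -- Every acyclic complex of vector spaces is contractible.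
    suffices Nonempty (Homotopy (𝟙 K) 0) by
      exact ⟨(Homotopy.ofEq (by simp)).trans (((this.some).compRight f).trans (Homotopy.ofEq (by simp)))⟩
    choose s hs using fun n : ℤ => exists_pseudoinverse (K.d n (n + 1)).hom
    have hs' (n : ℤ) (x : K.X (n + 1)) (hx : K.d (n + 1) (n + 1 + 1) x = 0) :
        K.d n (n + 1) (s n x) = x := by
      obtain ⟨w, rfl⟩ := (mod_exactAt_iff K n (n + 1) (n + 1 + 1) rfl rfl).1 (hK (n + 1)) x hx
      exact hs n w
    -- The map `s` only satisfies `d s d = d`. The element `x - s (d x)` is a cycle, hence a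
    -- boundary, and applying `s` to it instead of `x` gives `d t + t d = 1`.
    let t (n : ℤ) : K.X (n + 1) ⟶ K.X n := 
      (𝟙 _ - K.d (n + 1) (n + 1 + 1) ≫ ModuleCat.ofHom (s (n + 1))) ≫ ModuleCat.ofHom (s n)
    have key (n : ℤ) : t n ≫ K.d n (n + 1) + K.d (n + 1) (n + 1 + 1) ≫ t (n + 1) = 𝟙 _ := by
      ext x
      have e1 : t n x = s n (x - s (n + 1) (K.d (n + 1) (n + 1 + 1) x)) := rfl
      have e2 : t (n + 1) (K.d (n + 1) (n + 1 + 1) x) = s (n + 1) (K.d (n + 1) (n + 1 + 1) x) := by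
        have : K.d (n + 1 + 1) (n + 1 + 1 + 1) (K.d (n + 1) (n + 1 + 1) x) = 0 :=
          ConcreteCategory.congr_hom (K.d_comp_d (n + 1) (n + 1 + 1) (n + 1 + 1 + 1)) x
        have e : t (n + 1) (K.d (n + 1) (n + 1 + 1) x) = s (n + 1) (K.d (n + 1) (n + 1 + 1) x -
          s (n + 1 + 1) (K.d (n + 1 + 1) (n + 1 + 1 + 1) (K.d (n + 1) (n + 1 + 1) x))) := rfl
        rw [e, this, map_zero, sub_zero]
      have e3 : K.d n (n + 1) (t n x) = x - s (n + 1) (K.d (n + 1) (n + 1 + 1) x) := by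
        rw [e1]
        refine hs' n _ ?_
        rw [map_sub, sub_eq_zero]
        exact (hs (n + 1) x).symm
      change K.d n (n + 1) (t n x) + t (n + 1) (K.d (n + 1) (n + 1 + 1) x) = x
      rw [e3, e2, sub_add_cancel]
    -- The contraction as a cochain of degree `-1`; the index equality turns `p` into `q + 1`.
    let z : Cochain K K (-1) := Cochain.mk fun p q hpq =>
      eqToHom (by rw [show q + 1 = p by omega]) ≫ t q
    have hz (n : ℤ) : z.v (n + 1) n (by omega) = t n := by
      simp [z]
    have hδ : Cochain.ofHom (𝟙 K) = δ (-1) 0 z + Cochain.ofHom 0 := by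
      rw [Cochain.ofHom_zero, add_zero]
      ext1 p
      obtain ⟨n, rfl⟩ : ∃ n, p = n + 1 := ⟨p - 1, by omega⟩
      rw [δ_v (-1) 0 (by omega) z (n + 1) (n + 1) (by omega) n (n + 1 + 1) (by omega) (by omega), hz, hz,
        Int.negOnePow_zero, one_smul, key, Cochain.ofHom_v]
      rfl
    exact ⟨(Cochain.equivHomotopy _ _).symm ⟨z, hδ⟩⟩

end Field

/-! ### Exactness of tensor products over a field. -/

section TensExact

attribute [local instance] ModuleCat.moduleOfAlgebraModule
  ModuleCat.isScalarTower_of_algebra_moduleCat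

variable (k : Type u) [Field k] {X Y : Type u} [Ring X] [Ring Y] [Algebra k X] [Algebra k Y]
  {K K' : CochainComplex (ModuleCat.{u} X) ℤ} {L L' : CochainComplex (ModuleCat.{u} Y) ℤ}

/-- Over a field quasi-isomorphisms are homotopy equivalences, and these are preserved by the tensor
product. No boundedness is needed. -/
lemma quasiIso_tensMap_field {K K' L L' : CochainComplex (ModuleCat.{u} k) ℤ} (f : K ⟶ K')
    (g : L ⟶ L') [QuasiIso f] [QuasiIso g] : QuasiIso (tensMap k f g) := by
  have hK := isKInjective_of_field K
  have hK' := isKInjective_of_field K'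
  have hL := isKInjective_of_field L
  have hL' := isKInjective_of_field L'
  obtain ⟨a, ha⟩ := (CochainComplex.IsKInjective.quasiIso_iff f).1 inferInstance
  obtain ⟨b, hb⟩ := (CochainComplex.IsKInjective.quasiIso_iff g).1 inferInstance
  have hhom : ∀ {K₁ K₂ L₁ L₂ : CochainComplex (ModuleCat.{u} k) ℤ} {u v : K₁ ⟶ K₂} {u' v' : L₁ ⟶ L₂}
    (_ : Homotopy u v) (_ : Homotopy u' v'), Nonempty (Homotopy (tensMap k u u') (tensMap k v v')) :=
    fun {K₁ K₂ L₁ L₂ u v u' v'} w w' =>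
      ⟨(HomologicalComplex.mapBifunctorMapHomotopy₁ w u' (boxTensor k) (ComplexShape.up ℤ)).trans
        (HomologicalComplex.mapBifunctorMapHomotopy₂ v w' (boxTensor k) (ComplexShape.up ℤ))⟩
  let E : HomotopyEquiv (tens k K L) (tens k K' L') :=
    { hom := tensMap k a.hom b.hom
      inv := tensMap k a.inv b.inv
      homotopyHomInvId := (Homotopy.ofEq (tensMap_comp k _ _ _ _).symm).trans
        (((hhom a.homotopyHomInvId b.homotopyHomInvId).some).trans (Homotopy.ofEq (tensMap_id k)))
      homotopyInvHomId := (Homotopy.ofEq (tensMap_comp k _ _ _ _).symm).trans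
        (((hhom a.homotopyInvHomId b.homotopyInvHomId).some).trans (Homotopy.ofEq (tensMap_id k))) }
  have : tensMap k f g = E.hom := by
    change _ = tensMap k a.hom b.hom
    rw [ha, hb]
  rw [this]
  exact homotopyEquivalences_le_quasiIso _ _ _ ⟨E, rfl⟩

/-- Tensor products over a field preserve quasi-isomorphisms. -/
instance quasiIso_tensMap (f : K ⟶ K') (g : L ⟶ L') [QuasiIso f] [QuasiIso g] :
    QuasiIso (tensMap k f g) := by
  -- Quasi-isomorphisms can be detected after restriction to `k`, with which tensor products
  -- commute.
  let φ : k →ₐ[k] X := Algebra.ofId k X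
  let ψ : k →ₐ[k] Y := Algebra.ofId k Y
  have h1 : QuasiIso ((onCplx (resMod φ)).map f) :=
    HomologicalComplex.quasiIso_map_of_preservesHomology f (resMod φ)
  have h2 : QuasiIso ((onCplx (resMod ψ)).map g) :=
    HomologicalComplex.quasiIso_map_of_preservesHomology g (resMod ψ)
  have h3 := quasiIso_tensMap_field k ((onCplx (resMod φ)).map f) ((onCplx (resMod ψ)).map g)
  have h4 := tensResHom_naturality φ ψ f g
  have h5 : QuasiIso (tensResHom K L φ ψ ≫
      (onCplx (resMod (Algebra.TensorProduct.map φ ψ))).map (tensMap k f g)) := by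
    rw [← h4]
    infer_instance
  have h6 := quasiIso_of_comp_left (tensResHom K L φ ψ)
    ((onCplx (resMod (Algebra.TensorProduct.map φ ψ))).map (tensMap k f g))
  exact (HomologicalComplex.quasiIso_map_iff_of_preservesHomology (tensMap k f g)
    (resMod (Algebra.TensorProduct.map φ ψ))).1 h6

/-- The zero endomorphism of an acyclic complex is a quasi-isomorphism; tensoring it with `K` shows
that zero is an automorphism of the cohomology of `K ⊗ L`. -/
lemma acyclic_tens (hL : L.Acyclic) : (tens k K L).Acyclic := by
  have h0 : QuasiIso (0 : L ⟶ L) := quasiIso_of_epiMono _ fun i =>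
    epiMono_of_exactAt _ i (hL i) (hL (i + 1))
  have h1 : QuasiIso (tensMap k (𝟙 K) (0 : L ⟶ L)) := inferInstance
  rw [tensMap_zero_right] at h1
  intro i
  rw [HomologicalComplex.exactAt_iff_isZero_homology, IsZero.iff_id_eq_zero]
  have : IsIso (HomologicalComplex.homologyMap (0 : tens k K L ⟶ tens k K L) i) := inferInstance
  rw [HomologicalComplex.homologyMap_zero] at this
  exact (isZero_of_isIso_zero).eq_of_src _ _
where
  isZero_of_isIso_zero {M : ModuleCat.{u} (X ⊗[k] Y)} [h : IsIso (0 : M ⟶ M)] : IsZero M := by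
    rw [IsZero.iff_id_eq_zero, ← IsIso.hom_inv_id (0 : M ⟶ M), zero_comp]

/-- The short complex obtained by tensoring with `K`. -/
noncomputable def tensSC (K : CochainComplex (ModuleCat.{u} X) ℤ)
    (S : ShortComplex (CochainComplex (ModuleCat.{u} Y) ℤ)) :
    ShortComplex (CochainComplex (ModuleCat.{u} (X ⊗[k] Y)) ℤ) :=
  ShortComplex.mk (tensMap k (𝟙 K) S.f) (tensMap k (𝟙 K) S.g) (by
    rw [← tensMap_comp, S.zero, tensMap_zero_right])

/-- The map of terms of tensor products induced by maps of terms. -/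
noncomputable def tensX (K : CochainComplex (ModuleCat.{u} X) ℤ) (g : ∀ q, L.X q ⟶ L'.X q) (n : ℤ) :
    (tens k K L).X n ⟶ (tens k K L').X n :=
  tensDescX (fun _ q h => (AddMonoidHom.compl₂ (tmkHom k h) (g q).hom.toAddMonoidHom))
    (fun p q h a b x y => by
      change tmk (k := k) h (a • x) ((g q) (b • y)) = _
      rw [map_smul]
      exact (smul_tmk k h a b x (g q y)).symm)

lemma tensX_tmk (g : ∀ q, L.X q ⟶ L'.X q) {p q n : ℤ} (h : p + q = n) (x : K.X p) (y : L.X q) :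
    tensX k K g n (tmk h x y) = tmk (k := k) h x (g q y) := tensDescX_tmk _ _ p q h x y

/-- Degreewise splittings of `S`, though not chain maps, act on the terms of the tensor product. -/
lemma degreewiseSplit_tensSC {S : ShortComplex (CochainComplex (ModuleCat.{u} Y) ℤ)}
    (hS : DegreewiseSplit S) : DegreewiseSplit (tensSC k K S) := by
  have hh (q : ℤ) : ∃ (r : S.X₂.X q ⟶ S.X₁.X q) (s : S.X₃.X q ⟶ S.X₂.X q),
      S.f.f q ≫ r = 𝟙 _ ∧ s ≫ S.g.f q = 𝟙 _ ∧ r ≫ S.f.f q + S.g.f q ≫ s = 𝟙 _ :=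
    ⟨(hS q).some.r, (hS q).some.s, (hS q).some.f_r, (hS q).some.s_g, (hS q).some.id⟩
  choose r s h1 h2 h3 using hh
  refine fun n => ⟨{ r := tensX k K r n, s := tensX k K s n, f_r := ?_, s_g := ?_, id := ?_ }⟩
  · apply tens_hom_ext
    intro p q h x y
    refine (congrArg (tensX k K r n) (tensMap_tmk k (𝟙 K) S.f h x y)).trans ?_
    refine (tensX_tmk k r h _ _).trans ?_
    exact congrArg (tmk h x) (ConcreteCategory.congr_hom (h1 q) y)
  · apply tens_hom_ext
    intro p q h x y
    refine (congrArg ((tensMap k (𝟙 K) S.g).f n) (tensX_tmk k s h x y)).trans ?_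
    refine (tensMap_tmk k (𝟙 K) S.g h _ _).trans ?_
    exact congrArg (tmk h x) (ConcreteCategory.congr_hom (h2 q) y)
  · apply tens_hom_ext
    intro p q h x y
    have e1 := (congrArg ((tensMap k (𝟙 K) S.f).f n) (tensX_tmk k r h x y)).trans
      (tensMap_tmk k (𝟙 K) S.f h _ _)
    have e2 := (congrArg (tensX k K s n) (tensMap_tmk k (𝟙 K) S.g h x y)).trans
      (tensX_tmk k s h _ _)
    refine (congrArg₂ (· + ·) e1 e2).trans ?_
    refine (tmk_add_right k h x _ _).symm.trans ?_
    exact congrArg (tmk h x) (ConcreteCategory.congr_hom (h3 q) y)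

lemma isStrictlyGE_tens (m n l : ℤ) (hl : l ≤ m + n) [K.IsStrictlyGE m] [L.IsStrictlyGE n] :
    (tens k K L).IsStrictlyGE l := by
  rw [isStrictlyGE_iff]
  intro i hi
  rw [IsZero.iff_id_eq_zero]
  apply HomologicalComplex.mapBifunctor.hom_ext
  intro p q hpq
  have hpq' : p + q = i := hpq
  have hz : IsZero (((boxTensor k).obj (K.X p)).obj (L.X q)) := by
    by_cases hp : p < m
    · exact (((boxTensor k).flip.obj (L.X q)).map_isZero (K.isZero_of_isStrictlyGE m p hp))
    · exact ((boxTensor k).obj _).map_isZero (L.isZero_of_isStrictlyGE n q (by omega))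
  exact hz.eq_of_src _ _

lemma isGE_tens (m n l : ℤ) (hl : l ≤ m + n) [K.IsStrictlyGE m] [L.IsGE n] :
    (tens k K L).IsGE l := by
  have : QuasiIso (L.πTruncGE n) := (L.quasiIso_πTruncGE_iff n).2 inferInstance
  have := isStrictlyGE_tens k (K := K) (L := L.truncGE n) m n l hl
  exact isGE_of_quasiIso (tensMap k (𝟙 K) (L.πTruncGE n)) l

end TensExact

/-! ### The tensor evaluation `J ⊗ Hom(P, G) → Hom(P, J ⊗ G)`. -/

section TensHom

attribute [local instance] ModuleCat.moduleOfAlgebraModule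
  ModuleCat.isScalarTower_of_algebra_moduleCat

variable {k : Type u} [Field k] {Λ T S X : Type u} [Ring Λ] [Ring T] [Ring S] [Ring X] [Algebra k Λ]
  [Algebra k T] [Algebra k S] [Algebra k X]

/-- The identity, as a morphism to the restriction along the identity. -/
noncomputable def resIdHom (K : CochainComplex (ModuleCat.{u} X) ℤ) :
    K ⟶ (onCplx (resMod (AlgHom.id k X))).obj K where
  f n := ModuleCat.ofHom (Y := ((onCplx (resMod (AlgHom.id k X))).obj K).X n)
    { toFun x := x
      map_add' _ _ := rfl
      map_smul' _ _ := rfl }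
  comm' _ _ _ := rfl

instance (K : CochainComplex (ModuleCat.{u} X) ℤ) : IsIso (resIdHom (k := k) K) := by
  have (n : ℤ) : IsIso ((resIdHom (k := k) K).f n) := by
    rw [ConcreteCategory.isIso_iff_bijective]
    exact Function.bijective_id
  exact HomologicalComplex.Hom.isIso_of_components _

/-- Restriction of scalars in the second factor of a tensor product. -/
noncomputable def tensResRight (K : CochainComplex (ModuleCat.{u} X) ℤ)
    (L : CochainComplex (ModuleCat.{u} S) ℤ) (ψ : T →ₐ[k] S) :
    tens k K ((onCplx (resMod ψ)).obj L) ⟶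
      (onCplx (resMod (Algebra.TensorProduct.map (AlgHom.id k X) ψ))).obj (tens k K L) :=
  tensMap k (resIdHom K) (𝟙 _) ≫ tensResHom K L (AlgHom.id k X) ψ

lemma tensResRight_tmk (K : CochainComplex (ModuleCat.{u} X) ℤ)
    (L : CochainComplex (ModuleCat.{u} S) ℤ) (ψ : T →ₐ[k] S) {p q n : ℤ} (h : p + q = n)
    (x : K.X p) (y : L.X q) :
    (tensResRight K L ψ).f n (tmk (L := (onCplx (resMod ψ)).obj L) h x y) = tmk (k := k) h x y :=
  (congrArg ((tensResHom K L (AlgHom.id k X) ψ).f n)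
    (tensMap_tmk k (resIdHom K) (𝟙 ((onCplx (resMod ψ)).obj L)) h x y)).trans
    (tensResHom_tmk K L (AlgHom.id k X) ψ h x y)

instance (K : CochainComplex (ModuleCat.{u} X) ℤ) (L : CochainComplex (ModuleCat.{u} S) ℤ)
    (ψ : T →ₐ[k] S) : IsIso (tensResRight K L ψ) := by
  dsimp only [tensResRight]
  infer_instance

namespace ActPair

variable (D : ActPair k Λ T S)

/-- The actions on the second factor of a tensor product. -/
noncomputable def ext (X : Type u) [Ring X] [Algebra k X] : ActPair k Λ (X ⊗[k] T) (X ⊗[k] S) where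
  src := Algebra.TensorProduct.includeRight.comp D.src
  tgt := Algebra.TensorProduct.map (AlgHom.id k X) D.tgt
  comm s t := by
    induction t using TensorProduct.induction_on with
    | zero => rw [map_zero]; exact Commute.zero_right _
    | add a b ha hb => rw [map_add]; exact ha.add_right hb
    | tmul x t =>
      change (1 ⊗ₜ[k] D.src s : X ⊗[k] S) * (x ⊗ₜ[k] D.tgt t) = (x ⊗ₜ[k] D.tgt t) * (1 ⊗ₜ[k] D.src s)
      rw [Algebra.TensorProduct.tmul_mul_tmul, Algebra.TensorProduct.tmul_mul_tmul, one_mul, mul_one,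
        (D.comm s t).eq]

variable (J : CochainComplex (ModuleCat.{u} X) ℤ) (P P' : CochainComplex (ModuleCat.{u} Λ) ℤ)
  (G : CochainComplex (ModuleCat.{u} S) ℤ)

lemma ext_smul_tmk {p q n : ℤ} (h : p + q = n) (s : Λ) (x : J.X p) (y : G.X q) :
    (D.ext X).src s • tmk (k := k) h x y = tmk (k := k) h x (D.src s • y) := by
  have h1 := smul_tmk (K := J) (L := G) k h 1 (D.src s) x y
  rw [one_smul] at h1
  exact h1

variable {P} in
/-- The linear map `y ↦ x ⊗ z(y)`. -/
noncomputable def tensCochainLin {a c p q r : ℤ} (hr : p + c = r) (hq : a + r = q) (x : J.X a)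
    (z : Cochain P (D.res G) c) : P.X p ⟶ ((D.ext X).res (tens k J G)).X q :=
  ModuleCat.ofHom (Y := ((D.ext X).res (tens k J G)).X q)
    { toFun y := (tmk (k := k) hq x (show G.X r from z.v p r hr y) : (tens k J G).X q)
      map_add' y y' := (congrArg (fun w => tmk (k := k) (L := G) hq x w)
        (map_add (z.v p r hr).hom y y')).trans (tmk_add_right (L := G) k hq x _ _)
      map_smul' s y := (congrArg (fun w => tmk (k := k) (L := G) hq x w)
        (map_smul (z.v p r hr).hom s y)).trans
          (D.ext_smul_tmk J G hq s x (show G.X r from z.v p r hr y)).symm }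

variable {P} in
/-- The cochain `y ↦ x ⊗ z(y)`. -/
noncomputable def tensCochain {a c n : ℤ} (h : a + c = n) (x : J.X a) (z : Cochain P (D.res G) c) :
    Cochain P ((D.ext X).res (tens k J G)) n :=
  Cochain.mk fun _ _ hpq => D.tensCochainLin J G rfl (by omega) x z

variable {P} in
lemma tensCochain_v {a c n : ℤ} (h : a + c = n) (x : J.X a) (z : Cochain P (D.res G) c)
    (p q r : ℤ) (hpq : p + n = q) (hr : p + c = r) (hq : a + r = q) (y : P.X p) :
    (D.tensCochain J G h x z).v p q hpq y =
      (tmk (k := k) hq x (show G.X r from z.v p r hr y) : (tens k J G).X q) := by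
  subst hr
  rfl

section

variable {P} {a c n : ℤ} (h : a + c = n) (x x' : J.X a) (z z' : Cochain P (D.res G) c)

lemma tensCochain_add_left : D.tensCochain J G h (x + x') z =
    D.tensCochain J G h x z + D.tensCochain J G h x' z := by
  refine cochain_hom_ext fun p q hpq y => ?_
  exact tmk_add_left (L := G) k _ x x' _

lemma tensCochain_add_right : D.tensCochain J G h x (z + z') =
    D.tensCochain J G h x z + D.tensCochain J G h x z' := by
  refine cochain_hom_ext fun p q hpq y => ?_
  exact tmk_add_right (L := G) k _ x _ _

lemma tensCochain_smul (s : X) (t : T) : D.tensCochain J G h (s • x) (D.smulC t z) =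
    (D.ext X).smulC (s ⊗ₜ t) (D.tensCochain J G h x z) := by
  refine cochain_hom_ext fun p q hpq y => ?_
  refine Eq.trans ?_ ((D.ext X).smulC_v (F := P) (s ⊗ₜ t) (D.tensCochain J G h x z) p q hpq y).symm
  have h1 := D.smulC_v t z p (p + c) rfl y
  have h2 := smul_tmk (K := J) (L := G) (p := a) (q := p + c) (n := q) k (by omega) s (D.tgt t) x
    (z.v p (p + c) rfl y)
  refine Eq.trans ?_ h2.symm
  exact congrArg (fun w => tmk (k := k) (K := J) (L := G) (p := a) (q := p + c) (n := q) (by omega)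
    (s • x) w) h1

/-- No sign is needed in `y ↦ x ⊗ z(y)`, because `x`, `z` and `y` keep their order. -/
lemma δ_tensCochain : δ n (n + 1) (D.tensCochain J G h x z) =
    D.tensCochain J G (by omega) (J.d a (a + 1) x) z +
      a.negOnePow • D.tensCochain J G (by omega) x (δ c (c + 1) z) := by
  refine cochain_hom_ext fun p q hpq y => ?_
  rw [δ_v n (n + 1) rfl _ p q hpq (p + n) (p + 1) (by omega) (by omega)]
  have h1 : (δ c (c + 1) z).v p (p + c + 1) (by omega) y =
      ((D.res G).d (p + c) (p + c + 1) (z.v p (p + c) rfl y) +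
        (c + 1).negOnePow • z.v (p + 1) (p + c + 1) (by omega) (P.d p (p + 1) y) :
          (D.res G).X (p + c + 1)) := by
    rw [δ_v c (c + 1) rfl z p (p + c + 1) (by omega) (p + c) (p + 1) (by omega) (by omega)]
    rfl
  have h2 := d_tmk (K := J) (L := G) (p := a) (q := p + c) (n := p + n) (m := q) k (by omega)
    (by omega) rfl rfl x (z.v p (p + c) rfl y)
  have h3 := D.tensCochain_v J G h x z (p + 1) q (p + c + 1) (by omega) (by omega) (by omega)
    (P.d p (p + 1) y)
  have h4 := D.tensCochain_v J G (n := n + 1) (by omega) x (δ c (c + 1) z) p q (p + c + 1) hpq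
    (by omega) (by omega) y
  have key : (tens k J G).d (p + n) q (tmk (k := k) (K := J) (L := G) (by omega) x
      (z.v p (p + c) rfl y)) + (n + 1).negOnePow •
        (tmk (k := k) (K := J) (L := G) (by omega) x
          (z.v (p + 1) (p + c + 1) (by omega) (P.d p (p + 1) y)) : (tens k J G).X q) =
      tmk (k := k) (K := J) (L := G) (n := q) (by omega) (J.d a (a + 1) x) (z.v p (p + c) rfl y) +
        a.negOnePow • tmk (k := k) (K := J) (L := G) (n := q) (by omega) x
          ((G.d (p + c) (p + c + 1) (z.v p (p + c) rfl y) +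
            (c + 1).negOnePow • (show G.X (p + c + 1) from
              z.v (p + 1) (p + c + 1) (by omega) (P.d p (p + 1) y)))) := by
    rw [h2, tmk_add_right, tmk_units_smul_right, smul_add, smul_smul, ← Int.negOnePow_add,
      show a + (c + 1) = n + 1 by omega, add_assoc]
  refine Eq.trans ?_ (key.trans ?_)
  · exact congrArg (fun w => (tens k J G).d (p + n) q (tmk (k := k) (K := J) (L := G) (by omega) x
      (z.v p (p + c) rfl y)) + (n + 1).negOnePow • w) h3
  · exact congrArg (fun w => tmk (k := k) (K := J) (L := G) (n := q) (by omega) (J.d a (a + 1) x)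
      (z.v p (p + c) rfl y) + a.negOnePow • w) ((congrArg (fun w => tmk (k := k) (K := J) (L := G)
        (n := q) (by omega) x w) h1.symm).trans h4.symm)

end

variable {G} {E : CochainComplex (ModuleCat.{u} (X ⊗[k] S)) ℤ} (ι : tens k J G ⟶ E)

/-- The map `(x, z) ↦ (y ↦ x ⊗ z(y))`. -/
noncomputable def tensHomBi (G : CochainComplex (ModuleCat.{u} S) ℤ) {a c n : ℤ} (h : a + c = n) :
    J.X a →+ (D.homCplx P G).X c →+ ((D.ext X).homCplx P (tens k J G)).X n :=
  AddMonoidHom.mk' (fun x => AddMonoidHom.mk' (fun z => D.tensCochain J G h x z)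
    (D.tensCochain_add_right J G h x)) (fun x x' => AddMonoidHom.ext fun z =>
      D.tensCochain_add_left J G h x x' z)

/-- The morphism `J ⊗ Hom_Λ(P, G) → Hom_Λ(P, J ⊗ G)`, `x ⊗ z ↦ (y ↦ x ⊗ z(y))`. -/
noncomputable def tensHom (G : CochainComplex (ModuleCat.{u} S) ℤ) :
    tens k J (D.homCplx P G) ⟶ (D.ext X).homCplx P (tens k J G) :=
  tensDesc (K := J) (L := D.homCplx P G) (G := (D.ext X).homCplx P (tens k J G))
    (fun _ _ _ h => D.tensHomBi J P G h)
    (fun _ _ _ h s t x z => D.tensCochain_smul J G h x z s t)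
    (fun _ _ _ h x z => D.δ_tensCochain J G h x z)

lemma tensHom_tmk {a c n : ℤ} (h : a + c = n) (x : J.X a) (z : Cochain P (D.res G) c) :
    (D.tensHom J P G).f n (tmk (L := D.homCplx P G) h x z) = D.tensCochain J G h x z :=
  tensDesc_tmk (K := J) (L := D.homCplx P G) (G := (D.ext X).homCplx P (tens k J G))
    (fun _ _ _ h => D.tensHomBi J P G h) _ _ h x z

/-- The morphism `J ⊗ Hom_Λ(P, G) → Hom_Λ(P, E)` induced by `J ⊗ G → E`. -/
noncomputable def tensHomTo : tens k J (D.homCplx P G) ⟶ (D.ext X).homCplx P E :=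
  D.tensHom J P G ≫ (D.ext X).mapRight P ι

variable {P P'} in
lemma tensHomTo_naturality (f : P' ⟶ P) :
    tensMap k (𝟙 J) (D.mapLeft f G) ≫ D.tensHomTo J P' ι =
      D.tensHomTo J P ι ≫ (D.ext X).mapLeft f E := by
  dsimp only [tensHomTo]
  rw [Category.assoc, ← mapLeft_mapRight, ← Category.assoc, ← Category.assoc]
  congr 1
  ext1 n
  apply tens_hom_ext
  intro a c h x (z : Cochain P (D.res G) c)
  have h1 := congrArg ((D.tensHom J P' G).f n)
    (tensMap_tmk k (𝟙 J) (D.mapLeft f G) h x z)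
  have h2 := D.tensHom_tmk J P' (G := G) h x ((Cochain.ofHom f).comp z (zero_add c))
  have h3 := congrArg (((D.ext X).mapLeft f (tens k J G)).f n) (D.tensHom_tmk J P h x z)
  refine (h1.trans h2).trans (Eq.trans ?_ h3.symm)
  refine cochain_hom_ext fun p q hpq y => ?_
  have h4 : ((Cochain.ofHom f).comp z (zero_add c)).v p (p + c) rfl y = z.v p (p + c) rfl (f.f p y) := by
    rw [Cochain.zero_cochain_comp_v, Cochain.ofHom_v]
    rfl
  have h5 : ((Cochain.ofHom f).comp (D.tensCochain J G h x z) (zero_add n)).v p q hpq y =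
      (D.tensCochain J G h x z).v p q hpq (f.f p y) := by
    rw [Cochain.zero_cochain_comp_v, Cochain.ofHom_v]
    rfl
  refine Eq.trans ?_ h5.symm
  exact congrArg (fun w => tmk (k := k) (K := J) (L := G) (p := a) (q := p + c) (n := q) (by omega) x w) h4

/-- For `P = Λ` evaluation at the generator identifies the map with `J ⊗ G → E` itself; this is the
base case of the dévissage. -/
lemma tensHomTo_singleRing : D.tensHomTo J (singleRing Λ 0) ι ≫ (D.ext X).evalOne E =
    tensMap k (𝟙 J) (D.evalOne G) ≫ tensResRight J G D.tgt ≫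
      (onCplx (resMod (Algebra.TensorProduct.map (AlgHom.id k X) D.tgt))).map ι := by
  ext1 n
  apply tens_hom_ext
  intro a c h x (z : Cochain (singleRing Λ 0) (D.res G) c)
  have h1 := congrArg (fun w => ((D.ext X).evalOne E).f n (((D.ext X).mapRight (singleRing Λ 0) ι).f n w))
    (D.tensHom_tmk J (singleRing Λ 0) h x z)
  have h2 := congrArg (fun w => ι.f n ((tensResRight J G D.tgt).f n w))
    (tensMap_tmk k (𝟙 J) (D.evalOne G) h x z)
  have h3 := congrArg (ι.f n) (tensResRight_tmk J G D.tgt h x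
    (z.v 0 c (zero_add c) (genOne Λ)))
  refine h1.trans (Eq.trans ?_ (h2.trans h3).symm)
  have h4 := D.tensCochain_v J G h x z 0 n c (by omega) (by omega) (by omega) (genOne Λ)
  have h5 : ((D.tensCochain J G h x z).comp (Cochain.ofHom ((onCplx (resMod (D.ext X).src)).map ι))
      (add_zero n)).v 0 n (by omega) (genOne Λ) =
      ((onCplx (resMod (D.ext X).src)).map ι).f n ((D.tensCochain J G h x z).v 0 n (by omega) (genOne Λ)) := by
    rw [Cochain.comp_zero_cochain_v, Cochain.ofHom_v]
    rfl
  refine h5.trans ?_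
  exact congrArg (ι.f n) h4

/-- The morphism `J ⊗ Hom_Λ(P, G) → Hom_Λ(P, E)` is a quasi-isomorphism if `J ⊗ G → E` is. -/
theorem quasiIso_tensHomTo [IsNoetherianRing Λ] (m a b e : ℤ) [P.IsLE m] (hP : NoethHomology P)
    [J.IsStrictlyGE a] [G.IsStrictlyGE b] [E.IsStrictlyGE e] [(D.res G).IsKInjective]
    [((D.ext X).res E).IsKInjective] [QuasiIso ι] : QuasiIso (D.tensHomTo J P ι) := by
  let s₁ (S : ShortComplex (CochainComplex (ModuleCat.{u} Λ) ℤ)) := tensSC k J (D.homSC S G)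
  let s₂ (S : ShortComplex (CochainComplex (ModuleCat.{u} Λ) ℤ)) := (D.ext X).homSC S E
  have hs₁ {S : ShortComplex (CochainComplex (ModuleCat.{u} Λ) ℤ)} (hS : DegreewiseSplit S) :
      (s₁ S).ShortExact :=
    (degreewiseSplit_tensSC k (D.degreewiseSplit_homSC (G := G) hS)).shortExact
  have hs₂ {S : ShortComplex (CochainComplex (ModuleCat.{u} Λ) ℤ)} (hS : DegreewiseSplit S) :
      (s₂ S).ShortExact := ((D.ext X).degreewiseSplit_homSC (G := E) hS).shortExact
  let φ (S : ShortComplex (CochainComplex (ModuleCat.{u} Λ) ℤ)) : s₁ S ⟶ s₂ S :=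
    ShortComplex.Hom.mk (D.tensHomTo J S.X₃ ι) (D.tensHomTo J S.X₂ ι) (D.tensHomTo J S.X₁ ι)
      (D.tensHomTo_naturality J ι S.g).symm (D.tensHomTo_naturality J ι S.f).symm
  have hiso (K L : CochainComplex (ModuleCat.{u} Λ) ℤ) (e : K ≅ L)
      (h : QuasiIso (D.tensHomTo J K ι)) : QuasiIso (D.tensHomTo J L ι) := by
    have h1 := D.tensHomTo_naturality J ι e.inv
    have : IsIso (D.mapLeft e.inv G) := (D.mapLeftIso e G).isIso_hom
    have : IsIso ((D.ext X).mapLeft e.inv E) := ((D.ext X).mapLeftIso e E).isIso_hom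
    have h2 : QuasiIso (tensMap k (𝟙 J) (D.mapLeft e.inv G) ≫ D.tensHomTo J L ι) := by
      rw [h1]
      infer_instance
    exact quasiIso_of_comp_left (tensMap k (𝟙 J) (D.mapLeft e.inv G)) _
  have base (n : ℤ) : QuasiIso (D.tensHomTo J (singleRing Λ n) ι) := by
    refine single_induction (fun K => QuasiIso (D.tensHomTo J K ι)) hiso ?_ _ ?_ n
    · intro S hS hc
      have h1 := hs₁ hS
      have h2 := hs₂ hS
      have hc' : (tens k J (D.homCplx S.X₂ G)).Acyclic :=
        acyclic_tens k (D.acyclic_homCplx S.X₂ G hc)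
      have hc'' : ((D.ext X).homCplx S.X₂ E).Acyclic := (D.ext X).acyclic_homCplx S.X₂ E hc
      have : QuasiIso (φ S).τ₂ := quasiIso_of_epiMono _ fun i =>
        epiMono_of_exactAt _ i (hc'' i) (hc' (i + 1))
      refine ⟨fun h => ?_, fun h => ?_⟩
      · have : QuasiIso (φ S).τ₃ := h
        exact quasiIso_τ₁ (φ S) h1 h2
      · have : QuasiIso (φ S).τ₁ := h
        exact HomologicalComplex.HomologySequence.quasiIso_τ₃ (φ S) h1 h2 this inferInstance
    · have h1 := D.tensHomTo_singleRing J ι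
      have h2 : QuasiIso ((onCplx (resMod (Algebra.TensorProduct.map (AlgHom.id k X) D.tgt))).map ι) :=
        HomologicalComplex.quasiIso_map_of_preservesHomology ι
          (resMod (Algebra.TensorProduct.map (AlgHom.id k X) D.tgt))
      have h3 : QuasiIso (D.tensHomTo J (singleRing Λ 0) ι ≫ (D.ext X).evalOne E) := by
        rw [h1]
        have h4 : QuasiIso (tensMap k (𝟙 J) (D.evalOne G)) := inferInstance
        have h5 : QuasiIso (tensResRight J G D.tgt) := inferInstance
        have h6 : QuasiIso (tensResRight J G D.tgt ≫
          (onCplx (resMod (Algebra.TensorProduct.map (AlgHom.id k X) D.tgt))).map ι) :=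
            quasiIso_comp _ _
        exact quasiIso_comp (hφ := h4) (hφ' := h6)
      exact quasiIso_of_comp_right _ ((D.ext X).evalOne E)
  refine quasiIso_of_epiMono _ fun i => ?_
  -- For `K` in degrees at most `N` the source lies in degrees at least `a + b - N` and the target
  -- in degrees at least `e - N`. The source must vanish in degree `i + 1` and the target in degree
  -- `i`.
  refine devissage (fun K => EpiMono (D.tensHomTo J K ι) i) ?_ (min (a + b - i - 2) (e - i - 1)) ?_ P m
    inferInstance hP
  · rintro S hS n ⟨e⟩ h
    have : QuasiIso (φ S).τ₁ := hiso _ _ e.symm (base n)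
    exact epiMono_τ₃ (φ S) (hs₁ hS) (hs₂ hS) i h
  · intro K hK
    set N := min (a + b - i - 2) (e - i - 1) with hN
    have h1 : N ≤ a + b - i - 2 := min_le_left _ _
    have h2 : N ≤ e - i - 1 := min_le_right _ _
    have := D.isGE_homCplx (F := K) (G := G) N b (b - N) (by omega)
    have := isGE_tens k (K := J) (L := D.homCplx K G) a (b - N) (i + 2) (by omega)
    have := (D.ext X).isGE_homCplx (F := K) (G := E) N e (i + 1) (by omega)
    exact epiMono_of_exactAt _ i (exactAt_of_isGE _ (i + 1) i (by omega))
      (exactAt_of_isGE _ (i + 2) (i + 1) (by omega))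

end ActPair

end TensHom

lemma quasiIso_of_homotopy {C : Type*} [Category* C] [Abelian C] {K L : CochainComplex C ℤ}
    {f g : K ⟶ L} (h : Nonempty (Homotopy f g)) [QuasiIso f] : QuasiIso g := by
  refine (quasiIso_iff g).2 fun i => ?_
  rw [quasiIsoAt_iff_isIso_homologyMap, ← h.some.homologyMap_eq i]
  infer_instance

/-- Allows self-vanishing of `K` to be used for maps from `K` to a complex that is only known to be
quasi-isomorphic to it over `Λ`. -/
lemma VanishNeg.of_quasiIso {C : Type*} [Category* C] [Abelian C] {M N N' : CochainComplex C ℤ}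
    (h : VanishNeg M N) (ψ : N ⟶ N') [QuasiIso ψ] [N.IsKInjective] [N'.IsKInjective] :
    VanishNeg M N' := by
  intro i j l hi hj hl z hz
  obtain ⟨y, w, hy, hw⟩ := postcomp_surj ψ hj hl z hz
  obtain ⟨v, hv⟩ := h i j l hi hj hl y hy
  refine ⟨v.comp (Cochain.ofHom ψ) (add_zero l) - w, ?_⟩
  rw [δ_sub, δ_comp_ofHom, hv, hw, add_sub_cancel_right]

namespace ActPair

/-! ### The functor `Hom_Q(M, -)` on complexes of `Z`-modules. -/

section HomFun

attribute [local instance] ModuleCat.moduleOfAlgebraModule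
  ModuleCat.isScalarTower_of_algebra_moduleCat

variable {k Q T Z : Type u} [Field k] [Ring Q] [Ring T] [Ring Z] [Algebra k Q] [Algebra k T]
  [Algebra k Z] (O : ActPair k Q T Z) (M : ModuleCat.{u} Q)

/-- The data defining `Hom_Q(M, -)`, with no action on `M`. -/
noncomputable def homDatum : HomDatum k Q k T Z where
  src := O.src
  tgt := O.tgt
  comm := O.comm
  M := M
  act := Algebra.ofId k _

/-- The functor `Hom_Q(M, -)` from `Z`-modules to `T`-modules. -/
noncomputable def homFun : ModuleCat.{u} Z ⥤ ModuleCat.{u} T :=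
  (O.homDatum M).functor ⋙ resMod Algebra.TensorProduct.includeRight

instance : (O.homFun M).Additive := by
  dsimp only [homFun]
  infer_instance

/-- Elements of `Hom_Q(M, N)`. -/
noncomputable def homFunEquiv (N : ModuleCat.{u} Z) : (O.homFun M).obj N ≃+ (M →ₗ[Q] (resMod O.src).obj N) :=
  AddEquiv.refl _

lemma homFunEquiv_smul (N : ModuleCat.{u} Z) (t : T) (h : (O.homFun M).obj N) (m : M) :
    (show N from O.homFunEquiv M N (t • h) m) = O.tgt t • (show N from O.homFunEquiv M N h m) :=
  congrArg (fun w : M →ₗ[Q] (resMod O.src).obj N => (show N from w m))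
    ((O.homDatum M).action_one_tmul N t h)

variable {M} in
lemma homFun_ext {N : ModuleCat.{u} Z} {h h' : (O.homFun M).obj N}
    (w : ∀ m, O.homFunEquiv M N h m = O.homFunEquiv M N h' m) : h = h' :=
  (O.homFunEquiv M N).injective (LinearMap.ext w)

variable {M} in
/-- Construction of morphisms to `Hom_Q(M, N)`. -/
noncomputable def homFunLift {V : ModuleCat.{u} T} {N : ModuleCat.{u} Z} (g : V →+ (M →ₗ[Q] (resMod O.src).obj N))
    (hg : ∀ (t : T) (v : V) (m : M), (show N from g (t • v) m) = O.tgt t • (show N from g v m)) :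
    V ⟶ (O.homFun M).obj N :=
  ModuleCat.ofHom (Y := (O.homFun M).obj N)
    { toFun v := (O.homFunEquiv M N).symm (g v)
      map_add' v w := (congrArg _ (map_add g v w)).trans (map_add _ _ _)
      map_smul' t v := O.homFun_ext fun m => (hg t v m).trans
        (O.homFunEquiv_smul M N t ((O.homFunEquiv M N).symm (g v)) m).symm }

/-- `Hom_Q(M, E)` is injective over `T` if `E` is injective over `T ⊗ₖ Q`. -/
lemma injective_homFun (E : ModuleCat.{u} Z)
    (hE : Injective ((resMod (liftComm O.src O.tgt O.comm)).obj E)) :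
    Injective ((O.homFun M).obj E) := by
  refine ⟨fun {P P'} g i _ => ?_⟩
  obtain ⟨g', h1, h2⟩ := exists_extension_hom O.src O.tgt O.comm E hE M i
    ((O.homFunEquiv M E).toAddMonoidHom.comp g.hom.toAddMonoidHom) (fun t p m =>
      (congrArg (fun w => (show E from O.homFunEquiv M E w m)) (map_smul g.hom t p)).trans
        (O.homFunEquiv_smul M E t (g p) m))
  refine ⟨O.homFunLift g' h1, ?_⟩
  refine ModuleCat.hom_ext (LinearMap.ext fun (x : P) => O.homFun_ext fun m => ?_)
  exact DFunLike.congr_fun (h2 x) m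

/-- The functor `Hom_Q(M, -)` preserves quasi-isomorphisms between complexes which are K-injective
over `Q`. -/
lemma quasiIso_homFun {X X' : CochainComplex (ModuleCat.{u} Z) ℤ} (g : X ⟶ X') [QuasiIso g]
    [(O.res X).IsKInjective] [(O.res X').IsKInjective] :
    QuasiIso ((onCplx (O.homFun M)).map g) := by
  have : QuasiIso ((onCplx (resMod O.src)).map g) :=
    HomologicalComplex.quasiIso_map_of_preservesHomology g (resMod O.src)
  -- The homotopy inverse is linear over `Q` only, but this is enough to compare cycles and
  -- boundaries in `Hom_Q(M, -)`.
  obtain ⟨ρ, h1, h2⟩ := exists_homotopyEquiv ((onCplx (resMod O.src)).map g)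
  obtain ⟨s, hs⟩ := exists_cochain_of_homotopy h1
  obtain ⟨s', hs'⟩ := exists_cochain_of_homotopy h2
  -- On a cycle `M → W^j`, an endomorphism homotopic to the identity changes the map by a boundary;
  -- the other term of the homotopy vanishes there.
  have key {W : CochainComplex (ModuleCat.{u} Q) ℤ} {f : W ⟶ W} {s : Cochain W W (-1)}
      (hs : Cochain.ofHom f = Cochain.ofHom (𝟙 W) + δ (-1) 0 s) (i j l : ℤ) (hij : i + 1 = j)
      (hjl : j + 1 = l) (x : M ⟶ W.X j) (hx : x ≫ W.d j l = 0) :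
      x ≫ f.f j = x + (x ≫ s.v j i (by omega)) ≫ W.d i j := by
    have h := Cochain.congr_v hs j j (add_zero j)
    rw [Cochain.add_v, δ_v (-1) 0 rfl s j j _ i l (by omega) (by omega), Cochain.ofHom_v,
      Cochain.ofHom_v] at h
    rw [h, Preadditive.comp_add, Preadditive.comp_add, HomologicalComplex.id_f, Category.comp_id]
    rw [Linear.comp_units_smul, reassoc_of% hx, zero_comp, smul_zero, add_zero, Category.assoc]
  rw [mod_quasiIso_iff]
  refine ⟨fun i j l hij hjl x y hx hy => ?_, fun i j l hij hjl y hy => ?_⟩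
  · let x' : M ⟶ (O.res X).X j := ModuleCat.ofHom (Y := (O.res X).X j) (O.homFunEquiv M _ x)
    let y' : M ⟶ (O.res X').X i := ModuleCat.ofHom (Y := (O.res X').X i) (O.homFunEquiv M _ y)
    have hx' : x' ≫ (O.res X).d j l = 0 :=
      ModuleCat.hom_ext (LinearMap.ext fun m => DFunLike.congr_fun (congrArg (O.homFunEquiv M _) hx) m)
    have hy' : y' ≫ (O.res X').d i j = x' ≫ ((onCplx (resMod O.src)).map g).f j :=
      ModuleCat.hom_ext (LinearMap.ext fun m => DFunLike.congr_fun (congrArg (O.homFunEquiv M _) hy) m)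
    have h := key hs i j l hij hjl x' hx'
    have h' : (y' ≫ ρ.f i - x' ≫ s.v j i (by omega)) ≫ (O.res X).d i j = x' := by
      rw [Preadditive.sub_comp, Category.assoc, ρ.comm, reassoc_of% hy', ← HomologicalComplex.comp_f, h,
        add_sub_cancel_right]
    refine ⟨(O.homFunEquiv M _).symm (y' ≫ ρ.f i - x' ≫ s.v j i (by omega)).hom, ?_⟩
    exact O.homFun_ext fun m => DFunLike.congr_fun (congrArg ModuleCat.Hom.hom h') m
  · let y' : M ⟶ (O.res X').X j := ModuleCat.ofHom (Y := (O.res X').X j) (O.homFunEquiv M _ y)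
    have hy' : y' ≫ (O.res X').d j l = 0 :=
      ModuleCat.hom_ext (LinearMap.ext fun m => DFunLike.congr_fun (congrArg (O.homFunEquiv M _) hy) m)
    have h := key hs' i j l hij hjl y' hy'
    have h' : (y' ≫ ρ.f j) ≫ (O.res X).d j l = 0 := by
      rw [Category.assoc, ρ.comm, reassoc_of% hy', zero_comp]
    refine ⟨(O.homFunEquiv M _).symm (y' ≫ ρ.f j).hom,
      (O.homFunEquiv M _).symm (y' ≫ s'.v j i (by omega)).hom, ?_, ?_⟩
    · exact O.homFun_ext fun m => DFunLike.congr_fun (congrArg ModuleCat.Hom.hom h') m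
    · rw [HomologicalComplex.comp_f, ← Category.assoc] at h
      exact O.homFun_ext fun m => DFunLike.congr_fun (congrArg ModuleCat.Hom.hom h) m

end HomFun

end ActPair

namespace ActPair

/-! ### Exchanging two Hom functors. -/

section Exchange

attribute [local instance] ModuleCat.moduleOfAlgebraModule
  ModuleCat.isScalarTower_of_algebra_moduleCat

variable {k Q Λ T S Z' Z : Type u} [Field k] [Ring Q] [Ring Λ] [Ring T] [Ring S] [Ring Z'] [Ring Z]
  [Algebra k Q] [Algebra k Λ] [Algebra k T] [Algebra k S] [Algebra k Z'] [Algebra k Z]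
  (M : ModuleCat.{u} Q)

/-- Compatible actions, for which `Hom_Λ(P, Hom_Q(M, E)) ≅ Hom_Q(M, Hom_Λ(P, E))`. -/
structure Compat (D : ActPair k Λ T S) (D' : ActPair k Λ Z' Z) (O : ActPair k Q S Z)
    (O' : ActPair k Q T Z') : Prop where
  src_eq : ∀ s, O.src s = D'.tgt (O'.src s)
  tgt_eq : ∀ t, O.tgt (D.tgt t) = D'.tgt (O'.tgt t)
  tgt_src_eq : ∀ a, O.tgt (D.src a) = D'.src a

variable {D : ActPair k Λ T S} {D' : ActPair k Λ Z' Z} {O : ActPair k Q S Z} {O' : ActPair k Q T Z'}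
  (H : Compat D D' O O')
  {P P' : CochainComplex (ModuleCat.{u} Λ) ℤ} {E : CochainComplex (ModuleCat.{u} Z) ℤ}

variable {M}

/-- The cochain `y ↦ z(y)(m)`. -/
noncomputable def exchCochain {n : ℤ} (z : Cochain P (D.res ((onCplx (O.homFun M)).obj E)) n) (m : M) :
    Cochain P (D'.res E) n :=
  Cochain.mk fun p q hpq => ModuleCat.ofHom (Y := (D'.res E).X q)
    { toFun y := O.homFunEquiv M (E.X q) (z.v p q hpq y) m
      map_add' x y := (congrArg (fun w => O.homFunEquiv M (E.X q) w m) (map_add (z.v p q hpq).hom x y))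
      map_smul' a y := (congrArg (fun w => O.homFunEquiv M (E.X q) w m)
        (map_smul (z.v p q hpq).hom a y)).trans ((O.homFunEquiv_smul M (E.X q) (D.src a) _ m).trans
          (congrArg (fun w : Z => w • (show E.X q from O.homFunEquiv M (E.X q) (z.v p q hpq y) m))
            (H.tgt_src_eq a))) }

lemma exchCochain_smul_right {n : ℤ} (z : Cochain P (D.res ((onCplx (O.homFun M)).obj E)) n) (s : Q)
    (m : M) : exchCochain H z (s • m) = D'.smulC (O'.src s) (exchCochain H z m) := by
  refine cochain_hom_ext fun p q hpq y => ?_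
  refine Eq.trans ?_ (D'.smulC_v (F := P) (O'.src s) (exchCochain H z m) p q hpq y).symm
  refine (map_smul (O.homFunEquiv M (E.X q) (z.v p q hpq y)) s m).trans ?_
  exact congrArg (fun w : Z => w • (show E.X q from O.homFunEquiv M (E.X q) (z.v p q hpq y) m))
    (H.src_eq s)

lemma exchCochain_smul {n : ℤ} (z : Cochain P (D.res ((onCplx (O.homFun M)).obj E)) n) (t : T)
    (m : M) : exchCochain H (D.smulC t z) m = D'.smulC (O'.tgt t) (exchCochain H z m) := by
  refine cochain_hom_ext fun p q hpq y => ?_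
  refine Eq.trans ?_ (D'.smulC_v (F := P) (O'.tgt t) (exchCochain H z m) p q hpq y).symm
  refine (congrArg (fun w => O.homFunEquiv M (E.X q) w m)
    (D.smulC_v (F := P) t z p q hpq y)).trans ?_
  refine (O.homFunEquiv_smul M (E.X q) (D.tgt t) _ m).trans ?_
  exact congrArg (fun w : Z => w • (show E.X q from O.homFunEquiv M (E.X q) (z.v p q hpq y) m))
    (H.tgt_eq t)

lemma δ_exchCochain {n n' : ℤ} (hn : n + 1 = n')
    (z : Cochain P (D.res ((onCplx (O.homFun M)).obj E)) n)
    (m : M) : δ n n' (exchCochain H z m) = exchCochain H (δ n n' z) m := by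
  refine cochain_hom_ext fun p q hpq y => ?_
  have h : (δ n n' z).v p q hpq y = (D.res ((onCplx (O.homFun M)).obj E)).d (p + n) q (z.v p (p + n) rfl y)
      + n'.negOnePow • z.v (p + 1) q (by omega) (P.d p (p + 1) y) := by
    rw [δ_v n n' hn z p q hpq (p + n) (p + 1) (by omega) (by omega)]
    rfl
  rw [δ_v n n' hn _ p q hpq (p + n) (p + 1) (by omega) (by omega)]
  refine Eq.trans ?_ (congrArg (fun w => O.homFunEquiv M (E.X q) w m) h).symm
  rw [Units.smul_def, Units.smul_def]
  refine Eq.trans ?_ (congrArg (fun w : M →ₗ[Q] (resMod O.src).obj (E.X q) => w m)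
    (((O.homFunEquiv M (E.X q)).map_add _ _).trans (congrArg _
      ((O.homFunEquiv M (E.X q)).toAddMonoidHom.map_zsmul _ _)))).symm
  rfl

/-- The morphism `Hom_Λ(P, Hom_Q(M, E)) → Hom_Q(M, Hom_Λ(P, E))`. -/
noncomputable def exch (P : CochainComplex (ModuleCat.{u} Λ) ℤ)
    (E : CochainComplex (ModuleCat.{u} Z) ℤ) : D.homCplx P ((onCplx (O.homFun M)).obj E) ⟶
      (onCplx (O'.homFun M)).obj (D'.homCplx P E) where
  f n := O'.homFunLift (V := (D.homCplx P ((onCplx (O.homFun M)).obj E)).X n)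
      (N := (D'.homCplx P E).X n)
    { toFun z :=
        { toFun m := exchCochain H z m
          map_add' m m' := cochain_hom_ext fun p q hpq y =>
            map_add (O.homFunEquiv M (E.X q) (Cochain.v (F := P)
              (G := D.res ((onCplx (O.homFun M)).obj E)) z p q hpq y)) m m'
          map_smul' s m := exchCochain_smul_right H z s m }
      map_zero' := rfl
      map_add' z z' := rfl } (fun t z m => exchCochain_smul H z t m)
  comm' n n' hn := by
    refine ModuleCat.hom_ext (LinearMap.ext fun (z : Cochain P (D.res ((onCplx (O.homFun M)).obj E)) n) =>
      O'.homFun_ext fun m => ?_)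
    exact δ_exchCochain H hn z m

lemma exch_naturality (u : P' ⟶ P) : D.mapLeft u ((onCplx (O.homFun M)).obj E) ≫ exch H P' E =
    exch H P E ≫ (onCplx (O'.homFun M)).map (D'.mapLeft u E) := by
  ext1 n
  refine ModuleCat.hom_ext (LinearMap.ext fun (z : Cochain P (D.res ((onCplx (O.homFun M)).obj E)) n) =>
      O'.homFun_ext fun m => cochain_hom_ext fun p q hpq y => ?_)
  have h1 : ((Cochain.ofHom u).comp z (zero_add n)).v p q hpq y = z.v p q hpq (u.f p y) := by
    rw [Cochain.zero_cochain_comp_v, Cochain.ofHom_v]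
    rfl
  have h2 : ((Cochain.ofHom u).comp (exchCochain H z m) (zero_add n)).v p q hpq y =
      (exchCochain H z m).v p q hpq (u.f p y) := by
    rw [Cochain.zero_cochain_comp_v, Cochain.ofHom_v]
    rfl
  refine Eq.trans ?_ h2.symm
  exact congrArg (fun w => O.homFunEquiv M (E.X q) w m) h1

/-- Both sides are maps of the two variables `y` and `m`, linear over `Λ` and over `Q`; the inverse
reads them in the other order. -/
instance : IsIso (exch (M := M) H P E) := by
  have (n : ℤ) : IsIso ((exch (M := M) H P E).f n) := by
    rw [ConcreteCategory.isIso_iff_bijective]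
    constructor
    · intro (z : Cochain P (D.res ((onCplx (O.homFun M)).obj E)) n)
        (z' : Cochain P (D.res ((onCplx (O.homFun M)).obj E)) n) h
      refine cochain_hom_ext fun p q hpq y => O.homFun_ext fun m => ?_
      exact congrArg (fun w : Cochain P (D'.res E) n => w.v p q hpq y)
        (congrArg (fun w => O'.homFunEquiv M ((D'.homCplx P E).X n) w m) h)
    · intro w
      let w' (m : M) : Cochain P (D'.res E) n := O'.homFunEquiv M ((D'.homCplx P E).X n) w m
      have hs (s : Q) (m : M) (p q : ℤ) (hpq : p + n = q) (y : P.X p) :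
          (w' (s • m)).v p q hpq y = (show E.X q from O.src s • (show E.X q from (w' m).v p q hpq y)) := by
        refine (congrArg (fun v : Cochain P (D'.res E) n => v.v p q hpq y)
          (map_smul (O'.homFunEquiv M ((D'.homCplx P E).X n) w) s m)).trans ?_
        refine (D'.smulC_v (F := P) (O'.src s) (w' m) p q hpq y).trans ?_
        exact congrArg (fun v : Z => v • (show E.X q from (w' m).v p q hpq y)) (H.src_eq s).symm
      let G (p q : ℤ) (hpq : p + n = q) (y : P.X p) : (O.homFun M).obj (E.X q) :=
        (O.homFunEquiv M (E.X q)).symm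
          { toFun m := (w' m).v p q hpq y
            map_add' m m' := congrArg (fun v : Cochain P (D'.res E) n => v.v p q hpq y)
              (map_add (O'.homFunEquiv M ((D'.homCplx P E).X n) w) m m')
            map_smul' s m := hs s m p q hpq y }
      refine ⟨(Cochain.mk fun p q hpq => ModuleCat.ofHom
        (Y := (D.res ((onCplx (O.homFun M)).obj E)).X q)
        { toFun y := G p q hpq y
          map_add' y y' := O.homFun_ext fun m => map_add ((w' m).v p q hpq).hom y y'
          map_smul' a y := O.homFun_ext fun m => (map_smul ((w' m).v p q hpq).hom a y).trans
            ((congrArg (fun v : Z => v • (show E.X q from (w' m).v p q hpq y))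
              (H.tgt_src_eq a).symm).trans
                (O.homFunEquiv_smul M (E.X q) (D.src a) (G p q hpq y) m).symm) } :
            Cochain P (D.res ((onCplx (O.homFun M)).obj E)) n), ?_⟩
      refine O'.homFun_ext fun m => cochain_hom_ext fun p q hpq y => ?_
      rfl
  exact HomologicalComplex.Hom.isIso_of_components _

end Exchange

end ActPair

/-! ### Restriction of scalars and cohomological bounds. -/

section Bounds

variable {k : Type u} [Field k] {S T : Type u} [Ring S] [Ring T] [Algebra k S] [Algebra k T]

lemma isStrictlyGE_onCplx {C D : Type*} [Category* C] [Category* D] [Abelian C] [Abelian D]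
    (F : C ⥤ D) [F.Additive] (K : CochainComplex C ℤ) (n : ℤ) [K.IsStrictlyGE n] :
    ((onCplx F).obj K).IsStrictlyGE n := by
  rw [isStrictlyGE_iff]
  exact fun i hi => F.map_isZero (K.isZero_of_isStrictlyGE n i hi)

lemma isLE_resMod (φ : S →ₐ[k] T) (K : CochainComplex (ModuleCat.{u} T) ℤ) (n : ℤ) [K.IsLE n] :
    ((onCplx (resMod φ)).obj K).IsLE n := by
  rw [isLE_iff]
  intro i hi
  have h := K.exactAt_of_isLE n i hi
  rw [mod_exactAt_iff _ (i - 1) i (i + 1) (by omega) rfl] at h ⊢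
  exact h

lemma quasiIso_resMod_iff (φ : S →ₐ[k] T) {K L : CochainComplex (ModuleCat.{u} T) ℤ} (f : K ⟶ L) :
    QuasiIso ((onCplx (resMod φ)).map f) ↔ QuasiIso f :=
  HomologicalComplex.quasiIso_map_iff_of_preservesHomology f (resMod φ)

end Bounds

namespace ActPair

/-! ### The isomorphism `K ≅ RHom_Q(M, J ⊗ K)` for rigid `J`. -/

section Half

variable {k : Type u} [Field k]

/-- If the terms of `E` are injective over `Q ⊗ₖ Λ`, those of `Hom_Λ(P, E)` are injective over `Q`. -/
lemma injective_homCplx {Λ Z' Z Q : Type u} [Ring Λ] [Ring Z'] [Ring Z] [Ring Q] [Algebra k Λ]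
    [Algebra k Z'] [Algebra k Z] [Algebra k Q] (D : ActPair k Λ Z' Z) (ν : Q →ₐ[k] Z')
    (P : CochainComplex (ModuleCat.{u} Λ) ℤ) (E : CochainComplex (ModuleCat.{u} Z) ℤ)
    (h : ∀ s t, Commute (D.src s) ((D.tgt.comp ν) t))
    (hE : ∀ p, Injective ((resMod (liftComm D.src (D.tgt.comp ν) h)).obj (E.X p))) (n : ℤ) :
    Injective ((resMod ν).obj ((D.homCplx P E).X n)) := by
  refine ⟨fun {A B} g i _ => ?_⟩
  let g₀ (x : A) : Cochain P (D.res E) n := g x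
  have hg₀ (t : Q) (x : A) (p q : ℤ) (hpq : p + n = q) (y : P.X p) :
      (g₀ (t • x)).v p q hpq y =
        (show E.X q from (D.tgt.comp ν) t • (show E.X q from (g₀ x).v p q hpq y)) :=
    (congrArg (fun w : Cochain P (D.res E) n => w.v p q hpq y) (map_smul g.hom t x)).trans
      (D.smulC_v (F := P) (ν t) (g₀ x) p q hpq y)
  -- A cochain is an independent family of linear maps, so extensions may be chosen separately for
  -- every pair of degrees.
  have ext (p q : ℤ) (hpq : p + n = q) := exists_extension_hom D.src (D.tgt.comp ν) h (E.X q) (hE q)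
    (P.X p) i
    { toFun x := ((g₀ x).v p q hpq).hom
      map_zero' := (congrArg (fun w : Cochain P (D.res E) n => (w.v p q hpq).hom) (map_zero g.hom))
      map_add' x y := (congrArg (fun w : Cochain P (D.res E) n => (w.v p q hpq).hom)
        (map_add g.hom x y)) } (fun t x m => hg₀ t x p q hpq m)
  choose g' h1 h2 using ext
  refine ⟨ModuleCat.ofHom (Y := (resMod ν).obj ((D.homCplx P E).X n))
    { toFun x := (Cochain.mk fun p q hpq => ModuleCat.ofHom (Y := (D.res E).X q) (g' p q hpq x) :
        Cochain P (D.res E) n)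
      map_add' x y := cochain_hom_ext fun p q hpq m =>
        DFunLike.congr_fun (map_add (g' p q hpq) x y) m
      map_smul' t x := cochain_hom_ext fun p q hpq m => (h1 p q hpq t x m).trans
        (D.smulC_v (F := P) (ν t) (Cochain.mk fun p q hpq => ModuleCat.ofHom (Y := (D.res E).X q)
          (g' p q hpq x) : Cochain P (D.res E) n) p q hpq m).symm }, ?_⟩
  refine ModuleCat.hom_ext (LinearMap.ext fun (x : A) => cochain_hom_ext fun p q hpq m => ?_)
  exact DFunLike.congr_fun (h2 p q hpq x) m

variable {Λ Λ' S Q : Type u} [Ring Λ] [Ring Λ'] [Ring S] [Ring Q] [Algebra k Λ] [Algebra k Λ']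
  [Algebra k S] [Algebra k Q] {M : ModuleCat.{u} Q}
  (D : ActPair k Λ' Λ S) {O : ActPair k Q S (S ⊗[k] S)} {O' : ActPair k Q Λ' (S ⊗[k] Λ')}
  (H : Compat D.swap (D.swap.ext S) O O')
  {J K : CochainComplex (ModuleCat.{u} S) ℤ} {E C : CochainComplex (ModuleCat.{u} (S ⊗[k] S)) ℤ}
  (ι : tens k J J ⟶ E) (κ : tens k J K ⟶ C)

/-- The restriction of `J ⊗ K → C` to `S ⊗ₖ Λ'`. -/
noncomputable def resTens : tens k J (D.res K) ⟶ (D.swap.ext S).swap.res C :=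
  tensResRight J K D.src ≫ (onCplx (resMod (D.swap.ext S).tgt)).map κ

instance [QuasiIso κ] : QuasiIso (D.resTens κ) := by
  have : QuasiIso ((onCplx (resMod (D.swap.ext S).tgt)).map κ) :=
    (quasiIso_resMod_iff _ κ).2 inferInstance
  have h : QuasiIso (tensResRight J K D.src) := inferInstance
  exact quasiIso_comp (hφ := h) (hφ' := this)

lemma resTens_tmk {p q n : ℤ} (h : p + q = n) (x : J.X p) (y : K.X q) :
    (D.resTens κ).f n (tmk (L := D.res K) h x y) = κ.f n (tmk (k := k) h x y) :=
  congrArg (κ.f n) (tensResRight_tmk J K D.src h x y)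

lemma resTens_mul (c : Λ) : tensMap k (𝟙 J) (D.mul c K) ≫ D.resTens κ =
    D.resTens κ ≫ (D.swap.ext S).swap.mul c C := by
  ext1 n
  apply tens_hom_ext
  intro p q h x y
  refine (congrArg ((D.resTens κ).f n) (tensMap_tmk k (𝟙 J) (D.mul c K) h x y)).trans ?_
  refine (D.resTens_tmk κ h x _).trans ?_
  refine Eq.trans ?_ (congrArg (((D.swap.ext S).swap.mul c C).f n) (D.resTens_tmk κ h x y)).symm
  refine (congrArg (κ.f n) (D.swap.ext_smul_tmk J K h c x y).symm).trans ?_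
  exact map_smul (κ.f n).hom ((D.swap.ext S).src c) (tmk (k := k) (K := J) (L := K) h x y)

/-- The morphism `J ⊗ K → Hom_Λ(Hom_{Λ'}(K, J), E)`. -/
noncomputable def tensBidual (K : CochainComplex (ModuleCat.{u} S) ℤ) : tens k J (D.res K) ⟶
    (D.swap.ext S).homCplx (D.homCplx (D.res K) J) E :=
  tensMap k (𝟙 J) (D.bidual (D.res K) J) ≫ D.swap.tensHomTo J (D.homCplx (D.res K) J) ι

/-- On the double dual of `K`, formed over `Λ'` and `Λ`, the original action of `Λ` on `K` survives
only through functoriality in `K`. Naturality of biduality and of tensor evaluation carries it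
along. -/
lemma tensBidual_mul (c : Λ) : tensMap k (𝟙 J) (D.mul c K) ≫ D.tensBidual ι K =
    D.tensBidual ι K ≫ (D.swap.ext S).mapLeft (D.mapLeft (D.mul c K) J) E := by
  have h := D.bidual_naturality (J := J) (D.mul c K)
  dsimp only [tensBidual]
  rw [Category.assoc, ← tensHomTo_naturality, ← Category.assoc, ← Category.assoc, ← tensMap_comp,
    ← tensMap_comp, h]

/-- The morphism `K → Hom_Q(M, C)`, linear over `Λ'`, defined by `J → Hom_Q(M, E)` and
`Hom_Λ(Hom_{Λ'}(K, J), E) → C`. -/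
noncomputable def toHomFun (j : J ⟶ (onCplx (O.homFun M)).obj E)
    (g : (D.swap.ext S).homCplx (D.homCplx (D.res K) J) E ⟶ (D.swap.ext S).swap.res C) :
    D.res K ⟶ (onCplx (O'.homFun M)).obj ((D.swap.ext S).swap.res C) :=
  D.bidual (D.res K) J ≫ D.swap.mapRight _ j ≫ exch H _ E ≫ (onCplx (O'.homFun M)).map g

/-- The identity `Hom_Q(M, res C) → Hom_Q(M, C)`, on elements. -/
noncomputable def homFunResFun {V : ModuleCat.{u} (S ⊗[k] S)}
    (h : (O'.homFun M).obj ((resMod (D.swap.ext S).tgt).obj V)) : (O.homFun M).obj V :=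
  (O.homFunEquiv M V).symm
    { toFun m := (show V from O'.homFunEquiv M _ h m)
      map_add' m m' := map_add (O'.homFunEquiv M _ h) m m'
      map_smul' s m := (map_smul (O'.homFunEquiv M _ h) s m).trans
        (congrArg (fun v : S ⊗[k] S => v • (show V from O'.homFunEquiv M _ h m))
          (H.src_eq s).symm) }

/-- The identity `Hom_Q(M, res C) → res Hom_Q(M, C)`. -/
noncomputable def homFunRes (M : ModuleCat.{u} Q) (C : CochainComplex (ModuleCat.{u} (S ⊗[k] S)) ℤ) :
    (onCplx (O'.homFun M)).obj ((D.swap.ext S).swap.res C) ⟶ D.res ((onCplx (O.homFun M)).obj C) where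
  f n := ModuleCat.ofHom (X := ((onCplx (O'.homFun M)).obj ((D.swap.ext S).swap.res C)).X n)
    (Y := (D.res ((onCplx (O.homFun M)).obj C)).X n)
    { toFun h := D.homFunResFun H h
      map_add' h h' := rfl
      map_smul' t h := O.homFun_ext fun m => (O'.homFunEquiv_smul M _ t h m).trans
        ((congrArg (fun v : S ⊗[k] S => v • (show C.X n from O'.homFunEquiv M _ h m))
          (H.tgt_eq t).symm).trans
            (O.homFunEquiv_smul M (C.X n) (D.src t) (D.homFunResFun H h) m).symm) }
  comm' i j _ := by
    refine ModuleCat.hom_ext (LinearMap.ext fun x => O.homFun_ext fun m => ?_)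
    rfl

instance : IsIso (D.homFunRes H M C) := by
  have (n : ℤ) : IsIso ((D.homFunRes H M C).f n) := by
    rw [ConcreteCategory.isIso_iff_bijective]
    refine ⟨fun h h' w => O'.homFun_ext fun m => ?_, fun w => ⟨(O'.homFunEquiv M _).symm
        { toFun m := (show C.X n from O.homFunEquiv M (C.X n) w m)
          map_add' m m' := map_add (O.homFunEquiv M (C.X n) w) m m'
          map_smul' s m := (map_smul (O.homFunEquiv M (C.X n) w) s m).trans
            (congrArg (fun v : S ⊗[k] S => v • (show C.X n from O.homFunEquiv M (C.X n) w m))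
              (H.src_eq s)) }, rfl⟩⟩
    exact congrArg (fun v => O.homFunEquiv M (C.X n) v m) w
  exact HomologicalComplex.Hom.isIso_of_components _

lemma homFunRes_mul (c : Λ) : (onCplx (O'.homFun M)).map ((D.swap.ext S).swap.mul c C) ≫
    D.homFunRes H M C = D.homFunRes H M C ≫ D.mul c ((onCplx (O.homFun M)).obj C) := by
  ext1 n
  refine ModuleCat.hom_ext (LinearMap.ext fun
    (x : ((onCplx (O'.homFun M)).obj ((D.swap.ext S).swap.res C)).X n) => O.homFun_ext fun m => ?_)
  refine Eq.trans ?_ (O.homFunEquiv_smul M (C.X n) (D.tgt c) ((D.homFunRes H M C).f n x) m).symm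
  exact congrArg (fun v : S ⊗[k] S => v • (show C.X n from O'.homFunEquiv M _ x m))
    (H.tgt_src_eq c).symm

/-- Moves multiplication by `c` through the whole chain of natural maps until it reaches the
argument of `g`, the only map that is not natural in `K`. -/
lemma toHomFun_mul (j : J ⟶ (onCplx (O.homFun M)).obj E)
    (g : (D.swap.ext S).homCplx (D.homCplx (D.res K) J) E ⟶ (D.swap.ext S).swap.res C) (c : Λ) :
    D.mul c K ≫ D.toHomFun H j g = D.toHomFun H j
      ((D.swap.ext S).mapLeft (D.mapLeft (D.mul c K) J) E ≫ g) := by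
  have h := D.bidual_naturality (J := J) (D.mul c K)
  dsimp only [toHomFun]
  rw [← Category.assoc, h, Category.assoc, ← Category.assoc (D.swap.mapLeft _ _),
    D.swap.mapLeft_mapRight, Category.assoc, ← Category.assoc (D.swap.mapLeft _ _),
    exch_naturality, Category.assoc, Functor.map_comp]

include H in
/-- The complex `K` is quasi-isomorphic to `Hom_Q(M, C)`, where `C` is an injective resolution of
`J ⊗ K`. -/
theorem exists_quasiIso_homFun [IsNoetherianRing Λ] [IsNoetherianRing Λ']
    (hb : Function.Bijective (liftComm D.tgt D.src (fun u l => (D.comm l u).symm)))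
    (a b m m' e c : ℤ) [J.IsStrictlyGE a] [J.IsStrictlyLE b] [(D.res J).IsKInjective]
    [(D.swap.res J).IsKInjective] (hJ : QuasiIso (D.swap.canon J))
    (hJN : NoethHomology (D.swap.res J))
    [K.IsLE m] [K.IsStrictlyGE m'] [(D.res K).IsKInjective] (hKN : NoethHomology (D.res K))
    (hKV : VanishNeg (D.res K) (D.res K))
    [E.IsStrictlyGE e] [((D.swap.ext S).res E).IsKInjective] [QuasiIso ι]
    (hO : ∀ s t, Commute ((D.swap.ext S).src s) (((D.swap.ext S).tgt.comp O'.src) t))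
    (hE : ∀ p, Injective ((resMod (liftComm (D.swap.ext S).src ((D.swap.ext S).tgt.comp O'.src)
      hO)).obj (E.X p)))
    [C.IsStrictlyGE c] [((D.swap.ext S).swap.res C).IsKInjective] [(O'.res ((D.swap.ext S).swap.res C)).IsKInjective]
    [QuasiIso κ] (j : J ⟶ (onCplx (O.homFun M)).obj E) [QuasiIso j]
    [(D.swap.res ((onCplx (O.homFun M)).obj E)).IsKInjective]
    [∀ p, Injective (((onCplx (O.homFun M)).obj C).X p)]
    [(D.res ((onCplx (O.homFun M)).obj C)).IsKInjective] :
    ∃ y : K ⟶ (onCplx (O.homFun M)).obj C, QuasiIso y := by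
  have : (D.res K).IsLE m := isLE_resMod D.src K m
  have : (D.res K).IsStrictlyGE m' := isStrictlyGE_onCplx (resMod D.src) K m'
  -- The dual of `K` with respect to `J` over `Λ'`; it is a complex over `Λ`, bounded above since
  -- `K` is bounded below and `J` above.
  let P := D.homCplx (D.res K) J
  have : P.IsStrictlyLE (b - m') := D.isStrictlyLE_homCplx m' b (b - m') (by omega)
  have hP : NoethHomology P := D.noethHomology_homCplx (D.res K) J m a hKN hJN
  have q1 : QuasiIso (D.bidual (D.res K) J) := D.quasiIso_bidual (D.res K) J m a b hKN hJ
  have q2 : QuasiIso (D.swap.tensHomTo J P ι) :=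
    D.swap.quasiIso_tensHomTo J P ι (b - m') a a e hP
  -- Biduality inside the second tensor factor, followed by tensor evaluation: `J ⊗ K ≅ Hom_Λ(P,
  -- E)`, linearly over `S ⊗ Λ'`.
  have q3 : QuasiIso (D.tensBidual ι K) := by
    have : QuasiIso (tensMap k (𝟙 J) (D.bidual (D.res K) J)) := inferInstance
    exact quasiIso_comp (hφ := this) (hφ' := q2)
  -- Both `Hom_Λ(P, E)` and `C` resolve `J ⊗ K` over `S ⊗ Λ'`; the comparison exists because `C` is
  -- K-injective there, and it is unique up to homotopy.
  obtain ⟨g, ⟨hg⟩⟩ := exists_factor (D.tensBidual ι K) (D.resTens κ)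
  have q4 : QuasiIso (D.tensBidual ι K ≫ g) := quasiIso_of_homotopy ⟨hg.symm⟩
  have q5 : QuasiIso g := quasiIso_of_comp_left (D.tensBidual ι K) g
  have q6 : QuasiIso (D.swap.mapRight P j) := by
    have : QuasiIso ((onCplx (resMod D.swap.src)).map j) :=
      (quasiIso_resMod_iff D.swap.src j).2 inferInstance
    exact D.swap.quasiIso_mapRight j
  -- K-injectivity over `Q` of both complexes is what lets `Hom_Q(M, -)` preserve the
  -- quasi-isomorphism `g`.
  have i1 : (O'.res ((D.swap.ext S).homCplx P E)).IsKInjective := by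
    have : ((D.swap.ext S).homCplx P E).IsStrictlyGE (e - (b - m')) :=
      (D.swap.ext S).isStrictlyGE_homCplx (b - m') e _ (by omega)
    have := isStrictlyGE_onCplx (resMod O'.src) ((D.swap.ext S).homCplx P E) (e - (b - m'))
    have (n : ℤ) : Injective ((O'.res ((D.swap.ext S).homCplx P E)).X n) :=
      (D.swap.ext S).injective_homCplx O'.src P E hO hE n
    exact isKInjective_of_injective _ (e - (b - m'))
  have q7 : QuasiIso ((onCplx (O'.homFun M)).map g) := O'.quasiIso_homFun M g
  have q8 : QuasiIso (D.toHomFun H j g) := by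
    -- The chain is `K ≅ Hom_Λ(P, J) ≅ Hom_Λ(P, Hom_Q(M, E)) ≅ Hom_Q(M, Hom_Λ(P, E)) ≅ Hom_Q(M, C)`,
    -- over `Λ'`.
    have h1 : QuasiIso (exch (M := M) H P E ≫ (onCplx (O'.homFun M)).map g) := quasiIso_comp _ _
    have h2 := quasiIso_comp (hφ := q6) (hφ' := h1)
    exact quasiIso_comp (hφ := q1) (hφ' := h2)
  have q9 : QuasiIso (D.toHomFun H j g ≫ D.homFunRes H M C) := quasiIso_comp _ _
  have hz (u : Λ) : Nonempty (Homotopy (D.mul u K ≫ D.toHomFun H j g ≫ D.homFunRes H M C)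
      ((D.toHomFun H j g ≫ D.homFunRes H M C) ≫ D.mul u ((onCplx (O.homFun M)).obj C))) := by
    have hh : Nonempty (Homotopy ((D.swap.ext S).mapLeft (D.mapLeft (D.mul u K) J) E ≫ g)
        (g ≫ (D.swap.ext S).swap.mul u C)) := by
      -- Homotopies into the K-injective `C` may be tested on `J ⊗ K`, where both sides multiply the
      -- second factor by `u`.
      refine homotopy_of_precomp (D.tensBidual ι K) _ _ ?_
      have h1 : D.tensBidual ι K ≫ (D.swap.ext S).mapLeft (D.mapLeft (D.mul u K) J) E ≫ g =
          tensMap k (𝟙 J) (D.mul u K) ≫ D.tensBidual ι K ≫ g := by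
        rw [← Category.assoc, ← tensBidual_mul, Category.assoc]
      refine (Homotopy.ofEq h1).trans ((hg.compLeft _).trans ((Homotopy.ofEq (D.resTens_mul κ u)).trans
        (((hg.symm.compRight _).trans (Homotopy.ofEq (Category.assoc _ _ _))))))
    have h3 : D.mul u K ≫ D.toHomFun H j g ≫ D.homFunRes H M C =
        D.bidual (D.res K) J ≫ D.swap.mapRight _ j ≫ exch H _ E ≫ (onCplx (O'.homFun M)).map
          ((D.swap.ext S).mapLeft (D.mapLeft (D.mul u K) J) E ≫ g) ≫ D.homFunRes H M C := by
      rw [← Category.assoc, D.toHomFun_mul H j g u]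
      simp only [toHomFun, Category.assoc]
    have h4 : (D.toHomFun H j g ≫ D.homFunRes H M C) ≫ D.mul u ((onCplx (O.homFun M)).obj C) =
        D.bidual (D.res K) J ≫ D.swap.mapRight _ j ≫ exch H _ E ≫ (onCplx (O'.homFun M)).map
          (g ≫ (D.swap.ext S).swap.mul u C) ≫ D.homFunRes H M C := by
      rw [Category.assoc, ← D.homFunRes_mul H u, toHomFun]
      simp only [Category.assoc, Functor.map_comp]
    refine ⟨(Homotopy.ofEq h3).trans (Homotopy.trans ?_ (Homotopy.ofEq h4.symm))⟩
    exact (((((O'.homFun M).mapHomotopy hh.some).compRight _).compLeft _).compLeft _).compLeft _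
  -- Compatibility with `Λ` up to homotopy, and the vanishing of negative self-extensions of `K`
  -- over `Λ'`, upgrade the map from `Λ'` to `S`.
  obtain ⟨y, hy⟩ := exists_lift_res D.src D.tgt (fun u l => (D.comm l u).symm) hb m c
    (M := K) (N := (onCplx (O.homFun M)).obj C) (hKV.of_quasiIso (D.toHomFun H j g ≫ D.homFunRes H M C))
    (D.toHomFun H j g ≫ D.homFunRes H M C) hz
  exact ⟨y, (quasiIso_resMod_iff D.src y).1 (quasiIso_of_homotopy ⟨hy.some.symm⟩)⟩

end Half

end ActPair

/-! ### Bounded below derived categories through injective resolutions. -/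

section DerivedBasics

variable {S : Type u} [Ring S]

/-- The termwise injective complexes. -/
def TermInj (I : CochainComplex.Plus (ModuleCat.{u} S)) : Prop := ∀ n, Injective (I.obj.X n)

lemma TermInj.isKInjective {I : CochainComplex.Plus (ModuleCat.{u} S)} (hI : TermInj I) :
    I.obj.IsKInjective := by
  obtain ⟨n, _⟩ := I.property
  have : ∀ n, Injective (I.obj.X n) := hI
  exact isKInjective_of_injective I.obj n

lemma exists_quasiIso_termInj (K : CochainComplex.Plus (ModuleCat.{u} S)) :
    ∃ (I : CochainComplex.Plus (ModuleCat.{u} S)) (i : K ⟶ I), TermInj I ∧ QuasiIso i.hom := by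
  obtain ⟨n, hn⟩ := K.property
  obtain ⟨L, _, i, hi⟩ := CochainComplex.Plus.exists_quasiIso_injective K n
  exact ⟨_, i, fun p => inferInstanceAs (Injective ((InjectiveObject.ι _).obj (L.obj.X p))), hi⟩

lemma isIso_QPlus_map_iff {K L : CochainComplex.Plus (ModuleCat.{u} S)} (f : K ⟶ L) :
    IsIso ((QPlus S).map f) ↔ QuasiIso f.hom := by
  constructor
  · intro h
    have h1 : IsIso (DerivedCategory.Plus.ι.map ((QPlus S).map f)) := inferInstance
    have h2 : IsIso (DerivedCategory.Qh.map ((HomotopyCategory.quotient _ _).map f.hom)) := h1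
    exact (HomotopyCategory.quotient_map_mem_quasiIso_iff f.hom).1
      ((DerivedCategory.isIso_Qh_map_iff _).1 h2)
  · intro h
    exact Localization.inverts (QPlus S) (CochainComplex.Plus.quasiIso _) f h

lemma exists_termInj_iso (R : DPlus S) : ∃ I : CochainComplex.Plus (ModuleCat.{u} S),
    TermInj I ∧ Nonempty ((QPlus S).obj I ≅ R) := by
  obtain ⟨K, ⟨e⟩⟩ := (Localization.essSurj (QPlus S) (CochainComplex.Plus.quasiIso _)).mem_essImage R
  obtain ⟨I, i, hI, hi⟩ := exists_quasiIso_termInj K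
  have := (isIso_QPlus_map_iff i).2 hi
  exact ⟨I, hI, ⟨(asIso ((QPlus S).map i)).symm ≪≫ e⟩⟩

/-- A bounded below complex of injectives is K-injective, so derived maps into it are homotopy
classes of chain maps. All later identities between derived morphisms are checked on such
representatives. -/
lemma exists_QPlus_map_eq {K I : CochainComplex.Plus (ModuleCat.{u} S)} (hI : TermInj I)
    (g : (QPlus S).obj K ⟶ (QPlus S).obj I) : ∃ f : K ⟶ I, (QPlus S).map f = g := by
  obtain ⟨f, hf⟩ := (DerivedCategory.Plus.Qh_map_bijective_of_isKInjective
    ((HomotopyCategory.Plus.quotient _).obj K) ((HomotopyCategory.Plus.quotient _).obj I)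
    hI.isKInjective).2 g
  obtain ⟨f, rfl⟩ := (HomotopyCategory.Plus.quotient _).map_surjective f
  exact ⟨f, hf⟩

lemma QPlus_map_eq_of_homotopy {K I : CochainComplex.Plus (ModuleCat.{u} S)} {f g : K ⟶ I}
    (h : Nonempty (Homotopy f.hom g.hom)) : (QPlus S).map f = (QPlus S).map g := by
  have h1 : (HomotopyCategory.Plus.quotient _).map f = (HomotopyCategory.Plus.quotient _).map g := by
    ext : 1
    exact HomotopyCategory.eq_of_homotopy _ _ h.some
  exact congrArg (QhPlus S).map h1

lemma QPlus_map_eq_iff {K I : CochainComplex.Plus (ModuleCat.{u} S)} (hI : TermInj I) (f g : K ⟶ I) :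
    (QPlus S).map f = (QPlus S).map g ↔ Nonempty (Homotopy f.hom g.hom) := by
  refine ⟨fun h => ?_, QPlus_map_eq_of_homotopy⟩
  have h1 : (HomotopyCategory.Plus.quotient _).map f = (HomotopyCategory.Plus.quotient _).map g :=
    (DerivedCategory.Plus.Qh_map_bijective_of_isKInjective
      ((HomotopyCategory.Plus.quotient _).obj K) ((HomotopyCategory.Plus.quotient _).obj I)
      hI.isKInjective).1 h
  exact ⟨HomotopyCategory.homotopyOfEq _ _ (congrArg (·.hom) h1)⟩

variable {T : Type u} [Ring T] (F : ModuleCat.{u} S ⥤ ModuleCat.{u} T) [F.Additive]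

/-- Derived functors are computed by injective resolutions. -/
lemma isIso_unitRD {I : CochainComplex.Plus (ModuleCat.{u} S)} (hI : TermInj I) :
    IsIso ((unitRD F).app ((HomotopyCategory.Plus.quotient _).obj I)) := by
  obtain ⟨n, hn⟩ := I.property
  let L' : CochainComplex (InjectiveObject (ModuleCat.{u} S)) ℤ :=
    HomologicalComplex.liftObjectProperty _ I.obj hI
  have hL' : L'.IsStrictlyGE n := by
    rwa [← isStrictlyGE_mapHomologicalComplex_obj_iff _ (InjectiveObject.ι _)]
  let L : CochainComplex.Plus (InjectiveObject (ModuleCat.{u} S)) := ⟨L', n, hL'⟩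
  exact inferInstanceAs (IsIso (F.rightDerivedFunctorPlusUnit.app
    ((HomotopyCategory.Plus.quotient _).obj
      ((InjectiveObject.ι _).mapCochainComplexPlus.obj L))))

/-- `F(I) ≅ RF(I)` for a bounded below complex of injectives. -/
noncomputable def unitIso {I : CochainComplex.Plus (ModuleCat.{u} S)} (hI : TermInj I) :
    (QPlus T).obj (F.mapCochainComplexPlus.obj I) ≅ (RD F).obj ((QPlus S).obj I) :=
  @asIso _ _ _ _ ((unitRD F).app ((HomotopyCategory.Plus.quotient _).obj I)) (isIso_unitRD F hI)

end DerivedBasics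

/-! ### The square functor on resolutions. -/

section RhomSq

variable (k : Type u) [Field k] (A : Type u) [Ring A] [Algebra k A]

/-- `RHom_{Aᵉ}(A, I ⊗ I)` is computed by an injective resolution of `I ⊗ I`. -/
noncomputable def rhomSqIso {I : CochainComplex.Plus (ModuleCat.{u} (Env k A))}
    {E : CochainComplex.Plus (ModuleCat.{u} (Env k A ⊗[k] Env k A))} (hE : TermInj E)
    (ι : (diagTotal (extTensor k (S := Env k A))).obj I ⟶ E) (hι : QuasiIso ι.hom) :
    (QPlus (Env k A)).obj ((homEnv k A).mapCochainComplexPlus.obj E) ≅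
      (rhomSq k A).obj ((QPlus (Env k A)).obj I) :=
  unitIso (homEnv k A) hE ≪≫
    (rhomEnv k A).mapIso ((@asIso _ _ _ _ ((QPlus _).map ι) ((isIso_QPlus_map_iff ι).2 hι)).symm ≪≫
      ((tensorSqIso k (Env k A)).app I).symm)

end RhomSq

/-! ### Finite injective dimension in terms of cycles. -/

section InjDim

variable {S : Type u} [Ring S]

lemma FiniteInjDim.of_iso {N N' : DPlus S} (h : FiniteInjDim N) (e : N ≅ N') : FiniteInjDim N' := by
  obtain ⟨q₀, hq⟩ := h
  refine ⟨q₀, fun M q hq' g => ?_⟩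
  have h1 := hq M q hq' (g ≫ e.inv⟦q⟧')
  rw [← cancel_mono (e.inv⟦q⟧'), h1, zero_comp]

/-- A cocycle `M → L^q` represents an element of `Ext^q(M, L)`, because `L` is K-injective; its
vanishing provides the primitive. -/
lemma FiniteInjDim.exists_coboundary {L : CochainComplex.Plus (ModuleCat.{u} S)} (hL : TermInj L)
    (h : FiniteInjDim ((QPlus S).obj L)) : ∃ q₀ : ℤ, ∀ (M : ModuleCat.{u} S) (p q r : ℤ), q₀ < q →
      p + 1 = q → q + 1 = r → ∀ w : M ⟶ L.obj.X q, w ≫ L.obj.d q r = 0 →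
        ∃ u : M ⟶ L.obj.X p, u ≫ L.obj.d p q = w := by
  obtain ⟨q₀, hq⟩ := h
  refine ⟨q₀, fun M p q r hq' hp hr w hw => ?_⟩
  have := hL.isKInjective
  let z : Cocycle ((CochainComplex.singleFunctor _ 0).obj M) L.obj q :=
    Cocycle.mk (Cochain.fromSingleMk w (zero_add q)) (q + 1) rfl (by
      subst hr
      rw [Cochain.δ_fromSingleMk w (zero_add q) (q + 1) (q + 1) (zero_add _), hw,
        Cochain.fromSingleMk_zero])
  -- The Ext groups are maps in the bounded below derived category, so the homotopy class is first
  -- transported there through the full embedding and the shift.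
  have h0 : (CohomologyClass.mk z).toHom = 0 := by
    apply (CochainComplex.IsKInjective.Qh_map_bijective _ (L.obj⟦q⟧)).1
    rw [Functor.map_zero]
    let g : DerivedCategory.Q.obj ((CochainComplex.singleFunctor _ 0).obj M) ⟶
        DerivedCategory.Q.obj (L.obj⟦q⟧) := DerivedCategory.Qh.map (CohomologyClass.mk z).toHom
    let e := (DerivedCategory.Q.commShiftIso q).app L.obj
    let g' : DerivedCategory.Plus.ι.obj ((DerivedCategory.Plus.singleFunctor (ModuleCat.{u} S) 0).obj M) ⟶
        (DerivedCategory.Plus.ι.obj ((QPlus S).obj L))⟦q⟧ := g ≫ e.hom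
    have hg := hq M q hq' (DerivedCategory.Plus.ι.preimage (g' ≫
      (DerivedCategory.Plus.ι.commShiftIso q).inv.app ((QPlus S).obj L)))
    have hg2 := congrArg DerivedCategory.Plus.ι.map hg
    rw [Functor.map_preimage, Functor.map_zero, Preadditive.IsIso.comp_right_eq_zero] at hg2
    have hg3 : g ≫ e.hom = 0 := hg2
    rwa [Preadditive.IsIso.comp_right_eq_zero] at hg3
  rw [CohomologyClass.toHom_mk_eq_zero_iff, mem_coboundaries_iff z p hp] at h0
  obtain ⟨β, hβ⟩ := h0
  obtain ⟨u, rfl⟩ := Cochain.fromSingleMk_surjective β p (zero_add p)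
  refine ⟨u, ?_⟩
  rw [Cochain.δ_fromSingleMk u (zero_add p) q q (zero_add q)] at hβ
  have := congrArg (Cochain.fromSingleEquiv (zero_add q)) hβ
  change _ = Cochain.fromSingleEquiv (zero_add q) (Cochain.fromSingleMk w (zero_add q)) at this
  rwa [Cochain.fromSingleEquiv_fromSingleMk, Cochain.fromSingleEquiv_fromSingleMk] at this

/-- Given a map from a subobject into the cycles, extend it into `L^q`. The differential of the
extension factors through the quotient, as a cocycle of degree `q + 1 > q₀`; subtracting a primitive
brings the extension back into the cycles. -/
lemma FiniteInjDim.injective_cycles {L : CochainComplex.Plus (ModuleCat.{u} S)} (hL : TermInj L)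
    (h : FiniteInjDim ((QPlus S).obj L)) : ∃ q₀ : ℤ, ∀ q, q₀ ≤ q → Injective (L.obj.cycles q) := by
  obtain ⟨q₀, hq⟩ := h.exists_coboundary hL
  refine ⟨q₀, fun q hq' => ⟨fun {X Y} g f _ => ?_⟩⟩
  have : Injective (L.obj.X q) := hL q
  let h := Injective.factorThru (g ≫ L.obj.iCycles q) f
  have hh : f ≫ h = g ≫ L.obj.iCycles q := Injective.comp_factorThru _ _
  have hfd : f ≫ h ≫ L.obj.d q (q + 1) = 0 := by
    rw [← Category.assoc, hh, Category.assoc, HomologicalComplex.iCycles_d, comp_zero]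
  obtain ⟨u, hu⟩ := hq (cokernel f) q (q + 1) (q + 1 + 1) (by omega) rfl rfl
    (cokernel.desc f (h ≫ L.obj.d q (q + 1)) hfd) (by
      rw [← cancel_epi (cokernel.π f), cokernel.π_desc_assoc, Category.assoc,
        HomologicalComplex.d_comp_d, comp_zero, comp_zero])
  refine ⟨L.obj.liftCycles (h - cokernel.π f ≫ u) (q + 1) (by simp) (by
    rw [Preadditive.sub_comp, Category.assoc, hu, cokernel.π_desc, sub_self]), ?_⟩
  rw [← cancel_mono (L.obj.iCycles q), Category.assoc, HomologicalComplex.liftCycles_i,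
    Preadditive.comp_sub, hh, cokernel.condition_assoc, zero_comp, sub_zero]

end InjDim

/-! ### One-sided injectivity of truncations. -/

section Truncation

variable {k : Type u} [Field k] {S T : Type u} [Ring S] [Ring T] [Algebra k S] [Algebra k T]

/-- Restriction of scalars commutes with cycles. -/
lemma injective_res_truncLE (φ : S →ₐ[k] T) (I : CochainComplex (ModuleCat.{u} T) ℤ) (n : ℤ)
    (hI : ∀ p, Injective ((resMod φ).obj (I.X p)))
    (hn : Injective (((onCplx (resMod φ)).obj I).cycles n)) (p : ℤ) :
    Injective ((resMod φ).obj ((I.truncLE n).X p)) := by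
  rcases lt_trichotomy p n with h | h | h
  · exact Injective.of_iso ((resMod φ).mapIso (I.truncLEXIso n p h).symm) (hI p)
  · subst h
    -- The last term of the truncation is a module of cycles, and exactness of restriction
    -- identifies it with the cycles of the restricted complex.
    have e : ((onCplx (resMod φ)).obj I).cycles p ≅ (resMod φ).obj (I.cycles p) :=
      (((I.sc p).mapCyclesIso (resMod φ)) : ((I.sc p).map (resMod φ)).cycles ≅ _)
    exact Injective.of_iso (e ≪≫ (resMod φ).mapIso (I.truncLEXIsoCycles p).symm) hn
  · exact ((resMod φ).map_isZero ((I.truncLE n).isZero_of_isStrictlyLE n p h)).injective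

end Truncation

lemma homotopy_of_cochain {C : Type*} [Category* C] [Preadditive C] {K L : CochainComplex C ℤ}
    {f g : K ⟶ L} (w : Cochain K L (-1)) (h : Cochain.ofHom f = Cochain.ofHom g + δ (-1) 0 w) :
    Nonempty (Homotopy f g) :=
  ⟨(Cochain.equivHomotopy _ _).symm ⟨w, by rw [h, add_comm]⟩⟩

namespace ActPair

/-! ### The canonical morphism to the endomorphism complex. -/

section Canon

variable {k : Type u} [Field k] {Λ T Z : Type u} [Ring Λ] [Ring T] [Ring Z] [Algebra k Λ]
  [Algebra k T] [Algebra k Z] (D : ActPair k Λ T Z)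

/-- The morphism `T → Hom_Λ(I, I)` is a quasi-isomorphism. -/
structure IsCanon (I : CochainComplex (ModuleCat.{u} Z) ℤ) : Prop where
  exact : ∀ i j l : ℤ, j ≠ 0 → i + 1 = j → j + 1 = l → ∀ z : Cochain (D.res I) (D.res I) j,
    δ j l z = 0 → ∃ w : Cochain (D.res I) (D.res I) i, δ i j w = z
  surj : ∀ z : D.res I ⟶ D.res I, ∃ t, Nonempty (Homotopy z (D.mul t I))
  inj : ∀ t, Nonempty (Homotopy (D.mul t I) 0) → t = 0

variable {D} in
lemma IsCanon.vanishNeg {I : CochainComplex (ModuleCat.{u} Z) ℤ} (h : D.IsCanon I) :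
    VanishNeg (D.res I) (D.res I) :=
  fun i j l hi hij hl z hz => h.exact l i j hi.ne hl hij z hz

/-- The source is concentrated in degree zero, so the quasi-isomorphism splits into exactness
outside degree zero and a bijection between the ring and homotopy classes of endomorphisms. -/
lemma isCanon_of_canonicalMap {A : Type u} [Ring A] (e : A ≃+ T) (τ : A →+ Z)
    (hτ : ∀ a, τ a = D.tgt (e a)) (h : ∀ s a, Commute (D.src s) (τ a))
    (I : CochainComplex (ModuleCat.{u} Z) ℤ) (hI : QuasiIso (canonicalMap D.src τ h I)) :
    D.IsCanon I := by
  obtain ⟨h1, h2⟩ := (ab_quasiIso_iff _).1 hI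
  let s := (HomologicalComplex.single AddCommGrpCat.{u} (ComplexShape.up ℤ) 0).obj
    (AddCommGrpCat.of A)
  let E := HomologicalComplex.singleObjXSelf (ComplexShape.up ℤ) 0 (AddCommGrpCat.of A)
  have hz (j : ℤ) (hj : j ≠ 0) (x : s.X j) : x = 0 := by
    have : IsZero (s.X j) := HomologicalComplex.isZero_single_obj_X _ _ _ _ hj
    have := AddCommGrpCat.subsingleton_of_isZero this
    exact Subsingleton.elim _ _
  have hmul (a : A) : mulCochain D.src (τ a) (fun s => h s a) I =
      Cochain.ofHom (D.mul (e a) I) := by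
    dsimp only [mulCochain]
    congr 1
    ext n x
    exact congrArg (fun w => w • (show I.X n from x)) (hτ a)
  have hf (a : A) : (canonicalMap D.src τ h I).f 0 (E.inv a) = Cochain.ofHom (D.mul (e a) I) := by
    refine (ConcreteCategory.congr_hom (HomologicalComplex.mkHomFromSingle_f _ _) (E.inv a)).trans ?_
    refine Eq.trans ?_ (hmul a)
    exact congrArg (fun b : A => mulCochain D.src (τ b) (fun s => h s b) I)
      (ConcreteCategory.congr_hom E.inv_hom_id a)
  refine ⟨fun i j l hj hij hjl z hz' => ?_, fun z => ?_, fun t ht => ?_⟩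
  · obtain ⟨x, w, -, hw⟩ := h2 i j l hij hjl z hz'
    rw [hz j hj x, map_zero] at hw
    let w' : Cochain (D.res I) (D.res I) i := w
    have hw' : 0 = z + δ i j w' := hw
    exact ⟨-w', by rw [δ_neg]; exact neg_eq_of_add_eq_zero_left hw'.symm⟩
  · obtain ⟨x, w, -, hw⟩ := h2 (-1) 0 1 rfl rfl (Cochain.ofHom z) (δ_ofHom z)
    obtain ⟨a, rfl⟩ : ∃ a, E.inv a = x := ⟨E.hom x, ConcreteCategory.congr_hom E.hom_inv_id x⟩
    refine ⟨e a, ⟨(homotopy_of_cochain (f := D.mul (e a) I) (g := z) w ?_).some.symm⟩⟩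
    exact (hf a).symm.trans hw
  · obtain ⟨w, hw⟩ := exists_cochain_of_homotopy ht
    rw [Cochain.ofHom_zero, zero_add] at hw
    obtain ⟨v, hv⟩ := h1 (-1) 0 1 rfl rfl (E.inv (e.symm t)) w (by
      change s.d 0 1 _ = 0
      rw [HomologicalComplex.single_obj_d]
      rfl) (hw.symm.trans (by
        refine Eq.trans ?_ (hf (e.symm t)).symm
        rw [e.apply_symm_apply]))
    rw [hz (-1) (by decide) v, map_zero] at hv
    have h3 : E.hom (E.inv (e.symm t)) = e.symm t := ConcreteCategory.congr_hom E.inv_hom_id _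
    rw [← hv, map_zero] at h3
    exact (EmbeddingLike.map_eq_zero_iff (f := e.symm)).1 h3.symm

lemma canon_smul_genOne (I : CochainComplex (ModuleCat.{u} Z) ℤ) (t : T) :
    (D.canon I).f 0 (t • genOne T) = Cochain.ofHom (D.mul t I) := by
  have h1 := map_smul ((D.canon I).f 0).hom t (genOne T)
  have h2 := fromGen_genOne (F := D.homCplx (D.res I) I) (Cochain.ofHom (𝟙 (D.res I)))
    (δ_ofHom (𝟙 (D.res I)))
  refine h1.trans ((congrArg (fun w => t • w) h2).trans ?_)
  change D.smulC t (Cochain.ofHom (𝟙 (D.res I))) = _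
  rw [smulC, Cochain.id_comp]

/-- Returns to a quasi-isomorphism, now `T`-linear and starting from the ring in degree zero, as
biduality requires; the definition of a dualizing complex only sees abelian groups. -/
lemma quasiIso_canon {I : CochainComplex (ModuleCat.{u} Z) ℤ} (h : D.IsCanon I) :
    QuasiIso (D.canon I) := by
  have hz (j : ℤ) (hj : j ≠ 0) (x : (singleRing T 0).X j) : x = 0 := by
    have : IsZero ((singleRing T 0).X j) := HomologicalComplex.isZero_single_obj_X _ _ _ _ hj
    have := ModuleCat.subsingleton_of_isZero this
    exact Subsingleton.elim _ _
  rw [mod_quasiIso_iff]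
  refine ⟨fun i j l hij hjl x y _ hy => ?_, fun i j l hij hjl y hy => ?_⟩
  · by_cases hj : j = 0
    · subst hj
      obtain ⟨t, rfl⟩ := genOne_span x
      obtain rfl : i = -1 := by omega
      have h1 : t = 0 := h.inj t (homotopy_of_cochain (y : Cochain (D.res I) (D.res I) (-1)) (by
        rw [Cochain.ofHom_zero, zero_add]
        exact (D.canon_smul_genOne I t).symm.trans hy.symm))
      exact ⟨0, by rw [map_zero, h1, zero_smul]⟩
    · exact ⟨0, by rw [map_zero, hz j hj x]⟩
  · by_cases hj : j = 0
    · subst hj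
      obtain rfl : i = -1 := by omega
      obtain rfl : l = 1 := by omega
      let z : Cocycle (D.res I) (D.res I) 0 := Cocycle.mk y 1 rfl hy
      obtain ⟨t, ht⟩ := h.surj (Cocycle.homOf z)
      obtain ⟨w, hw⟩ := exists_cochain_of_homotopy ⟨ht.some.symm⟩
      refine ⟨t • genOne T, w, ?_, ?_⟩
      · rw [HomologicalComplex.single_obj_d]
        rfl
      · refine (D.canon_smul_genOne I t).trans (hw.trans ?_)
        rw [Cocycle.cochain_ofHom_homOf_eq_coe]
        rfl
    · obtain ⟨w, hw⟩ := h.exact i j l hj hij hjl y hy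
      refine ⟨0, (-w : Cochain (D.res I) (D.res I) i), by rw [map_zero], ?_⟩
      rw [map_zero]
      let y' : Cochain (D.res I) (D.res I) j := y
      have h5 : y' + δ i j (-w) = 0 := by
        rw [δ_neg, hw]
        exact add_neg_cancel y'
      exact h5.symm

lemma canon_naturality {I J : CochainComplex (ModuleCat.{u} Z) ℤ} (ι : J ⟶ I) :
    D.canon J ≫ D.mapRight (D.res J) ι =
      D.canon I ≫ D.mapLeft ((onCplx (resMod D.src)).map ι) I := by
  refine singleRing_hom_ext ?_
  have h1 := fromGen_genOne (F := D.homCplx (D.res I) I) (Cochain.ofHom (𝟙 (D.res I)))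
    (δ_ofHom (𝟙 (D.res I)))
  have h2 := fromGen_genOne (F := D.homCplx (D.res J) J) (Cochain.ofHom (𝟙 (D.res J)))
    (δ_ofHom (𝟙 (D.res J)))
  refine (congrArg ((D.mapRight (D.res J) ι).f 0) h2).trans (Eq.trans ?_
    (congrArg ((D.mapLeft ((onCplx (resMod D.src)).map ι) I).f 0) h1).symm)
  change (Cochain.ofHom (𝟙 (D.res J))).comp (Cochain.ofHom ((onCplx (resMod D.src)).map ι)) (add_zero 0)
    = (Cochain.ofHom ((onCplx (resMod D.src)).map ι)).comp (Cochain.ofHom (𝟙 (D.res I))) (zero_add 0)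
  rw [Cochain.id_comp, Cochain.comp_id]

/-- Both endomorphism complexes are quasi-isomorphic to `Hom_Λ(J, I)`, compatibly with
multiplications. This carries the canonical condition from an injective resolution to a bounded
model. -/
lemma quasiIso_canon_of_quasiIso {I J : CochainComplex (ModuleCat.{u} Z) ℤ} (ι : J ⟶ I) [QuasiIso ι]
    [(D.res J).IsKInjective] [(D.res I).IsKInjective] [QuasiIso (D.canon I)] :
    QuasiIso (D.canon J) := by
  have : QuasiIso ((onCplx (resMod D.src)).map ι) := (quasiIso_resMod_iff D.src ι).2 inferInstance
  have h1 := D.quasiIso_mapLeft ((onCplx (resMod D.src)).map ι) (G := I)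
  have h2 := D.quasiIso_mapRight ι (F := D.res J)
  have h3 : QuasiIso (D.canon J ≫ D.mapRight (D.res J) ι) := by
    rw [canon_naturality]
    infer_instance
  exact quasiIso_of_comp_right _ (D.mapRight (D.res J) ι)

end Canon

end ActPair

/-! ### Identifying an algebra with a tensor product. -/

section Bijective

variable {k : Type u} [Field k] {Λ T Z : Type u} [Ring Λ] [Ring T] [Ring Z]
  [Algebra k Λ] [Algebra k T] [Algebra k Z] (σ : Λ →ₐ[k] Z) (τ : T →ₐ[k] Z)
  (h : ∀ s t, Commute (σ s) (τ t))

lemma bijective_liftComm_of (e : T ⊗[k] Λ ≃ₐ[k] Z) (he : ∀ t l, τ t * σ l = e (t ⊗ₜ l)) :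
    Function.Bijective (liftComm σ τ h) := by
  have : liftComm σ τ h = e.toAlgHom :=
    Algebra.TensorProduct.ext' fun t l => (Algebra.TensorProduct.lift_tmul _ _ _ t l).trans (he t l)
  rw [this]
  exact e.bijective

end Bijective

/-! ### One-sided properties of dualizing complexes. -/

section Dualizing

variable (k A : Type u) [Field k] [Ring A] [Algebra k A]

/-- The left and right actions of `A` on bimodules. -/
noncomputable def bimodPair : ActPair k A Aᵐᵒᵖ (Env k A) :=
  ⟨inclLeft k A, inclRight k A, commute_incl k A⟩

lemma bijective_liftComm_bimodPair :
    Function.Bijective (liftComm (bimodPair k A).src (bimodPair k A).tgt (bimodPair k A).comm) :=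
  bijective_liftComm_of _ _ _ (Algebra.TensorProduct.comm k Aᵐᵒᵖ A) fun t l => by
    change (1 ⊗ₜ[k] t) * (l ⊗ₜ[k] 1) = l ⊗ₜ[k] t
    rw [Algebra.TensorProduct.tmul_mul_tmul, one_mul, mul_one]

lemma bijective_liftComm_bimodPair_swap : Function.Bijective (liftComm (bimodPair k A).tgt
    (bimodPair k A).src (fun u l => ((bimodPair k A).comm l u).symm)) :=
  bijective_liftComm_of _ _ _ AlgEquiv.refl fun t l => by
    change (t ⊗ₜ[k] 1) * (1 ⊗ₜ[k] l) = t ⊗ₜ[k] l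
    rw [Algebra.TensorProduct.tmul_mul_tmul, one_mul, mul_one]

variable {k A}

/-- `Aᵉ` is the tensor product of its two commuting subalgebras `A` and `Aᵒᵖ`. -/
lemma injective_res_left (E : ModuleCat.{u} (Env k A)) [Injective E] :
    Injective ((resMod (bimodPair k A).src).obj E) :=
  injective_res _ _ _ (bijective_liftComm_bimodPair_swap k A) E

lemma injective_res_right (E : ModuleCat.{u} (Env k A)) [Injective E] :
    Injective ((resMod (bimodPair k A).tgt).obj E) :=
  injective_res _ _ _ (bijective_liftComm_bimodPair k A) E

section

variable {S T : Type u} [Ring S] [Ring T] [Algebra k S] [Algebra k T] (φ : S →ₐ[k] T)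

/-- Restriction of scalars of a complex, as an object of the derived category. -/
noncomputable def resDIso (I : CochainComplex.Plus (ModuleCat.{u} T)) :
    (resD φ).obj ((QPlus T).obj I) ≅ (QPlus S).obj ((resMod φ).mapCochainComplexPlus.obj I) :=
  (exactDIsoQ (resMod φ)).app I

lemma isLE_of_Q {I : CochainComplex.Plus (ModuleCat.{u} S)} {R : DPlus S}
    (e : (QPlus S).obj I ≅ R) (n : ℤ) [hR : R.IsLE n] : I.obj.IsLE n := by
  have h1 : ((QPlus S).obj I).IsLE n := DerivedCategory.Plus.TStructure.t.isLE_of_iso e.symm n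
  rw [← DerivedCategory.Plus.isLE_ι_obj_iff] at h1
  exact (DerivedCategory.isLE_Q_obj_iff I.obj n).1 h1

lemma noethHomology_of_Q [IsNoetherianRing S] {I : CochainComplex.Plus (ModuleCat.{u} S)} {R : DPlus S}
    (e : (QPlus S).obj I ≅ R) (h : FiniteCohomology R) : NoethHomology I.obj := by
  intro i
  have h1 := h i
  have e1 : (DerivedCategory.Plus.homologyFunctor (ModuleCat.{u} S) i).obj R ≅ I.obj.homology i :=
    (DerivedCategory.Plus.homologyFunctor (ModuleCat.{u} S) i).mapIso e.symm ≪≫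
      ((DerivedCategory.homologyFunctorFactors (ModuleCat.{u} S) i).app I.obj)
  have : IsNoetherian S ((DerivedCategory.Plus.homologyFunctor (ModuleCat.{u} S) i).obj R) :=
    inferInstance
  exact isNoetherian_of_moduleIso e1 this

end

lemma isCanon_left {R : DPlus (Env k A)} (hR : IsDualizing R)
    {I : CochainComplex.Plus (ModuleCat.{u} (Env k A))} (hI : TermInj I)
    (e : (QPlus (Env k A)).obj I ≅ R) : (bimodPair k A).IsCanon I.obj :=
  ActPair.isCanon_of_canonicalMap _ (MulOpposite.opAddEquiv : A ≃+ Aᵐᵒᵖ) _ (fun _ => rfl) _ I.obj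
    (hR.canonical_left I hI ⟨e⟩)

lemma isCanon_right {R : DPlus (Env k A)} (hR : IsDualizing R)
    {I : CochainComplex.Plus (ModuleCat.{u} (Env k A))} (hI : TermInj I)
    (e : (QPlus (Env k A)).obj I ≅ R) : (bimodPair k A).swap.IsCanon I.obj :=
  ActPair.isCanon_of_canonicalMap _ (AddEquiv.refl A) _ (fun _ => rfl) _ I.obj
    (hR.canonical_right I hI ⟨e⟩)

/-- A dualizing complex is represented by a bounded complex of bimodules that are injective on
both sides. -/
lemma exists_bounded_injective {R : DPlus (Env k A)} (hR : IsDualizing R)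
    {I : CochainComplex.Plus (ModuleCat.{u} (Env k A))} (hI : TermInj I)
    (e : (QPlus (Env k A)).obj I ≅ R) (a : ℤ) [I.obj.IsStrictlyGE a] :
    ∃ (b : ℤ) (J : CochainComplex (ModuleCat.{u} (Env k A)) ℤ) (ι : J ⟶ I.obj), QuasiIso ι ∧
      J.IsStrictlyGE a ∧ J.IsStrictlyLE b ∧ (∀ n, Injective (((bimodPair k A).res J).X n)) ∧
      ∀ n, Injective (((bimodPair k A).swap.res J).X n) := by
  obtain ⟨b, _⟩ := hR.bounded
  have hb := isLE_of_Q e b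
  have h1 : TermInj ((resMod (bimodPair k A).src).mapCochainComplexPlus.obj I) := fun n =>
    have := hI n
    injective_res_left (I.obj.X n)
  have h2 : TermInj ((resMod (bimodPair k A).tgt).mapCochainComplexPlus.obj I) := fun n =>
    have := hI n
    injective_res_right (I.obj.X n)
  obtain ⟨q, hq⟩ := (hR.injDim_left.of_iso
    ((resD (inclLeft k A)).mapIso e.symm ≪≫ resDIso (inclLeft k A) I)).injective_cycles h1
  obtain ⟨q', hq'⟩ := (hR.injDim_right.of_iso
    ((resD (inclRight k A)).mapIso e.symm ≪≫ resDIso (inclRight k A) I)).injective_cycles h2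
  -- Beyond `b` truncation does not change the cohomology; beyond `q` and `q'` the cycles are
  -- injective over `A` and over `Aᵒᵖ`. Injectivity over `Aᵉ` is not claimed for the truncation.
  let n := max b (max q q')
  have : I.obj.IsLE n := I.obj.isLE_of_le b n (le_max_left _ _)
  refine ⟨n, I.obj.truncLE n, I.obj.ιTruncLE n, inferInstance, inferInstance, inferInstance,
    fun p => ?_, fun p => ?_⟩
  · exact injective_res_truncLE (bimodPair k A).src I.obj n h1 (hq n (by omega)) p
  · exact injective_res_truncLE (bimodPair k A).tgt I.obj n h2 (hq' n (by omega)) p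

end Dualizing

/-! ### Injectivity along tensor factors. -/

section Bijective

variable {k : Type u} [Field k] {Λ T Z X Y : Type u} [Ring Λ] [Ring T] [Ring Z] [Ring X] [Ring Y]
  [Algebra k Λ] [Algebra k T] [Algebra k Z] [Algebra k X] [Algebra k Y]

lemma bijective_liftComm_symm (σ : Λ →ₐ[k] Z) (τ : T →ₐ[k] Z) (h : ∀ s t, Commute (σ s) (τ t))
    (hb : Function.Bijective (liftComm σ τ h)) :
    Function.Bijective (liftComm τ σ (fun t s => (h s t).symm)) :=
  bijective_liftComm_of _ _ _ ((Algebra.TensorProduct.comm k Λ T).trans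
    (AlgEquiv.ofBijective (liftComm σ τ h) hb)) fun s t =>
      (h s t).eq.trans (Algebra.TensorProduct.lift_tmul τ σ (fun t s => (h s t).symm) t s).symm

lemma injective_res_includeLeft (E : ModuleCat.{u} (X ⊗[k] Y)) [Injective E] :
    Injective ((resMod (Algebra.TensorProduct.includeLeft : X →ₐ[k] X ⊗[k] Y)).obj E) :=
  injective_res (T := X) (Λ := Y) (k := k) Algebra.TensorProduct.includeRight Algebra.TensorProduct.includeLeft
    (fun s t => by
      change (1 ⊗ₜ[k] s) * (t ⊗ₜ[k] 1) = (t ⊗ₜ[k] 1) * (1 ⊗ₜ[k] s)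
      simp only [Algebra.TensorProduct.tmul_mul_tmul, mul_one, one_mul])
    (bijective_liftComm_of _ _ _ AlgEquiv.refl fun t l => by
      change (t ⊗ₜ[k] 1) * (1 ⊗ₜ[k] l) = t ⊗ₜ[k] l
      rw [Algebra.TensorProduct.tmul_mul_tmul, one_mul, mul_one]) E

/-- If `X ⊗ₖ Y ≅ Z`, then restriction of scalars along `X → Z` preserves injective modules. -/
lemma injective_res_of_equiv (φ : X →ₐ[k] Z) (e : X ⊗[k] Y ≃ₐ[k] Z) (h : ∀ x, e (x ⊗ₜ 1) = φ x)
    (E : ModuleCat.{u} Z) [Injective E] : Injective ((resMod φ).obj E) := by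
  obtain rfl : (e : X ⊗[k] Y →ₐ[k] Z).comp Algebra.TensorProduct.includeLeft = φ := AlgHom.ext h
  have := injective_res_of_bijective (e : X ⊗[k] Y →ₐ[k] Z) e.bijective E
  exact injective_res_includeLeft ((resMod (e : X ⊗[k] Y →ₐ[k] Z)).obj E)

end Bijective

namespace ActPair

/-! ### Injective resolutions supply the hypotheses of the isomorphism. -/

section Half

variable {k : Type u} [Field k] {Λ Λ' S Q : Type u} [Ring Λ] [Ring Λ'] [Ring S] [Ring Q]
  [Algebra k Λ] [Algebra k Λ'] [Algebra k S] [Algebra k Q] {M : ModuleCat.{u} Q}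
  (D : ActPair k Λ' Λ S) {O : ActPair k Q S (S ⊗[k] S)} {O' : ActPair k Q Λ' (S ⊗[k] Λ')}
  (H : Compat D.swap (D.swap.ext S) O O')

lemma injective_res_tgt (hb' : Function.Bijective (liftComm D.src D.tgt D.comm))
    (E : ModuleCat.{u} S) [Injective E] : Injective ((resMod D.tgt).obj E) :=
  injective_res D.src D.tgt D.comm hb' E

lemma injective_res_src (hb' : Function.Bijective (liftComm D.src D.tgt D.comm))
    (E : ModuleCat.{u} S) [Injective E] : Injective ((resMod D.src).obj E) :=
  injective_res D.tgt D.src _ (bijective_liftComm_symm _ _ _ hb') E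

/-- Rearrangement of factors: `S ⊗ S ≅ Λ ⊗ (Λ' ⊗ S)`, with `Λ` inside the second copy of `S`. -/
lemma injective_ext_src (hb' : Function.Bijective (liftComm D.src D.tgt D.comm))
    (E : ModuleCat.{u} (S ⊗[k] S)) [Injective E] :
    Injective ((resMod (D.swap.ext S).src).obj E) := by
  let e : Λ ⊗[k] (Λ' ⊗[k] S) ≃ₐ[k] S ⊗[k] S :=
    (Algebra.TensorProduct.assoc k k k Λ Λ' S).symm.trans
      ((Algebra.TensorProduct.congr (AlgEquiv.ofBijective _ hb') AlgEquiv.refl).trans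
        (Algebra.TensorProduct.comm k S S))
  refine injective_res_of_equiv _ e (fun x => ?_) E
  change (1 : S) ⊗ₜ[k] liftComm D.src D.tgt D.comm (x ⊗ₜ 1) = 1 ⊗ₜ[k] D.tgt x
  rw [Algebra.TensorProduct.lift_tmul, map_one, mul_one]

lemma injective_ext_tgt (hb' : Function.Bijective (liftComm D.src D.tgt D.comm))
    (E : ModuleCat.{u} (S ⊗[k] S)) [Injective E] :
    Injective ((resMod (D.swap.ext S).tgt).obj E) := by
  let e : (S ⊗[k] Λ') ⊗[k] Λ ≃ₐ[k] S ⊗[k] S :=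
    (Algebra.TensorProduct.assoc k k k S Λ' Λ).trans
      (Algebra.TensorProduct.congr AlgEquiv.refl
        (AlgEquiv.ofBijective _ (bijective_liftComm_symm _ _ _ hb')))
  refine injective_res_of_equiv _ e (fun x => ?_) E
  induction x using TensorProduct.induction_on with
  | zero => rw [zero_tmul, map_zero, map_zero]
  | add x y hx hy => rw [add_tmul, map_add, map_add, hx, hy]
  | tmul s x =>
    change s ⊗ₜ[k] liftComm D.tgt D.src (fun s t => (D.comm t s).symm) (x ⊗ₜ 1) = s ⊗ₜ[k] D.src x
    rw [Algebra.TensorProduct.lift_tmul, map_one, mul_one]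

include H in
lemma commute_ext_src (s : Λ) (t : Q) :
    Commute ((D.swap.ext S).src s) (((D.swap.ext S).tgt.comp O'.src) t) := by
  have h1 : O.tgt (D.tgt s) = (D.swap.ext S).src s := H.tgt_src_eq s
  have h2 : O.src t = ((D.swap.ext S).tgt.comp O'.src) t := H.src_eq t
  rw [← h1, ← h2]
  exact (O.comm t (D.tgt s)).symm

-- Rearrangement `S ⊗ S ≅ (Q ⊗ Λ) ⊗ Λ'`: the copy acted on by `O.tgt` is split into `Λ'` and `Λ`.
-- This injectivity makes `Hom_Λ(P, E)` termwise injective over `Q`.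
include H in
lemma injective_three (hb' : Function.Bijective (liftComm D.src D.tgt D.comm))
    (hγ : Function.Bijective (liftComm O.src O.tgt O.comm))
    (E : ModuleCat.{u} (S ⊗[k] S)) [Injective E] :
    Injective ((resMod (liftComm (D.swap.ext S).src ((D.swap.ext S).tgt.comp O'.src)
      (D.commute_ext_src H))).obj E) := by
  let e : (Q ⊗[k] Λ) ⊗[k] Λ' ≃ₐ[k] S ⊗[k] S :=
    (Algebra.TensorProduct.assoc k k k Q Λ Λ').trans
      ((Algebra.TensorProduct.congr AlgEquiv.refl (AlgEquiv.ofBijective _ hb')).trans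
        (AlgEquiv.ofBijective _ (bijective_liftComm_symm _ _ _ hγ)))
  refine injective_res_of_equiv _ e (fun x => ?_) E
  induction x using TensorProduct.induction_on with
  | zero => rw [zero_tmul, map_zero, map_zero]
  | add x y hx hy => rw [add_tmul, map_add, map_add, hx, hy]
  | tmul q l =>
    change liftComm O.tgt O.src (fun s t => (O.comm t s).symm) (q ⊗ₜ[k] liftComm D.src D.tgt D.comm (l ⊗ₜ[k] 1)) = _
    have h1 : O.tgt (D.tgt l) = (D.swap.ext S).src l := H.tgt_src_eq l
    have h2 : O.src q = ((D.swap.ext S).tgt.comp O'.src) q := H.src_eq q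
    rw [Algebra.TensorProduct.lift_tmul, Algebra.TensorProduct.lift_tmul,
      Algebra.TensorProduct.lift_tmul, map_one, mul_one, h1, h2]

variable {J : CochainComplex (ModuleCat.{u} S) ℤ} {K : CochainComplex.Plus (ModuleCat.{u} S)}
  {E C : CochainComplex.Plus (ModuleCat.{u} (S ⊗[k] S))}
  (ι : tens k J J ⟶ E.obj) (κ : tens k J K.obj ⟶ C.obj)

lemma isKInjective_res {R T : Type u} [Ring R] [Ring T] [Algebra k R] [Algebra k T] (φ : R →ₐ[k] T)
    (L : CochainComplex.Plus (ModuleCat.{u} T))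
    (h : ∀ n, Injective ((resMod φ).obj (L.obj.X n))) : ((onCplx (resMod φ)).obj L.obj).IsKInjective :=
  TermInj.isKInjective (I := (resMod φ).mapCochainComplexPlus.obj L) h

-- When `K`, `E` and `C` are termwise injective over the full algebras, every one-sided injectivity
-- condition in `exists_quasiIso_homFun` follows from a tensor decomposition of the algebra. Only
-- `J` keeps separate hypotheses, being a bounded model.
include H in
theorem exists_quasiIso_of_injective [IsNoetherianRing Λ] [IsNoetherianRing Λ']
    (hb' : Function.Bijective (liftComm D.src D.tgt D.comm))
    (hγ : Function.Bijective (liftComm O.src O.tgt O.comm))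
    (a b : ℤ) [J.IsStrictlyGE a] [J.IsStrictlyLE b] [(D.res J).IsKInjective]
    [(D.swap.res J).IsKInjective] (hJ : QuasiIso (D.swap.canon J))
    (hJN : NoethHomology (D.swap.res J)) (hK : TermInj K) (hKm : ∃ m, K.obj.IsLE m)
    (hKN : NoethHomology (D.res K.obj)) (hKV : VanishNeg (D.res K.obj) (D.res K.obj))
    (hE : TermInj E) (hC : TermInj C) [QuasiIso ι] [QuasiIso κ]
    (j : J ⟶ (onCplx (O.homFun M)).obj E.obj) [QuasiIso j] :
    ∃ y : K.obj ⟶ (onCplx (O.homFun M)).obj C.obj, QuasiIso y := by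
  obtain ⟨m, _⟩ := hKm
  obtain ⟨m', _⟩ := K.property
  obtain ⟨e, _⟩ := E.property
  obtain ⟨c, _⟩ := C.property
  have hE' : ∀ n, Injective (E.obj.X n) := hE
  have hC' : ∀ n, Injective (C.obj.X n) := hC
  have hK' : ∀ n, Injective (K.obj.X n) := hK
  have hHom (V : CochainComplex.Plus (ModuleCat.{u} (S ⊗[k] S))) (hV : ∀ n, Injective (V.obj.X n))
      (n : ℤ) : Injective (((onCplx (O.homFun M)).obj V.obj).X n) :=
    O.injective_homFun M (V.obj.X n) (injective_res_of_bijective _ hγ _)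
  have i1 := isKInjective_res D.src K (fun n => D.injective_res_src hb' _)
  have i2 := isKInjective_res (D.swap.ext S).src E (fun n => D.injective_ext_src hb' _)
  have i3 : ((D.swap.ext S).swap.res C.obj).IsKInjective :=
    isKInjective_res (D.swap.ext S).tgt C (fun n => D.injective_ext_tgt hb' _)
  have i4 : (O'.res ((D.swap.ext S).swap.res C.obj)).IsKInjective := by
    refine isKInjective_res ((D.swap.ext S).tgt.comp O'.src) C (fun n => ?_)
    -- The action of `Q` on `C` through `Λ'` is its original one, and `S ⊗ S` is `Q ⊗ S`.
    have h2 : O.src = (D.swap.ext S).tgt.comp O'.src := AlgHom.ext H.src_eq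
    rw [← h2]
    exact injective_res_of_equiv O.src (AlgEquiv.ofBijective _ (bijective_liftComm_symm _ _ _ hγ))
      (fun x => (Algebra.TensorProduct.lift_tmul _ _ (fun q s => O.comm q s) x 1).trans (by
        rw [map_one, mul_one])) _
  have i5 : (D.swap.res ((onCplx (O.homFun M)).obj E.obj)).IsKInjective := by
    exact isKInjective_res D.tgt ((O.homFun M).mapCochainComplexPlus.obj E)
      (fun n => @injective_res_tgt _ _ _ _ _ _ _ _ _ _ _ D hb' _ (hHom E hE' n))
  have i6 := hHom C hC'
  have i7 : (D.res ((onCplx (O.homFun M)).obj C.obj)).IsKInjective :=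
    isKInjective_res D.src ((O.homFun M).mapCochainComplexPlus.obj C)
      (fun n => @injective_res_src _ _ _ _ _ _ _ _ _ _ _ D hb' _ (hHom C hC' n))
  exact D.exists_quasiIso_homFun H ι κ (bijective_liftComm_symm _ _ _ hb') a b m m' e c hJ hJN hKN
    hKV (D.commute_ext_src H) (fun p => D.injective_three H hb' hγ _) j

end Half

end ActPair

/-! ### Symmetry of the tensor product of complexes. -/

section Flip

variable {k : Type u} [Field k] {X Y : Type u} [Ring X] [Ring Y] [Algebra k X] [Algebra k Y]
  (K : CochainComplex (ModuleCat.{u} X) ℤ) (L : CochainComplex (ModuleCat.{u} Y) ℤ)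

/-- The signed symmetry on pure tensors. -/
noncomputable def flipTmk {p q n : ℤ} (h : p + q = n) : K.X p →+ L.X q →+
    ((onCplx (resMod (Algebra.TensorProduct.comm k X Y).toAlgHom)).obj (tens k L K)).X n :=
  AddMonoidHom.mk' (fun x => AddMonoidHom.mk'
    (fun y => ((p * q).negOnePow • tmk (K := L) (L := K) (show q + p = n by omega) y x : (tens k L K).X n))
    (fun y y' => by
      rw [tmk_add_left, smul_add]
      rfl))
    (fun x x' => AddMonoidHom.ext fun y => by
      change (p * q).negOnePow • tmk (K := L) (L := K) _ y (x + x') = _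
      rw [tmk_add_right, smul_add]
      rfl)

lemma flipTmk_smul {p q n : ℤ} (h : p + q = n) (a : X) (b : Y) (x : K.X p) (y : L.X q) :
    flipTmk (k := k) K L h (a • x) (b • y) = (a ⊗ₜ[k] b : X ⊗[k] Y) • flipTmk (k := k) K L h x y := by
  have h1 := smul_tmk (K := L) (L := K) k (show q + p = n by omega) b a y x
  have h2 : (b ⊗ₜ[k] a : Y ⊗[k] X) • ((p * q).negOnePow • tmk (K := L) (L := K)
      (show q + p = n by omega) y x : (tens k L K).X n) = (p * q).negOnePow •
        tmk (K := L) (L := K) (show q + p = n by omega) (b • y) (a • x) :=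
    (smul_comm _ _ _).trans (congrArg (fun z => (p * q).negOnePow • z) h1)
  exact h2.symm

/-- The Koszul sign `(-1)^(p q)` is what reconciles the two conventions `d(x ⊗ y) = dx ⊗ y ± x ⊗
dy`, taken in either order. -/
lemma d_flipTmk (n p q : ℤ) (h : p + q = n) (x : K.X p) (y : L.X q) :
    ((onCplx (resMod (Algebra.TensorProduct.comm k X Y).toAlgHom)).obj (tens k L K)).d n (n + 1)
      (flipTmk K L h x y) =
      flipTmk K L (by omega) (K.d p (p + 1) x) y +
        p.negOnePow • flipTmk K L (by omega) x (L.d q (q + 1) y) := by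
  have h1 := d_tmk (K := L) (L := K) k (show q + p = n by omega) (m := n + 1) rfl rfl rfl y x
  have e1 : ((p + 1) * q).negOnePow = (p * q).negOnePow * q.negOnePow := by
    rw [← Int.negOnePow_add]; congr 1; ring
  have e2 : p.negOnePow * (p * (q + 1)).negOnePow = (p * q).negOnePow := by
    rw [mul_add, mul_one, Int.negOnePow_add, mul_comm, mul_assoc, ← Int.negOnePow_add,
      Int.negOnePow_even _ (Even.add_self p), mul_one]
  have h2 : (tens k L K).d n (n + 1) ((p * q).negOnePow • tmk (K := L) (L := K)
      (show q + p = n by omega) y x : (tens k L K).X n) =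
      ((p + 1) * q).negOnePow • tmk (K := L) (L := K) (show q + (p + 1) = n + 1 by omega) y
          (K.d p (p + 1) x) + p.negOnePow • (p * (q + 1)).negOnePow •
            tmk (K := L) (L := K) (show q + 1 + p = n + 1 by omega) (L.d q (q + 1) y) x := by
    rw [smul_smul, e2, e1, mul_smul, ← smul_add, Units.smul_def, map_zsmul, ← Units.smul_def]
    exact congrArg (fun z => (p * q).negOnePow • z) (h1.trans (add_comm _ _))
  exact h2

/-- The symmetry of the tensor product of complexes. -/
noncomputable def tensFlip : tens k K L ⟶
    (onCplx (resMod (Algebra.TensorProduct.comm k X Y).toAlgHom)).obj (tens k L K) :=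
  tensDesc (fun _ _ _ h => flipTmk K L h) (fun _ _ _ h a b x y => flipTmk_smul K L h a b x y)
    (fun n p q h x y => d_flipTmk K L n p q h x y)

lemma tensFlip_tmk {p q n : ℤ} (h : p + q = n) (x : K.X p) (y : L.X q) :
    (tensFlip K L).f n (tmk h x y) = ((p * q).negOnePow •
      tmk (K := L) (L := K) (show q + p = n by omega) y x : (tens k L K).X n) :=
  tensDesc_tmk (fun _ _ _ h => flipTmk K L h) _ _ h x y

/-- The components of the symmetry, as additive maps. -/
noncomputable def tensFlipAdd (n : ℤ) : (tens k K L).X n →+ (tens k L K).X n :=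
  ((tensFlip K L).f n).hom.toAddMonoidHom

lemma tensFlipAdd_tmk {p q n : ℤ} (h : p + q = n) (x : K.X p) (y : L.X q) :
    tensFlipAdd K L n (tmk (k := k) h x y) = (p * q).negOnePow •
      tmk (K := L) (L := K) (show q + p = n by omega) y x := tensFlip_tmk K L h x y

lemma tensFlipAdd_tensFlipAdd (n : ℤ) (z : (tens k K L).X n) :
    tensFlipAdd L K n (tensFlipAdd K L n z) = z := by
  induction z using tens_induction with
  | h0 => rw [map_zero, map_zero]
  | hadd s t hs ht => rw [map_add, map_add, hs, ht]
  | htmk p q h x y =>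
    rw [tensFlipAdd_tmk, Units.smul_def, map_zsmul, tensFlipAdd_tmk, ← Units.smul_def, smul_smul,
      mul_comm q p, Int.units_mul_self, one_smul]

instance isIso_tensFlip : IsIso (tensFlip (k := k) K L) := by
  have (n : ℤ) : IsIso ((tensFlip (k := k) K L).f n) := by
    rw [ConcreteCategory.isIso_iff_bijective]
    exact ⟨Function.LeftInverse.injective (tensFlipAdd_tensFlipAdd K L n),
      Function.RightInverse.surjective (tensFlipAdd_tensFlipAdd L K n)⟩
  exact HomologicalComplex.Hom.isIso_of_components _

end Flip

namespace ActPair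

/-! ### The variant with the tensor factors exchanged. -/

section Push

variable {k : Type u} [Field k]

/-- The actions obtained by composition with a homomorphism. -/
def push {Q S Z Z' : Type u} [Ring Q] [Ring S] [Ring Z] [Ring Z'] [Algebra k Q] [Algebra k S]
    [Algebra k Z] [Algebra k Z'] (O : ActPair k Q S Z) (τ : Z →ₐ[k] Z') : ActPair k Q S Z' where
  src := τ.comp O.src
  tgt := τ.comp O.tgt
  comm s t := (O.comm s t).map τ

lemma onCplx_push_homFun {Q S Z Z' : Type u} [Ring Q] [Ring S] [Ring Z] [Ring Z'] [Algebra k Q]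
    [Algebra k S] [Algebra k Z] [Algebra k Z'] (M : ModuleCat.{u} Q) (O : ActPair k Q S Z)
    (τ : Z →ₐ[k] Z') (E : CochainComplex (ModuleCat.{u} Z') ℤ) :
    (onCplx ((O.push τ).homFun M)).obj E =
      (onCplx (O.homFun M)).obj ((onCplx (resMod τ)).obj E) := by
  exact rfl

variable {Λ Λ' S Q : Type u} [Ring Λ] [Ring Λ'] [Ring S] [Ring Q]
  [Algebra k Λ] [Algebra k Λ'] [Algebra k S] [Algebra k Q] {M : ModuleCat.{u} Q}
  (D : ActPair k Λ' Λ S) {O : ActPair k Q S (S ⊗[k] S)} {O' : ActPair k Q Λ' (S ⊗[k] Λ')}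
  (H : Compat D.swap (D.swap.ext S) O O')
  {J : CochainComplex (ModuleCat.{u} S) ℤ} {K : CochainComplex.Plus (ModuleCat.{u} S)}
  {E C : CochainComplex.Plus (ModuleCat.{u} (S ⊗[k] S))}

include H in
/-- Variant of `exists_quasiIso_of_injective` with the two tensor factors exchanged. -/
theorem exists_quasiIso_of_injective_flip (ι : tens k J J ⟶ E.obj) (κ : tens k K.obj J ⟶ C.obj)
    [IsNoetherianRing Λ] [IsNoetherianRing Λ']
    (hb' : Function.Bijective (liftComm D.src D.tgt D.comm))
    (hγ : Function.Bijective (liftComm O.src O.tgt O.comm))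
    (a b : ℤ) [J.IsStrictlyGE a] [J.IsStrictlyLE b] [(D.res J).IsKInjective]
    [(D.swap.res J).IsKInjective] (hJ : QuasiIso (D.swap.canon J))
    (hJN : NoethHomology (D.swap.res J)) (hK : TermInj K) (hKm : ∃ m, K.obj.IsLE m)
    (hKN : NoethHomology (D.res K.obj)) (hKV : VanishNeg (D.res K.obj) (D.res K.obj))
    (hE : TermInj E) (hC : TermInj C) [QuasiIso ι] [QuasiIso κ]
    {V W : CochainComplex (ModuleCat.{u} S) ℤ}
    (hV : V = (onCplx (O.homFun M)).obj
      ((resMod (Algebra.TensorProduct.comm k S S).toAlgHom).mapCochainComplexPlus.obj E).obj)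
    (hW : W = (onCplx (O.homFun M)).obj
      ((resMod (Algebra.TensorProduct.comm k S S).toAlgHom).mapCochainComplexPlus.obj C).obj)
    (j : J ⟶ V) [QuasiIso j] :
    ∃ y : K.obj ⟶ W, QuasiIso y := by
  subst hV hW
  let τ := (Algebra.TensorProduct.comm k S S).toAlgHom
  have hinj (V : ModuleCat.{u} (S ⊗[k] S)) (hV : Injective V) : Injective ((resMod τ).obj V) :=
    injective_res_of_bijective τ (Algebra.TensorProduct.comm k S S).bijective V
  -- The resolutions are pulled back along the exchange of factors, so that `J` again stands on the
  -- left.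
  let ι' : tens k J J ⟶ ((resMod τ).mapCochainComplexPlus.obj E).obj :=
    tensFlip J J ≫ (onCplx (resMod τ)).map ι
  let κ' : tens k J K.obj ⟶ ((resMod τ).mapCochainComplexPlus.obj C).obj :=
    tensFlip J K.obj ≫ (onCplx (resMod τ)).map κ
  have h1 : QuasiIso ((onCplx (resMod τ)).map ι) := (quasiIso_resMod_iff τ ι).2 inferInstance
  have h2 : QuasiIso ((onCplx (resMod τ)).map κ) := (quasiIso_resMod_iff τ κ).2 inferInstance
  have h3 : QuasiIso (tensFlip (k := k) J J) := inferInstance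
  have h4 : QuasiIso (tensFlip (k := k) J K.obj) := inferInstance
  have h5 : QuasiIso ι' := quasiIso_comp (hφ := h3) (hφ' := h1)
  have h6 : QuasiIso κ' := quasiIso_comp (hφ := h4) (hφ' := h2)
  have h7 : TermInj ((resMod τ).mapCochainComplexPlus.obj E) := fun n => hinj _ (hE n)
  have h8 : TermInj ((resMod τ).mapCochainComplexPlus.obj C) := fun n => hinj _ (hC n)
  exact D.exists_quasiIso_of_injective (C := (resMod τ).mapCochainComplexPlus.obj C)
    (E := (resMod τ).mapCochainComplexPlus.obj E) H ι' κ' hb' hγ a b hJ hJN hK hKm hKN hKV h7 h8 j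

end Push

end ActPair

/-! ### Identities checked on pure tensors. -/

section PureTensors

variable {k X Y Z W R : Type u} [Field k] [Ring X] [Ring Y] [Ring Z] [Ring W] [Ring R]
  [Algebra k X] [Algebra k Y] [Algebra k Z] [Algebra k W] [Algebra k R]

lemma mul_eq_of_tmul (F : X ⊗[k] Y →ₐ[k] R) (G : Z ⊗[k] W →ₐ[k] R)
    (e : (X ⊗[k] Y) ⊗[k] (Z ⊗[k] W) →ₐ[k] R)
    (h : ∀ x y z w, F (x ⊗ₜ y) * G (z ⊗ₜ w) = e ((x ⊗ₜ y) ⊗ₜ (z ⊗ₜ w)))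
    (s : X ⊗[k] Y) (t : Z ⊗[k] W) : F s * G t = e (s ⊗ₜ t) := by
  induction s using TensorProduct.induction_on with
  | zero => rw [zero_tmul, map_zero, map_zero, zero_mul]
  | add s s' hs hs' => rw [add_tmul, map_add, map_add, add_mul, hs, hs']
  | tmul x y =>
    induction t using TensorProduct.induction_on with
    | zero => rw [tmul_zero, map_zero, map_zero, mul_zero]
    | add t t' ht ht' => rw [tmul_add, map_add, map_add, mul_add, ht, ht']
    | tmul z w => exact h x y z w

lemma commute_of_tmul_left (F : X ⊗[k] Y →ₐ[k] R) (r : R) (h : ∀ x y, Commute (F (x ⊗ₜ y)) r)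
    (s : X ⊗[k] Y) : Commute (F s) r := by
  induction s using TensorProduct.induction_on with
  | zero => rw [map_zero]; exact Commute.zero_left _
  | add a b ha hb => rw [map_add]; exact ha.add_left hb
  | tmul a b => exact h a b

end PureTensors

/-! ### The outside and inside actions of `Aᵉ`. -/

section EnvPair

variable (k A : Type u) [Field k] [Ring A] [Algebra k A]

/-- The outside and inside actions. -/
noncomputable def envPair : ActPair k (Env k A) (Env k A) (Env k A ⊗[k] Env k A) :=
  ⟨outside k A, inside k A, commute_outside_inside k A⟩

/-- `Aᵉ ⊗ Aᵉ` has four tensor factors; the outside and inside actions each use two of them, so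
together they are a permutation of the factors. -/
lemma bijective_envPair :
    Function.Bijective (liftComm (k := k) (Λ := Env k A) (T := Env k A)
      (Z := Env k A ⊗[k] Env k A) (envPair k A).src (envPair k A).tgt (envPair k A).comm) := by
  let e : Env k A ⊗[k] Env k A ≃ₐ[k] Env k A ⊗[k] Env k A :=
    (Algebra.TensorProduct.comm k _ _).trans
      ((Algebra.TensorProduct.congr AlgEquiv.refl (Algebra.TensorProduct.comm k A Aᵐᵒᵖ)).trans
        ((Algebra.TensorProduct.tensorTensorTensorComm k k k k A Aᵐᵒᵖ Aᵐᵒᵖ A).trans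
          (Algebra.TensorProduct.congr AlgEquiv.refl (Algebra.TensorProduct.comm k Aᵐᵒᵖ A))))
  refine bijective_liftComm_of _ _ _ e fun t s => ?_
  refine mul_eq_of_tmul (R := Env k A ⊗[k] Env k A) (inside k A) (outside k A) e.toAlgHom (fun c d a b => ?_) t s
  change ((1 ⊗ₜ[k] d) ⊗ₜ[k] (c ⊗ₜ[k] 1)) * ((a ⊗ₜ[k] 1) ⊗ₜ[k] (1 ⊗ₜ[k] b)) =
    (a ⊗ₜ[k] d) ⊗ₜ[k] (c ⊗ₜ[k] b)
  simp only [Algebra.TensorProduct.tmul_mul_tmul, one_mul, mul_one]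

/-- The actions of `Aᵉ` and `Aᵒᵖ` on `Aᵉ ⊗ Aᵒᵖ` induced by the outside and inside actions. -/
noncomputable def envPairRight : ActPair k (Env k A) Aᵐᵒᵖ (Env k A ⊗[k] Aᵐᵒᵖ) where
  src := Algebra.TensorProduct.map Algebra.TensorProduct.includeLeft (AlgHom.id k _)
  tgt := Algebra.TensorProduct.includeLeft.comp (inclRight k A)
  comm s t := commute_of_tmul_left (R := Env k A ⊗[k] Aᵐᵒᵖ) _ _ (fun a b => by
      change ((a ⊗ₜ[k] 1) ⊗ₜ[k] b) * ((1 ⊗ₜ[k] t) ⊗ₜ[k] 1) =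
        ((1 ⊗ₜ[k] t) ⊗ₜ[k] 1) * ((a ⊗ₜ[k] 1) ⊗ₜ[k] b)
      simp only [Algebra.TensorProduct.tmul_mul_tmul, one_mul, mul_one]) s

/-- The actions of `Aᵉ` and `A` on `Aᵉ ⊗ A` induced by the outside and inside actions. -/
noncomputable def envPairLeft : ActPair k (Env k A) A (Env k A ⊗[k] A) where
  src := (Algebra.TensorProduct.map Algebra.TensorProduct.includeRight (AlgHom.id k _)).comp
    (Algebra.TensorProduct.comm k A Aᵐᵒᵖ).toAlgHom
  tgt := Algebra.TensorProduct.includeLeft.comp (inclLeft k A)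
  comm s t := commute_of_tmul_left (R := Env k A ⊗[k] A) _ _ (fun a b => by
      change ((1 ⊗ₜ[k] b) ⊗ₜ[k] a) * ((t ⊗ₜ[k] 1) ⊗ₜ[k] 1) =
        ((t ⊗ₜ[k] 1) ⊗ₜ[k] 1) * ((1 ⊗ₜ[k] b) ⊗ₜ[k] a)
      simp only [Algebra.TensorProduct.tmul_mul_tmul, one_mul, mul_one]) s

/-- In `M ⊗ N` the inside action multiplies `N` on the left and `M` on the right. With the complex
of interest in the second place, its left action is therefore inside, and its right action outside.
-/
lemma compat_right : ActPair.Compat (bimodPair k A).swap.swap ((bimodPair k A).swap.swap.ext (Env k A))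
    (envPair k A) (envPairRight k A) where
  src_eq s := by
    induction s using TensorProduct.induction_on with
    | zero => rw [map_zero, map_zero, map_zero]
    | add a b ha hb => rw [map_add, map_add, map_add, ha, hb]
    | tmul a b => rfl
  tgt_eq t := rfl
  tgt_src_eq a := rfl

/-- The actions of `envPair`, after exchanging the two factors. -/
noncomputable def envPairFlip : ActPair k (Env k A) (Env k A) (Env k A ⊗[k] Env k A) :=
  (envPair k A).push (Algebra.TensorProduct.comm k (Env k A) (Env k A)).toAlgHom

lemma push_envPairFlip : (envPairFlip k A).push
    (Algebra.TensorProduct.comm k (Env k A) (Env k A)).toAlgHom = envPair k A := by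
  have h (φ : Env k A →ₐ[k] Env k A ⊗[k] Env k A) :
      (Algebra.TensorProduct.comm k (Env k A) (Env k A)).toAlgHom.comp
        ((Algebra.TensorProduct.comm k (Env k A) (Env k A)).toAlgHom.comp φ) = φ :=
    AlgHom.ext fun x => (Algebra.TensorProduct.comm k (Env k A) (Env k A)).symm_apply_apply (φ x)
  have h1 := h (outside k A)
  have h2 := h (inside k A)
  dsimp only [ActPair.push, envPairFlip, envPair]
  congr 1

lemma bijective_envPairFlip : Function.Bijective
    (liftComm (k := k) (Λ := Env k A) (T := Env k A)
      (Z := Env k A ⊗[k] Env k A) (envPairFlip k A).src (envPairFlip k A).tgt (envPairFlip k A).comm) := by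
  refine bijective_liftComm_of _ _ _ ((AlgEquiv.ofBijective _ (bijective_envPair k A)).trans
    (Algebra.TensorProduct.comm k (Env k A) (Env k A))) fun t s => ?_
  refine (map_mul (Algebra.TensorProduct.comm k (Env k A) (Env k A)) _ _).symm.trans ?_
  exact congrArg (Algebra.TensorProduct.comm k (Env k A) (Env k A))
    (Algebra.TensorProduct.lift_tmul _ _ (fun t s => ((envPair k A).comm s t).symm) t s).symm

/-- The mirror case: after the exchange the complex of interest stands second again, now with its
right action inside and its left action outside. -/
lemma compat_left : ActPair.Compat (bimodPair k A).swap ((bimodPair k A).swap.ext (Env k A))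
    (envPairFlip k A) (envPairLeft k A) where
  src_eq s := by
    induction s using TensorProduct.induction_on with
    | zero => rw [map_zero, map_zero, map_zero]
    | add a b ha hb => rw [map_add, map_add, map_add, ha, hb]
    | tmul a b => rfl
  tgt_eq t := rfl
  tgt_src_eq a := rfl

end EnvPair

/-! ### The rigidifying isomorphism on resolutions. -/

section Existence

variable {k A : Type u} [Field k] [Ring A] [Algebra k A]

/-- Outside and inside actions together make up all of `Aᵉ ⊗ Aᵉ`, so Hom with respect to one of them
is injective for the other. Hence the rigidifying isomorphism can be represented by a chain map. -/
lemma termInj_homEnv {E : CochainComplex.Plus (ModuleCat.{u} (Env k A ⊗[k] Env k A))}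
    (hE : TermInj E) : TermInj ((homEnv k A).mapCochainComplexPlus.obj E) := fun n =>
  have := hE n
  (envPair k A).injective_homFun (bimodSelf k A) (E.obj.X n)
    (injective_res_of_bijective _ (bijective_envPair k A) _)

/-- The rigidifying isomorphism, as a morphism of complexes. -/
lemma exists_rigidity_map (R : RigidDualizingComplex k A)
    {I : CochainComplex.Plus (ModuleCat.{u} (Env k A))} (e : (QPlus (Env k A)).obj I ≅ R.R)
    {E : CochainComplex.Plus (ModuleCat.{u} (Env k A ⊗[k] Env k A))} (hE : TermInj E)
    (ι : (diagTotal (extTensor k (S := Env k A))).obj I ⟶ E) (hι : QuasiIso ι.hom) :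
    ∃ j : I ⟶ (homEnv k A).mapCochainComplexPlus.obj E, QuasiIso j.hom ∧
      (QPlus (Env k A)).map j ≫ (rhomSqIso k A hE ι hι).hom =
        e.hom ≫ R.φ.hom ≫ (rhomSq k A).map e.inv := by
  obtain ⟨j, hj⟩ := exists_QPlus_map_eq (termInj_homEnv hE)
    ((e.hom ≫ R.φ.hom ≫ (rhomSq k A).map e.inv) ≫ (rhomSqIso k A hE ι hι).inv)
  refine ⟨j, ?_, ?_⟩
  · rw [← isIso_QPlus_map_iff, hj]
    infer_instance
  · rw [hj, Category.assoc, Iso.inv_hom_id, Category.comp_id]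

end Existence

/-! ### Two rigid dualizing complexes are isomorphic. -/

section Existence

variable {k A : Type u} [Field k] [Ring A] [Algebra k A]

lemma NoethHomology.of_quasiIso {Λ : Type u} [Ring Λ] {K L : CochainComplex (ModuleCat.{u} Λ) ℤ}
    (f : K ⟶ L) [QuasiIso f] (h : NoethHomology L) : NoethHomology K := fun i =>
  isNoetherian_of_moduleIso (asIso (HomologicalComplex.homologyMap f i)).symm (h i)

variable [IsNoetherianRing A] [IsNoetherianRing Aᵐᵒᵖ] {R : DPlus (Env k A)} (hR : IsDualizing R)
    {I : CochainComplex.Plus (ModuleCat.{u} (Env k A))} (hI : TermInj I)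
    (e : (QPlus (Env k A)).obj I ≅ R)

include hR e

lemma noethHomology_left : NoethHomology ((bimodPair k A).res I.obj) :=
  noethHomology_of_Q ((resDIso (inclLeft k A) I).symm ≪≫ (resD (inclLeft k A)).mapIso e)
    hR.finite_left

lemma noethHomology_right : NoethHomology ((bimodPair k A).swap.res I.obj) :=
  noethHomology_of_Q ((resDIso (inclRight k A) I).symm ≪≫ (resD (inclRight k A)).mapIso e)
    hR.finite_right

include hI

/-- Collects what biduality asks of `J`; each property is carried over from the injective resolution
`I` along the quasi-isomorphism `J → I`. -/
lemma exists_bounded_model : ∃ (a b : ℤ) (J : CochainComplex (ModuleCat.{u} (Env k A)) ℤ)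
    (i : J ⟶ I.obj), QuasiIso i ∧ J.IsStrictlyGE a ∧ J.IsStrictlyLE b ∧
      ((bimodPair k A).res J).IsKInjective ∧ ((bimodPair k A).swap.res J).IsKInjective ∧
      QuasiIso ((bimodPair k A).canon J) ∧ QuasiIso ((bimodPair k A).swap.canon J) ∧
      NoethHomology ((bimodPair k A).res J) ∧ NoethHomology ((bimodPair k A).swap.res J) := by
  obtain ⟨a, ha⟩ := I.property
  obtain ⟨b, J, i, _, _, _, h1, h2⟩ := exists_bounded_injective hR hI e a
  have q1 : QuasiIso ((onCplx (resMod (bimodPair k A).src)).map i) :=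
    (quasiIso_resMod_iff _ i).2 inferInstance
  have q2 : QuasiIso ((onCplx (resMod (bimodPair k A).tgt)).map i) :=
    (quasiIso_resMod_iff _ i).2 inferInstance
  have q2' : QuasiIso ((onCplx (resMod (bimodPair k A).swap.src)).map i) := q2
  have k1 := ActPair.isKInjective_res (bimodPair k A).src ⟨J, a, inferInstance⟩ h1
  have k2 := ActPair.isKInjective_res (bimodPair k A).tgt ⟨J, a, inferInstance⟩ h2
  have k3 := ActPair.isKInjective_res (bimodPair k A).src I
    (fun n => have := hI n; injective_res_left _)
  have k4 := ActPair.isKInjective_res (bimodPair k A).tgt I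
    (fun n => have := hI n; injective_res_right _)
  have k2' : ((bimodPair k A).swap.res J).IsKInjective := k2
  have k4' : ((bimodPair k A).swap.res I.obj).IsKInjective := k4
  have c1 := (bimodPair k A).quasiIso_canon (isCanon_left hR hI e)
  have c2 := (bimodPair k A).swap.quasiIso_canon (isCanon_right hR hI e)
  exact ⟨a, b, J, i, inferInstance, inferInstance, inferInstance, k1, k2,
    (bimodPair k A).quasiIso_canon_of_quasiIso i, (bimodPair k A).swap.quasiIso_canon_of_quasiIso i,
    (noethHomology_left hR e).of_quasiIso ((onCplx (resMod (bimodPair k A).src)).map i),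
    (noethHomology_right hR e).of_quasiIso ((onCplx (resMod (bimodPair k A).swap.src)).map i)⟩

omit hR hI e

/-- Exchanging the two factors twice is the identity, so the square functor may be computed with
flipped actions on flipped complexes. -/
lemma onCplx_homFun_envPair (k A : Type u) [Field k] [Ring A] [Algebra k A]
    (E : CochainComplex (ModuleCat.{u} (Env k A ⊗[k] Env k A)) ℤ) :
    (onCplx ((envPair k A).homFun (bimodSelf k A))).obj E =
      (onCplx ((envPairFlip k A).homFun (bimodSelf k A))).obj ((onCplx (resMod
        (Algebra.TensorProduct.comm k (Env k A) (Env k A)).toAlgHom)).obj E) := by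
  rw [← ActPair.onCplx_push_homFun, push_envPairFlip]

/-- Two rigid dualizing complexes are isomorphic. -/
theorem nonempty_iso (R R' : RigidDualizingComplex k A) : Nonempty (R.R ≅ R'.R) := by
  obtain ⟨I, hI, ⟨e⟩⟩ := exists_termInj_iso R.R
  obtain ⟨I', hI', ⟨e'⟩⟩ := exists_termInj_iso R'.R
  obtain ⟨E, ι, hE, hι⟩ := exists_quasiIso_termInj ((diagTotal (extTensor k (S := Env k A))).obj I)
  obtain ⟨E', ι', hE', hι'⟩ := exists_quasiIso_termInj ((diagTotal (extTensor k (S := Env k A))).obj I')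
  obtain ⟨j, hj, -⟩ := exists_rigidity_map R e hE ι hι
  obtain ⟨j', hj', -⟩ := exists_rigidity_map R' e' hE' ι' hι'
  obtain ⟨a, b, J, i, hi, _, _, k1, _, c1, c2, n1, n2⟩ := exists_bounded_model R.isDualizing hI e
  obtain ⟨a', b', J', i', hi', _, _, _, _, c1', c2', n1', n2'⟩ :=
    exists_bounded_model R'.isDualizing hI' e'
  obtain ⟨m, hm⟩ := R.isDualizing.bounded
  obtain ⟨m', hm'⟩ := R'.isDualizing.bounded
  obtain ⟨l, hl⟩ := I.property
  obtain ⟨l', hl'⟩ := I'.property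
  -- A resolution of the mixed tensor product `I ⊗ I'`; both complexes will be compared with
  -- `Hom_{Aᵉ}(A, C)`.
  obtain ⟨C, κ, hC, hκ⟩ := exists_quasiIso_termInj
    (⟨tens k I.obj I'.obj, l + l', isStrictlyGE_tens k l l' (l + l') le_rfl⟩ :
      CochainComplex.Plus (ModuleCat.{u} (Env k A ⊗[k] Env k A)))
  let κ₀ : tens k I.obj I'.obj ⟶ C.obj := κ.hom
  let ι₀ : tens k I.obj I.obj ⟶ E.obj := ι.hom
  let ι₀' : tens k I'.obj I'.obj ⟶ E'.obj := ι'.hom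
  have hκ₀ : QuasiIso κ₀ := hκ
  have hι₀ : QuasiIso ι₀ := hι
  have hι₀' : QuasiIso ι₀' := hι'
  have k1' : ((bimodPair k A).swap.swap.res J).IsKInjective := k1
  have p1 : QuasiIso (tensMap k i i ≫ ι₀) :=
    quasiIso_comp (hφ := quasiIso_tensMap k i i) (hφ' := hι₀)
  have p2 : QuasiIso (tensMap k i' i' ≫ ι₀') :=
    quasiIso_comp (hφ := quasiIso_tensMap k i' i') (hφ' := hι₀')
  have p3 : QuasiIso (tensMap k i (𝟙 I'.obj) ≫ κ₀) :=
    quasiIso_comp (hφ := quasiIso_tensMap k i (𝟙 _)) (hφ' := hκ₀)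
  have p4 : QuasiIso (tensMap k (𝟙 I.obj) i' ≫ κ₀) :=
    quasiIso_comp (hφ := quasiIso_tensMap k (𝟙 _) i') (hφ' := hκ₀)
  let j₁ : J ⟶ (onCplx ((envPair k A).homFun (bimodSelf k A))).obj E.obj := i ≫ j.hom
  have q1 : QuasiIso j₁ := quasiIso_comp (hφ := hi) (hφ' := hj)
  let j₂ : J' ⟶ (onCplx ((envPair k A).homFun (bimodSelf k A))).obj E'.obj := i' ≫ j'.hom
  have q2 : QuasiIso j₂ := quasiIso_comp (hφ := hi') (hφ' := hj')
  have hm1 : ∃ m, I.obj.IsLE m := ⟨m, isLE_of_Q e m⟩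
  have hm2 : ∃ m, I'.obj.IsLE m := ⟨m', isLE_of_Q e' m'⟩
  -- Rigidity of the first complex, with biduality applied to the second complex as a right module.
  have s1 : ∃ y : I'.obj ⟶ (onCplx ((envPair k A).homFun (bimodSelf k A))).obj C.obj, QuasiIso y :=
    ActPair.exists_quasiIso_of_injective (bimodPair k A).swap (O := envPair k A) (E := E)
      (compat_right k A) (tensMap k i i ≫ ι₀) (tensMap k i (𝟙 I'.obj) ≫ κ₀)
      (bijective_liftComm_bimodPair_swap k A) (bijective_envPair k A) a b c1 n1 hI' hm2
      (noethHomology_right R'.isDualizing e') (isCanon_right R'.isDualizing hI' e').vanishNeg hE hC j₁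
  -- Rigidity of the second complex, with biduality applied to the first complex as a left module
  -- and the tensor factors exchanged.
  have s2 : ∃ y : I.obj ⟶ (onCplx ((envPair k A).homFun (bimodSelf k A))).obj C.obj, QuasiIso y :=
    ActPair.exists_quasiIso_of_injective_flip (bimodPair k A) (O := envPairFlip k A) (E := E')
      (compat_left k A) (tensMap k i' i' ≫ ι₀') (tensMap k (𝟙 I.obj) i' ≫ κ₀)
      (bijective_liftComm_bimodPair k A) (bijective_envPairFlip k A) a' b' c2' n2' hI hm1
      (noethHomology_left R.isDualizing e) (isCanon_left R.isDualizing hI e).vanishNeg hE' hC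
      (onCplx_homFun_envPair k A E'.obj) (onCplx_homFun_envPair k A C.obj) j₂
  obtain ⟨y, hy⟩ := s1
  obtain ⟨y', hy'⟩ := s2
  let z : I' ⟶ (homEnv k A).mapCochainComplexPlus.obj C := ObjectProperty.homMk y
  let z' : I ⟶ (homEnv k A).mapCochainComplexPlus.obj C := ObjectProperty.homMk y'
  have hz := (isIso_QPlus_map_iff z).2 hy
  have hz' := (isIso_QPlus_map_iff z').2 hy'
  exact ⟨e.symm ≪≫ asIso ((QPlus _).map z') ≪≫ (asIso ((QPlus _).map z)).symm ≪≫ e'⟩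

end Existence

/-! ### Maps that are multiples of a fixed map. -/

section Scalars

variable {k : Type u} [Field k] {S S' : Type u} [Ring S] [Ring S'] [Algebra k S] [Algebra k S']

/-- Multiplication by an element of `S` commuting with the image of `g`. -/
noncomputable abbrev mulBy (g : S' →ₐ[k] S) (t : S) (h : ∀ s, Commute (g s) t)
    (K : CochainComplex (ModuleCat.{u} S) ℤ) :
    (onCplx (resMod g)).obj K ⟶ (onCplx (resMod g)).obj K :=
  natCplx (mulNat g t h) K

variable {Λ T T' : Type u} [Ring Λ] [Ring T] [Ring T'] [Algebra k Λ] [Algebra k T] [Algebra k T']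
  (D : ActPair k Λ T' S') (g : S' →ₐ[k] S) (τ : T →ₐ[k] S)
  (hτ : ∀ s t, Commute ((g.comp D.src) s) (τ t))

/-- The actions of `Λ` and `T` on `S`-modules. -/
abbrev ActPair.along : ActPair k Λ T S := ⟨g.comp D.src, τ, hτ⟩

variable {I : CochainComplex (ModuleCat.{u} S) ℤ} {I' : CochainComplex (ModuleCat.{u} S') ℤ}

/-- The map of complexes of `Λ`-modules underlying a map of complexes of `S'`-modules. -/
noncomputable def ActPair.resMap (ψ : (onCplx (resMod g)).obj I ⟶ I') :
    (D.along g τ hτ).res I ⟶ D.res I' :=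
  (onCplx (resMod D.src)).map ψ

/-- The `Λ`-linear maps `I → W` are, up to homotopy, the multiples of `θ` by elements of `T`. -/
structure ActPair.IsFreeMap (O : ActPair k Λ T S) {W : CochainComplex (ModuleCat.{u} Λ) ℤ}
    (θ : O.res I ⟶ W) : Prop where
  vanishNeg : VanishNeg (O.res I) W
  surj : ∀ z : O.res I ⟶ W, ∃ t, Nonempty (Homotopy z (O.mul t I ≫ θ))
  inj : ∀ t, Nonempty (Homotopy (O.mul t I ≫ θ) 0) → t = 0

lemma ActPair.IsFreeMap.eq_of_homotopy {O : ActPair k Λ T S}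
    {W : CochainComplex (ModuleCat.{u} Λ) ℤ} {θ : O.res I ⟶ W} (hθ : O.IsFreeMap θ) {t t' : T}
    (h : Nonempty (Homotopy (O.mul t I ≫ θ) (O.mul t' I ≫ θ))) : t = t' := by
  rw [← sub_eq_zero]
  refine hθ.inj _ ⟨(Homotopy.ofEq ?_).trans (Homotopy.equivSubZero h.some)⟩
  rw [← Preadditive.sub_comp]
  congr 1
  rw [eq_sub_iff_add_eq, ← ActPair.mul_add', sub_add_cancel]

/-- Only the linearity of `ψ` over the second action, read as a relation between multiplications on
the source and on the target. -/
lemma ActPair.mul_resMap (f₂ : T' →ₐ[k] T) (hf : ∀ t', g (D.tgt t') = τ (f₂ t'))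
    (ψ : (onCplx (resMod g)).obj I ⟶ I') (t' : T') :
    (D.along g τ hτ).mul (f₂ t') I ≫ D.resMap g τ hτ ψ = D.resMap g τ hτ ψ ≫ D.mul t' I' := by
  ext n x
  refine Eq.trans ?_ (map_smul (ψ.f n).hom (D.tgt t')
    (show ((onCplx (resMod g)).obj I).X n from x))
  exact congrArg (fun w : S => ψ.f n (w • (show I.X n from x))) (hf t').symm

lemma ActPair.resMap_mulBy (ψ : (onCplx (resMod g)).obj I ⟶ I') (t : T)
    (ht : ∀ s, Commute (g s) (τ t)) : D.resMap g τ hτ (mulBy g (τ t) ht I ≫ ψ) =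
      (D.along g τ hτ).mul t I ≫ D.resMap g τ hτ ψ := by
  ext n x
  rfl

variable {D g τ hτ} in
/-- A map of complexes of `S'`-modules `I → I'` is, up to homotopy, a multiple of `ψ`. -/
lemma ActPair.exists_scalar_of_isFreeMap {ψ : (onCplx (resMod g)).obj I ⟶ I'}
    (hψ : (D.along g τ hτ).IsFreeMap (D.resMap g τ hτ ψ)) (hb : Function.Bijective (liftComm D.tgt D.src (fun u l => (D.comm l u).symm)))
    (f₂ : T' →ₐ[k] T) (hf : ∀ t', g (D.tgt t') = τ (f₂ t')) (a b : ℤ) [I.IsLE a]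
    [I'.IsStrictlyGE b] [∀ p, Injective (I'.X p)] (ψ' : (onCplx (resMod g)).obj I ⟶ I') :
    ∃ (t : T) (ht : ∀ s, Commute (g s) (τ t)),
      Nonempty (Homotopy ψ' (mulBy g (τ t) ht I ≫ ψ)) := by
  obtain ⟨t, ⟨ht⟩⟩ := hψ.surj (D.resMap g τ hτ ψ')
  -- `ψ'` and `ψ` are linear over `T'`, so the scalars `t f₂(t')` and `f₂(t') t` give homotopic
  -- multiples of `ψ`; uniqueness of scalars makes them equal.
  have h1 (t' : T') : t * f₂ t' = f₂ t' * t := by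
    refine hψ.eq_of_homotopy ⟨?_⟩
    rw [ActPair.mul_mul', ActPair.mul_mul', Category.assoc, Category.assoc]
    rw [ActPair.mul_resMap D g τ hτ f₂ hf]
    refine (ht.symm.compLeft _).trans ?_
    rw [ActPair.mul_resMap D g τ hτ f₂ hf, ← Category.assoc]
    exact ht.compRight _
  -- `S'` is generated by `Λ`, which commutes with all of `T`, and by `T'`.
  have h2 (s : S') : Commute (g s) (τ t) := by
    obtain ⟨x, rfl⟩ := hb.2 s
    refine commute_of_tmul_left (g.comp (liftComm D.tgt D.src (fun u l => (D.comm l u).symm))) (τ t)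
      (fun l t' => ?_) x
    have h3 : (g.comp (liftComm D.tgt D.src (fun u l => (D.comm l u).symm))) (l ⊗ₜ t') =
        g (D.src l) * g (D.tgt t') :=
      (congrArg g (Algebra.TensorProduct.lift_tmul D.src D.tgt
        (fun l u => D.comm l u) l t')).trans (map_mul g _ _)
    rw [h3, hf]
    refine Commute.mul_left (hτ l t) ?_
    exact (show Commute (f₂ t') t from (h1 t').symm).map τ
  refine ⟨t, h2, ?_⟩
  have := isLE_resMod g I a
  have hv : VanishNeg ((onCplx (resMod D.src)).obj ((onCplx (resMod g)).obj I))
      ((onCplx (resMod D.src)).obj I') := hψ.vanishNeg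
  -- The homotopy found so far is only `Λ`-linear; vanishing in negative degrees makes it
  -- `S'`-linear.
  refine homotopic_of_res (M := (onCplx (resMod g)).obj I) (N := I') D.src D.tgt
    (fun u l => (D.comm l u).symm) hb a b hv _ _ ⟨?_⟩
  exact ht.trans (Homotopy.ofEq (D.resMap_mulBy g τ hτ ψ t h2).symm)

end Scalars

/-! ### Maps into a complex through its coextension. -/

section Adjunction

variable {C D : Type*} [Category* C] [Category* D] [Abelian C] [Abelian D]
  {F : C ⥤ D} {G : D ⥤ C} [F.Additive] [G.Additive] (adj : F ⊣ G)
  {M P : CochainComplex C ℤ} {W : CochainComplex D ℤ}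

/-- The cochain `M ⟶ G(W)` adjoint to a cochain `F(M) ⟶ W`. -/
def adjointCochain {n : ℤ} (w : Cochain ((onCplx F).obj M) W n) :
    Cochain M ((onCplx G).obj W) n :=
  (Cochain.ofHom (unitCplx adj M)).comp (w.map G) (zero_add n)

lemma δ_adjointCochain {n m : ℤ} (w : Cochain ((onCplx F).obj M) W n) :
    δ n m (adjointCochain adj w) = adjointCochain adj (δ n m w) := by
  rw [adjointCochain, δ_ofHom_comp, δ_map, adjointCochain]

lemma map_adjointCochain {n : ℤ} (w : Cochain ((onCplx F).obj M) W n) :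
    ((adjointCochain adj w).map F).comp (Cochain.ofHom (counitCplx adj W)) (add_zero n) = w := by
  ext p q h
  have e {X : C} {Y : D} (w : F.obj X ⟶ Y) :
      F.map (adj.unit.app X ≫ G.map w) ≫ adj.counit.app Y = w := by
    simp
  rw [Cochain.comp_zero_cochain_v, adjointCochain, Cochain.map_v, Cochain.zero_cochain_comp_v,
    Cochain.ofHom_v, Cochain.ofHom_v, Cochain.map_v]
  exact e (w.v p q h)

lemma adjointCochain_map_comp {n : ℤ} (y : Cochain M P n) (θ : (onCplx F).obj P ⟶ W) :
    adjointCochain adj ((y.map F).comp (Cochain.ofHom θ) (add_zero n)) =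
      y.comp (Cochain.ofHom (unitCplx adj P ≫ (onCplx G).map θ)) (add_zero n) := by
  ext p q h
  have e {X Y : C} {Z : D} (u : X ⟶ Y) (w : F.obj Y ⟶ Z) :
      adj.unit.app X ≫ G.map (F.map u ≫ w) = u ≫ adj.unit.app Y ≫ G.map w := by
    simp
  rw [adjointCochain, Cochain.comp_zero_cochain_v, Cochain.zero_cochain_comp_v, Cochain.ofHom_v,
    Cochain.ofHom_v, Cochain.map_v, Cochain.comp_zero_cochain_v, Cochain.map_v, Cochain.ofHom_v]
  exact e _ _

lemma map_ofHom_comp (y : M ⟶ P) (θ : (onCplx F).obj P ⟶ W) :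
    ((Cochain.ofHom y).map F).comp (Cochain.ofHom θ) (add_zero 0) =
      Cochain.ofHom ((onCplx F).map y ≫ θ) := by
  rw [Cochain.ofHom_comp, Cochain.map_ofHom]

lemma δ_map_comp {n m : ℤ} (y : Cochain M P n) (θ : (onCplx F).obj P ⟶ W) :
    δ n m ((y.map F).comp (Cochain.ofHom θ) (add_zero n)) =
      ((δ n m y).map F).comp (Cochain.ofHom θ) (add_zero m) := by
  rw [δ_comp_ofHom, δ_map]

lemma exists_eq_adjointCochain {n : ℤ} (w : Cochain M ((onCplx G).obj W) n) :
    ∃ v : Cochain ((onCplx F).obj M) W n, adjointCochain adj v = w := by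
  refine ⟨(w.map F).comp (Cochain.ofHom (counitCplx adj W)) (add_zero n), ?_⟩
  ext p q h
  have e {X : C} {Y : D} (w : X ⟶ G.obj Y) :
      adj.unit.app X ≫ G.map (F.map w ≫ adj.counit.app Y) = w := by
    simp
  rw [adjointCochain, Cochain.zero_cochain_comp_v, Cochain.ofHom_v, Cochain.map_v,
    Cochain.comp_zero_cochain_v, Cochain.map_v, Cochain.ofHom_v]
  exact e (w.v p q h)

lemma adjointCochain_injective {n : ℤ} {w w' : Cochain ((onCplx F).obj M) W n}
    (h : adjointCochain adj w = adjointCochain adj w') : w = w' := by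
  rw [← map_adjointCochain adj w, h, map_adjointCochain]

lemma adjointCochain_add {n : ℤ} (w w' : Cochain ((onCplx F).obj M) W n) :
    adjointCochain adj (w + w') = adjointCochain adj w + adjointCochain adj w' := by
  rw [adjointCochain, Cochain.map_add, Cochain.comp_add, adjointCochain, adjointCochain]

variable [P.IsKInjective] [((onCplx G).obj W).IsKInjective] (θ : (onCplx F).obj P ⟶ W)
  [QuasiIso (unitCplx adj P ≫ (onCplx G).map θ)]

include adj in
/-- If the adjoint of `θ : F(P) ⟶ W` is a quasi-isomorphism between K-injective complexes, then
cocycles `F(M) ⟶ W` factor through `θ` up to coboundaries. -/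
lemma exists_map_comp_eq {n n' m : ℤ} (hn : n + 1 = n') (hm : m + 1 = n)
    (z : Cochain ((onCplx F).obj M) W n) (hz : δ n n' z = 0) :
    ∃ (y : Cochain M P n) (w : Cochain ((onCplx F).obj M) W m), δ n n' y = 0 ∧
      (y.map F).comp (Cochain.ofHom θ) (add_zero n) = z + δ m n w := by
  -- Pass to adjoint cochains, where composition with `θ` becomes composition with a
  -- quasi-isomorphism of K-injective complexes.
  obtain ⟨y, w, hy, hw⟩ := postcomp_surj (unitCplx adj P ≫ (onCplx G).map θ) hn hm
    (adjointCochain adj z) (by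
      rw [δ_adjointCochain, hz, adjointCochain, Cochain.map_zero, Cochain.comp_zero])
  obtain ⟨w, rfl⟩ := exists_eq_adjointCochain adj w
  refine ⟨y, w, hy, adjointCochain_injective adj ?_⟩
  rw [adjointCochain_map_comp, hw, adjointCochain_add, δ_adjointCochain]

include adj in
lemma exists_δ_eq_of_map_comp {n n' m : ℤ} (hn : n + 1 = n') (hm : m + 1 = n)
    (y : Cochain M P n) (hy : δ n n' y = 0) (w : Cochain ((onCplx F).obj M) W m)
    (h : (y.map F).comp (Cochain.ofHom θ) (add_zero n) = δ m n w) :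
    ∃ v : Cochain M P m, δ m n v = y :=
  postcomp_inj (unitCplx adj P ≫ (onCplx G).map θ) hn hm y hy (adjointCochain adj w) (by
    rw [← adjointCochain_map_comp, h, δ_adjointCochain])

end Adjunction

/-! ### Condition (i) makes linear maps free over one generator. -/

section Free

variable {k : Type u} [Field k] {Λ Λ' T S : Type u} [Ring Λ] [Ring Λ'] [Ring T] [Ring S]
  [Algebra k Λ] [Algebra k Λ'] [Algebra k T] [Algebra k S]

/-- Restriction of the first action of an action pair. -/
abbrev ActPair.precomp (D : ActPair k Λ' T S) (f : Λ →ₐ[k] Λ') : ActPair k Λ T S :=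
  ⟨D.src.comp f, D.tgt, fun s t => D.comm (f s) t⟩

variable (D : ActPair k Λ' T S) (f : Λ →ₐ[k] Λ') {I : CochainComplex (ModuleCat.{u} S) ℤ}
  {W : CochainComplex (ModuleCat.{u} Λ) ℤ}

lemma ActPair.mul_map_comp (θ : (D.precomp f).res I ⟶ W) (t : T) :
    ((Cochain.ofHom (D.mul t I)).map (resMod f)).comp
      (Cochain.ofHom (F := (onCplx (resMod f)).obj (D.res I)) θ) (add_zero 0) =
    Cochain.ofHom ((D.precomp f).mul t I ≫ θ) := 
  map_ofHom_comp (F := resMod f) (D.mul t I) θ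

/-- If the adjoint `I ⟶ Hom_Λ(Λ', W)` of `θ : I ⟶ W` is a quasi-isomorphism, and if the
`Λ'`-linear endomorphisms of `I` are given by `T`, then the `Λ`-linear maps `I ⟶ W` are the
multiples of `θ`. -/
lemma ActPair.isFreeMap_precomp (hI : D.IsCanon I) [(D.res I).IsKInjective]
    [((onCplx (coextMod f)).obj W).IsKInjective] (θ : (D.precomp f).res I ⟶ W)
    (hθ : QuasiIso (unitCplx (resCoextAdj f) (D.res I) ≫ (onCplx (coextMod f)).map θ)) :
    (D.precomp f).IsFreeMap θ where
  vanishNeg i j l hi hij hl z hz := by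
    -- Cocycles into `W` come from `Λ'`-linear self-cocycles of `I`, which bound in negative
    -- degrees.
    obtain ⟨y, w, hy, hw⟩ := exists_map_comp_eq (resCoextAdj f) (P := D.res I) θ hij hl
      (M := D.res I) z hz
    obtain ⟨v, rfl⟩ := hI.vanishNeg i j l hi hij hl y hy
    let θ' : (onCplx (resMod f)).obj (D.res I) ⟶ W := θ
    refine ⟨(v.map (resMod f)).comp (Cochain.ofHom θ') (add_zero l) - w, ?_⟩
    refine (δ_sub _ _ _ _).trans (sub_eq_of_eq_add ?_)
    exact (δ_map_comp (F := resMod f) v θ').trans hw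
  surj z := by
    -- In degree zero the factor through `θ` is a `Λ'`-linear endomorphism of `I`, that is, a
    -- multiplication by an element of `T`.
    obtain ⟨y, w, hy, hw⟩ := exists_map_comp_eq (resCoextAdj f) (P := D.res I) θ (zero_add 1)
      (neg_add_cancel 1) (M := D.res I) (Cochain.ofHom z) (δ_ofHom z)
    let y' := (Cocycle.mk y 1 (zero_add 1) hy).homOf
    have hy' : Cochain.ofHom y' = y := Cocycle.cochain_ofHom_homOf_eq_coe _
    obtain ⟨t, ⟨ht⟩⟩ := hI.surj y'
    refine ⟨t, ?_⟩
    let θ' : (onCplx (resMod f)).obj (D.res I) ⟶ W := θ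
    rw [← hy'] at hw
    have h1 : Nonempty (Homotopy ((onCplx (resMod f)).map y' ≫ θ') z) :=
      homotopy_of_cochain w ((map_ofHom_comp (F := resMod f) y' θ').symm.trans hw)
    have h2 := ((resMod f).mapHomotopy ht).compRight θ'
    exact ⟨h1.some.symm.trans h2⟩
  inj t ht := by
    obtain ⟨w, hw⟩ := exists_cochain_of_homotopy ht
    rw [Cochain.ofHom_zero, zero_add] at hw
    obtain ⟨v, hv⟩ := exists_δ_eq_of_map_comp (resCoextAdj f) (P := D.res I) θ (zero_add 1)
      (neg_add_cancel 1) (M := D.res I) (Cochain.ofHom (D.mul t I)) (δ_ofHom _) w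
      ((D.mul_map_comp f θ t).trans hw)
    exact hI.inj t (homotopy_of_cochain v (by rw [Cochain.ofHom_zero, zero_add, hv]))

/-- A chain map of module complexes which agrees, as an additive map, with a quasi-isomorphism
over another ring, is a quasi-isomorphism. -/
lemma quasiIso_of_addEquiv {R R' : Type*} [Ring R] [Ring R']
    {K L : CochainComplex (ModuleCat.{v} R) ℤ} {K' L' : CochainComplex (ModuleCat.{v} R') ℤ}
    (f : K ⟶ L) (f' : K' ⟶ L') (a : ∀ n, K.X n ≃+ K'.X n) (b : ∀ n, L.X n ≃+ L'.X n)
    (ha : ∀ i j x, a j (K.d i j x) = K'.d i j (a i x))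
    (hb : ∀ i j x, b j (L.d i j x) = L'.d i j (b i x))
    (hf : ∀ n x, b n (f.f n x) = f'.f n (a n x)) (h : QuasiIso f) : QuasiIso f' := by
  let e₁ : (toAb R).obj K ≅ (toAb R').obj K' :=
    HomologicalComplex.Hom.isoOfComponents (fun n => AddEquiv.toAddCommGrpIso (a n))
      (fun i j _ => ConcreteCategory.hom_ext _ _ fun x => (ha i j x).symm)
  let e₂ : (toAb R).obj L ≅ (toAb R').obj L' :=
    HomologicalComplex.Hom.isoOfComponents (fun n => AddEquiv.toAddCommGrpIso (b n))
      (fun i j _ => ConcreteCategory.hom_ext _ _ fun x => (hb i j x).symm)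
  refine quasiIso_of_toAb_eq f f' (Arrow.isoMk e₁ e₂ ?_) h
  ext n x
  exact (hf n x).symm

/-- The two descriptions of the `Λ`-action on `I` are equal but not by definition. Stating the
hypothesis on the adjoint map elementwise avoids transporting morphisms along this equality. -/
lemma ActPair.isFreeMap_of_eq (hI : D.IsCanon I) (hK : (D.res I).IsKInjective) (b : ℤ)
    [W.IsStrictlyGE b] [∀ n, Injective (W.X n)] (O : ActPair k Λ T S) (hO : O = D.precomp f)
    (θ : O.res I ⟶ W)
    (h : ∀ θ' : D.res I ⟶ (onCplx (coextMod f)).obj W, (∀ n (x : I.X n) (c : Λ'),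
      (ModuleCat.CoextendScalars.equiv f.toRingHom (W.X n) (θ'.f n x)) c =
        θ.f n (show I.X n from D.src c • x)) → QuasiIso θ') : O.IsFreeMap θ := by
  subst hO
  have h1 (n : ℤ) : Injective (((onCplx (coextMod f)).obj W).X n) :=
    (resCoextAdj f).map_injective (W.X n) inferInstance
  have : ((onCplx (coextMod f)).obj W).IsStrictlyGE b := inferInstance
  have := isKInjective_of_injective ((onCplx (coextMod f)).obj W) b
  exact D.isFreeMap_precomp f hI θ (h _ fun _ _ _ => rfl)

end Free

/-! ### The derived evaluation morphism on complexes. -/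

section Eval

variable {P P' : Type u} [Ring P] [Ring P']

/-- The map `H(K) ⟶ F'(H(K))` obtained from `τ : H ⟶ F' ∘ H`. -/
def evalUnit {H : ModuleCat.{u} P ⥤ ModuleCat.{u} P'} [H.Additive]
    {F' : ModuleCat.{u} P' ⥤ ModuleCat.{u} P'} [F'.Additive] (τ : H ⟶ H ⋙ F')
    (K : CochainComplex.Plus (ModuleCat.{u} P)) :
    H.mapCochainComplexPlus.obj K ⟶
      F'.mapCochainComplexPlus.obj (H.mapCochainComplexPlus.obj K) :=
  ObjectProperty.homMk (natCplx τ K.obj)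

/-- The map `H(K) ⟶ F'(L)` obtained from `τ : H ⟶ F' ∘ H` and `ψ : H(K) ⟶ L`. -/
def evalPlus {H : ModuleCat.{u} P ⥤ ModuleCat.{u} P'} [H.Additive]
    {F' : ModuleCat.{u} P' ⥤ ModuleCat.{u} P'} [F'.Additive] (τ : H ⟶ H ⋙ F')
    {K : CochainComplex.Plus (ModuleCat.{u} P)} {L : CochainComplex.Plus (ModuleCat.{u} P')}
    (ψ : H.mapCochainComplexPlus.obj K ⟶ L) :
    H.mapCochainComplexPlus.obj K ⟶ F'.mapCochainComplexPlus.obj L :=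
  evalUnit τ K ≫ F'.mapCochainComplexPlus.map ψ

variable {H : ModuleCat.{u} P ⥤ ModuleCat.{u} P'} [H.Additive]
  [PreservesFiniteLimits H] [PreservesFiniteColimits H]
  {F' : ModuleCat.{u} P' ⥤ ModuleCat.{u} P'} [F'.Additive] (τ : H ⟶ H ⋙ F')
  {K : CochainComplex.Plus (ModuleCat.{u} P)} {L : CochainComplex.Plus (ModuleCat.{u} P')}

/-- The canonical morphism `F(K) ⟶ RF(K)`. -/
noncomputable def unitQ (F : ModuleCat.{u} P ⥤ ModuleCat.{u} P') [F.Additive]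
    (K : CochainComplex.Plus (ModuleCat.{u} P)) :
    (QPlus P').obj (F.mapCochainComplexPlus.obj K) ⟶ (RD F).obj ((QPlus P).obj K) :=
  (unitRD F).app ((HomotopyCategory.Plus.quotient _).obj K)

lemma unitQ_naturality (F : ModuleCat.{u} P ⥤ ModuleCat.{u} P') [F.Additive]
    {K L : CochainComplex.Plus (ModuleCat.{u} P)} (f : K ⟶ L) :
    (QPlus P').map (F.mapCochainComplexPlus.map f) ≫ unitQ F L =
      unitQ F K ≫ (RD F).map ((QPlus P).map f) :=
  (unitRD F).naturality ((HomotopyCategory.Plus.quotient _).map f)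

variable (H) in
/-- `exactD H` is computed by applying `H` termwise. -/
noncomputable def exactQ (K : CochainComplex.Plus (ModuleCat.{u} P)) :
    (exactD H).obj ((QPlus P).obj K) ≅ (QPlus P').obj (H.mapCochainComplexPlus.obj K) :=
  (exactDIsoQ H).app K

variable (H) in
lemma exactQ_naturality {K L : CochainComplex.Plus (ModuleCat.{u} P)} (f : K ⟶ L) :
    (exactD H).map ((QPlus P).map f) ≫ (exactQ H L).hom =
      (exactQ H K).hom ≫ (QPlus P').map (H.mapCochainComplexPlus.map f) :=
  (exactDIsoQ H).hom.naturality f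

lemma quotient_map_evalUnit (K : CochainComplex.Plus (ModuleCat.{u} P)) :
    (HomotopyCategory.Plus.quotient _).map (evalUnit τ K) =
      (mapHPlus τ).app ((HomotopyCategory.Plus.quotient _).obj K) ≫
        (Functor.mapHomotopyCategoryPlusCompIso (Iso.refl (H ⋙ F'))).inv.app
          ((HomotopyCategory.Plus.quotient _).obj K) := by
  rfl

/-- Unfolds the lift to the localization: on an actual complex it is termwise evaluation followed by
the canonical map to the derived functor. -/
lemma derivedEval_app (K : CochainComplex.Plus (ModuleCat.{u} P)) :
    (derivedEval τ).app ((QPlus P).obj K) = (exactQ H K).hom ≫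
      (QPlus P').map (evalUnit τ K) ≫ unitQ F' (H.mapCochainComplexPlus.obj K) ≫
      (RD F').map (exactQ H K).inv := by
  refine (Localization.liftNatTrans_app (QhPlus P) (HomotopyCategory.Plus.quasiIso _) _ _ _ _ _
    ((HomotopyCategory.Plus.quotient _).obj K)).trans ?_
  refine (Category.id_comp _).trans ((Category.comp_id _).trans ?_)
  have h := congrArg (QhPlus P').map (quotient_map_evalUnit τ K)
  exact congrArg (fun y => (exactQ H K).hom ≫ y ≫ unitQ F' (H.mapCochainComplexPlus.obj K) ≫
    (RD F').map (exactQ H K).inv) h.symm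

lemma derivedEval_app_comp (ψ : H.mapCochainComplexPlus.obj K ⟶ L) :
    (derivedEval τ).app ((QPlus P).obj K) ≫ (RD F').map ((exactQ H K).hom ≫
      (QPlus P').map ψ) = (exactQ H K).hom ≫ (QPlus P').map (evalPlus τ ψ) ≫ unitQ F' L := by
  refine (congrArg (· ≫ _) (derivedEval_app τ K)).trans ?_
  rw [evalPlus, Functor.map_comp (QPlus P'), Category.assoc ((QPlus P').map _), unitQ_naturality]
  simp only [Category.assoc, ← Functor.map_comp, Iso.inv_hom_id_assoc]

end Eval

section Eval

variable {P P' : Type u} [Ring P] [Ring P'] {H : ModuleCat.{u} P ⥤ ModuleCat.{u} P'} [H.Additive]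
  [PreservesFiniteLimits H] [PreservesFiniteColimits H]
  {F' : ModuleCat.{u} P' ⥤ ModuleCat.{u} P'} [F'.Additive] (τ : H ⟶ H ⋙ F')

/-- `m ↦ (b ↦ ψ(b m))` is an isomorphism in the derived category if and only if it is a
quasi-isomorphism on injective resolutions. -/
lemma quasiIso_evalPlus {M : DPlus P} {N : DPlus P'} (ψ : (exactD H).obj M ⟶ N)
    {K : CochainComplex.Plus (ModuleCat.{u} P)} {L : CochainComplex.Plus (ModuleCat.{u} P')}
    (e : (QPlus P).obj K ≅ M) (e' : (QPlus P').obj L ≅ N) (hL : TermInj L)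
    (g : H.mapCochainComplexPlus.obj K ⟶ L)
    (hg : (exactQ H K).hom ≫ (QPlus P').map g = (exactD H).map e.hom ≫ ψ ≫ e'.inv)
    (hψ : IsIso ((derivedEval τ).app M ≫ (RD F').map ψ)) : QuasiIso (evalPlus τ g).hom := by
  rw [← isIso_QPlus_map_iff]
  have h1 := derivedEval_app_comp τ g
  rw [hg] at h1
  have h2 : (derivedEval τ).app ((QPlus P).obj K) ≫
      (RD F').map ((exactD H).map e.hom ≫ ψ ≫ e'.inv) =
      (exactD H).map e.hom ≫ ((derivedEval τ).app M ≫ (RD F').map ψ) ≫ (RD F').map e'.inv := by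
    have h3 : (exactD H).map e.hom ≫ (derivedEval τ).app M =
      (derivedEval τ).app ((QPlus P).obj K) ≫ (RD F').map ((exactD H).map e.hom) :=
        (derivedEval τ).naturality e.hom
    rw [Functor.map_comp, Functor.map_comp, Category.assoc, ← Category.assoc, ← h3, Category.assoc]
  -- On a termwise injective `L` the derived functor is computed termwise, so invertibility can be
  -- tested on the chain map.
  have h3 : IsIso (unitQ F' L) := isIso_unitRD F' hL
  have h4 : IsIso ((exactQ H K).hom ≫ (QPlus P').map (evalPlus τ g) ≫ unitQ F' L) := by
    rw [← h1, h2]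
    infer_instance
  have h5 := IsIso.of_isIso_comp_left (exactQ H K).hom ((QPlus P').map (evalPlus τ g) ≫ unitQ F' L)
  exact IsIso.of_isIso_comp_right ((QPlus P').map (evalPlus τ g)) (unitQ F' L)

end Eval

/-! ### Freeness over `B` of the maps `R_B → R_A`. -/

section Free

variable {k A B : Type u} [Field k] [Ring A] [Ring B] [Algebra k A] [Algebra k B] (f : A →ₐ[k] B)

lemma ActPair.mk_eq {Λ T Z : Type u} [Ring Λ] [Ring T] [Ring Z] [Algebra k Λ] [Algebra k T]
    [Algebra k Z] {σ σ' : Λ →ₐ[k] Z} {τ : T →ₐ[k] Z} {h : ∀ s t, Commute (σ s) (τ t)}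
    {h' : ∀ s t, Commute (σ' s) (τ t)} (hσ : σ = σ') :
    (⟨σ, τ, h⟩ : ActPair k Λ T Z) = ⟨σ', τ, h'⟩ := by
  subst hσ
  rfl

lemma envMap_comp_inclLeft : (envMap f).comp (bimodPair k A).src = (inclLeft k B).comp f :=
  AlgHom.ext fun a => envMap_left f a

lemma envMap_comp_inclRight :
    (envMap f).comp (bimodPair k A).swap.src = (inclRight k B).comp (AlgHom.op f) :=
  AlgHom.ext fun a => envMap_right f a

lemma commute_envMap_left (a : A) (b : Bᵐᵒᵖ) :
    Commute (((envMap f).comp (bimodPair k A).src) a) (inclRight k B b) := by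
  rw [envMap_comp_inclLeft]
  exact commute_incl k B (f a) b

lemma commute_envMap_right (a : Aᵐᵒᵖ) (b : B) :
    Commute (((envMap f).comp (bimodPair k A).swap.src) a) (inclLeft k B b) := by
  rw [envMap_comp_inclRight]
  exact (commute_incl k B b (AlgHom.op f a)).symm

variable {I : CochainComplex.Plus (ModuleCat.{u} (Env k B))}
  {I' : CochainComplex.Plus (ModuleCat.{u} (Env k A))} (hI : TermInj I) (hI' : TermInj I')
  (ψ : (resMod (envMap f)).mapCochainComplexPlus.obj I ⟶ I')

include hI hI'

/-- The evaluation map is the adjoint of `ψ` under restriction and coextension along `A → B`. It is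
a quasi-isomorphism by assumption, and the `B`-linear endomorphisms of `I` are right
multiplications. -/
lemma isFreeMap_left (hc : (bimodPair k B).IsCanon I.obj)
    (hψ : QuasiIso (evalPlus (evalLeft f) ψ).hom) :
    ((bimodPair k A).along (envMap f) (inclRight k B) (commute_envMap_left f)).IsFreeMap
      ((bimodPair k A).resMap (envMap f) (inclRight k B) (commute_envMap_left f) ψ.hom) := by
  obtain ⟨b, hb⟩ := I'.property
  obtain ⟨b', hb'⟩ := I.property
  have hW (n : ℤ) : Injective (((bimodPair k A).res I'.obj).X n) :=
    have := hI' n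
    injective_res_left (I'.obj.X n)
  have hW' (n : ℤ) : Injective (((bimodPair k B).res I.obj).X n) :=
    have := hI n
    injective_res_left (I.obj.X n)
  have : ((bimodPair k A).res I'.obj).IsStrictlyGE b := inferInstance
  have : ((bimodPair k B).res I.obj).IsStrictlyGE b' := inferInstance
  refine (bimodPair k B).isFreeMap_of_eq f hc (isKInjective_of_injective _ b') b _
    (ActPair.mk_eq (envMap_comp_inclLeft f)) _ (fun θ' hθ' => ?_)
  -- The two maps carry different module structures but agree as additive maps, which is all a
  -- quasi-isomorphism sees.
  refine quasiIso_of_addEquiv (evalPlus (evalLeft f) ψ).hom θ' (fun n => AddEquiv.refl (I.obj.X n))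
    (fun n => AddEquiv.refl ((leftDatum f).Carrier (I'.obj.X n)))
    (fun i j x => rfl) (fun i j x => rfl) (fun n x => ?_) hψ
  refine LinearMap.ext fun c : B => ?_
  exact (hθ' n x c).symm

lemma isFreeMap_right (hc : (bimodPair k B).swap.IsCanon I.obj)
    (hψ : QuasiIso (evalPlus (evalRight f) ψ).hom) :
    ((bimodPair k A).swap.along (envMap f) (inclLeft k B) (commute_envMap_right f)).IsFreeMap
      ((bimodPair k A).swap.resMap (envMap f) (inclLeft k B) (commute_envMap_right f) ψ.hom) := by
  obtain ⟨b, hb⟩ := I'.property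
  obtain ⟨b', hb'⟩ := I.property
  have hW (n : ℤ) : Injective (((bimodPair k A).swap.res I'.obj).X n) :=
    have := hI' n
    injective_res_right (I'.obj.X n)
  have hW' (n : ℤ) : Injective (((bimodPair k B).swap.res I.obj).X n) :=
    have := hI n
    injective_res_right (I.obj.X n)
  have : ((bimodPair k A).swap.res I'.obj).IsStrictlyGE b := inferInstance
  have : ((bimodPair k B).swap.res I.obj).IsStrictlyGE b' := inferInstance
  refine (bimodPair k B).swap.isFreeMap_of_eq (AlgHom.op f) hc (isKInjective_of_injective _ b') b _
    (ActPair.mk_eq (envMap_comp_inclRight f)) _ (fun θ' hθ' => ?_)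
  -- The right module `B` and the left module `Bᵐᵒᵖ` over itself differ by the wrapper
  -- `MulOpposite`, which has to be inserted by hand.
  let b (n : ℤ) : (rightDatum f).Carrier (I'.obj.X n) ≃+
      ((resMod (AlgHom.op f)).obj (ModuleCat.of Bᵐᵒᵖ Bᵐᵒᵖ) →ₗ[Aᵐᵒᵖ]
        ((bimodPair k A).swap.res I'.obj).X n) :=
    { toFun h :=
        { toFun c := h (MulOpposite.unop (show Bᵐᵒᵖ from c))
          map_add' x y := map_add h (MulOpposite.unop (show Bᵐᵒᵖ from x)) (MulOpposite.unop (show Bᵐᵒᵖ from y))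
          map_smul' a x := map_smul h a (show rightMod f from MulOpposite.unop (show Bᵐᵒᵖ from x)) }
      invFun h :=
        { toFun c := h (MulOpposite.op (show B from c))
          map_add' x y := map_add h (MulOpposite.op (show B from x)) (MulOpposite.op (show B from y))
          map_smul' a x := map_smul h a
            (show (resMod (AlgHom.op f)).obj (ModuleCat.of Bᵐᵒᵖ Bᵐᵒᵖ) from
              MulOpposite.op (show B from x)) }
      left_inv h := rfl
      right_inv h := rfl
      map_add' x y := rfl }
  refine quasiIso_of_addEquiv (evalPlus (evalRight f) ψ).hom θ' (fun n => AddEquiv.refl (I.obj.X n))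
    b (fun i j x => rfl) (fun i j x => rfl) (fun n x => ?_) hψ
  refine LinearMap.ext fun c : Bᵐᵒᵖ => ?_
  exact (hθ' n x c).symm

end Free

/-! ### The derived comparison morphism on complexes. -/

section Comparison

variable {P P' X Y : Type u} [Ring P] [Ring P'] [Ring X] [Ring Y]

/-- The map `G(F(K)) ⟶ F'(H(K))` of bounded below complexes obtained from a natural
transformation. -/
def compPlus {F : ModuleCat.{u} P ⥤ ModuleCat.{u} X} [F.Additive]
    {G : ModuleCat.{u} X ⥤ ModuleCat.{u} Y} [G.Additive]
    {H : ModuleCat.{u} P ⥤ ModuleCat.{u} P'} [H.Additive]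
    {F' : ModuleCat.{u} P' ⥤ ModuleCat.{u} Y} [F'.Additive] (τ : F ⋙ G ⟶ H ⋙ F')
    (K : CochainComplex.Plus (ModuleCat.{u} P)) :
    G.mapCochainComplexPlus.obj (F.mapCochainComplexPlus.obj K) ⟶
      F'.mapCochainComplexPlus.obj (H.mapCochainComplexPlus.obj K) :=
  ObjectProperty.homMk (natCplx τ K.obj)

variable {F : ModuleCat.{u} P ⥤ ModuleCat.{u} X} [F.Additive]
  {G : ModuleCat.{u} X ⥤ ModuleCat.{u} Y} [G.Additive]
  [PreservesFiniteLimits G] [PreservesFiniteColimits G]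
  {H : ModuleCat.{u} P ⥤ ModuleCat.{u} P'} [H.Additive]
  [PreservesFiniteLimits H] [PreservesFiniteColimits H]
  {F' : ModuleCat.{u} P' ⥤ ModuleCat.{u} Y} [F'.Additive] (τ : F ⋙ G ⟶ H ⋙ F')

lemma quotient_map_compPlus (K : CochainComplex.Plus (ModuleCat.{u} P)) :
    (HomotopyCategory.Plus.quotient _).map (compPlus τ K) =
      (Functor.mapHomotopyCategoryPlusCompIso (Iso.refl (F ⋙ G))).hom.app
          ((HomotopyCategory.Plus.quotient _).obj K) ≫
        (mapHPlus τ).app ((HomotopyCategory.Plus.quotient _).obj K) ≫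
        (Functor.mapHomotopyCategoryPlusCompIso (Iso.refl (H ⋙ F'))).inv.app
          ((HomotopyCategory.Plus.quotient _).obj K) := by
  rfl

lemma derivedComparison_app (K : CochainComplex.Plus (ModuleCat.{u} P)) :
    (exactD G).map (unitQ F K) ≫ (derivedComparison τ).app ((QPlus P).obj K) =
      (exactQ G (F.mapCochainComplexPlus.obj K)).hom ≫ (QPlus Y).map (compPlus τ K) ≫
        unitQ F' (H.mapCochainComplexPlus.obj K) ≫ (RD F').map (exactQ H K).inv := by
  refine (congrArg (fun α => α.app ((HomotopyCategory.Plus.quotient _).obj K))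
    ((RD F ⋙ exactD G).rightDerived_fac (F := (F.mapHomotopyCategoryPlus ⋙ QhPlus X) ⋙ exactD G)
    (L := QhPlus P) (Functor.whiskerRight (unitRD F) (exactD G))
    (HomotopyCategory.Plus.quasiIso (ModuleCat.{u} P)) (exactD H ⋙ RD F') _)).trans ?_
  have h := congrArg (QhPlus Y).map (quotient_map_compPlus τ K)
  exact congrArg (fun y => (exactQ G (F.mapCochainComplexPlus.obj K)).hom ≫ y ≫
    unitQ F' (H.mapCochainComplexPlus.obj K) ≫ (RD F').map (exactQ H K).inv) h.symm

/-- Naturality packaged for use on resolutions: a chain map `g` representing `χ` on the chosen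
models determines the composite. -/
lemma derivedComparison_app_comp {M : DPlus P} {N : DPlus P'} (χ : (exactD H).obj M ⟶ N)
    {E : CochainComplex.Plus (ModuleCat.{u} P)} {E' : CochainComplex.Plus (ModuleCat.{u} P')}
    (m : (QPlus P).obj E ⟶ M) (m' : (QPlus P').obj E' ⟶ N)
    (g : H.mapCochainComplexPlus.obj E ⟶ E')
    (hg : (exactQ H E).hom ≫ (QPlus P').map g ≫ m' = (exactD H).map m ≫ χ) :
    (exactD G).map (unitQ F E ≫ (RD F).map m) ≫ (derivedComparison τ).app M ≫ (RD F').map χ =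
      (exactQ G (F.mapCochainComplexPlus.obj E)).hom ≫
        (QPlus Y).map (compPlus τ E ≫ F'.mapCochainComplexPlus.map g) ≫ unitQ F' E' ≫
          (RD F').map m' := by
  have h1 : (exactD G).map ((RD F).map m) ≫ (derivedComparison τ).app M =
      (derivedComparison τ).app ((QPlus P).obj E) ≫ (RD F').map ((exactD H).map m) :=
    (derivedComparison τ).naturality m
  have h2 : (exactD G).map (unitQ F E) ≫ (derivedComparison τ).app ((QPlus P).obj E) ≫
      (RD F').map ((exactD H).map m) ≫ (RD F').map χ =
      ((exactD G).map (unitQ F E) ≫ (derivedComparison τ).app ((QPlus P).obj E)) ≫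
      (RD F').map ((exactD H).map m ≫ χ) := by
    rw [Functor.map_comp, Category.assoc]
  rw [Functor.map_comp, Category.assoc, reassoc_of% h1, h2, derivedComparison_app, ← hg,
    Functor.map_comp (QPlus Y)]
  simp only [Category.assoc]
  rw [← Functor.map_comp, Iso.inv_hom_id_assoc, Functor.map_comp (RD F'),
    ← reassoc_of% unitQ_naturality]

end Comparison

/-! ### The derived tensor square on complexes. -/

section TensorSquare

variable (k : Type u) [Field k] {S T : Type u} [Ring S] [Ring T] [Algebra k S] [Algebra k T]

/-- `tensorSq` is computed by total complexes. -/
noncomputable def sqQ (K : CochainComplex.Plus (ModuleCat.{u} S)) :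
    (tensorSq k S).obj ((QPlus S).obj K) ≅ (QPlus (S ⊗[k] S)).obj ((diagTotal (extTensor k)).obj K) :=
  (tensorSqIso k S).app K

lemma sqQ_naturality {K L : CochainComplex.Plus (ModuleCat.{u} S)} (g : K ⟶ L) :
    (tensorSq k S).map ((QPlus S).map g) ≫ (sqQ k L).hom =
      (sqQ k K).hom ≫ (QPlus (S ⊗[k] S)).map ((diagTotal (extTensor k)).map g) :=
  (tensorSqIso k S).hom.naturality g

variable {k} (φ : S →ₐ[k] T)

/-- The isomorphism between the restriction of `K ⊗ K` and the tensor square of the restriction. -/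
noncomputable def sqRes (K : CochainComplex.Plus (ModuleCat.{u} T)) :
    (diagTotal (extTensor k)).obj ((resMod φ).mapCochainComplexPlus.obj K) ≅
      (resMod (Algebra.TensorProduct.map φ φ)).mapCochainComplexPlus.obj
        ((diagTotal (extTensor k)).obj K) :=
  (sqResIso φ).app K

lemma tensorSqRes_inv_app (K : CochainComplex.Plus (ModuleCat.{u} T)) :
    (tensorSqRes φ).inv.app ((QPlus T).obj K) =
      (resD (Algebra.TensorProduct.map φ φ)).map (sqQ k K).hom ≫
      (exactQ (resMod (Algebra.TensorProduct.map φ φ)) ((diagTotal (extTensor k)).obj K)).hom ≫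
      (QPlus (S ⊗[k] S)).map (sqRes φ K).inv ≫
      (sqQ k ((resMod φ).mapCochainComplexPlus.obj K)).inv ≫
      (tensorSq k S).map (exactQ (resMod φ) K).inv := by
  refine (Localization.liftNatTrans_app (QPlus T) (CochainComplex.Plus.quasiIso _) _ _ _ _ _ K).trans ?_
  refine (Category.id_comp _).trans ((Category.comp_id _).trans ?_)
  simp only [Iso.trans_inv, NatTrans.comp_app, Category.assoc]
  rfl

/-- `tensorSqRes` followed by the tensor square of a morphism of complexes. -/
lemma tensorSqRes_inv_app_comp {K : CochainComplex.Plus (ModuleCat.{u} T)}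
    {L : CochainComplex.Plus (ModuleCat.{u} S)} (g : (resMod φ).mapCochainComplexPlus.obj K ⟶ L) :
    (tensorSqRes φ).inv.app ((QPlus T).obj K) ≫
        (tensorSq k S).map ((exactQ (resMod φ) K).hom ≫ (QPlus S).map g) =
      (resD (Algebra.TensorProduct.map φ φ)).map (sqQ k K).hom ≫
      (exactQ (resMod (Algebra.TensorProduct.map φ φ)) ((diagTotal (extTensor k)).obj K)).hom ≫
      (QPlus (S ⊗[k] S)).map ((sqRes φ K).inv ≫ (diagTotal (extTensor k)).map g) ≫
      (sqQ k L).inv := by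
  refine (congrArg (· ≫ _) (tensorSqRes_inv_app φ K)).trans ?_
  rw [Functor.map_comp (tensorSq k S), Functor.map_comp (QPlus (S ⊗[k] S)),
    Category.assoc ((QPlus (S ⊗[k] S)).map _) _ (sqQ k L).inv]
  have h : (QPlus (S ⊗[k] S)).map ((diagTotal (extTensor k)).map g) ≫ (sqQ k L).inv =
      (sqQ k _).inv ≫ (tensorSq k S).map ((QPlus S).map g) := by
    rw [Iso.comp_inv_eq, Category.assoc, sqQ_naturality, Iso.inv_hom_id_assoc]
  rw [h]
  simp only [Category.assoc]
  rw [← Functor.map_comp_assoc (tensorSq k S), Iso.inv_hom_id, CategoryTheory.Functor.map_id, Category.id_comp]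

end TensorSquare

/-! ### The morphism of square functors on resolutions. -/

section RhomSq

variable {k A B : Type u} [Field k] [Ring A] [Ring B] [Algebra k A] [Algebra k B]

/-- The chain-level isomorphism `Q(E) ≅ M ⊗ M` for a resolution `E` of the tensor square. -/
noncomputable def sqIso {I : CochainComplex.Plus (ModuleCat.{u} (Env k A))}
    {E : CochainComplex.Plus (ModuleCat.{u} (Env k A ⊗[k] Env k A))}
    (ι : (diagTotal (extTensor k (S := Env k A))).obj I ⟶ E) (hι : QuasiIso ι.hom) :
    (QPlus (Env k A ⊗[k] Env k A)).obj E ≅ (tensorSq k (Env k A)).obj ((QPlus (Env k A)).obj I) :=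
  (@asIso _ _ _ _ ((QPlus _).map ι) ((isIso_QPlus_map_iff ι).2 hι)).symm ≪≫ (sqQ k I).symm

lemma map_comp_sqIso_hom {I : CochainComplex.Plus (ModuleCat.{u} (Env k A))}
    {E : CochainComplex.Plus (ModuleCat.{u} (Env k A ⊗[k] Env k A))}
    (ι : (diagTotal (extTensor k (S := Env k A))).obj I ⟶ E) (hι : QuasiIso ι.hom) :
    (QPlus (Env k A ⊗[k] Env k A)).map ι ≫ (sqIso ι hι).hom = (sqQ k I).inv := by
  have := (isIso_QPlus_map_iff ι).2 hι
  exact IsIso.hom_inv_id_assoc ((QPlus _).map ι) _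

/-- Compatibility of `rhomSq` with a morphism of resolutions. -/
lemma rhomSqIso_naturality {I I' : CochainComplex.Plus (ModuleCat.{u} (Env k A))}
    {E E' : CochainComplex.Plus (ModuleCat.{u} (Env k A ⊗[k] Env k A))} (hE : TermInj E)
    (hE' : TermInj E') (ι : (diagTotal (extTensor k (S := Env k A))).obj I ⟶ E)
    (hι : QuasiIso ι.hom) (ι' : (diagTotal (extTensor k (S := Env k A))).obj I' ⟶ E')
    (hι' : QuasiIso ι'.hom) (g : I ⟶ I') (Ψ : E ⟶ E')
    (h : (QPlus _).map (ι ≫ Ψ) = (QPlus _).map ((diagTotal (extTensor k)).map g ≫ ι')) :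
    (rhomSqIso k A hE ι hι).hom ≫ (rhomSq k A).map ((QPlus (Env k A)).map g) =
      (QPlus (Env k A)).map ((homEnv k A).mapCochainComplexPlus.map Ψ) ≫
        (rhomSqIso k A hE' ι' hι').hom := by
  -- The map `Ψ` of resolutions represents the tensor square of `g`; this may be checked after the
  -- quasi-isomorphism `ι`.
  have h1 : (QPlus _).map Ψ ≫ (sqIso ι' hι').hom =
      (sqIso ι hι).hom ≫ (tensorSq k (Env k A)).map ((QPlus (Env k A)).map g) := by
    have := (isIso_QPlus_map_iff ι).2 hι
    rw [← cancel_epi ((QPlus _).map ι), ← Category.assoc, ← Functor.map_comp, h, Functor.map_comp,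
      Category.assoc, map_comp_sqIso_hom, reassoc_of% map_comp_sqIso_hom, Iso.comp_inv_eq,
      Category.assoc, sqQ_naturality, Iso.inv_hom_id_assoc]
  have h2 : (unitQ (homEnv k A) E ≫ (RD (homEnv k A)).map (sqIso ι hι).hom) ≫
      (RD (homEnv k A)).map ((tensorSq k (Env k A)).map ((QPlus (Env k A)).map g)) =
      (QPlus (Env k A)).map ((homEnv k A).mapCochainComplexPlus.map Ψ) ≫
        unitQ (homEnv k A) E' ≫ (RD (homEnv k A)).map (sqIso ι' hι').hom := by
    rw [reassoc_of% unitQ_naturality, ← Functor.map_comp, h1, Functor.map_comp, Category.assoc]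
  exact h2

variable (f : A →ₐ[k] B)

/-- Restriction of scalars along `env2Map f`. -/
noncomputable abbrev resMod2 :
    ModuleCat.{u} (Env k B ⊗[k] Env k B) ⥤ ModuleCat.{u} (Env k A ⊗[k] Env k A) :=
  resMod (env2Map f)

/-- Restriction of scalars along `env2Map f` on bounded below complexes. -/
noncomputable abbrev res2 : CochainComplex.Plus (ModuleCat.{u} (Env k B ⊗[k] Env k B)) ⥤
    CochainComplex.Plus (ModuleCat.{u} (Env k A ⊗[k] Env k A)) :=
  (resMod (env2Map f)).mapCochainComplexPlus

/-- Restriction of scalars along `env2Map f` on derived categories. -/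
noncomputable abbrev resD2 : DPlus (Env k B ⊗[k] Env k B) ⥤ DPlus (Env k A ⊗[k] Env k A) :=
  resD (env2Map f)

/-- `resD2` is computed by restricting scalars termwise. -/
noncomputable abbrev exactQ2 (K : CochainComplex.Plus (ModuleCat.{u} (Env k B ⊗[k] Env k B))) :
    (resD2 f).obj ((QPlus (Env k B ⊗[k] Env k B)).obj K) ≅
      (QPlus (Env k A ⊗[k] Env k A)).obj ((res2 f).obj K) :=
  exactQ (resMod2 f) K

/-- The map `I ⊗ I ⟶ I' ⊗ I'` induced by `ψ : I ⟶ I'`. -/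
noncomputable def sqMap {I : CochainComplex.Plus (ModuleCat.{u} (Env k B))}
    {I' : CochainComplex.Plus (ModuleCat.{u} (Env k A))}
    (ψ : (resMod (envMap f)).mapCochainComplexPlus.obj I ⟶ I') :
    (res2 f).obj
      ((diagTotal (extTensor k (S := Env k B))).obj I) ⟶
      (diagTotal (extTensor k (S := Env k A))).obj I' :=
  (sqRes (envMap f) I).inv ≫ (diagTotal (extTensor k)).map ψ

/-- `rhomSqMap` in terms of resolutions. -/
lemma rhomSqIso_rhomSqMap {I : CochainComplex.Plus (ModuleCat.{u} (Env k B))}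
    {I' : CochainComplex.Plus (ModuleCat.{u} (Env k A))}
    {E : CochainComplex.Plus (ModuleCat.{u} (Env k B ⊗[k] Env k B))}
    {E' : CochainComplex.Plus (ModuleCat.{u} (Env k A ⊗[k] Env k A))} (hE : TermInj E)
    (hE' : TermInj E') (ι : (diagTotal (extTensor k (S := Env k B))).obj I ⟶ E)
    (hι : QuasiIso ι.hom) (ι' : (diagTotal (extTensor k (S := Env k A))).obj I' ⟶ E')
    (hι' : QuasiIso ι'.hom) (ψ : (resMod (envMap f)).mapCochainComplexPlus.obj I ⟶ I')
    (Ψ : (res2 f).obj E ⟶ E')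
    (h : (QPlus (Env k A ⊗[k] Env k A)).map ((res2 f).map (Y := E) ι ≫ Ψ) =
      (QPlus (Env k A ⊗[k] Env k A)).map (sqMap f ψ ≫ ι')) :
    (resD (envMap f)).map (rhomSqIso k B hE ι hι).hom ≫
        rhomSqMap (M := (QPlus (Env k B)).obj I) (N := (QPlus (Env k A)).obj I') f
          ((exactQ (resMod (envMap f)) I).hom ≫ (QPlus (Env k A)).map ψ) =
      (exactQ (resMod (envMap f)) ((homEnv k B).mapCochainComplexPlus.obj E)).hom ≫
        (QPlus (Env k A)).map
          (compPlus (precomp f) E ≫ (homEnv k A).mapCochainComplexPlus.map Ψ) ≫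
        (rhomSqIso k A hE' ι' hι').hom := by
  have := (isIso_QPlus_map_iff ι).2 hι
  -- The derived morphism of tensor squares induced by `ψ`, given a name so that it can be described
  -- in two ways.
  obtain ⟨χ, hχ⟩ : ∃ χ : (resD2 f).obj ((tensorSq k (Env k B)).obj
      ((QPlus (Env k B)).obj I)) ⟶ (tensorSq k (Env k A)).obj ((QPlus (Env k A)).obj I'),
      χ = (resD2 f).map (sqQ k I).hom ≫ (exactQ2 f ((diagTotal (extTensor k (S := Env k B))).obj I)).hom ≫
        (QPlus (Env k A ⊗[k] Env k A)).map (sqMap f ψ) ≫ (sqQ k I').inv := ⟨_, rfl⟩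
  have h1 : (tensorSqRes (envMap f)).inv.app ((QPlus (Env k B)).obj I) ≫
      (tensorSq k (Env k A)).map ((exactQ (resMod (envMap f)) I).hom ≫
        (QPlus (Env k A)).map ψ) = χ :=
    (tensorSqRes_inv_app_comp (envMap f) ψ).trans hχ.symm
  have h2 : (resD2 f).map ((QPlus (Env k B ⊗[k] Env k B)).map ι) ≫
      (exactQ2 f E).hom ≫
      (QPlus (Env k A ⊗[k] Env k A)).map Ψ ≫ (sqIso ι' hι').hom =
      (exactQ2 f ((diagTotal (extTensor k (S := Env k B))).obj I)).hom ≫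
        (QPlus (Env k A ⊗[k] Env k A)).map (sqMap f ψ) ≫ (sqQ k I').inv := by
    have h0 := exactQ_naturality (resMod2 f) ι
    rw [reassoc_of% h0, ← Functor.map_comp_assoc, h, Functor.map_comp_assoc,
      map_comp_sqIso_hom]
  -- `Ψ` represents it on the chosen resolutions; once more it suffices to check this after `ι`.
  have h3 : (exactQ2 f E).hom ≫
      (QPlus (Env k A ⊗[k] Env k A)).map Ψ ≫ (sqIso ι' hι').hom =
      (resD2 f).map (sqIso ι hι).hom ≫ χ := by
    rw [← cancel_epi ((resD2 f).map ((QPlus (Env k B ⊗[k] Env k B)).map ι)), h2, hχ,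
      ← Functor.map_comp_assoc, map_comp_sqIso_hom, ← Functor.map_comp_assoc, Iso.inv_hom_id,
      CategoryTheory.Functor.map_id, Category.id_comp]
  have h4 := derivedComparison_app_comp (precomp f) χ (sqIso ι hι).hom (sqIso ι' hι').hom Ψ h3
  rw [← h1] at h4
  exact h4

end RhomSq

attribute [local instance] ModuleCat.moduleOfAlgebraModule
  ModuleCat.isScalarTower_of_algebra_moduleCat

/-! ### Multiplications on tensor squares. -/

section Scalars

variable {k : Type u} [Field k] {S T : Type u} [Ring S] [Ring T] [Algebra k S] [Algebra k T]
  (φ : S →ₐ[k] T)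

/-- Multiplication by an element of `T` commuting with `S`, on a bounded below complex. -/
noncomputable def mulPlus (t : T) (h : ∀ s, Commute (φ s) t)
    (K : CochainComplex.Plus (ModuleCat.{u} T)) :
    (resMod φ).mapCochainComplexPlus.obj K ⟶ (resMod φ).mapCochainComplexPlus.obj K :=
  ObjectProperty.homMk (mulBy φ t h K.obj)

variable {K L : CochainComplex.Plus (ModuleCat.{u} T)}

lemma mulPlus_naturality (t : T) (h : ∀ s, Commute (φ s) t) (i : K ⟶ L) :
    (resMod φ).mapCochainComplexPlus.map i ≫ mulPlus φ t h L =
      mulPlus φ t h K ≫ (resMod φ).mapCochainComplexPlus.map i := by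
  ext n x
  exact (map_smul (i.hom.f n).hom t (show K.obj.X n from x)).symm

lemma mulPlus_mul (s t r : T) (hs : ∀ a, Commute (φ a) s) (ht : ∀ a, Commute (φ a) t)
    (hr : ∀ a, Commute (φ a) r) (h : r = s * t) :
    mulPlus φ r hr K = mulPlus φ t ht K ≫ mulPlus φ s hs K := by
  subst h
  ext n x
  exact mul_smul s t (show K.obj.X n from x)

lemma mulPlus_one (t : T) (ht : ∀ a, Commute (φ a) t) (h : t = 1) : mulPlus φ t ht K = 𝟙 _ := by
  subst h
  ext n x
  exact one_smul T (show K.obj.X n from x)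

/-- The element `t` of `T ⊗ T` commutes with the image of `S ⊗ S`. -/
def CommSq (t : T ⊗[k] T) : Prop := ∀ s, Commute (Algebra.TensorProduct.map φ φ s) t

/-- Multiplication by an element of `T ⊗ T` commuting with `S ⊗ S`. -/
noncomputable def mulSq (t : T ⊗[k] T) (h : CommSq φ t)
    (K : CochainComplex.Plus (ModuleCat.{u} (T ⊗[k] T))) :
    (resMod (Algebra.TensorProduct.map φ φ)).mapCochainComplexPlus.obj K ⟶
      (resMod (Algebra.TensorProduct.map φ φ)).mapCochainComplexPlus.obj K :=
  mulPlus (Algebra.TensorProduct.map φ φ) t h K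

lemma mulSq_naturality (t : T ⊗[k] T) (h : CommSq φ t)
    {K L : CochainComplex.Plus (ModuleCat.{u} (T ⊗[k] T))} (i : K ⟶ L) :
    (resMod (Algebra.TensorProduct.map φ φ)).mapCochainComplexPlus.map i ≫ mulSq φ t h L =
      mulSq φ t h K ≫ (resMod (Algebra.TensorProduct.map φ φ)).mapCochainComplexPlus.map i :=
  mulPlus_naturality _ t h i

lemma commute_map_tmul {μ ν : T} (hμ : ∀ s, Commute (φ s) μ) (hν : ∀ s, Commute (φ s) ν) :
    CommSq φ (μ ⊗ₜ[k] ν) := fun z =>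
  commute_of_tmul_left (R := T ⊗[k] T) (Algebra.TensorProduct.map φ φ) _ (fun a b => by
    change (φ a ⊗ₜ[k] φ b) * (μ ⊗ₜ[k] ν) = (μ ⊗ₜ[k] ν) * (φ a ⊗ₜ[k] φ b)
    rw [Algebra.TensorProduct.tmul_mul_tmul, Algebra.TensorProduct.tmul_mul_tmul, (hμ a).eq,
      (hν b).eq]) z

lemma sqRes_hom_tmk {p q n : ℤ} (h : p + q = n) (x : K.obj.X p) (y : K.obj.X q) :
    (sqRes φ K).hom.hom.f n (tmk (K := (onCplx (resMod φ)).obj K.obj)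
      (L := (onCplx (resMod φ)).obj K.obj) h x y) = tmk (k := k) h x y := by
  have := ι_totalCompX (F := extTensor k (S := T)) (F' := extTensor k (S := S))
    (G := resMod (Algebra.TensorProduct.map φ φ)) (K := K.obj)
    (K' := (onCplx (resMod φ)).obj K.obj)
    (fun p q => extTensorRes φ (K.obj.X p) (K.obj.X q)) p q n h
  exact congrArg (fun f => f.hom ((show (resMod φ).obj (K.obj.X p) from x) ⊗ₜ[k]
    (show (resMod φ).obj (K.obj.X q) from y) :
      (resMod φ).obj (K.obj.X p) ⊗[k] (resMod φ).obj (K.obj.X q))) this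

/-- Different scalars may act on the two factors. Their tensor product is a scalar of `T ⊗ T`, which
moves freely through resolutions. -/
lemma tensMap_mulBy_comp_sqRes {μ ν : T} (hμ : ∀ s, Commute (φ s) μ)
    (hν : ∀ s, Commute (φ s) ν) :
    tensMap k (mulBy φ μ hμ K.obj) (mulBy φ ν hν K.obj) ≫ (sqRes φ K).hom.hom =
      (sqRes φ K).hom.hom ≫ (mulSq φ (μ ⊗ₜ ν)
        (commute_map_tmul φ hμ hν) ((diagTotal (extTensor k)).obj K)).hom := by
  ext1 n
  apply tens_hom_ext
  intro p q h x y
  have h1 := congrArg ((sqRes φ K).hom.hom.f n)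
    (tensMap_tmk k (mulBy φ μ hμ K.obj) (mulBy φ ν hν K.obj) h x y)
  refine (h1.trans (sqRes_hom_tmk φ h _ _)).trans ?_
  have h2 := congrArg ((mulSq φ (μ ⊗ₜ ν)
        (commute_map_tmul φ hμ hν) ((diagTotal (extTensor k)).obj K)).hom.f n)
        (sqRes_hom_tmk (K := K) φ h x y)
  refine Eq.trans ?_ h2.symm
  exact (smul_tmk (K := K.obj) (L := K.obj) k h μ ν x y).symm

lemma homotopic_tensMap {X Y : Type u} [Ring X] [Ring Y] [Algebra k X] [Algebra k Y]
    {K₁ K₂ : CochainComplex (ModuleCat.{u} X) ℤ} {L₁ L₂ : CochainComplex (ModuleCat.{u} Y) ℤ}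
    {u v : K₁ ⟶ K₂} {u' v' : L₁ ⟶ L₂} (w : Nonempty (Homotopy u v))
    (w' : Nonempty (Homotopy u' v')) :
    Nonempty (Homotopy (tensMap k u u') (tensMap k v v')) :=
  ⟨(HomologicalComplex.mapBifunctorMapHomotopy₁ w.some u' (boxTensor k) (ComplexShape.up ℤ)).trans
    (HomologicalComplex.mapBifunctorMapHomotopy₂ v w'.some (boxTensor k) (ComplexShape.up ℤ))⟩

/-- If `ψ'` is homotopic to both `μ ψ` and `ν ψ`, then `ψ' ⊗ ψ'` is homotopic to
`(μ ⊗ ν) (ψ ⊗ ψ)`. -/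
lemma QPlus_map_sq_eq {L : CochainComplex.Plus (ModuleCat.{u} S)}
    (ψ ψ' : (resMod φ).mapCochainComplexPlus.obj K ⟶ L) {μ ν : T} (hμ : ∀ s, Commute (φ s) μ)
    (hν : ∀ s, Commute (φ s) ν) (h : Nonempty (Homotopy ψ'.hom (mulBy φ μ hμ K.obj ≫ ψ.hom)))
    (h' : Nonempty (Homotopy ψ'.hom (mulBy φ ν hν K.obj ≫ ψ.hom))) :
    (QPlus (S ⊗[k] S)).map ((sqRes φ K).inv ≫ (diagTotal (extTensor k)).map ψ') =
      (QPlus (S ⊗[k] S)).map (mulSq φ (μ ⊗ₜ ν)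
        (commute_map_tmul φ hμ hν) ((diagTotal (extTensor k)).obj K) ≫
          (sqRes φ K).inv ≫ (diagTotal (extTensor k)).map ψ) := by
  let m : (diagTotal (extTensor k)).obj ((resMod φ).mapCochainComplexPlus.obj K) ⟶
      (diagTotal (extTensor k)).obj ((resMod φ).mapCochainComplexPlus.obj K) :=
    ObjectProperty.homMk (tensMap k (mulBy φ μ hμ K.obj) (mulBy φ ν hν K.obj))
  -- The first factor `ψ'` is replaced by `μ ψ` and the second by `ν ψ`.
  have h1 : (QPlus (S ⊗[k] S)).map ((diagTotal (extTensor k)).map ψ') =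
      (QPlus (S ⊗[k] S)).map (m ≫ (diagTotal (extTensor k)).map ψ) := by
    refine QPlus_map_eq_of_homotopy ?_
    exact ⟨(homotopic_tensMap (k := k) h h').some.trans (Homotopy.ofEq
      (tensMap_comp k (mulBy φ μ hμ K.obj) ψ.hom (mulBy φ ν hν K.obj) ψ.hom))⟩
  have h3 : m ≫ (sqRes φ K).hom = (sqRes φ K).hom ≫
      mulSq φ (μ ⊗ₜ ν)
        (commute_map_tmul φ hμ hν) ((diagTotal (extTensor k)).obj K) := by
    ext1
    exact tensMap_mulBy_comp_sqRes φ hμ hν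
  have h4 : (sqRes φ K).inv ≫ m = mulSq φ (μ ⊗ₜ ν)
      (commute_map_tmul φ hμ hν) ((diagTotal (extTensor k)).obj K) ≫ (sqRes φ K).inv := by
    rw [Iso.inv_comp_eq, ← Category.assoc, ← h3, Category.assoc, Iso.hom_inv_id, Category.comp_id]
  rw [Functor.map_comp, h1, ← Functor.map_comp, reassoc_of% h4]

end Scalars

/-! ### Functoriality of the square in both arguments. -/

section Trace

variable {k A B : Type u} [Field k] [Ring A] [Ring B] [Algebra k A] [Algebra k B] (f : A →ₐ[k] B)

/-- Multiplication by an element of `Env k B ⊗ Env k B` commuting with `Env k A ⊗ Env k A`. -/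
noncomputable def mul2 (t : Env k B ⊗[k] Env k B) (h : CommSq (envMap f) t)
    (K : CochainComplex.Plus (ModuleCat.{u} (Env k B ⊗[k] Env k B))) :
    (res2 f).obj K ⟶ (res2 f).obj K :=
  mulSq (envMap f) t h K

lemma mul2_naturality {K L : CochainComplex.Plus (ModuleCat.{u} (Env k B ⊗[k] Env k B))}
    (t : Env k B ⊗[k] Env k B) (h : CommSq (envMap f) t) (i : K ⟶ L) :
    (res2 f).map i ≫ mul2 f t h L = mul2 f t h K ≫ (res2 f).map i :=
  mulSq_naturality (envMap f) t h i

/-- The map `Hom_{Bᵉ}(B, E) ⟶ Hom_{Aᵉ}(A, E')` induced by `f` and `Ψ : E ⟶ E'`. -/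
noncomputable def homEnvMap {E : CochainComplex.Plus (ModuleCat.{u} (Env k B ⊗[k] Env k B))}
    {E' : CochainComplex.Plus (ModuleCat.{u} (Env k A ⊗[k] Env k A))} (Ψ : (res2 f).obj E ⟶ E') :
    (resMod (envMap f)).mapCochainComplexPlus.obj ((homEnv k B).mapCochainComplexPlus.obj E) ⟶
      (homEnv k A).mapCochainComplexPlus.obj E' :=
  compPlus (precomp f) E ≫ (homEnv k A).mapCochainComplexPlus.map Ψ

/-- The `Bᵉ`-module structure of `Hom_{Bᵉ}(B, E)` comes from the inside action on `E`, so inside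
multiplication on the target is scalar multiplication on Hom. -/
lemma homEnvMap_mul2 {E : CochainComplex.Plus (ModuleCat.{u} (Env k B ⊗[k] Env k B))}
    {E' : CochainComplex.Plus (ModuleCat.{u} (Env k A ⊗[k] Env k A))} (Ψ : (res2 f).obj E ⟶ E')
    (z : Env k B) (hz : ∀ s, Commute (envMap f s) z)
    (hz' : CommSq (envMap f) (inside k B z)) :
    homEnvMap f (mul2 f (inside k B z) hz' E ≫ Ψ) =
      mulPlus (envMap f) z hz ((homEnv k B).mapCochainComplexPlus.obj E) ≫ homEnvMap f Ψ := by
  ext n h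
  refine LinearMap.ext fun a => ?_
  have h1 : (show E.obj.X n from ((envDatum k B).action (E.obj.X n) (1 ⊗ₜ z)
      (show (envDatum k B).Carrier (E.obj.X n) from h)) (bimodMap f a)) =
      inside k B z • (show E.obj.X n from (show (envDatum k B).Carrier (E.obj.X n) from h)
        (bimodMap f a)) := by
    rw [HomDatum.action_one_tmul]
    rfl
  exact congrArg (Ψ.hom.f n) h1.symm

/-- The morphism `M ⊗ M ⟶ N ⊗ N` induced by `ψ : M ⟶ N`. -/
noncomputable def sqD {M : DPlus (Env k B)} {N : DPlus (Env k A)}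
    (ψ : (resD (envMap f)).obj M ⟶ N) :
    (resD2 f).obj ((tensorSq k (Env k B)).obj M) ⟶ (tensorSq k (Env k A)).obj N :=
  (tensorSqRes (envMap f)).inv.app M ≫ (tensorSq k (Env k A)).map ψ

lemma sqD_comp {M : DPlus (Env k B)} {N N' : DPlus (Env k A)}
    (ψ : (resD (envMap f)).obj M ⟶ N) (b : N ⟶ N') :
    sqD f (ψ ≫ b) = sqD f ψ ≫ (tensorSq k (Env k A)).map b :=
  (congrArg (fun y => (tensorSqRes (envMap f)).inv.app M ≫ y)
    ((tensorSq k (Env k A)).map_comp ψ b)).trans (Category.assoc _ _ _).symm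

lemma map_comp_sqD {M M' : DPlus (Env k B)} {N : DPlus (Env k A)} (a : M' ⟶ M)
    (ψ : (resD (envMap f)).obj M ⟶ N) :
    (resD2 f).map ((tensorSq k (Env k B)).map a) ≫ sqD f ψ =
      sqD f ((resD (envMap f)).map a ≫ ψ) := by
  have h : (resD2 f).map ((tensorSq k (Env k B)).map a) ≫ (tensorSqRes (envMap f)).inv.app M =
      (tensorSqRes (envMap f)).inv.app M' ≫
        (tensorSq k (Env k A)).map ((resD (envMap f)).map a) :=
    (tensorSqRes (envMap f)).inv.naturality a
  refine (Category.assoc _ _ _).symm.trans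
    ((congrArg (· ≫ (tensorSq k (Env k A)).map ψ) h).trans ?_)
  exact (Category.assoc _ _ _).trans (congrArg (fun y => (tensorSqRes (envMap f)).inv.app M' ≫ y)
    ((tensorSq k (Env k A)).map_comp _ ψ).symm)

/-- The morphism `RHom_{Bᵉ}(B, Z) ⟶ RHom_{Aᵉ}(A, Z)` induced by `f`. -/
noncomputable def rhomEnvMap (Z : DPlus (Env k B ⊗[k] Env k B)) :
    (resD (envMap f)).obj ((rhomEnv k B).obj Z) ⟶ (rhomEnv k A).obj ((resD2 f).obj Z) :=
  (derivedComparison (precomp f)).app Z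

lemma rhomEnvMap_naturality {Z Z' : DPlus (Env k B ⊗[k] Env k B)} (c : Z ⟶ Z') :
    (resD (envMap f)).map ((rhomEnv k B).map c) ≫ rhomEnvMap f Z' =
      rhomEnvMap f Z ≫ (rhomEnv k A).map ((resD2 f).map c) :=
  (derivedComparison (precomp f)).naturality c

lemma rhomSqMap_comp {M : DPlus (Env k B)} {N N' : DPlus (Env k A)}
    (ψ : (resD (envMap f)).obj M ⟶ N) (b : N ⟶ N') :
    rhomSqMap f (ψ ≫ b) = rhomSqMap f ψ ≫ (rhomSq k A).map b := by
  refine (congrArg (fun y => rhomEnvMap f _ ≫ (rhomEnv k A).map y) (sqD_comp f ψ b)).trans ?_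
  refine (congrArg (fun y => rhomEnvMap f _ ≫ y) ((rhomEnv k A).map_comp _ _)).trans ?_
  exact (Category.assoc _ _ _).symm

lemma map_comp_rhomSqMap {M M' : DPlus (Env k B)} {N : DPlus (Env k A)} (a : M' ⟶ M)
    (ψ : (resD (envMap f)).obj M ⟶ N) :
    (resD (envMap f)).map ((rhomSq k B).map a) ≫ rhomSqMap f ψ =
      rhomSqMap f ((resD (envMap f)).map a ≫ ψ) := by
  have h := rhomEnvMap_naturality f ((tensorSq k (Env k B)).map a)
  refine (Category.assoc _ _ _).symm.trans
    ((congrArg (· ≫ (rhomEnv k A).map (sqD f ψ)) h).trans ?_)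
  refine (Category.assoc _ _ _).trans ?_
  refine congrArg (fun y => rhomEnvMap f _ ≫ y) ?_
  exact ((rhomEnv k A).map_comp _ _).symm.trans
    (congrArg (rhomEnv k A).map (map_comp_sqD f a ψ))

end Trace

/-! ### Uniqueness of the rigid trace. -/

section Trace

variable {k A B : Type u} [Field k] [Ring A] [Ring B] [Algebra k A] [Algebra k B] {f : A →ₐ[k] B}

section Model

variable {RA : RigidDualizingComplex k A} {RB : RigidDualizingComplex k B}
  {I : CochainComplex.Plus (ModuleCat.{u} (Env k B))}
  {I' : CochainComplex.Plus (ModuleCat.{u} (Env k A))}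
  (e : (QPlus (Env k B)).obj I ≅ RB.R) (e' : (QPlus (Env k A)).obj I' ≅ RA.R)
  {E : CochainComplex.Plus (ModuleCat.{u} (Env k B ⊗[k] Env k B))}
  {E' : CochainComplex.Plus (ModuleCat.{u} (Env k A ⊗[k] Env k A))} (hE : TermInj E)
  (hE' : TermInj E') (ι : (diagTotal (extTensor k (S := Env k B))).obj I ⟶ E)
  (hι : QuasiIso ι.hom) (ι' : (diagTotal (extTensor k (S := Env k A))).obj I' ⟶ E')
  (hι' : QuasiIso ι'.hom)
  {j : I ⟶ (homEnv k B).mapCochainComplexPlus.obj E}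
  (hj : (QPlus (Env k B)).map j ≫ (rhomSqIso k B hE ι hι).hom =
    e.hom ≫ RB.φ.hom ≫ (rhomSq k B).map e.inv)
  {j' : I' ⟶ (homEnv k A).mapCochainComplexPlus.obj E'}
  (hj' : (QPlus (Env k A)).map j' ≫ (rhomSqIso k A hE' ι' hι').hom =
    e'.hom ≫ RA.φ.hom ≫ (rhomSq k A).map e'.inv)

include hj hj'

/-- The compatibility of a rigid trace with the rigidifying isomorphisms, in terms of
resolutions. -/
lemma IsRigidTrace.map_comp_eq {ψ : (resD (envMap f)).obj RB.R ⟶ RA.R}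
    (hψ : IsRigidTrace f RA RB ψ) (g : (resMod (envMap f)).mapCochainComplexPlus.obj I ⟶ I')
    (hg : (exactQ (resMod (envMap f)) I).hom ≫ (QPlus (Env k A)).map g =
      (resD (envMap f)).map e.hom ≫ ψ ≫ e'.inv)
    (Ψ : (res2 f).obj E ⟶ E')
    (h : (QPlus (Env k A ⊗[k] Env k A)).map ((res2 f).map (Y := E) ι ≫ Ψ) =
      (QPlus (Env k A ⊗[k] Env k A)).map (sqMap f g ≫ ι')) :
    (QPlus (Env k A)).map (g ≫ j') = (QPlus (Env k A)).map
      ((resMod (envMap f)).mapCochainComplexPlus.map j ≫ homEnvMap f Ψ) := by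
  rw [← cancel_epi (exactQ (resMod (envMap f)) I).hom,
    ← cancel_mono (rhomSqIso k A hE' ι' hι').hom]
  have h1 : (exactQ (resMod (envMap f)) I).hom ≫ (QPlus (Env k A)).map (g ≫ j') ≫
      (rhomSqIso k A hE' ι' hι').hom =
      (resD (envMap f)).map e.hom ≫ ψ ≫ RA.φ.hom ≫ (rhomSq k A).map e'.inv := by
    rw [Functor.map_comp, Category.assoc, hj', reassoc_of% hg, Iso.inv_hom_id_assoc]
  have h2 : (exactQ (resMod (envMap f)) I).hom ≫ (QPlus (Env k A)).map
      ((resMod (envMap f)).mapCochainComplexPlus.map j ≫ homEnvMap f Ψ) ≫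
      (rhomSqIso k A hE' ι' hι').hom = (resD (envMap f)).map (e.hom ≫ RB.φ.hom ≫
        (rhomSq k B).map e.inv) ≫ rhomSqMap f ((resD (envMap f)).map e.hom ≫ ψ ≫ e'.inv) := by
    rw [← hj, ← hg, Functor.map_comp (resD (envMap f)), Category.assoc,
      rhomSqIso_rhomSqMap f hE hE' ι hι ι' hι' g Ψ h, Functor.map_comp (QPlus (Env k A)),
      Category.assoc, ← reassoc_of% exactQ_naturality]
    rfl
  have h3 : (resD (envMap f)).map (e.hom ≫ RB.φ.hom ≫
        (rhomSq k B).map e.inv) ≫ rhomSqMap f ((resD (envMap f)).map e.hom ≫ ψ ≫ e'.inv) =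
      (resD (envMap f)).map e.hom ≫ ψ ≫ RA.φ.hom ≫ (rhomSq k A).map e'.inv := by
    have h4 : (resD (envMap f)).map e.inv ≫ (resD (envMap f)).map e.hom ≫ ψ ≫ e'.inv =
        ψ ≫ e'.inv := by
      rw [← Functor.map_comp_assoc, Iso.inv_hom_id, CategoryTheory.Functor.map_id,
        Category.id_comp]
    rw [Functor.map_comp, Functor.map_comp, Category.assoc, Category.assoc, map_comp_rhomSqMap,
      h4, rhomSqMap_comp, ← reassoc_of% hψ.comm]
  rw [Category.assoc, Category.assoc, h1, h2, h3]

end Model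

/-- The decisive use of both sides at once: with `μ` a right and `ν` a left multiplication, `μ ⊗ ν`
is an inside multiplication. -/
lemma QPlus_map_sqMap_eq {I : CochainComplex.Plus (ModuleCat.{u} (Env k B))}
    {I' : CochainComplex.Plus (ModuleCat.{u} (Env k A))}
    (g g' : (resMod (envMap f)).mapCochainComplexPlus.obj I ⟶ I') {μ ν : Env k B}
    (hμ : ∀ s, Commute (envMap f s) μ) (hν : ∀ s, Commute (envMap f s) ν)
    (h : Nonempty (Homotopy g'.hom (mulBy (envMap f) μ hμ I.obj ≫ g.hom)))
    (h' : Nonempty (Homotopy g'.hom (mulBy (envMap f) ν hν I.obj ≫ g.hom))) :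
    (QPlus (Env k A ⊗[k] Env k A)).map (sqMap f g') =
      (QPlus (Env k A ⊗[k] Env k A)).map
        (mul2 f (μ ⊗ₜ ν) (commute_map_tmul (envMap f) hμ hν) _ ≫ sqMap f g) :=
  QPlus_map_sq_eq (envMap f) g g' hμ hν h h'

section Unique

variable {RA : RigidDualizingComplex k A} {RB : RigidDualizingComplex k B}
  {I : CochainComplex.Plus (ModuleCat.{u} (Env k B))}
  {I' : CochainComplex.Plus (ModuleCat.{u} (Env k A))}
  (hI : TermInj I) (hI' : TermInj I')
  (e : (QPlus (Env k B)).obj I ≅ RB.R) (e' : (QPlus (Env k A)).obj I' ≅ RA.R)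

include hI hI'

/-- Applies to each of two competing traces: the first expresses the other as a multiple, the second
shows that its scalar is trivial. -/
lemma IsRigidTrace.isFreeMap_left {ψ : (resD (envMap f)).obj RB.R ⟶ RA.R}
    (hψ : IsRigidTrace f RA RB ψ) (g : (resMod (envMap f)).mapCochainComplexPlus.obj I ⟶ I')
    (hg : (exactQ (resMod (envMap f)) I).hom ≫ (QPlus (Env k A)).map g =
      (resD (envMap f)).map e.hom ≫ ψ ≫ e'.inv) :
    ((bimodPair k A).along (envMap f) (inclRight k B) (commute_envMap_left f)).IsFreeMap
      ((bimodPair k A).resMap (envMap f) (inclRight k B) (commute_envMap_left f) g.hom) :=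
  RigidDC.isFreeMap_left f hI hI' g (isCanon_left RB.isDualizing hI e)
    (quasiIso_evalPlus (evalLeft f) ψ e e' hI' g hg hψ.isIso_left)

lemma IsRigidTrace.isFreeMap_right {ψ : (resD (envMap f)).obj RB.R ⟶ RA.R}
    (hψ : IsRigidTrace f RA RB ψ) (g : (resMod (envMap f)).mapCochainComplexPlus.obj I ⟶ I')
    (hg : (exactQ (resMod (envMap f)) I).hom ≫ (QPlus (Env k A)).map g =
      (resD (envMap f)).map e.hom ≫ ψ ≫ e'.inv) :
    ((bimodPair k A).swap.along (envMap f) (inclLeft k B) (commute_envMap_right f)).IsFreeMap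
      ((bimodPair k A).swap.resMap (envMap f) (inclLeft k B) (commute_envMap_right f) g.hom) :=
  RigidDC.isFreeMap_right f hI hI' g (isCanon_right RB.isDualizing hI e)
    (quasiIso_evalPlus (evalRight f) ψ e e' hI' g hg hψ.isIso_right)

end Unique

lemma quasiIso_mapPlus {C D : Type*} [Category* C] [Category* D] [Abelian C] [Abelian D]
    (F : C ⥤ D) [F.Additive] [PreservesFiniteLimits F] [PreservesFiniteColimits F]
    {K L : CochainComplex.Plus C} (i : K ⟶ L) (hi : QuasiIso i.hom) :
    QuasiIso (F.mapCochainComplexPlus.map i).hom :=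
  inferInstanceAs (QuasiIso ((F.mapHomologicalComplex _).map i.hom))

variable (f) in
lemma quasiIso_map_res2 {K E : CochainComplex.Plus (ModuleCat.{u} (Env k B ⊗[k] Env k B))}
    (ι : K ⟶ E) (hι : QuasiIso ι.hom) : QuasiIso ((res2 f).map ι).hom :=
  quasiIso_mapPlus (resMod2 f) ι hι

lemma inclLeft_mul_inclRight (d : B) (c : Bᵐᵒᵖ) :
    inclLeft k B d * inclRight k B c = d ⊗ₜ[k] c :=
  (Algebra.TensorProduct.tmul_mul_tmul _ _ _ _).trans (by rw [mul_one, one_mul])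

-- Restriction of scalars is exact, so the restricted resolution map is still a quasi-isomorphism
-- and maps into the injective `E'` extend, up to homotopy.
variable (f) in
lemma exists_extension {K E : CochainComplex.Plus (ModuleCat.{u} (Env k B ⊗[k] Env k B))}
    {E' : CochainComplex.Plus (ModuleCat.{u} (Env k A ⊗[k] Env k A))} (hE' : TermInj E')
    (ι : K ⟶ E) (hι : QuasiIso ι.hom) (h : (res2 f).obj K ⟶ E') :
    ∃ Ψ : (res2 f).obj E ⟶ E', (QPlus (Env k A ⊗[k] Env k A)).map ((res2 f).map ι ≫ Ψ) =
      (QPlus (Env k A ⊗[k] Env k A)).map h := by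
  have q : QuasiIso ((res2 f).map ι).hom := quasiIso_map_res2 f ι hι
  have := (isIso_QPlus_map_iff _).2 q
  obtain ⟨Ψ, hΨ⟩ := exists_QPlus_map_eq hE' (inv ((QPlus (Env k A ⊗[k] Env k A)).map
    ((res2 f).map ι)) ≫ (QPlus (Env k A ⊗[k] Env k A)).map h)
  exact ⟨Ψ, by rw [Functor.map_comp, hΨ, IsIso.hom_inv_id_assoc]⟩

/-- There is at most one rigid trace. -/
theorem IsRigidTrace.unique {RA : RigidDualizingComplex k A} {RB : RigidDualizingComplex k B}
    {ψ ψ' : (resD (envMap f)).obj RB.R ⟶ RA.R} (hψ : IsRigidTrace f RA RB ψ)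
    (hψ' : IsRigidTrace f RA RB ψ') : ψ = ψ' := by
  obtain ⟨I, hI, ⟨e⟩⟩ := exists_termInj_iso RB.R
  obtain ⟨I', hI', ⟨e'⟩⟩ := exists_termInj_iso RA.R
  obtain ⟨E, ι, hE, hι⟩ := exists_quasiIso_termInj ((diagTotal (extTensor k (S := Env k B))).obj I)
  obtain ⟨E', ι', hE', hι'⟩ :=
    exists_quasiIso_termInj ((diagTotal (extTensor k (S := Env k A))).obj I')
  obtain ⟨j, -, hj⟩ := exists_rigidity_map RB e hE ι hι
  obtain ⟨j', hj'', hj'⟩ := exists_rigidity_map RA e' hE' ι' hι'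
  obtain ⟨n, _⟩ := RB.isDualizing.bounded
  have hn : I.obj.IsLE n := isLE_of_Q e n
  obtain ⟨b, hb⟩ := I'.property
  have hb' : I'.obj.IsStrictlyGE b := hb
  have hinj : ∀ p, Injective (I'.obj.X p) := hI'
  have lift (χ : (resD (envMap f)).obj RB.R ⟶ RA.R) :
      ∃ g : (resMod (envMap f)).mapCochainComplexPlus.obj I ⟶ I',
        (exactQ (resMod (envMap f)) I).hom ≫ (QPlus (Env k A)).map g =
          (resD (envMap f)).map e.hom ≫ χ ≫ e'.inv := by
    obtain ⟨g, hg⟩ := exists_QPlus_map_eq hI' ((exactQ (resMod (envMap f)) I).inv ≫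
      (resD (envMap f)).map e.hom ≫ χ ≫ e'.inv)
    exact ⟨g, by rw [hg, Iso.hom_inv_id_assoc]⟩
  obtain ⟨g, hg⟩ := lift ψ
  obtain ⟨g', hg'⟩ := lift ψ'
  -- `ψ' = ψ(- c)`, from the left condition on `ψ`.
  obtain ⟨c, hμ, hc⟩ := ActPair.exists_scalar_of_isFreeMap (D := bimodPair k A) (I := I.obj)
    (I' := I'.obj)
    (hψ.isFreeMap_left hI hI' e e' g hg) (bijective_liftComm_bimodPair_swap k A) (AlgHom.op f)
    (envMap_right f) n b g'.hom
  -- `ψ' = ψ(d -)`, from the right condition on `ψ`.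
  obtain ⟨d, hν, hd⟩ := ActPair.exists_scalar_of_isFreeMap (D := (bimodPair k A).swap)
    (I := I.obj) (I' := I'.obj)
    (hψ.isFreeMap_right hI hI' e e' g hg) (bijective_liftComm_bimodPair k A) f
    (envMap_left f) n b g'.hom
  have hz (s : Env k A) : Commute (envMap f s) (d ⊗ₜ[k] c) := by
    have := (hν s).mul_right (hμ s)
    rwa [inclLeft_mul_inclRight] at this
  have hz' : CommSq (envMap f) (inside k B (d ⊗ₜ[k] c)) := commute_map_tmul (envMap f) hμ hν
  obtain ⟨Ψ, hΨ⟩ : ∃ Ψ : (res2 f).obj E ⟶ E',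
      (QPlus (Env k A ⊗[k] Env k A)).map ((res2 f).map (Y := E) ι ≫ Ψ) =
        (QPlus (Env k A ⊗[k] Env k A)).map (sqMap f g ≫ ι') := exists_extension f hE' ι hι _
  -- `ψ' ⊗ ψ'` is `ψ ⊗ ψ` after right multiplication by `c` on the first factor and left
  -- multiplication by `d` on the second, that is, after the inside action of `d ⊗ c`.
  have hΨ' : (QPlus (Env k A ⊗[k] Env k A)).map ((res2 f).map (Y := E) ι ≫
      mul2 f (inside k B (d ⊗ₜ[k] c)) hz' E ≫ Ψ) =
        (QPlus (Env k A ⊗[k] Env k A)).map (sqMap f g' ≫ ι') := by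
    rw [Functor.map_comp _ (sqMap f g'), QPlus_map_sqMap_eq g g' hμ hν hc hd, ← Category.assoc,
      mul2_naturality, Category.assoc, Functor.map_comp, hΨ, ← Functor.map_comp,
      ← Functor.map_comp, Category.assoc]
    rfl
  have h1 := hψ.map_comp_eq e e' hE hE' ι hι ι' hι' hj hj' g hg Ψ hΨ
  have h2 := hψ'.map_comp_eq e e' hE hE' ι hι ι' hι' hj hj' g' hg' _ hΨ'
  -- Compatibility of both traces with the rigidifying isomorphisms gives `ψ'(r) = ψ(d r c)`; the
  -- resolved rigidifying map `j'` is cancelled.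
  have h3 : (QPlus (Env k A)).map g' =
      (QPlus (Env k A)).map (mulPlus (envMap f) (d ⊗ₜ[k] c) hz I ≫ g) := by
    have := (isIso_QPlus_map_iff j').2 hj''
    rw [← cancel_mono ((QPlus (Env k A)).map j'), ← Functor.map_comp, h2,
      homEnvMap_mul2 f Ψ (d ⊗ₜ[k] c) hz hz', ← Category.assoc, mulPlus_naturality, Category.assoc,
      Functor.map_comp, ← h1, ← Functor.map_comp, ← Functor.map_comp, Category.assoc]
  -- Absorbing `d` turns this into `ψ'(r) = ψ'(r c)`.
  have h4 : (QPlus (Env k A)).map g' =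
      (QPlus (Env k A)).map (mulPlus (envMap f) (inclRight k B c) hμ I ≫ g') := by
    rw [h3, mulPlus_mul (envMap f) (inclLeft k B d) (inclRight k B c) _ hν hμ hz
      (inclLeft_mul_inclRight d c).symm, Category.assoc, Functor.map_comp,
      Functor.map_comp _ _ g']
    congr 1
    exact (QPlus_map_eq_of_homotopy (hd : Nonempty (Homotopy g'.hom
      (mulPlus (envMap f) (inclLeft k B d) hν I ≫ g).hom))).symm
  -- Scalars are unique for `ψ'` by its own left condition.
  have h5 : c = 1 := by
    obtain ⟨w⟩ := (QPlus_map_eq_iff hI' _ _).1 h4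
    refine (hψ'.isFreeMap_left hI hI' e e' g' hg').eq_of_homotopy ⟨?_⟩
    rw [ActPair.mul_one', Category.id_comp, ← ActPair.resMap_mulBy _ _ _ _ g'.hom c hμ]
    exact ((resMod (bimodPair k A).src).mapHomotopy w.symm)
  have h6 : (QPlus (Env k A)).map g' = (QPlus (Env k A)).map g := by
    have h7 : (QPlus (Env k A)).map g' =
        (QPlus (Env k A)).map (mulPlus (envMap f) (inclRight k B c) hμ I ≫ g) :=
      QPlus_map_eq_of_homotopy hc
    rw [h7, mulPlus_one (envMap f) _ hμ (by rw [h5, map_one]), Category.id_comp]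
  rw [h6, hg, cancel_epi ((resD (envMap f)).map e.hom), cancel_mono] at hg'
  exact hg'

end Trace

/-! ### Endomorphisms as central multiplications. -/

section Central

variable {k S : Type u} [Field k] [Ring S] [Algebra k S]

/-- Multiplication by a central element. -/
noncomputable def centralMul (z : S) (hz : ∀ s, Commute s z)
    (K : CochainComplex (ModuleCat.{u} S) ℤ) : K ⟶ K where
  f p := ModuleCat.ofHom
    { toFun := fun x => z • x
      map_add' := fun x y => smul_add z x y
      map_smul' := fun s x => by
        change z • s • x = s • z • x
        rw [smul_smul, smul_smul, (hz s).eq] }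
  comm' p q _ := by
    ext x
    exact map_smul (K.d p q).hom z x

/-- Multiplication by a central element, on bounded below complexes. -/
noncomputable def centralMulPlus (z : S) (hz : ∀ s, Commute s z)
    (K : CochainComplex.Plus (ModuleCat.{u} S)) : K ⟶ K :=
  ObjectProperty.homMk (centralMul z hz K.obj)

lemma centralMulPlus_naturality {K L : CochainComplex.Plus (ModuleCat.{u} S)} (z : S)
    (hz : ∀ s, Commute s z) (i : K ⟶ L) :
    i ≫ centralMulPlus z hz L = centralMulPlus z hz K ≫ i := by
  ext n x
  exact (map_smul (i.hom.f n).hom z x).symm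

lemma centralMulPlus_mul {K : CochainComplex.Plus (ModuleCat.{u} S)} (s t r : S)
    (hs : ∀ a, Commute a s) (ht : ∀ a, Commute a t) (hr : ∀ a, Commute a r) (h : r = s * t) :
    centralMulPlus r hr K = centralMulPlus t ht K ≫ centralMulPlus s hs K := by
  subst h
  ext n x
  exact mul_smul s t (show K.obj.X n from x)

lemma tensMap_centralMul {T : Type u} [Ring T] [Algebra k T]
    (K : CochainComplex (ModuleCat.{u} S) ℤ) (L : CochainComplex (ModuleCat.{u} T) ℤ) (μ : S)
    (ν : T) (hμ : ∀ s, Commute s μ) (hν : ∀ s, Commute s ν) (hz : ∀ s, Commute s (μ ⊗ₜ[k] ν)) :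
    tensMap k (centralMul μ hμ K) (centralMul ν hν L) =
      centralMul (μ ⊗ₜ[k] ν) hz (tens k K L) := by
  ext1 n
  apply tens_hom_ext
  intro p q h x y
  refine (tensMap_tmk k _ _ h x y).trans ?_
  exact (smul_tmk (K := K) (L := L) k h μ ν x y).symm

lemma commute_tmul {T : Type u} [Ring T] [Algebra k T] {μ : S} {ν : T}
    (hμ : ∀ s, Commute s μ) (hν : ∀ s, Commute s ν) (s : S ⊗[k] T) : Commute s (μ ⊗ₜ[k] ν) := by
  induction s using TensorProduct.induction_on with
  | zero => exact Commute.zero_left _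
  | tmul x y =>
    change (x ⊗ₜ[k] y) * (μ ⊗ₜ[k] ν) = (μ ⊗ₜ[k] ν) * (x ⊗ₜ[k] y)
    rw [Algebra.TensorProduct.tmul_mul_tmul, Algebra.TensorProduct.tmul_mul_tmul, (hμ x).eq,
      (hν y).eq]
  | add x y hx hy => exact hx.add_left hy

variable {Λ T : Type u} [Ring Λ] [Ring T] [Algebra k Λ] [Algebra k T] {D : ActPair k Λ T S}

/-- An endomorphism of a complex whose `Λ`-linear endomorphisms are the elements of `T` is given
by a central element of `S`, up to homotopy. -/
lemma ActPair.IsCanon.exists_central {I : CochainComplex (ModuleCat.{u} S) ℤ} (hI : D.IsCanon I)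
    (hb : Function.Bijective (liftComm D.tgt D.src (fun u l => (D.comm l u).symm))) (a b : ℤ)
    [I.IsLE a] [I.IsStrictlyGE b] [∀ p, Injective (I.X p)] (ψ : I ⟶ I) :
    ∃ (t : T) (ht : ∀ s, Commute s (D.tgt t)),
      Nonempty (Homotopy ψ (centralMul (D.tgt t) ht I)) := by
  obtain ⟨t, ⟨ht⟩⟩ := hI.surj ((onCplx (resMod D.src)).map ψ)
  have hcomm (t' : T) : D.mul t' I ≫ (onCplx (resMod D.src)).map ψ =
      (onCplx (resMod D.src)).map ψ ≫ D.mul t' I := by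
    ext n x
    exact map_smul (ψ.f n).hom (D.tgt t') (show I.X n from x)
  -- The endomorphism commutes with multiplication by every `t'`, and scalars are unique, so `t` is
  -- central in `T`.
  have h1 (t' : T) : t * t' = t' * t := by
    rw [← sub_eq_zero]
    refine hI.inj _ ⟨(Homotopy.ofEq ?_).trans (Homotopy.equivSubZero
      (((ht.symm.compLeft (D.mul t' I)).trans (Homotopy.ofEq (hcomm t'))).trans
        (ht.compRight (D.mul t' I))))⟩
    rw [← ActPair.mul_mul', ← ActPair.mul_mul', eq_sub_iff_add_eq, ← ActPair.mul_add',
      sub_add_cancel]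
  have h2 (s : S) : Commute s (D.tgt t) := by
    obtain ⟨x, rfl⟩ := hb.2 s
    refine commute_of_tmul_left (liftComm D.tgt D.src (fun u l => (D.comm l u).symm)) _
      (fun l t' => ?_) x
    rw [show liftComm D.tgt D.src (fun u l => (D.comm l u).symm) (l ⊗ₜ t') =
      D.src l * D.tgt t' from Algebra.TensorProduct.lift_tmul D.src D.tgt
        (fun l u => D.comm l u) l t']
    exact (D.comm l t).mul_left ((show Commute t' t from (h1 t').symm).map D.tgt)
  -- The homotopy over `Λ` becomes one over `S`, since the complex has no negative self-extensions
  -- over `Λ`.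
  exact ⟨t, h2, homotopic_of_res D.src D.tgt (fun u l => (D.comm l u).symm) hb a b hI.vanishNeg
    _ _ ⟨ht⟩⟩

end Central

/-! ### The unique rigid isomorphism. -/

section Rigid

variable {k A : Type u} [Field k] [Ring A] [Algebra k A]

/-- As for traces, inside multiplication on `E` is by definition the module structure of
`Hom_{Aᵉ}(A, E)`. -/
lemma homEnv_map_centralMulPlus (E : CochainComplex.Plus (ModuleCat.{u} (Env k A ⊗[k] Env k A)))
    (z : Env k A) (hz : ∀ s, Commute s z) (hz' : ∀ s, Commute s (inside k A z)) :
    (homEnv k A).mapCochainComplexPlus.map (centralMulPlus (inside k A z) hz' E) =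
      centralMulPlus z hz ((homEnv k A).mapCochainComplexPlus.obj E) := by
  ext n h
  refine LinearMap.ext fun a => ?_
  have h1 : (show E.obj.X n from ((envDatum k A).action (E.obj.X n) (1 ⊗ₜ z)
      (show (envDatum k A).Carrier (E.obj.X n) from h)) a) =
      inside k A z • (show E.obj.X n from (show (envDatum k A).Carrier (E.obj.X n) from h) a) := by
    rw [HomDatum.action_one_tmul]
    rfl
  exact h1.symm

/-- An endomorphism `e` of a rigid dualizing complex acts as `e²` on the square. -/
lemma RigidDualizingComplex.φ_comp_rhomSq_map (R : RigidDualizingComplex k A) (e : R.R ⟶ R.R) :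
    R.φ.hom ≫ (rhomSq k A).map e = e ≫ e ≫ R.φ.hom := by
  obtain ⟨I, hI, ⟨i⟩⟩ := exists_termInj_iso R.R
  obtain ⟨E, ι, hE, hι⟩ := exists_quasiIso_termInj ((diagTotal (extTensor k (S := Env k A))).obj I)
  obtain ⟨j, -, hj⟩ := exists_rigidity_map R i hE ι hι
  obtain ⟨n, _⟩ := R.isDualizing.bounded
  have hn : I.obj.IsLE n := isLE_of_Q i n
  obtain ⟨b, hb⟩ := I.property
  have hb' : I.obj.IsStrictlyGE b := hb
  have hinj : ∀ p, Injective (I.obj.X p) := hI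
  obtain ⟨g, hg⟩ := exists_QPlus_map_eq hI (i.hom ≫ e ≫ i.inv)
  -- The endomorphism is a right multiplication by `c` and, just below, also a left multiplication
  -- by `d`, both central.
  obtain ⟨c, hμ, hc⟩ := (isCanon_left R.isDualizing hI i).exists_central
    (bijective_liftComm_bimodPair_swap k A) n b g.hom
  obtain ⟨d, hν, hd⟩ := (isCanon_right R.isDualizing hI i).exists_central
    (bijective_liftComm_bimodPair k A) n b g.hom
  have hμ' (s) : Commute s (inclRight k A c) := hμ s
  have hν' (s) : Commute s (inclLeft k A d) := hν s
  have hz (s : Env k A) : Commute s (d ⊗ₜ[k] c) := by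
    have := (hν' s).mul_right (hμ' s)
    rwa [inclLeft_mul_inclRight] at this
  have hz' (s : Env k A ⊗[k] Env k A) : Commute s (inclRight k A c ⊗ₜ[k] inclLeft k A d) :=
    commute_tmul hμ' hν' s
  have hc' : (QPlus (Env k A)).map g = (QPlus (Env k A)).map (centralMulPlus _ hμ' I) :=
    QPlus_map_eq_of_homotopy hc
  have hd' : (QPlus (Env k A)).map g = (QPlus (Env k A)).map (centralMulPlus _ hν' I) :=
    QPlus_map_eq_of_homotopy hd
  -- Multiplying by `d` on the left and by `c` on the right applies the endomorphism twice.
  have hgg : (QPlus (Env k A)).map (centralMulPlus (d ⊗ₜ[k] c) hz I) =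
      i.hom ≫ e ≫ e ≫ i.inv := by
    rw [centralMulPlus_mul (inclLeft k A d) (inclRight k A c) _ hν' hμ' hz
      (inclLeft_mul_inclRight d c).symm, Functor.map_comp, ← hc', ← hd', hg]
    simp
  -- On the tensor square, `c` is used on the first factor and `d` on the second, so the square of
  -- the endomorphism is the inside action of `d ⊗ c`.
  have hsq : (QPlus (Env k A ⊗[k] Env k A)).map ((diagTotal (extTensor k)).map g) =
      (QPlus (Env k A ⊗[k] Env k A)).map (centralMulPlus _ hz' _) :=
    QPlus_map_eq_of_homotopy ⟨(homotopic_tensMap (k := k) hc hd).some.trans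
      (Homotopy.ofEq (tensMap_centralMul I.obj I.obj _ _ hμ' hν' hz'))⟩
  have hnat := rhomSqIso_naturality hE hE ι hι ι hι g (centralMulPlus _ hz' E) (by
    rw [centralMulPlus_naturality, Functor.map_comp, Functor.map_comp, hsq])
  rw [hg, show (homEnv k A).mapCochainComplexPlus.map (centralMulPlus _ hz' E) = _ from
    homEnv_map_centralMulPlus E (d ⊗ₜ c) hz hz'] at hnat
  have h1 := congrArg ((QPlus (Env k A)).map j ≫ ·) hnat
  rw [← Functor.map_comp_assoc, centralMulPlus_naturality, Functor.map_comp_assoc, hj,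
    ← Category.assoc, hj, hgg] at h1
  simp only [Functor.map_comp, Category.assoc, Iso.inv_hom_id_assoc] at h1
  rw [← Functor.map_comp_assoc, Iso.inv_hom_id, CategoryTheory.Functor.map_id, Category.id_comp,
    cancel_epi] at h1
  rw [← cancel_mono ((rhomSq k A).map i.inv)]
  simpa using h1

/-- Rigid dualizing complexes are isomorphic by a unique isomorphism compatible with the
rigidifying isomorphisms. -/
theorem RigidDualizingComplex.existsUnique_iso [IsNoetherianRing A] [IsNoetherianRing Aᵐᵒᵖ]
    (R R' : RigidDualizingComplex k A) :
    ∃! e : R.R ≅ R'.R, R.φ.hom ≫ (rhomSq k A).map e.hom = e.hom ≫ R'.φ.hom := by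
  obtain ⟨w⟩ := nonempty_iso R R'
  -- The defect of `w`: it is rigid exactly when this automorphism is the identity.
  let c : R.R ≅ R.R := R.φ ≪≫ (rhomSq k A).mapIso w ≪≫ R'.φ.symm ≪≫ w.symm
  have hc : R.φ.hom ≫ (rhomSq k A).map w.hom = c.hom ≫ w.hom ≫ R'.φ.hom := by simp [c]
  refine ⟨c.symm ≪≫ w, ?_, fun e he => ?_⟩
  -- Precomposing with the inverse of `c` contributes its square, one copy of which cancels the
  -- defect.
  · change R.φ.hom ≫ (rhomSq k A).map (c.inv ≫ w.hom) = (c.inv ≫ w.hom) ≫ R'.φ.hom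
    rw [Functor.map_comp, ← Category.assoc, R.φ_comp_rhomSq_map, Category.assoc, Category.assoc,
      hc, Iso.inv_hom_id_assoc, Category.assoc]
  · dsimp only at he
    let x : R.R ≅ R.R := e ≪≫ w.symm
    have hx : e.hom = x.hom ≫ w.hom := by simp [x]
    -- Any isomorphism is `w` after some automorphism `x`; rigidity reads `x x c = x`, which forces
    -- `x` to be the inverse of `c`.
    have h1 : x.hom ≫ c.hom = 𝟙 _ := by
      rw [hx, Functor.map_comp, ← Category.assoc, R.φ_comp_rhomSq_map, Category.assoc,
        Category.assoc, Category.assoc, cancel_epi, hc, ← Category.assoc, ← Category.assoc,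
        cancel_mono] at he
      rw [← cancel_mono w.hom, he, Category.id_comp]
    ext1
    rw [hx]
    change x.hom ≫ w.hom = c.inv ≫ w.hom
    rw [(Iso.eq_comp_inv c).2 h1]
    simp

end Rigid

end RigidDC

theorem theorem4p2 (k : Type u) [Field k] (A : Type u) [Ring A] [Algebra k A]
    [IsNoetherianRing A] [IsNoetherianRing Aᵐᵒᵖ] :
    (∀ (B : Type u) [Ring B] [Algebra k B] [IsNoetherianRing B] [IsNoetherianRing Bᵐᵒᵖ]
      (f : A →ₐ[k] B), IsFiniteHom f →
      ∀ (RA : RigidDualizingComplex k A) (RB : RigidDualizingComplex k B)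
        (ψ ψ' : (resD (envMap f)).obj RB.R ⟶ RA.R),
        IsRigidTrace f RA RB ψ → IsRigidTrace f RA RB ψ' → ψ = ψ') ∧
    (∀ R R' : RigidDualizingComplex k A,
      ∃! e : R.R ≅ R'.R, R.φ.hom ≫ (rhomSq k A).map e.hom = e.hom ≫ R'.φ.hom) :=
  ⟨fun _ _ _ _ _ _ _ _ _ _ _ hψ hψ' => hψ.unique hψ', fun R R' => R.existsUnique_iso R'⟩
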